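/- Let $n\ge 4$, let $S$ be the unit sphere of an $n$-dimensional Euclidean space $E$, and put $\rho=\frac{n-1}{2}$. The group $G=SO_0(1,n)$, the identity component of the group of linear automorphisms of $\mathbb R\oplus E$ preserving $x_0^2-|x|^2$, acts conformally on $S$ by $g(1,x)=t\,(1,g(x))$, $t>0$; let $\kappa(g,x)$ be its conformal factor, so that $|Dg(x)\xi|=\kappa(g,x)\,|\xi|$ for every tangent vector $\xi$ at $x$ (explicitly $\kappa(g,x)=1/t$). For $\lambda\in\mathbb C$ let $G$ act on $C^\infty(S)$ by $$\pi_\lambda(g)f(x)=\kappa(g^{-1},x)^{\rho+\lambda}f(g^{-1}(x)),$$ and for $\lambda_1,\lambda_2\in\mathbb C$ on $C^\infty(S\times S)$ by $$(\pi_{\lambda_1}\otimes\pi_{\lambda_2})(g)f(x,y)=\kappa(g^{-1},x)^{\rho+\lambda_1}\kappa(g^{-1},y)^{\rho+\lambda_2}f(g^{-1}(x),g^{-1}(y)).$$ For $\boldsymbol\lambda=(\lambda_1,\lambda_2,\lambda_3)\in\mathbb C^3$ put $\alpha_1=-\rho-\lambda_1+\lambda_2+\lambda_3$, $\alpha_2=-\rho+\lambda_1-\lambda_2+\lambda_3$,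 $\alpha_3=-\rho+\lambda_1+\lambda_2-\lambda_3$. For $f\in C^\infty(S\times S\times S)$ let $\boldsymbol\lambda\mapsto\widetilde{\mathcal K}^{\boldsymbol\lambda}(f)$ be the entire function on $\mathbb C^3$ that is given by $$\widetilde{\mathcal K}^{\boldsymbol\lambda}(f)=\frac{\displaystyle\iiint_{S\times S\times S}|x-y|^{\alpha_3}|y-z|^{\alpha_1}|z-x|^{\alpha_2}f(x,y,z)\,dx\,dy\,dz}{\Gamma(\rho+\frac{\alpha_1}{2})\,\Gamma(\rho+\frac{\alpha_2}{2})\,\Gamma(\rho+\frac{\alpha_3}{2})\,\Gamma(\frac{\alpha_1+\alpha_2+\alpha_3}{2}+2\rho)}$$ on the domain of absolute convergence, $\operatorname{Re}\alpha_j>-(n-1)$ for $j=1,2,3$ and $\operatorname{Re}(\alpha_1+\alpha_2+\alpha_3)>-2(n-1)$. Let $Z$ be the set of all $\boldsymbol\lambda\in\mathbb C^3$ such that $\widetilde{\mathcal K}^{\boldsymbol\lambda}(f)=0$ for every $f\in C^\infty(S\times S\times S)$, and for $k\in\mathbb N=\{0,1,2,\dots\}$ let $$Z_k=\{(\lambda_1,\lambda_2)\in\mathbb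 C^2:\ (\lambda_1,\lambda_2,-\rho-2k-\lambda_1-\lambda_2)\in Z\}.$$ A bi-differential operator is a linear map $B:C^\infty(S\times S)\to C^\infty(S)$ for which there is an $N\in\mathbb N$ such that, in local coordinates, $Bf(x)$ is a linear combination, with coefficients depending on $x$, of the partial derivatives of $f$ of order at most $N$ at $(x,x)$. Let $\mathcal{BD}_G(\lambda_1,\lambda_2;k)$ be the complex vector space of all bi-differential operators $B$ such that $$B\circ(\pi_{\lambda_1}\otimes\pi_{\lambda_2})(g)=\pi_{\lambda_1+\lambda_2+\rho+2k}(g)\circ B\qquad\text{for all } g\in G.$$ **Theorem.** Let $k\in\mathbb N$ and $(\lambda_1,\lambda_2)\in\mathbb C^2$ with $(\lambda_1,\lambda_2)\notin Z_k$. Then $$\dim\mathcal{BD}_G(\lambda_1,\lambda_2;k)=1.$$ -/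

import Mathlib

open Set Metric MeasureTheory
open scoped Manifold ContDiff

noncomputable section

namespace ConformalSphere

/-- The Euclidean space `E` of dimension `n = d + 1`. -/
abbrev E (d : ℕ) : Type := EuclideanSpace ℝ (Fin (d + 1))

/-- The unit sphere `S` of `E`, a smooth manifold of dimension `d = n - 1`. -/
abbrev S (d : ℕ) : Type := sphere (0 : E d) 1

/-- `ρ = (n - 1) / 2`. -/
def rho (d : ℕ) : ℂ := (d : ℂ) / 2

/-! ### The group `SO₀(1, n)` and its conformal action on the sphere -/

/-- The Lorentzian form `x₀² - |x|²` on `ℝ ⊕ E`. -/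
def lorentzForm (d : ℕ) (p : ℝ × E d) : ℝ := p.1 ^ 2 - ‖p.2‖ ^ 2

/-- `SO₀(1, n)`, the identity component of the Lorentz group of `ℝ ⊕ E`: the linear automorphisms
that preserve the Lorentzian form, have determinant one and preserve the forward cone. -/
def SO0 (d : ℕ) : Subgroup ((ℝ × E d) ≃ₗ[ℝ] (ℝ × E d)) where
  carrier := {g | (∀ p, lorentzForm d (g p) = lorentzForm d p) ∧
    LinearMap.det (g : (ℝ × E d) →ₗ[ℝ] (ℝ × E d)) = 1 ∧
    ∀ p, 0 < p.1 → 0 ≤ lorentzForm d p → 0 < (g p).1}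
  mul_mem' := by
    rintro g h ⟨g1, g2, g3⟩ ⟨h1, h2, h3⟩
    refine ⟨fun p => by rw [LinearEquiv.mul_apply, g1, h1], ?_, fun p hp hq => ?_⟩
    · have : ((g * h : (ℝ × E d) ≃ₗ[ℝ] (ℝ × E d)) : (ℝ × E d) →ₗ[ℝ] (ℝ × E d)) =
          (g : (ℝ × E d) →ₗ[ℝ] (ℝ × E d)) * (h : (ℝ × E d) →ₗ[ℝ] (ℝ × E d)) := rfl
      rw [this, map_mul, g2, h2, one_mul]
    · exact g3 _ (h3 p hp hq) ((h1 p).symm ▸ hq)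
  one_mem' := by
    refine ⟨fun p => rfl, ?_, fun p hp _ => hp⟩
    exact LinearMap.det_id
  inv_mem' := by
    rintro g ⟨g1, g2, g3⟩
    have key : ∀ p, g (g⁻¹ p) = p := fun p => LinearEquiv.apply_symm_apply g p
    have hQ : ∀ p, lorentzForm d (g⁻¹ p) = lorentzForm d p := fun p => by
      rw [← g1, key]
    refine ⟨hQ, ?_, fun p hp hq => ?_⟩
    · have h := LinearEquiv.det_mul_det_symm g
      rw [g2, one_mul] at h
      exact h
    · have hq' : 0 ≤ lorentzForm d (g⁻¹ p) := by rw [hQ]; exact hq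
      rcases lt_trichotomy (g⁻¹ p).1 0 with h | h | h
      · have h2 := g3 (-(g⁻¹ p)) (by simpa using h) (by simpa [lorentzForm] using hq')
        rw [map_neg, key] at h2
        simp only [Prod.fst_neg] at h2
        linarith
      · exfalso
        have h0 : (g⁻¹ p) = 0 := by
          have h3 : ‖(g⁻¹ p).2‖ = 0 := by
            unfold lorentzForm at hq'
            rw [h] at hq'
            nlinarith [norm_nonneg (g⁻¹ p).2]
          exact Prod.ext h (norm_eq_zero.mp h3)
        have h4 := key p
        rw [h0, map_zero] at h4
        rw [← h4] at hp
        simp at hp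
      · exact h

variable {d : ℕ}

/-- The light-like vector `g (1, x)`. -/
def lift (g : SO0 d) (x : S d) : ℝ × E d := g.1 (1, (x : E d))

theorem lorentzForm_one (x : S d) : lorentzForm d (1, (x : E d)) = 0 := by
  have h : ‖(x : E d)‖ = 1 := by simp
  simp [lorentzForm]

theorem lift_fst_pos (g : SO0 d) (x : S d) : 0 < (lift g x).1 :=
  g.2.2.2 _ one_pos (lorentzForm_one x).ge

theorem norm_lift_snd (g : SO0 d) (x : S d) : ‖(lift g x).2‖ = (lift g x).1 := by
  have h : lorentzForm d (lift g x) = 0 := (g.2.1 _).trans (lorentzForm_one x)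
  unfold lorentzForm at h
  exact (sq_eq_sq₀ (norm_nonneg _) (lift_fst_pos g x).le).1 (by linarith)

/-- The action of `SO₀(1, n)` on the sphere, identified with the set of rays of the forward light
cone: `g (1, x) = t (1, g(x))`. -/
def act (g : SO0 d) (x : S d) : S d :=
  ⟨(lift g x).1⁻¹ • (lift g x).2, by
    rw [mem_sphere_zero_iff_norm, norm_smul, norm_lift_snd, Real.norm_eq_abs,
      abs_of_pos (inv_pos.2 (lift_fst_pos g x)), inv_mul_cancel₀ (lift_fst_pos g x).ne']⟩

/-- The conformal factor `κ(g, x)`, that is `1 / t` where `g (1, x) = t (1, g(x))`;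
`norm_mfderiv_act` shows that it is the factor by which the differential of `g` at `x` scales
tangent vectors. -/
def kappa (g : SO0 d) (x : S d) : ℝ := (lift g x).1⁻¹

theorem kappa_pos (g : SO0 d) (x : S d) : 0 < kappa g x := inv_pos.2 (lift_fst_pos g x)

/-- The linear map underlying `g`, as a continuous linear map. -/
def toCLM (g : SO0 d) : (ℝ × E d) →L[ℝ] (ℝ × E d) :=
  LinearMap.toContinuousLinearMap (g.1 : (ℝ × E d) →ₗ[ℝ] (ℝ × E d))

theorem contDiff_lift_aux (g : SO0 d) :
    ContDiff ℝ ∞ (fun v : E d => toCLM g ((1 : ℝ), v)) :=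
  (toCLM g).contDiff.comp (contDiff_const.prodMk contDiff_id)

theorem contMDiff_lift (g : SO0 d) : ContMDiff (𝓡 d) 𝓘(ℝ, ℝ × E d) ∞ (lift g) :=
  have := Fact.mk (finrank_euclideanSpace_fin (𝕜 := ℝ) (n := d + 1))
  (contDiff_lift_aux g).contMDiff.comp (contMDiff_coe_sphere (n := d))

theorem contMDiff_lift_fst (g : SO0 d) :
    ContMDiff (𝓡 d) 𝓘(ℝ, ℝ) ∞ (fun x => (lift g x).1) :=
  (contDiff_fst (𝕜 := ℝ) (E := ℝ) (F := E d)).contMDiff.comp (contMDiff_lift g)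

theorem contMDiff_lift_snd (g : SO0 d) :
    ContMDiff (𝓡 d) 𝓘(ℝ, E d) ∞ (fun x => (lift g x).2) :=
  (contDiff_snd (𝕜 := ℝ) (E := ℝ) (F := E d)).contMDiff.comp (contMDiff_lift g)

theorem contMDiff_kappa (g : SO0 d) : ContMDiff (𝓡 d) 𝓘(ℝ, ℝ) ∞ (kappa g) := by
  intro x
  have h : ContDiffAt ℝ ∞ (fun t : ℝ => t⁻¹) ((lift g x).1) :=
    contDiffAt_inv ℝ (lift_fst_pos g x).ne'
  exact h.contMDiffAt.comp x (contMDiff_lift_fst g x)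

theorem contMDiff_act (g : SO0 d) : ContMDiff (𝓡 d) (𝓡 d) ∞ (act g) :=
  have := Fact.mk (finrank_euclideanSpace_fin (𝕜 := ℝ) (n := d + 1))
  ((contMDiff_kappa g).smul (contMDiff_lift_snd g)).codRestrict_sphere _

/-- The defining property of the conformal factor: `|Dg(x) ξ| = κ(g, x) |ξ|` for all tangent vectors
`ξ` at `x`, with the lengths taken in `E`. -/
theorem norm_mfderiv_act (g : SO0 d) (x : S d) (ξ : TangentSpace (𝓡 d) x) :
    ‖mvfderiv (𝓡 d) (fun y : S d => (y : E d)) (act g x) (mfderiv (𝓡 d) (𝓡 d) (act g) x ξ)‖ =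
    kappa g x * ‖mvfderiv (𝓡 d) (fun y : S d => (y : E d)) x ξ‖ := by
  have := Fact.mk (finrank_euclideanSpace_fin (𝕜 := ℝ) (n := d + 1))
  have hcoe : ∀ y : S d, MDifferentiableAt (𝓡 d) 𝓘(ℝ, E d) (fun y : S d => (y : E d)) y :=
    fun y => (contMDiff_coe_sphere (m := ∞) (n := d)).mdifferentiableAt (by simp)
  have hact : MDifferentiableAt (𝓡 d) (𝓡 d) (act g) x :=
    (contMDiff_act g).mdifferentiableAt (by simp)
  have hpos := lift_fst_pos g x
  set L := toCLM g with hL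
  have hd : HasFDerivAt (fun u : E d => L ((1 : ℝ), u)) (L.comp (.inr ℝ ℝ (E d))) (x : E d) :=
    L.hasFDerivAt.comp (x : E d) (hasFDerivAt_prodMk_right (1 : ℝ) (x : E d))
  have hne : (L ((1 : ℝ), (x : E d))).1 ≠ 0 := hpos.ne'
  have h3 := ((hasDerivAt_inv hne).comp_hasFDerivAt (x : E d) hd.fst).smul hd.snd
  have h4 := h3.hasMFDerivAt.comp x (hcoe x).hasMFDerivAt
  have h5 : HasMFDerivAt (𝓡 d) 𝓘(ℝ, E d) (fun y : S d => (act g y : E d)) x _ :=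
    (hcoe (act g x)).hasMFDerivAt.comp x hact.hasMFDerivAt
  have h7 := congrArg (fun A => A ξ) (hasMFDerivAt_unique h5 h4)
  set v : E d := mvfderiv (𝓡 d) (fun y : S d => (y : E d)) x ξ with hv
  have horth : inner ℝ (x : E d) v = 0 := by
    have h := range_mvfderiv_subtypeVal (n := d) x
    have h' : v ∈ (ℝ ∙ (x : E d))ᗮ := by
      rw [← h]
      exact ⟨ξ, rfl⟩
    exact Submodule.mem_orthogonal_singleton_iff_inner_right.1 h'
  have h8 : mvfderiv (𝓡 d) (fun y : S d => (y : E d)) (act g x)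
      (mfderiv (𝓡 d) (𝓡 d) (act g) x ξ) =
      (L ((1 : ℝ), (x : E d))).1⁻¹ • (L ((0 : ℝ), v)).2 +
      (-(((L ((1 : ℝ), (x : E d))).1 ^ 2)⁻¹) * (L ((0 : ℝ), v)).1) • (L ((1 : ℝ), (x : E d))).2 := by
    exact h7
  have hQ : ∀ p, (L p).1 ^ 2 - ‖(L p).2‖ ^ 2 = p.1 ^ 2 - ‖p.2‖ ^ 2 := g.2.1
  have hadd : L ((1 : ℝ), (x : E d) + v) = L ((1 : ℝ), (x : E d)) + L ((0 : ℝ), v) := by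
    rw [← map_add]
    simp
  have hx : ‖(x : E d)‖ = 1 := by simp
  have q1 := hQ ((1 : ℝ), (x : E d))
  have q2 := hQ ((0 : ℝ), v)
  have q3 := hQ ((1 : ℝ), (x : E d) + v)
  rw [hadd] at q3
  rw [h8]
  have hk : kappa g x = (L ((1 : ℝ), (x : E d))).1⁻¹ := rfl
  have hpos' : 0 < (L ((1 : ℝ), (x : E d))).1 := hpos
  rw [hk, ← sq_eq_sq₀ (norm_nonneg _) (mul_nonneg (inv_pos.2 hpos').le (norm_nonneg _))]
  clear_value v
  generalize L ((1 : ℝ), (x : E d)) = p at *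
  generalize L ((0 : ℝ), v) = q at *
  simp only [Prod.fst_add, Prod.snd_add, norm_add_sq_real, hx, horth] at q1 q2 q3
  have hw : inner ℝ q.2 p.2 = p.1 * q.1 := by
    rw [real_inner_comm]
    linarith
  have hp2 : ‖p.2‖ ^ 2 = p.1 ^ 2 := by linarith
  have hq2 : ‖q.2‖ ^ 2 = q.1 ^ 2 + ‖v‖ ^ 2 := by linarith
  rw [norm_add_sq_real, norm_smul, norm_smul, inner_smul_left, inner_smul_right, hw, mul_pow,
    mul_pow, hp2, hq2]
  simp only [Real.norm_eq_abs, sq_abs, conj_trivial]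
  field_simp
  ring

/-! ### The scalar principal series -/

/-- `C^∞(M)`: the complex vector space of smooth complex valued functions on a manifold `M`. -/
def SmoothFun {V H : Type*} [NormedAddCommGroup V] [NormedSpace ℝ V] [TopologicalSpace H]
    (I : ModelWithCorners ℝ V H) (M : Type*) [TopologicalSpace M] [ChartedSpace H M] :
    Submodule ℂ (M → ℂ) where
  carrier := {f | ContMDiff I 𝓘(ℝ, ℂ) ∞ f}
  add_mem' := fun hf hg => hf.add hg
  zero_mem' := contMDiff_const
  smul_mem' := fun c _ hf =>
    ((ContinuousLinearMap.mul ℝ ℂ c).contDiff (n := ∞)).contMDiff.comp hf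

/-- `C^∞(S)`. -/
abbrev CS (d : ℕ) : Submodule ℂ (S d → ℂ) := SmoothFun (𝓡 d) (S d)

/-- `C^∞(S × S)`. -/
abbrev CSS (d : ℕ) : Submodule ℂ (S d × S d → ℂ) := SmoothFun ((𝓡 d).prod (𝓡 d)) (S d × S d)

/-- `C^∞(S × S × S)`. -/
abbrev CSSS (d : ℕ) : Submodule ℂ (S d × S d × S d → ℂ) :=
  SmoothFun ((𝓡 d).prod ((𝓡 d).prod (𝓡 d))) (S d × S d × S d)

theorem contMDiff_kappa_cpow (g : SO0 d) (s : ℂ) :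
    ContMDiff (𝓡 d) 𝓘(ℝ, ℂ) ∞ (fun x => (kappa g x : ℂ) ^ s) := by
  have h1 : ContMDiff (𝓡 d) 𝓘(ℝ, ℂ) ∞
      (fun x => Complex.exp (Complex.ofRealCLM (Real.log (kappa g x)) * s)) := by
    intro x
    have h : ContDiffAt ℝ ∞
        (fun t : ℝ => Complex.exp (Complex.ofRealCLM (Real.log t) * s)) (kappa g x) := by
      have hl : ContDiffAt ℝ ∞ Real.log (kappa g x) :=
        Real.contDiffAt_log.2 (kappa_pos g x).ne'
      have hm : ContDiffAt ℝ ∞ (fun t : ℝ => Complex.ofRealCLM (Real.log t)) (kappa g x) :=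
        Complex.ofRealCLM.contDiff.contDiffAt.comp (kappa g x) hl
      exact (hm.mul contDiffAt_const).cexp
    exact h.contMDiffAt.comp x (contMDiff_kappa g x)
  convert h1 using 2 with x
  rw [Complex.cpow_def_of_ne_zero (by exact_mod_cast (kappa_pos g x).ne'),
    ← Complex.ofReal_log (kappa_pos g x).le]
  rfl

theorem contMDiff_mul_complex {V H M : Type*} [NormedAddCommGroup V] [NormedSpace ℝ V]
    [TopologicalSpace H] {I : ModelWithCorners ℝ V H} [TopologicalSpace M] [ChartedSpace H M]
    {f g : M → ℂ} (hf : ContMDiff I 𝓘(ℝ, ℂ) ∞ f) (hg : ContMDiff I 𝓘(ℝ, ℂ) ∞ g) :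
    ContMDiff I 𝓘(ℝ, ℂ) ∞ (fun x => f x * g x) :=
  (contDiff_mul (𝕜 := ℝ) (𝔸 := ℂ) (n := ∞)).contMDiff.comp (hf.prodMk_space hg)

/-- The operator `π_l(g)` on `C^∞(S)`: `π_l(g) f (x) = κ(g⁻¹, x)^(ρ + l) f(g⁻¹(x))`. -/
def piRep (l : ℂ) (g : SO0 d) : CS d →ₗ[ℂ] CS d where
  toFun f := ⟨fun x => (kappa g⁻¹ x : ℂ) ^ (rho d + l) * f.1 (act g⁻¹ x),
    contMDiff_mul_complex (contMDiff_kappa_cpow _ _) (f.2.comp (contMDiff_act _))⟩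
  map_add' f f' := by ext x; simp [mul_add]
  map_smul' c f := by ext x; simp; ring

/-- The operator `(π_l ⊗ π_m)(g)` on `C^∞(S × S)`:
`f ↦ κ(g⁻¹, x)^(ρ + l) κ(g⁻¹, y)^(ρ + m) f(g⁻¹(x), g⁻¹(y))`. -/
def piTensor (l m : ℂ) (g : SO0 d) : CSS d →ₗ[ℂ] CSS d where
  toFun f := ⟨fun p => (kappa g⁻¹ p.1 : ℂ) ^ (rho d + l) * (kappa g⁻¹ p.2 : ℂ) ^ (rho d + m) *
      f.1 (act g⁻¹ p.1, act g⁻¹ p.2),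
    contMDiff_mul_complex (contMDiff_mul_complex
      ((contMDiff_kappa_cpow _ _).comp contMDiff_fst)
      ((contMDiff_kappa_cpow _ _).comp contMDiff_snd))
      (f.2.comp (((contMDiff_act _).comp contMDiff_fst).prodMk
        ((contMDiff_act _).comp contMDiff_snd)))⟩
  map_add' f f' := by ext x; simp [mul_add]
  map_smul' c f := by ext x; simp; ring

/-! ### Covariant bi-differential operators -/

/-- All the partial derivatives of `f` of order at most `N` vanish at the point `p` (read in the
preferred chart at `p`), that is, the `N`-jet of `f` at `p` is zero. -/
def JetVanishes {V H M : Type*} [NormedAddCommGroup V] [NormedSpace ℝ V]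
    [TopologicalSpace H] (I : ModelWithCorners ℝ V H) [TopologicalSpace M] [ChartedSpace H M]
    (N : ℕ) (f : M → ℂ) (p : M) : Prop :=
  ∀ m ≤ N, iteratedFDeriv ℝ m (f ∘ (extChartAt I p).symm) (extChartAt I p p) = 0

/-- `B : C^∞(S × S) → C^∞(S)` is a bi-differential operator: for some `N`, the value `B f (x)` is a
linear combination of the partial derivatives of `f` of order at most `N` at `(x, x)`, that is, it
depends only on the `N`-jet of `f` at `(x, x)`. (The coefficients are then smooth in `x`, because
`B` maps smooth functions to smooth functions.) -/
def IsBiDifferential (B : CSS d →ₗ[ℂ] CS d) : Prop :=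
  ∃ N : ℕ, ∀ (f : CSS d) (x : S d),
    JetVanishes ((𝓡 d).prod (𝓡 d)) N f.1 (x, x) → (B f).1 x = 0

/-- The space `BD_G(l, m; k)` of the bi-differential operators from `C^∞(S × S)` to `C^∞(S)` that
are covariant with respect to `π_l ⊗ π_m` and `π_{l + m + ρ + 2k}`. -/
def BD (d : ℕ) (l m : ℂ) (k : ℕ) : Submodule ℂ (CSS d →ₗ[ℂ] CS d) where
  carrier := {B | IsBiDifferential B ∧
    ∀ (g : SO0 d) (f : CSS d), B (piTensor l m g f) = piRep (l + m + rho d + 2 * k) g (B f)}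
  add_mem' := by
    rintro B C ⟨⟨N, hN⟩, hB⟩ ⟨⟨N', hN'⟩, hC⟩
    refine ⟨⟨max N N', fun f x h => ?_⟩, fun g f => ?_⟩
    · have h1 := hN f x fun m hm => h m (hm.trans (le_max_left _ _))
      have h2 := hN' f x fun m hm => h m (hm.trans (le_max_right _ _))
      simp [h1, h2]
    · simp [hB, hC]
  zero_mem' := ⟨⟨0, fun f x _ => rfl⟩, fun g f => by simp⟩
  smul_mem' := by
    rintro c B ⟨⟨N, hN⟩, hB⟩
    refine ⟨⟨N, fun f x h => ?_⟩, fun g f => ?_⟩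
    · simp [hN f x h]
    · simp [hB]

/-! ### The zero set of the normalized family of invariant trilinear forms -/

/-- The geometric parameter `α = (α₁, α₂, α₃)` associated with the spectral parameter
`l = (l₁, l₂, l₃)`. -/
def geom (d : ℕ) (l : Fin 3 → ℂ) : Fin 3 → ℂ :=
  ![-rho d - l 0 + l 1 + l 2, -rho d + l 0 - l 1 + l 2, -rho d + l 0 + l 1 - l 2]

/-- The Euclidean surface measure on the sphere. -/
def sigma (d : ℕ) : Measure (S d) := (volume : Measure (E d)).toSphere

/-- `K^l(f) = ∫∫∫ |x - y|^α₃ |y - z|^α₁ |z - x|^α₂ f(x, y, z) dx dy dz`. -/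
def trilinearK (d : ℕ) (l : Fin 3 → ℂ) (f : S d × S d × S d → ℂ) : ℂ :=
  ∫ p : S d × S d × S d,
    (dist p.1 p.2.1 : ℂ) ^ geom d l 2 * (dist p.2.1 p.2.2 : ℂ) ^ geom d l 0 *
      (dist p.2.2 p.1 : ℂ) ^ geom d l 1 * f p
    ∂((sigma d).prod ((sigma d).prod (sigma d)))

/-- The domain of absolute convergence of `K^l`: `Re α_j > -(n - 1)` for `j = 1, 2, 3` and
`Re (α₁ + α₂ + α₃) > -2 (n - 1)`. -/
def convergenceDomain (d : ℕ) : Set (Fin 3 → ℂ) :=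
  {l | (∀ j, -(d : ℝ) < (geom d l j).re) ∧
    -(2 * d : ℝ) < (geom d l 0 + geom d l 1 + geom d l 2).re}

/-- The product of the four Gamma factors in the normalization of `K^l`. -/
def gammaFactors (d : ℕ) (l : Fin 3 → ℂ) : ℂ :=
  Complex.Gamma (rho d + geom d l 0 / 2) * Complex.Gamma (rho d + geom d l 1 / 2) *
    Complex.Gamma (rho d + geom d l 2 / 2) *
    Complex.Gamma ((geom d l 0 + geom d l 1 + geom d l 2) / 2 + 2 * rho d)

/-- `F` is the function `l ↦ K̃^l(f)`: the holomorphic function on `ℂ³` that equals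
`K^l(f)`, divided by the Gamma factors, on the domain of convergence. It is unique, as the domain of
convergence is open and not empty. -/
def IsNormalizedK (d : ℕ) (f : S d × S d × S d → ℂ) (F : (Fin 3 → ℂ) → ℂ) : Prop :=
  AnalyticOnNhd ℂ F univ ∧
    ∀ l ∈ convergenceDomain d, F l = trilinearK d l f / gammaFactors d l

/-- The zero set `Z` of the holomorphic family `K̃^l`: all `l` such that `K̃^l(f) = 0` for
every smooth function `f` on `S × S × S`. -/
def Z (d : ℕ) : Set (Fin 3 → ℂ) :=
  {l | ∀ f ∈ CSSS d, ∀ F : (Fin 3 → ℂ) → ℂ, IsNormalizedK d f F → F l = 0}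

/-- `Z_k`: all `(l₁, l₂)` such that `(l₁, l₂, -ρ - 2k - l₁ - l₂)` belongs to `Z`. -/
def Zk (d k : ℕ) : Set (ℂ × ℂ) :=
  {l | ![l.1, l.2, -rho d - 2 * k - l.1 - l.2] ∈ Z d}

end ConformalSphere

end

open Set Metric MeasureTheory
open scoped Manifold ContDiff

noncomputable section

namespace ConformalSphere

variable {d : ℕ}

/-! ### Tangential derivations of the sphere -/

instance factFinrank (d : ℕ) : Fact (Module.finrank ℝ (E d) = d + 1) :=
  ⟨finrank_euclideanSpace_fin⟩

/-- The first basis vector, as a point of the sphere. -/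
def pole (d : ℕ) : S d := ⟨EuclideanSpace.single 0 1, by simp⟩

theorem norm_coe (x : S d) : ‖(x : E d)‖ = 1 := by simp

theorem coe_ne_zero (x : S d) : (x : E d) ≠ 0 := by
  intro h; have := norm_coe x; simp [h] at this

theorem inner_self_coe (x : S d) : inner ℝ (x : E d) (x : E d) = 1 := by
  rw [real_inner_self_eq_norm_sq, norm_coe]; norm_num

/-- The radial projection `v ↦ v / |v|` onto the sphere. -/
def proj (v : E d) : S d :=
  if h : v = 0 then pole d else ⟨‖v‖⁻¹ • v, by simp [norm_smul, h]⟩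

theorem coe_proj {v : E d} (h : v ≠ 0) : (proj v : E d) = ‖v‖⁻¹ • v := by simp [proj, h]

theorem proj_coe (x : S d) : proj (x : E d) = x := by
  apply Subtype.ext; rw [coe_proj (coe_ne_zero x), norm_coe]; simp

theorem proj_smul {r : ℝ} (hr : 0 < r) (v : E d) : proj (r • v) = proj v := by
  by_cases h : v = 0
  · simp [h]
  · apply Subtype.ext
    rw [coe_proj h, coe_proj (smul_ne_zero hr.ne' h), norm_smul, smul_smul, Real.norm_eq_abs,
      abs_of_pos hr]
    congr 1
    field_simp

theorem contDiffAt_coe_proj {v : E d} (h : v ≠ 0) {m : ℕ∞ω} :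
    ContDiffAt ℝ m (fun w : E d => ‖w‖⁻¹ • w) v :=
  ((contDiffAt_norm ℝ h).inv (by simpa using h)).smul contDiffAt_id

theorem contMDiffAt_proj {v : E d} (h : v ≠ 0) {m : ℕ∞ω} :
    ContMDiffAt 𝓘(ℝ, E d) (𝓡 d) m (proj (d := d)) v := by
  let U : TopologicalSpace.Opens (E d) := ⟨{0}ᶜ, isOpen_compl_singleton⟩
  have h1 : ContMDiff 𝓘(ℝ, E d) 𝓘(ℝ, E d) m (fun w : U => ‖(w : E d)‖⁻¹ • (w : E d)) := by
    intro w
    have := (contDiffAt_coe_proj (d := d) (v := w) w.2 (m := m)).contMDiffAt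
    exact ContMDiffAt.comp (I' := 𝓘(ℝ, E d)) (f := fun w : U => (w : E d)) w this
      (contMDiff_subtype_val (I := 𝓘(ℝ, E d)) w)
  have h2 := h1.codRestrict_sphere (n := d) (fun w => by
    have hw : (w : E d) ≠ 0 := w.2
    simp [norm_smul, hw])
  have h3 := (contMDiffAt_subtype_iff (U := U) (f := proj (d := d)) (x := ⟨v, h⟩)
    (I := 𝓘(ℝ, E d)) (I' := 𝓡 d) (n := m)).1
  apply h3
  refine (h2 ⟨v, h⟩).congr_of_eventuallyEq (Filter.Eventually.of_forall fun w => ?_)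
  apply Subtype.ext
  exact coe_proj (v := (w : E d)) w.2

theorem contMDiff_coe {m : ℕ∞ω} : ContMDiff (𝓡 d) 𝓘(ℝ, E d) m (fun x : S d => (x : E d)) :=
  contMDiff_coe_sphere

/-- The derivative of `f` in the direction of the tangential part of `e`. -/
def sd (e : E d) (f : S d → ℂ) (x : S d) : ℂ := fderiv ℝ (fun v => f (proj v)) x e

theorem contDiffAt_comp_proj {f : S d → ℂ} {m : ℕ∞ω} {x : S d}
    (hf : ContMDiffAt (𝓡 d) 𝓘(ℝ, ℂ) m f x) :
    ContDiffAt ℝ m (fun v => f (proj v)) (x : E d) := by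
  rw [← contMDiffAt_iff_contDiffAt]
  have := contMDiffAt_proj (coe_ne_zero x) (m := m)
  refine ContMDiffAt.comp (x : E d) ?_ this
  rwa [proj_coe]

variable {V H M : Type*} [NormedAddCommGroup V] [NormedSpace ℝ V] [TopologicalSpace H]
    {I : ModelWithCorners ℝ V H} [TopologicalSpace M] [ChartedSpace H M]

/-- Derivatives along the sphere of a function that depends smoothly on a parameter are smooth. -/
theorem contMDiff_sd_param [IsManifold I ∞ M] (e : E d) {f : S d → M → ℂ}
    (hf : ContMDiff ((𝓡 d).prod I) 𝓘(ℝ, ℂ) ∞ (Function.uncurry f)) :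
    ContMDiff ((𝓡 d).prod I) 𝓘(ℝ, ℂ) ∞ (fun p : S d × M => sd e (fun x => f x p.2) p.1) := by
  intro p
  have h1 : ContMDiffAt (((𝓡 d).prod I).prod 𝓘(ℝ, E d)) 𝓘(ℝ, ℂ) ∞
      (Function.uncurry (fun (q : S d × M) (v : E d) => f (proj v) q.2)) (p, (p.1 : E d)) := by
    have ha : ContMDiffAt (((𝓡 d).prod I).prod 𝓘(ℝ, E d)) (𝓡 d) ∞
        (fun z : (S d × M) × E d => proj z.2) (p, (p.1 : E d)) :=
      ContMDiffAt.comp (p, (p.1 : E d)) (contMDiffAt_proj (coe_ne_zero p.1)) contMDiffAt_snd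
    have hb : ContMDiffAt (((𝓡 d).prod I).prod 𝓘(ℝ, E d)) I ∞
        (fun z : (S d × M) × E d => z.1.2) (p, (p.1 : E d)) :=
      (contMDiff_snd.comp contMDiff_fst).contMDiffAt
    exact ContMDiffAt.comp (p, (p.1 : E d)) hf.contMDiffAt (ha.prodMk hb)
  have h2 := ContMDiffAt.mfderiv (m := ∞) (fun (q : S d × M) (v : E d) => f (proj v) q.2)
    (fun q : S d × M => (q.1 : E d)) h1
    ((contMDiff_coe.comp contMDiff_fst).contMDiffAt) (by simp)
  have h2' : ContMDiffAt ((𝓡 d).prod I) 𝓘(ℝ, E d →L[ℝ] ℂ) ∞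
      (fun q : S d × M => fderiv ℝ (fun v => f (proj v) q.2) (q.1 : E d)) p := by
    have h4 := inTangentCoordinates_model_space (I := 𝓘(ℝ, E d)) (I' := 𝓘(ℝ, ℂ))
      (fun q : S d × M => (q.1 : E d)) (fun x : S d × M => f (proj (x.1 : E d)) x.2)
      (fun q : S d × M => fderiv ℝ (fun v => f (proj v) q.2) (q.1 : E d)) p
    rw [← h4]
    simp only [mfderiv_eq_fderiv] at h2
    exact h2
  exact h2'.clm_apply (contMDiffAt_const (c := e))

theorem contMDiff_sd {m n : ℕ∞ω} (hmn : m + 1 ≤ n) (e : E d) {f : S d → ℂ}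
    (hf : ContMDiff (𝓡 d) 𝓘(ℝ, ℂ) n f) : ContMDiff (𝓡 d) 𝓘(ℝ, ℂ) m (sd e f) := by
  intro x
  have h1 := contDiffAt_comp_proj (hf x)
  have h2 := (h1.fderiv_right hmn).clm_apply (contDiffAt_const (c := e))
  exact ContMDiffAt.comp x h2.contMDiffAt contMDiff_coe.contMDiffAt

section derivation

/-- Differentiability of `f` at `x`, read off on the radial extension. -/
def SDiff (f : S d → ℂ) (x : S d) : Prop := DifferentiableAt ℝ (fun v => f (proj v)) (x : E d)

theorem SDiff.of_contMDiff {f : S d → ℂ} {m : ℕ∞ω} (hf : ContMDiff (𝓡 d) 𝓘(ℝ, ℂ) m f)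
    (hm : m ≠ 0) (x : S d) : SDiff f x := (contDiffAt_comp_proj (hf x)).differentiableAt hm

variable {f g : S d → ℂ} {x : S d}

theorem SDiff.const (c : ℂ) : SDiff (fun _ => c) x := differentiableAt_const c

theorem sd_add (e : E d) (hf : SDiff f x) (hg : SDiff g x) :
    sd e (fun x => f x + g x) x = sd e f x + sd e g x := by
  simp only [sd]
  rw [fderiv_fun_add hf hg]; rfl

theorem sd_mul (e : E d) (hf : SDiff f x) (hg : SDiff g x) :
    sd e (fun x => f x * g x) x = f x * sd e g x + sd e f x * g x := by
  simp only [sd]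
  rw [fderiv_fun_mul hf hg]
  simp [proj_coe, mul_comm]

theorem sd_const (e : E d) (c : ℂ) : sd e (fun _ => c) x = 0 := by simp [sd]

theorem sd_const_mul (e : E d) (c : ℂ) (hf : SDiff f x) :
    sd e (fun x => c * f x) x = c * sd e f x := by
  rw [sd_mul e (SDiff.const c) hf, sd_const]; ring

theorem sd_vadd (e e' : E d) : sd (e + e') f x = sd e f x + sd e' f x := by simp [sd]

theorem sd_vsmul (r : ℝ) (e : E d) : sd (r • e) f x = r * sd e f x := by simp [sd]

theorem sd_self : sd (x : E d) f x = 0 := by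
  simp only [sd]
  by_cases h : DifferentiableAt ℝ (fun v => f (proj v)) (x : E d)
  swap
  · rw [fderiv_zero_of_not_differentiableAt h]; simp
  have h1 : HasDerivAt (fun r : ℝ => r • (x : E d)) ((1 : ℝ) • (x : E d)) 1 :=
    (hasDerivAt_id (1 : ℝ)).smul_const _
  have h' : HasFDerivAt (fun v => f (proj v)) (fderiv ℝ (fun v => f (proj v)) (x : E d))
      ((1 : ℝ) • (x : E d)) := by simpa using h.hasFDerivAt
  have h2 := h'.comp_hasDerivAt (1 : ℝ) h1
  have h3 : HasDerivAt (fun r : ℝ => f (proj (r • (x : E d)))) 0 1 := by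
    refine (hasDerivAt_const (1 : ℝ) (f x)).congr_of_eventuallyEq ?_
    filter_upwards [lt_mem_nhds (zero_lt_one (α := ℝ))] with r hr
    rw [proj_smul hr, proj_coe]
  simpa using h2.unique h3

/-- The composition of an ambient function with the inclusion. -/
theorem sd_ambient {F : E d → ℂ} (hF : DifferentiableAt ℝ F (x : E d)) (e : E d) :
    SDiff (fun x : S d => F x) x ∧
    sd e (fun x : S d => F x) x = fderiv ℝ F x (e - inner ℝ (x : E d) e • (x : E d)) := by
  have hx := coe_ne_zero x
  have h1 : HasFDerivAt (fun w : E d => ‖w‖⁻¹ • w)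
      (ContinuousLinearMap.id ℝ (E d) - (innerSL ℝ (x : E d)).smulRight (x : E d)) (x : E d) := by
    have hn : HasFDerivAt (fun w : E d => ‖w‖) (innerSL ℝ (x : E d)) (x : E d) := by
      have h := (contDiffAt_norm ℝ hx (n := 1)).differentiableAt (by simp) |>.hasFDerivAt
      have h2 : HasFDerivAt (fun w : E d => ‖w‖ ^ 2) (2 • innerSL ℝ (x : E d)) (x : E d) :=
        (hasStrictFDerivAt_norm_sq (x : E d)).hasFDerivAt
      have h3 := h.pow 2
      have h4 := h3.unique h2
      have key : fderiv ℝ (fun w : E d => ‖w‖) (x : E d) = innerSL ℝ (x : E d) := by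
        ext v
        have := congrArg (fun A => A v) h4
        simpa using this
      rwa [key] at h
    have h3 := (hasDerivAt_inv (x := ‖(x : E d)‖) (by simp)).comp_hasFDerivAt (x : E d) hn
    have h4 := h3.smul (hasFDerivAt_id (x : E d))
    refine h4.congr_fderiv ?_
    ext v
    simp
    ring
  have h2 : HasFDerivAt F (fderiv ℝ F (x : E d)) (‖(x : E d)‖⁻¹ • (x : E d)) := by
    simpa [norm_coe] using hF.hasFDerivAt
  have h3 := HasFDerivAt.comp (f := fun w : E d => ‖w‖⁻¹ • w) (x : E d) h2 h1
  have h4 : (fun v => F (proj v : E d)) =ᶠ[nhds (x : E d)] F ∘ (fun w : E d => ‖w‖⁻¹ • w) := by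
    filter_upwards [isOpen_ne.mem_nhds hx] with v hv
    simp [coe_proj hv]
  have h5 := h3.congr_of_eventuallyEq h4
  refine ⟨h5.differentiableAt, ?_⟩
  rw [sd, h5.fderiv]
  simp

end derivation

/-! ### The Todorov operator -/

theorem sd_congr {f g : S d → ℂ} {x : S d} (h : f =ᶠ[nhds x] g) (e : E d) :
    sd e f x = sd e g x ∧ (SDiff f x ↔ SDiff g x) := by
  have hc : ContinuousAt (proj (d := d)) (x : E d) :=
    (contMDiffAt_proj (coe_ne_zero x) (m := 0)).continuousAt
  rw [ContinuousAt, proj_coe] at hc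
  have h2 : (fun v => f (proj v)) =ᶠ[nhds (x : E d)] fun v => g (proj v) := hc.eventually h
  exact ⟨by simp only [sd]; rw [h2.fderiv_eq], h2.differentiableAt_iff⟩

/-- The standard basis of `E`. -/
def bv (i : Fin (d + 1)) : E d := EuclideanSpace.single i 1

theorem inner_bv (v : E d) (i : Fin (d + 1)) : inner ℝ v (bv i) = v i := by
  simp [bv, EuclideanSpace.inner_single_right]

theorem sum_bv (v : E d) : ∑ i, v i • bv i = v := by
  ext j
  simp [bv, Finset.sum_apply, Pi.single_apply]

theorem sum_coord_sq (x : S d) : ∑ i, (x : E d) i ^ 2 = 1 := by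
  have h := EuclideanSpace.norm_sq_eq (x : E d)
  rw [norm_coe] at h
  simpa using h.symm

/-- The Laplacian of the sphere. -/
def Lap (f : S d → ℂ) (x : S d) : ℂ := ∑ i, sd (bv i) (sd (bv i) f) x

/-- The Todorov operator, from weight `t` to weight `t + 1`, in the direction `w`. -/
def dd (t : ℂ) (w : ℝ × E d) (f : S d → ℂ) (x : S d) : ℂ :=
  (rho d - 1 - t) * (sd w.2 f x - t * (inner ℝ (x : E d) w.2 : ℝ) * f x) +
    1 / 2 * ((w.1 - inner ℝ (x : E d) w.2 : ℝ) : ℂ) * (Lap f x + t * (t + 1 - d) * f x)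

/-- The Lorentzian pairing. -/
def lz (p q : ℝ × E d) : ℝ := p.1 * q.1 - inner ℝ p.2 q.2

/-- The contraction with the Lorentzian form. -/
def ctr (b : (ℝ × E d) → (ℝ × E d) → ℂ) : ℂ := b (1, 0) (1, 0) - ∑ i, b (0, bv i) (0, bv i)

/-- The wave operator. -/
def Box (F : ℝ × E d → ℂ) (p : ℝ × E d) : ℂ :=
  ctr fun u v => fderiv ℝ (fderiv ℝ F) p u v

theorem sd_restrict {F : ℝ × E d → ℂ} {x : S d} (hF : DifferentiableAt ℝ F (1, (x : E d)))
    {f : S d → ℂ} (hf : f =ᶠ[nhds x] fun y => F (1, (y : E d))) (e : E d) :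
    SDiff f x ∧ sd e f x = fderiv ℝ F (1, (x : E d)) (0, e - inner ℝ (x : E d) e • (x : E d)) := by
  have h1 : HasFDerivAt (fun v : E d => F (1, v))
      ((fderiv ℝ F (1, (x : E d))).comp (.inr ℝ ℝ (E d))) (x : E d) :=
    HasFDerivAt.comp (f := fun v : E d => ((1 : ℝ), v)) (x : E d) hF.hasFDerivAt
      (hasFDerivAt_prodMk_right (1 : ℝ) (x : E d))
  obtain ⟨h2, h3⟩ := sd_ambient h1.differentiableAt e
  obtain ⟨h4, h5⟩ := sd_congr hf e
  refine ⟨h5.2 h2, ?_⟩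
  rw [h4, h3, h1.fderiv]
  simp

theorem dd_ambient {F : ℝ × E d → ℂ} {x : S d} {s : ℂ} (hF : ContDiffAt ℝ 2 F (1, (x : E d)))
    (hE : ∀ᶠ p in nhds ((1 : ℝ), (x : E d)), fderiv ℝ F p p = -s * F p)
    {f : S d → ℂ} (hf : f =ᶠ[nhds x] fun y => F (1, (y : E d))) (w : ℝ × E d) :
    dd s w f x = (rho d - 1 - s) * fderiv ℝ F (1, (x : E d)) w -
      1 / 2 * (lz (1, (x : E d)) w : ℂ) * Box F (1, (x : E d)) := by
  set X : ℝ × E d := (1, (x : E d)) with hX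
  have hF1 : ∀ᶠ p in nhds X, ContDiffAt ℝ 2 F p := hF.eventually (by simp)
  have hd1 : DifferentiableAt ℝ F X := hF.differentiableAt (by simp)
  have hdF : DifferentiableAt ℝ (fderiv ℝ F) X :=
    (hF.fderiv_right (m := 1) (by norm_num)).differentiableAt (by simp)
  set D2 := fderiv ℝ (fderiv ℝ F) X with hD2
  have hcx : Filter.Tendsto (fun y : S d => ((1 : ℝ), (y : E d))) (nhds x) (nhds X) :=
    (continuous_const.prodMk continuous_subtype_val).continuousAt
  have hs1 : ∀ e : E d, sd e f =ᶠ[nhds x] fun y => fderiv ℝ F (1, (y : E d))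
      (0, e - inner ℝ (y : E d) e • (y : E d)) := by
    intro e
    filter_upwards [hcx.eventually hF1, hf.eventuallyEq_nhds] with y hy hy2
    exact (sd_restrict (hy.differentiableAt (by simp)) hy2 e).2
  have hs2 : ∀ e : E d, sd e (sd e f) x =
      D2 (0, e - inner ℝ (x : E d) e • (x : E d)) (0, e - inner ℝ (x : E d) e • (x : E d)) -
      fderiv ℝ F X (0, (inner ℝ e e - inner ℝ (x : E d) e ^ 2) • (x : E d) +
        inner ℝ (x : E d) e • (e - inner ℝ (x : E d) e • (x : E d))) := by
    intro e
    have h1 : HasFDerivAt (fun v : E d => fderiv ℝ F (1, v))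
        (D2.comp (.inr ℝ ℝ (E d))) (x : E d) :=
      HasFDerivAt.comp (f := fun v : E d => ((1 : ℝ), v)) (x : E d) hdF.hasFDerivAt
        (hasFDerivAt_prodMk_right (1 : ℝ) (x : E d))
    have h2 : HasFDerivAt (fun v : E d => inner ℝ v e) (innerSL ℝ e) (x : E d) := by
      have := (innerSL ℝ e).hasFDerivAt (x := (x : E d))
      refine this.congr_of_eventuallyEq (Filter.Eventually.of_forall fun v => ?_)
      simp [real_inner_comm]
    have h3 : HasFDerivAt (fun v : E d => ((0 : ℝ), e - inner ℝ v e • v)) _ (x : E d) :=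
      (hasFDerivAt_const (0 : ℝ) (x : E d)).prodMk
        ((hasFDerivAt_const e (x : E d)).sub (h2.smul (hasFDerivAt_id (x : E d))))
    have h4 := h1.clm_apply h3
    rw [(sd_congr (hs1 e) e).1]
    obtain ⟨_, h5⟩ := sd_ambient (F := fun v : E d => fderiv ℝ F (1, v) (0, e - inner ℝ v e • v))
      h4.differentiableAt e
    rw [h5, h4.fderiv]
    simp only [_root_.add_apply, ContinuousLinearMap.comp_apply,
      ContinuousLinearMap.flip_apply, ContinuousLinearMap.prod_apply,
      _root_.sub_apply, _root_.zero_apply,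
      ContinuousLinearMap.inr_apply, _root_.smul_apply,
      ContinuousLinearMap.smulRight_apply, innerSL_apply_apply,
      ContinuousLinearMap.id_apply]
    have hneg : ∀ (a : ℂ) u, a - fderiv ℝ F X u = a + fderiv ℝ F X (-u) := by
      intro a u; rw [map_neg, sub_eq_add_neg]
    rw [add_comm, hneg]
    congr 2
    ext
    · simp
    · simp [inner_sub_right, inner_smul_right, real_inner_comm]
      ring
  set p := fderiv ℝ F X (1, 0) with hp
  set q := fderiv ℝ F X (0, (x : E d)) with hq
  have hXs : X = (1, 0) + (0, (x : E d)) := by simp [hX]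
  have hEX : p + q = -s * f x := by
    have := hE.self_of_nhds
    rw [hf.self_of_nhds]
    rw [← this, hp, hq, ← map_add, ← hXs]
  have hdE : ∀ v, D2 v X = (-s - 1) * fderiv ℝ F X v := by
    intro v
    have h1 := (hdF.hasFDerivAt.clm_apply (hasFDerivAt_id X))
    have h2 := (hd1.hasFDerivAt.const_mul (-s))
    have h3 := h1.congr_of_eventuallyEq (f₁ := fun p => -s * F p)
      (hE.mono fun p hp => hp.symm)
    have h4 := congrArg (fun A => A v) (h3.unique h2)
    simp at h4
    linear_combination h4
  have hsymm : ∀ u v, D2 u v = D2 v u := by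
    intro u v
    exact hF.isSymmSndFDerivAt (by simp) u v
  have e1 := hdE (1, 0)
  have e2 := hdE (0, (x : E d))
  have hDX : ∀ v, D2 v X = D2 v (1, 0) + D2 v (0, (x : E d)) := fun v => by
    rw [← map_add, ← hXs]
  rw [hDX] at e1 e2
  have hL : Lap f x = ∑ i, D2 (0, bv i) (0, bv i) - D2 (0, (x : E d)) (0, (x : E d)) - d * q := by
    have hsm : ∀ (r : ℝ) (v : E d), ((0 : ℝ), r • v) = r • ((0 : ℝ), v) := by intro r v; simp
    have hsb : ∀ (v u : E d), ((0 : ℝ), v - u) = ((0 : ℝ), v) - ((0 : ℝ), u) := by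
      intro r v; simp
    have hsa : ∀ (v u : E d), ((0 : ℝ), v + u) = ((0 : ℝ), v) + ((0 : ℝ), u) := by
      intro r v; simp
    have hsum : ∑ i, (x : E d) i • ((0 : ℝ), bv i) = ((0 : ℝ), (x : E d)) := by
      ext j
      · simp [Prod.fst_sum]
      · rw [Prod.snd_sum]
        simp [sum_bv]
    have hx2 := sum_coord_sq x
    have t1 : ∑ i, ((x : E d) i : ℂ) * D2 (0, bv i) (0, (x : E d)) =
        D2 (0, (x : E d)) (0, (x : E d)) := by
      have h := congrArg (fun u => D2 u (0, (x : E d))) hsum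
      simpa only [map_sum, map_smul, _root_.sum_apply, _root_.smul_apply,
        Complex.real_smul] using h
    have t2 : ∑ i, ((x : E d) i : ℂ) * fderiv ℝ F X (0, bv i) = q := by
      have h := congrArg (fun u => fderiv ℝ F X u) hsum
      simpa only [map_sum, map_smul, Complex.real_smul] using h
    have hx2' : ∑ i, ((x : E d) i : ℂ) ^ 2 = 1 := by exact_mod_cast hx2
    have hbb : ∀ i : Fin (d + 1), inner ℝ (bv i) (bv i) = (1 : ℝ) := by
      intro i; simp [bv]
    unfold Lap
    rw [Finset.sum_congr rfl fun i _ => hs2 (bv i)]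
    simp only [inner_bv, hsm, hsb, hsa, map_add, map_sub, map_smul, hbb,
      _root_.sub_apply, _root_.smul_apply, Complex.real_smul]
    rw [← hq]
    have : ∀ i : Fin (d + 1), D2 (0, bv i) (0, bv i) - ((x : E d) i : ℂ) * D2 (0, (x : E d)) (0, bv i)
        - (((x : E d) i : ℂ) * (D2 (0, bv i) (0, (x : E d)) -
          ((x : E d) i : ℂ) * D2 (0, (x : E d)) (0, (x : E d)))) -
        (((1 - (x : E d) i ^ 2 : ℝ) : ℂ) * q + ((x : E d) i : ℂ) * (fderiv ℝ F X (0, bv i) -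
          ((x : E d) i : ℂ) * q)) = D2 (0, bv i) (0, bv i)
          - 2 * (((x : E d) i : ℂ) * D2 (0, bv i) (0, (x : E d))) +
          ((x : E d) i : ℂ) ^ 2 * (D2 (0, (x : E d)) (0, (x : E d)))
          - q + 2 * (((x : E d) i : ℂ) ^ 2 * q) - ((x : E d) i : ℂ) * fderiv ℝ F X (0, bv i) := by
      intro i
      rw [hsymm (0, (x : E d)) (0, bv i)]
      push_cast
      ring
    rw [Finset.sum_congr rfl fun i _ => this i]
    simp only [Finset.sum_sub_distrib, Finset.sum_add_distrib, ← Finset.mul_sum, ← Finset.sum_mul,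
      t1, t2, hx2', Finset.sum_const, Finset.card_univ, Fintype.card_fin]
    simp
    ring
  have hw : fderiv ℝ F X w = w.1 * p + sd w.2 f x + (inner ℝ (x : E d) w.2 : ℝ) * q := by
    rw [(sd_restrict hd1 hf w.2).2, hp, hq]
    have : w = w.1 • ((1 : ℝ), (0 : E d)) + (0, w.2 - inner ℝ (x : E d) w.2 • (x : E d)) +
        inner ℝ (x : E d) w.2 • ((0 : ℝ), (x : E d)) := by
      ext <;> simp
    conv_lhs => rw [this]
    rw [map_add, map_add, map_smul, map_smul]
    simp [hX]
  have hB : Box F X = D2 (1, 0) (1, 0) - ∑ i, D2 (0, bv i) (0, bv i) := rfl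
  have hlz : (lz X w : ℝ) = w.1 - inner ℝ (x : E d) w.2 := by simp [lz, hX]
  rw [dd, hw, hB, hlz, hL]
  have e3 := hsymm (1, 0) (0, (x : E d))
  rw [← hp] at e1
  rw [← hq] at e2
  generalize (inner ℝ (x : E d) w.2 : ℝ) = m
  generalize (∑ i, D2 (0, bv i) (0, bv i)) = Q at *
  have hrho : (d : ℂ) = 2 * rho d := by simp [rho]; ring
  rw [hrho]
  push_cast
  linear_combination (1 / 2 * ((w.1 : ℂ) - m)) * (e1 - e2 - e3) +
    ((rho d - 1 - s) * m - 1 / 2 * ((w.1 : ℂ) - m) * (s + 1 - 2 * rho d)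
      - 2 * rho d * w.1 + (s + 1) * (m + w.1)) * hEX

/-! ### Covariance of the Todorov operator -/

theorem lz_act (g : SO0 d) (p q : ℝ × E d) : lz (g.1 p) (g.1 q) = lz p q := by
  have h : ∀ p : ℝ × E d, lorentzForm d p = lz p p := by
    intro p; simp [lorentzForm, lz]; ring
  have hadd : ∀ p q : ℝ × E d, lz (p + q) (p + q) = lz p p + 2 * lz p q + lz q q := by
    intro p q
    simp only [lz, Prod.fst_add, Prod.snd_add, inner_add_left, inner_add_right]
    rw [real_inner_comm q.2 p.2]; ring
  have h1 := g.2.1 (p + q)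
  rw [map_add, h, h, hadd, hadd, ← h, ← h, ← h, ← h, g.2.1 p, g.2.1 q] at h1
  linarith

theorem lz_comm (p q : ℝ × E d) : lz p q = lz q p := by
  simp [lz, mul_comm, real_inner_comm]

theorem coord_expand (v : ℝ × E d) :
    v = lz v (1, 0) • ((1 : ℝ), (0 : E d)) - ∑ i, lz v (0, bv i) • ((0 : ℝ), bv i) := by
  ext j
  · simp [lz, Prod.fst_sum]
  · rw [Prod.snd_sub, Prod.snd_sum]
    have h := congrArg (fun u : E d => u j) (sum_bv v.2)
    simp only [lz, mul_zero, inner_bv, zero_sub, Prod.smul_mk, neg_smul]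
    simpa using h.symm

theorem ctr_act (g : SO0 d) (b : (ℝ × E d) →ₗ[ℝ] (ℝ × E d) →ₗ[ℝ] ℂ) :
    ctr (fun u v => b (g.1 u) (g.1 v)) = ctr (fun u v => b u v) := by
  have hex : ∀ u v, b u v = lz v (1, 0) * b u (1, 0) - ∑ i, lz v (0, bv i) * b u (0, bv i) := by
    intro u v
    conv_lhs => rw [coord_expand v]
    simp only [map_sub, map_sum, map_smul, Complex.real_smul]
  have hex' : ∀ u v, b v u = lz v (1, 0) * b (1, 0) u - ∑ i, lz v (0, bv i) * b (0, bv i) u := by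
    intro u v
    conv_lhs => rw [coord_expand v]
    simp only [map_sub, map_sum, map_smul, Complex.real_smul, LinearMap.sub_apply,
      LinearMap.sum_apply, LinearMap.smul_apply]
  have key : ∀ w u : ℝ × E d, lz (g.1 (1, 0)) w * b (g.1 (1, 0)) u -
      ∑ i, lz (g.1 (0, bv i)) w * b (g.1 (0, bv i)) u = b w u := by
    intro w u
    have h1 : ∀ v, lz (g.1 v) w = lz (g.1.symm w) v := by
      intro v
      have := lz_act g v (g.1.symm w)
      rw [LinearEquiv.apply_symm_apply] at this
      rw [this, lz_comm]
    have h2 := congrArg (fun q => b (g.1 q) u) (coord_expand (g.1.symm w))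
    simp only [map_sub, map_sum, map_smul, LinearEquiv.apply_symm_apply, LinearMap.sub_apply,
      LinearMap.sum_apply, LinearMap.smul_apply, Complex.real_smul] at h2
    simp only [h1]
    exact h2.symm
  unfold ctr
  simp only []
  rw [hex (g.1 (1, 0)) (g.1 (1, 0)), ← key (1, 0) (1, 0)]
  have : ∀ i, b (g.1 (0, bv i)) (g.1 (0, bv i)) = _ := fun i => hex (g.1 (0, bv i)) (g.1 (0, bv i))
  rw [Finset.sum_congr rfl fun i _ => this i, Finset.sum_congr rfl fun i _ => (key (0, bv i) (0, bv i)).symm]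
  simp only [Finset.sum_sub_distrib]
  rw [Finset.sum_comm]
  ring

/-- The extension of `f` to the cone, homogeneous of degree `-s`. -/
def wext (s : ℂ) (f : S d → ℂ) (p : ℝ × E d) : ℂ := (p.1 : ℂ) ^ (-s) * f (proj p.2)

theorem contDiffAt_ofReal_cpow {t : ℝ} (ht : 0 < t) (s : ℂ) {m : ℕ∞ω} :
    ContDiffAt ℝ m (fun t : ℝ => (t : ℂ) ^ s) t := by
  have h1 : ContDiffAt ℝ m (fun t : ℝ => Complex.exp (Complex.ofRealCLM (Real.log t) * s)) t := by
    have hl : ContDiffAt ℝ m Real.log t := Real.contDiffAt_log.2 ht.ne'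
    have hm : ContDiffAt ℝ m (fun t : ℝ => Complex.ofRealCLM (Real.log t)) t :=
      Complex.ofRealCLM.contDiff.contDiffAt.comp t hl
    exact (hm.mul contDiffAt_const).cexp
  refine h1.congr_of_eventuallyEq ?_
  filter_upwards [lt_mem_nhds ht] with r hr
  rw [Complex.cpow_def_of_ne_zero (by exact_mod_cast hr.ne'), ← Complex.ofReal_log hr.le]
  rfl

theorem ofReal_inv_cpow {t : ℝ} (ht : 0 < t) (s : ℂ) : ((t⁻¹ : ℝ) : ℂ) ^ s = (t : ℂ) ^ (-s) := by
  rw [Complex.ofReal_inv, Complex.inv_cpow, Complex.cpow_neg]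
  rw [Complex.arg_ofReal_of_nonneg ht.le]
  exact Real.pi_pos.ne

theorem contDiffAt_wext {s : ℂ} {f : S d → ℂ} {m : ℕ∞ω} (hf : ContMDiff (𝓡 d) 𝓘(ℝ, ℂ) m f)
    {p : ℝ × E d} (h1 : 0 < p.1) (h2 : p.2 ≠ 0) : ContDiffAt ℝ m (wext s f) p := by
  have ha : ContDiffAt ℝ m (fun p : ℝ × E d => (p.1 : ℂ) ^ (-s)) p :=
    (contDiffAt_ofReal_cpow h1 (-s)).comp p contDiffAt_fst
  have hb : ContDiffAt ℝ m (fun v => f (proj v)) p.2 := by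
    rw [← contMDiffAt_iff_contDiffAt]
    exact ContMDiffAt.comp p.2 hf.contMDiffAt (contMDiffAt_proj h2)
  exact ha.mul (hb.comp p contDiffAt_snd)

theorem wext_smul (s : ℂ) (f : S d → ℂ) {r : ℝ} (hr : 0 < r) {p : ℝ × E d} (hp : 0 < p.1) :
    wext s f (r • p) = (r : ℂ) ^ (-s) * wext s f p := by
  simp only [wext, Prod.smul_fst, Prod.smul_snd, proj_smul hr, smul_eq_mul, Complex.ofReal_mul]
  rw [Complex.mul_cpow_ofReal_nonneg hr.le hp.le]; ring

theorem wext_euler {s : ℂ} {f : S d → ℂ} (hf : ContMDiff (𝓡 d) 𝓘(ℝ, ℂ) 2 f)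
    {p : ℝ × E d} (h1 : 0 < p.1) (h2 : p.2 ≠ 0) : fderiv ℝ (wext s f) p p = -s * wext s f p := by
  have hd : DifferentiableAt ℝ (wext s f) p := (contDiffAt_wext hf h1 h2).differentiableAt (by simp)
  have ha : HasDerivAt (fun r : ℝ => r • p) ((1 : ℝ) • p) 1 := (hasDerivAt_id (1 : ℝ)).smul_const _
  have hb : HasFDerivAt (wext s f) (fderiv ℝ (wext s f) p) ((1 : ℝ) • p) := by
    simpa using hd.hasFDerivAt
  have hc := hb.comp_hasDerivAt (1 : ℝ) ha
  have he : HasDerivAt (fun r : ℝ => (r : ℂ) ^ (-s) * wext s f p) (-s * wext s f p) 1 := by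
    by_cases hs : s = 0
    · simpa [hs] using hasDerivAt_const (1 : ℝ) (wext 0 f p)
    have := (hasDerivAt_id (1 : ℂ)).cpow_const (c := -s) (by simp)
    have h3 := this.comp_ofReal (z := 1)
    simpa using h3.mul_const (wext s f p)
  have hg := he.congr_of_eventuallyEq (f₁ := wext s f ∘ fun r : ℝ => r • p) (by
    filter_upwards [lt_mem_nhds (zero_lt_one (α := ℝ))] with r hr
    exact wext_smul s f hr h1)
  simpa using hc.unique hg

theorem fderiv_smul_homogeneous {W : Type*} [NormedAddCommGroup W] [NormedSpace ℂ W]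
    {G : ℝ × E d → W} {a : ℂ} {r : ℝ} (hr : 0 < r)
    (hG : ∀ p : ℝ × E d, 0 < p.1 → G (r • p) = (r : ℂ) ^ a • G p) {p : ℝ × E d} (hp : 0 < p.1) :
    fderiv ℝ G (r • p) = (r : ℂ) ^ (a - 1) • fderiv ℝ G p := by
  have h1 : (fun p => G (r • p)) =ᶠ[nhds p] fun p => (r : ℂ) ^ a • G p := by
    have : ∀ᶠ q : ℝ × E d in nhds p, 0 < q.1 := (continuous_fst.tendsto p).eventually (lt_mem_nhds hp)
    filter_upwards [this] with q hq using hG q hq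
  have h2 := h1.fderiv_eq (𝕜 := ℝ)
  have hcs := congrFun (fderiv_const_smul_field (𝕜 := ℝ) (f := G) ((r : ℂ) ^ a)) p
  rw [fderiv_comp_smul] at h2
  rw [show (fun p => (r : ℂ) ^ a • G p) = (r : ℂ) ^ a • G from rfl, hcs, Pi.smul_apply] at h2
  have h3 : fderiv ℝ G (r • p) = (r⁻¹ : ℝ) • (r : ℂ) ^ a • fderiv ℝ G p := by
    rw [← h2, smul_smul, inv_mul_cancel₀ hr.ne', one_smul]
  rw [h3, Complex.cpow_sub _ _ (by exact_mod_cast hr.ne'), Complex.cpow_one]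
  refine ContinuousLinearMap.ext fun v => ?_
  change r⁻¹ • ((r : ℂ) ^ a • fderiv ℝ G p v) = ((r : ℂ) ^ a / r) • fderiv ℝ G p v
  rw [← Complex.coe_smul, smul_smul]
  congr 1
  push_cast
  field_simp

theorem lift_eq (g : SO0 d) (x : S d) :
    lift g x = (lift g x).1 • ((1 : ℝ), (act g x : E d)) := by
  ext
  · simp
  · simp [act, (lift_fst_pos g x).ne']

theorem dd_add (t : ℂ) (w w' : ℝ × E d) (f : S d → ℂ) (x : S d) :
    dd t (w + w') f x = dd t w f x + dd t w' f x := by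
  simp [dd, sd_vadd, inner_add_right]; ring

theorem dd_smul (t : ℂ) (r : ℝ) (w : ℝ × E d) (f : S d → ℂ) (x : S d) :
    dd t (r • w) f x = r * dd t w f x := by
  simp [dd, sd_vsmul, inner_smul_right]; ring

theorem dd_covariant (h : SO0 d) {f : S d → ℂ} (hf : ContMDiff (𝓡 d) 𝓘(ℝ, ℂ) 2 f) (s : ℂ)
    (w : ℝ × E d) (x : S d) :
    dd s w (fun x => (kappa h x : ℂ) ^ s * f (act h x)) x =
      (kappa h x : ℂ) ^ (s + 1) * dd s (h.1 w) f (act h x) := by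
  set F := wext s f with hFdef
  set X : ℝ × E d := (1, (x : E d)) with hX
  set y := act h x with hy
  set Y : ℝ × E d := (1, (y : E d)) with hY
  set t := (lift h x).1 with ht
  have htpos : 0 < t := lift_fst_pos h x
  have hLX : toCLM h X = t • Y := lift_eq h x
  have hpos : ∀ᶠ p in nhds (t • Y), 0 < p.1 ∧ p.2 ≠ 0 := by
    have h1 : 0 < (t • Y).1 := by simpa [hY] using htpos
    have h2 : (t • Y).2 ≠ 0 := by simpa [hY] using ⟨htpos.ne', coe_ne_zero y⟩
    exact ((continuous_fst.tendsto _).eventually (lt_mem_nhds h1)).and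
      ((continuous_snd.tendsto _).eventually (isOpen_ne.mem_nhds h2))
  have hposY : ∀ᶠ p in nhds Y, 0 < p.1 ∧ p.2 ≠ 0 := by
    have h1 : 0 < Y.1 := by simp [hY]
    have h2 : Y.2 ≠ 0 := coe_ne_zero y
    exact ((continuous_fst.tendsto _).eventually (lt_mem_nhds h1)).and
      ((continuous_snd.tendsto _).eventually (isOpen_ne.mem_nhds h2))
  have hposX : ∀ᶠ p in nhds X, 0 < (toCLM h p).1 ∧ (toCLM h p).2 ≠ 0 := by
    have := (toCLM h).continuous.tendsto X
    rw [hLX] at this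
    exact this.eventually hpos
  have hC : ContDiffAt ℝ 2 F (t • Y) := contDiffAt_wext hf hpos.self_of_nhds.1 hpos.self_of_nhds.2
  have hC2 : ContDiffAt ℝ 2 (F ∘ toCLM h) X := by
    refine ContDiffAt.comp X ?_ (toCLM h).contDiff.contDiffAt
    rw [hLX]; exact hC
  have hfd : ∀ p, 0 < (toCLM h p).1 → (toCLM h p).2 ≠ 0 →
      fderiv ℝ (F ∘ toCLM h) p = (fderiv ℝ F (toCLM h p)).comp (toCLM h) := by
    intro p h1 h2
    rw [fderiv_comp p ((contDiffAt_wext hf h1 h2).differentiableAt (by simp))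
      (toCLM h).differentiableAt, ContinuousLinearMap.fderiv]
  have hE : ∀ᶠ p in nhds X, fderiv ℝ (F ∘ toCLM h) p p = -s * (F ∘ toCLM h) p := by
    filter_upwards [hposX] with p hp
    rw [hfd p hp.1 hp.2]
    exact wext_euler hf hp.1 hp.2
  have hres : ∀ x : S d, (kappa h x : ℂ) ^ s * f (act h x) = (F ∘ toCLM h) (1, (x : E d)) := by
    intro x
    have : toCLM h (1, (x : E d)) = (lift h x).1 • ((1 : ℝ), (act h x : E d)) := lift_eq h x
    rw [Function.comp, this, hFdef, wext_smul _ _ (lift_fst_pos h x) (by simp)]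
    simp only [wext, Complex.ofReal_one, Complex.one_cpow, one_mul, proj_coe, kappa]
    rw [ofReal_inv_cpow (lift_fst_pos h x)]
  rw [dd_ambient hC2 hE (Filter.Eventually.of_forall hres)]
  have hEY : ∀ᶠ p in nhds Y, fderiv ℝ F p p = -s * F p := by
    filter_upwards [hposY] with p hp using wext_euler hf hp.1 hp.2
  rw [dd_ambient (F := F) (x := y) (contDiffAt_wext hf (by simp) (coe_ne_zero y)) hEY
    (Filter.Eventually.of_forall fun z => by simp [hFdef, wext, proj_coe])]
  have hd1 : ∀ p : ℝ × E d, 0 < p.1 → fderiv ℝ F (t • p) = (t : ℂ) ^ (-s - 1) • fderiv ℝ F p :=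
    fun p hp => fderiv_smul_homogeneous htpos (fun p hp => wext_smul s f htpos hp) hp
  have hd2 : fderiv ℝ (fderiv ℝ F) (t • Y) = (t : ℂ) ^ (-s - 1 - 1) • fderiv ℝ (fderiv ℝ F) Y :=
    fderiv_smul_homogeneous htpos hd1 (by simp [hY])
  have hBox : Box (F ∘ toCLM h) X = (t : ℂ) ^ (-s - 1 - 1) * Box F Y := by
    have h1 : fderiv ℝ (F ∘ toCLM h) =ᶠ[nhds X]
        fun p => (fderiv ℝ F (toCLM h p)).comp (toCLM h) := by
      filter_upwards [hposX] with p hp using hfd p hp.1 hp.2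
    have h2 : HasFDerivAt (fun p => fderiv ℝ F (toCLM h p))
        ((fderiv ℝ (fderiv ℝ F) (t • Y)).comp (toCLM h)) X := by
      have h3 : DifferentiableAt ℝ (fderiv ℝ F) (toCLM h X) := by
        rw [hLX]
        exact (hC.fderiv_right (m := 1) (by norm_num)).differentiableAt (by simp)
      have h4 := h3.hasFDerivAt.comp X (toCLM h).hasFDerivAt
      rwa [hLX] at h4
    have h5 : ∀ u v, fderiv ℝ (fderiv ℝ (F ∘ toCLM h)) X u v =
        (t : ℂ) ^ (-s - 1 - 1) * fderiv ℝ (fderiv ℝ F) Y (h.1 u) (h.1 v) := by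
      intro u v
      have h6 := h2.clm_comp (hasFDerivAt_const (toCLM h) X)
      rw [h1.fderiv_eq, h6.fderiv, hd2]
      simp [toCLM]
    have h7 := ctr_act h ((ContinuousLinearMap.coeLM ℝ).comp
      (fderiv ℝ (fderiv ℝ F) Y : (ℝ × E d) →ₗ[ℝ] ((ℝ × E d) →L[ℝ] ℂ)))
    simp at h7
    simp only [Box, h5]
    rw [← h7]
    simp only [ctr, mul_sub, Finset.mul_sum]
  have hlz : t * lz Y (h.1 w) = lz X w := by
    rw [← lz_act h X w]
    have : h.1 X = t • Y := hLX
    rw [this]; simp [lz, inner_smul_left]; ring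
  rw [hfd X hposX.self_of_nhds.1 hposX.self_of_nhds.2, hBox, ContinuousLinearMap.comp_apply, hLX,
    hd1 Y (by simp [hY]), ← hlz]
  have hk : (kappa h x : ℂ) ^ (s + 1) = (t : ℂ) ^ (-s - 1) := by
    rw [kappa, ofReal_inv_cpow htpos]; congr 1; ring
  have hk2 : (t : ℂ) ^ (-s - 1 - 1) * t = (t : ℂ) ^ (-s - 1) := by
    rw [Complex.cpow_sub _ _ (by exact_mod_cast htpos.ne'), Complex.cpow_one]
    field_simp [show (t : ℂ) ≠ 0 by exact_mod_cast htpos.ne']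
  rw [hk]
  have hw : toCLM h w = h.1 w := rfl
  simp only [_root_.smul_apply, smul_eq_mul, hw]
  push_cast
  linear_combination (-(1 / 2) * (lz Y (h.1 w) : ℂ) * Box F Y) * hk2

/-! ### The covariant operator on functions of two variables -/

theorem two_le_infty : (2 : ℕ∞ω) ≤ ∞ := WithTop.coe_le_coe.2 le_top

section linear

variable {f g : S d → ℂ}

theorem SDiff.sd (hf : ContMDiff (𝓡 d) 𝓘(ℝ, ℂ) 2 f) (e : E d) (x : S d) : SDiff (sd e f) x :=
  SDiff.of_contMDiff (contMDiff_sd (m := 1) (by norm_num) e hf) (by simp) x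

theorem Lap_add (hf : ContMDiff (𝓡 d) 𝓘(ℝ, ℂ) 2 f) (hg : ContMDiff (𝓡 d) 𝓘(ℝ, ℂ) 2 g) (x : S d) :
    Lap (fun x => f x + g x) x = Lap f x + Lap g x := by
  unfold Lap
  rw [← Finset.sum_add_distrib]
  refine Finset.sum_congr rfl fun i _ => ?_
  have : sd (bv i) (fun x => f x + g x) = fun x => sd (bv i) f x + sd (bv i) g x := by
    ext y
    exact sd_add _ (.of_contMDiff hf (by simp) y) (.of_contMDiff hg (by simp) y)
  rw [this, sd_add _ (.sd hf _ x) (.sd hg _ x)]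

theorem Lap_const_mul (c : ℂ) (hf : ContMDiff (𝓡 d) 𝓘(ℝ, ℂ) 2 f) (x : S d) :
    Lap (fun x => c * f x) x = c * Lap f x := by
  unfold Lap
  rw [Finset.mul_sum]
  refine Finset.sum_congr rfl fun i _ => ?_
  have : sd (bv i) (fun x => c * f x) = fun x => c * sd (bv i) f x := by
    ext y
    exact sd_const_mul _ c (.of_contMDiff hf (by simp) y)
  rw [this, sd_const_mul _ c (.sd hf _ x)]

theorem dd_fun_add (hf : ContMDiff (𝓡 d) 𝓘(ℝ, ℂ) 2 f) (hg : ContMDiff (𝓡 d) 𝓘(ℝ, ℂ) 2 g)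
    (t : ℂ) (w : ℝ × E d) (x : S d) :
    dd t w (fun x => f x + g x) x = dd t w f x + dd t w g x := by
  simp only [dd, Lap_add hf hg, sd_add _ (.of_contMDiff hf (by simp) x) (.of_contMDiff hg (by simp) x)]
  ring

theorem dd_const_mul (c : ℂ) (hf : ContMDiff (𝓡 d) 𝓘(ℝ, ℂ) 2 f) (t : ℂ) (w : ℝ × E d) (x : S d) :
    dd t w (fun x => c * f x) x = c * dd t w f x := by
  simp only [dd, Lap_const_mul c hf, sd_const_mul _ c (.of_contMDiff hf (by simp) x)]
  ring

end linear

section param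

variable {V H M : Type*} [NormedAddCommGroup V] [NormedSpace ℝ V] [TopologicalSpace H]
    {I : ModelWithCorners ℝ V H} [TopologicalSpace M] [ChartedSpace H M] [IsManifold I ∞ M]

theorem contMDiff_coord (e : E d) :
    ContMDiff (𝓡 d) 𝓘(ℝ, ℂ) ∞ (fun x : S d => ((inner ℝ (x : E d) e : ℝ) : ℂ)) := by
  have h : ContDiff ℝ ∞ (fun v : E d => ((inner ℝ v e : ℝ) : ℂ)) :=
    Complex.ofRealCLM.contDiff.comp (contDiff_id.inner ℝ contDiff_const)
  exact h.contMDiff.comp contMDiff_coe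

theorem contMDiff_dd_param (t : ℂ) (w : ℝ × E d) {f : S d → M → ℂ}
    (hf : ContMDiff ((𝓡 d).prod I) 𝓘(ℝ, ℂ) ∞ (Function.uncurry f)) {a : M → S d}
    (ha : ContMDiff I (𝓡 d) ∞ a) :
    ContMDiff I 𝓘(ℝ, ℂ) ∞ (fun m => dd t w (fun x => f x m) (a m)) := by
  have hc : ContMDiff I 𝓘(ℝ, ℂ) ∞ (fun m => ((inner ℝ (a m : E d) w.2 : ℝ) : ℂ)) :=
    (contMDiff_coord w.2).comp ha
  have hp : ContMDiff I ((𝓡 d).prod I) ∞ (fun m => (a m, m)) := ha.prodMk contMDiff_id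
  have h0 : ContMDiff I 𝓘(ℝ, ℂ) ∞ (fun m => f (a m) m) := hf.comp hp
  have h1 : ∀ e : E d, ContMDiff ((𝓡 d).prod I) 𝓘(ℝ, ℂ) ∞
      (Function.uncurry fun x m => sd e (fun x => f x m) x) := fun e => contMDiff_sd_param e hf
  have h2 : ∀ e : E d, ContMDiff I 𝓘(ℝ, ℂ) ∞ (fun m => sd e (fun x => f x m) (a m)) :=
    fun e => (h1 e).comp hp
  have h3 : ∀ e : E d, ContMDiff I 𝓘(ℝ, ℂ) ∞ (fun m => sd e (sd e (fun x => f x m)) (a m)) :=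
    fun e => (contMDiff_sd_param e (h1 e)).comp hp
  have h4 : ContMDiff I 𝓘(ℝ, ℂ) ∞ (fun m => Lap (fun x => f x m) (a m)) := by
    unfold Lap
    exact ContMDiff.sum fun i _ => h3 (bv i)
  have hk : ∀ c : ℂ, ContMDiff I 𝓘(ℝ, ℂ) ∞ (fun _ : M => c) := fun c => contMDiff_const
  unfold dd
  refine ContMDiff.add (contMDiff_mul_complex (hk _) (ContMDiff.sub (h2 _)
    (contMDiff_mul_complex (contMDiff_mul_complex (hk _) hc) h0)))
    (contMDiff_mul_complex (contMDiff_mul_complex (hk _) ?_)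
      (ContMDiff.add h4 (contMDiff_mul_complex (hk _) h0)))
  simp only [Complex.ofReal_sub]
  exact (hk _).sub hc

end param

section slices

theorem smooth_slice_left (f : CSS d) (y : S d) :
    ContMDiff (𝓡 d) 𝓘(ℝ, ℂ) ∞ (fun x => f.1 (x, y)) :=
  f.2.comp (contMDiff_id.prodMk contMDiff_const)

theorem smooth_slice_right (f : CSS d) (x : S d) :
    ContMDiff (𝓡 d) 𝓘(ℝ, ℂ) ∞ (fun y => f.1 (x, y)) :=
  f.2.comp (contMDiff_const.prodMk contMDiff_id)

/-- The Todorov operator in the first variable. -/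
def ddx (s : ℂ) (w : ℝ × E d) : Module.End ℂ (CSS d) where
  toFun f := ⟨fun p => dd s w (fun x => f.1 (x, p.2)) p.1,
    contMDiff_dd_param s w (f := fun x (p : S d × S d) => f.1 (x, p.2))
      (f.2.comp (contMDiff_fst.prodMk (contMDiff_snd.comp contMDiff_snd))) contMDiff_fst⟩
  map_add' f g := by
    ext p
    exact dd_fun_add ((smooth_slice_left f p.2).of_le two_le_infty)
      ((smooth_slice_left g p.2).of_le two_le_infty) s w p.1
  map_smul' c f := by
    ext p
    exact dd_const_mul c ((smooth_slice_left f p.2).of_le two_le_infty) s w p.1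

/-- The Todorov operator in the second variable. -/
def ddy (s : ℂ) (w : ℝ × E d) : Module.End ℂ (CSS d) where
  toFun f := ⟨fun p => dd s w (fun y => f.1 (p.1, y)) p.2,
    contMDiff_dd_param s w (f := fun y (p : S d × S d) => f.1 (p.1, y))
      (f.2.comp ((contMDiff_fst.comp contMDiff_snd).prodMk contMDiff_fst)) contMDiff_snd⟩
  map_add' f g := by
    ext p
    exact dd_fun_add ((smooth_slice_right f p.1).of_le two_le_infty)
      ((smooth_slice_right g p.1).of_le two_le_infty) s w p.2
  map_smul' c f := by
    ext p
    exact dd_const_mul c ((smooth_slice_right f p.1).of_le two_le_infty) s w p.2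

/-- The covariant differential operator from weights `(s, t)` to weights `(s + 1, t + 1)`. -/
def DD (s t : ℂ) : Module.End ℂ (CSS d) :=
  ddx s (1, 0) * ddy t (1, 0) - ∑ i, ddx s (0, bv i) * ddy t (0, bv i)

theorem DD_apply (s t : ℂ) (f : CSS d) (p : S d × S d) :
    (DD s t f).1 p = ctr fun w w' => dd s w (fun x => dd t w' (fun y => f.1 (x, y)) p.2) p.1 := by
  simp only [DD, ctr, LinearMap.sub_apply, LinearMap.sum_apply, Module.End.mul_apply]
  simp only [Submodule.coe_sub, Submodule.coe_sum, Pi.sub_apply, Finset.sum_apply]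
  rfl

/-- The bilinear form contracted by `DD`. -/
def ddBilin (s t : ℂ) (f : CSS d) (p : S d × S d) : (ℝ × E d) →ₗ[ℝ] (ℝ × E d) →ₗ[ℝ] ℂ :=
  LinearMap.mk₂ ℝ (fun w w' => (ddx s w (ddy t w' f)).1 p)
    (fun w w' v => dd_add s w w' _ _) (fun c w v => dd_smul s c w _ _)
    (fun w v v' => by
      have : ddy t (v + v') f = ddy t v f + ddy t v' f := by
        ext q; exact dd_add t v v' _ _
      rw [this, map_add]; rfl)
    (fun c w v => by
      have : ddy t (c • v) f = (c : ℂ) • ddy t v f := by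
        ext q; exact dd_smul t c v _ _
      rw [this, map_smul]; rfl)

theorem DD_covariant (l m : ℂ) (g : SO0 d) (f : CSS d) :
    DD (rho d + l) (rho d + m) (piTensor l m g f) =
      piTensor (l + 1) (m + 1) g (DD (rho d + l) (rho d + m) f) := by
  ext ⟨x, y⟩
  set h := g⁻¹ with hh
  set s := rho d + l with hs
  set t := rho d + m with ht
  have key : ∀ w w', dd s w (fun x => dd t w' (fun y => (piTensor l m g f).1 (x, y)) y) x =
      (kappa h x : ℂ) ^ (s + 1) * (kappa h y : ℂ) ^ (t + 1) *
        ddBilin s t f (act h x, act h y) (h.1 w) (h.1 w') := by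
    intro w w'
    have h1 : ∀ x, dd t w' (fun y => (piTensor l m g f).1 (x, y)) y =
        (kappa h y : ℂ) ^ (t + 1) * ((kappa h x : ℂ) ^ s * (ddy t (h.1 w') f).1 (act h x, act h y)) := by
      intro x
      have h2 : (fun y => (piTensor l m g f).1 (x, y)) = fun y => (kappa h x : ℂ) ^ s *
          ((kappa h y : ℂ) ^ t * f.1 (act h x, act h y)) := by
        ext y; simp only [piTensor, LinearMap.coe_mk, AddHom.coe_mk]; rw [← hh, mul_assoc]
      rw [h2, dd_const_mul, dd_covariant h
        ((smooth_slice_right f (act h x)).of_le two_le_infty) t w' y]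
      · simp only [ddy, LinearMap.coe_mk, AddHom.coe_mk]; ring
      · exact (contMDiff_mul_complex (contMDiff_kappa_cpow h t)
          ((smooth_slice_right f (act h x)).comp (contMDiff_act h))).of_le two_le_infty
    simp only [h1]
    rw [dd_const_mul, dd_covariant h
      ((smooth_slice_left (ddy t (h.1 w') f) (act h y)).of_le two_le_infty) s w x]
    · simp only [ddBilin, LinearMap.mk₂_apply, ddx, LinearMap.coe_mk, AddHom.coe_mk]; ring
    · exact (contMDiff_mul_complex (contMDiff_kappa_cpow h s)
          ((smooth_slice_left (ddy t (h.1 w') f) (act h y)).comp (contMDiff_act h))).of_le two_le_infty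
  rw [DD_apply]
  simp only [key]
  have h3 := ctr_act h (ddBilin s t f (act h x, act h y))
  have h4 : (piTensor (l + 1) (m + 1) g (DD s t f)).1 (x, y) = (kappa h x : ℂ) ^ (s + 1) *
      (kappa h y : ℂ) ^ (t + 1) * (DD s t f).1 (act h x, act h y) := by
    simp only [piTensor, LinearMap.coe_mk, AddHom.coe_mk, hs, ht, ← hh, add_assoc]
  rw [h4, DD_apply]
  change _ = _ * ctr (fun u v => ddBilin s t f (act h x, act h y) u v)
  rw [← h3]
  simp only [ctr, mul_sub, Finset.mul_sum]

/-- Restriction to the diagonal. -/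
def resDiag : CSS d →ₗ[ℂ] CS d where
  toFun f := ⟨fun x => f.1 (x, x), f.2.comp (contMDiff_id.prodMk contMDiff_id)⟩
  map_add' f g := by ext x; simp
  map_smul' c f := by ext x; simp

/-- The composition of `k` successive covariant operators. -/
def DDpow (s t : ℂ) : ℕ → Module.End ℂ (CSS d)
  | 0 => 1
  | k + 1 => DD (s + k) (t + k) * DDpow s t k

/-- The family of covariant bi-differential operators. -/
def BB (k : ℕ) (s t : ℂ) : CSS d →ₗ[ℂ] CS d := resDiag.comp (DDpow s t k)

theorem DDpow_covariant (l m : ℂ) (g : SO0 d) (f : CSS d) (k : ℕ) :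
    DDpow (rho d + l) (rho d + m) k (piTensor l m g f) =
      piTensor (l + k) (m + k) g (DDpow (rho d + l) (rho d + m) k f) := by
  induction k with
  | zero => simp [DDpow]
  | succ k ih =>
    simp only [DDpow, Module.End.mul_apply, ih]
    rw [add_assoc, add_assoc, DD_covariant]
    push_cast
    simp only [add_assoc]

theorem BB_covariant (l m : ℂ) (k : ℕ) (g : SO0 d) (f : CSS d) :
    BB k (rho d + l) (rho d + m) (piTensor l m g f) =
      piRep (l + m + rho d + 2 * k) g (BB k (rho d + l) (rho d + m) f) := by
  ext x
  simp only [BB, LinearMap.comp_apply, DDpow_covariant]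
  simp only [resDiag, piTensor, piRep, LinearMap.coe_mk, AddHom.coe_mk]
  congr 1
  rw [← Complex.cpow_add _ _ (by exact_mod_cast (kappa_pos _ _).ne')]
  congr 1
  ring

end slices

/-! ### Jets -/

universe u

section jets

variable {V W G : Type*} [NormedAddCommGroup V] [NormedSpace ℝ V] [NormedAddCommGroup W]
  [NormedSpace ℝ W] [NormedAddCommGroup G] [NormedSpace ℝ G]

/-- The derivatives of `F` of order at most `N` vanish at `p`. -/
def JV (N : ℕ) (F : V → G) (p : V) : Prop := ∀ m ≤ N, iteratedFDeriv ℝ m F p = 0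

theorem natCast_le_infty (m : ℕ) : (m : ℕ∞ω) ≤ ∞ := WithTop.coe_le_coe.2 le_top

theorem JV.mono {N N' : ℕ} {F : V → G} {p : V} (h : JV N F p) (hN : N' ≤ N) : JV N' F p :=
  fun m hm => h m (hm.trans hN)

theorem JV_zero_iff {F : V → G} {p : V} : JV 0 F p ↔ F p = 0 := by
  constructor
  · intro h
    have := congrArg (fun A => A 0) (h 0 le_rfl)
    simpa using this
  · intro h m hm
    obtain rfl : m = 0 := by omega
    ext v
    simpa using h

theorem JV_succ_iff {N : ℕ} {F : V → G} {p : V} :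
    JV (N + 1) F p ↔ F p = 0 ∧ JV N (fderiv ℝ F) p := by
  constructor
  · refine fun h => ⟨JV_zero_iff.1 (h.mono (by omega)), fun m hm => ?_⟩
    rw [← norm_eq_zero, norm_iteratedFDeriv_fderiv, h (m + 1) (by omega), norm_zero]
  · rintro ⟨h0, h⟩ m hm
    cases m with
    | zero => exact JV_zero_iff.2 h0 0 le_rfl
    | succ m =>
      rw [← norm_eq_zero, ← norm_iteratedFDeriv_fderiv, h m (by omega), norm_zero]

theorem JV.congr {N : ℕ} {F F' : V → G} {p : V} (h : JV N F p) (he : F =ᶠ[nhds p] F') :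
    JV N F' p := fun m hm => by rw [← (he.iteratedFDeriv ℝ m).eq_of_nhds, h m hm]

theorem JV.add {N : ℕ} {F F' : V → G} {p : V} (h : JV N F p) (h' : JV N F' p)
    (hF : ContDiffAt ℝ ∞ F p) (hF' : ContDiffAt ℝ ∞ F' p) : JV N (fun v => F v + F' v) p := by
  intro m hm
  have := iteratedFDeriv_add_apply (x := p) (i := m) (hF.of_le (natCast_le_infty m))
    (hF'.of_le (natCast_le_infty m))
  rw [h m hm, h' m hm, add_zero] at this
  exact this

theorem ContDiffAt.exists_isOpen {F : V → G} {p : V} (hF : ContDiffAt ℝ ∞ F p) (N : ℕ) :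
    ∃ u, IsOpen u ∧ p ∈ u ∧ ContDiffOn ℝ N F u := by
  obtain ⟨u, hu, h⟩ := (hF.of_le (natCast_le_infty N)).contDiffOn le_rfl (by simp)
  obtain ⟨t, ht, ho, hp⟩ := _root_.mem_nhds_iff.1 hu
  exact ⟨t, ho, hp, h.mono ht⟩

theorem JV.comp {N : ℕ} {F : W → G} {φ : V → W} {p : V} (hF : ContDiffAt ℝ ∞ F (φ p))
    (hφ : ContDiffAt ℝ ∞ φ p) (h : JV N F (φ p)) : JV N (fun v => F (φ v)) p := by
  obtain ⟨t, ot, pt, ht⟩ := ContDiffAt.exists_isOpen hF N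
  obtain ⟨s, os, ps, hs⟩ := ContDiffAt.exists_isOpen hφ N
  have os' : IsOpen (s ∩ φ ⁻¹' t) := hs.continuousOn.isOpen_inter_preimage os ot
  intro m hm
  have hmN : (m : ℕ∞ω) ≤ N := by exact_mod_cast hm
  let D : ℝ := 1 + ∑ i ∈ Finset.range (m + 1), ‖iteratedFDerivWithin ℝ i φ (s ∩ φ ⁻¹' t) p‖
  have hle : ∀ i ≤ m, ‖iteratedFDerivWithin ℝ i φ (s ∩ φ ⁻¹' t) p‖ ≤ D := by
    intro i hi
    have := Finset.single_le_sum (f := fun i => ‖iteratedFDerivWithin ℝ i φ (s ∩ φ ⁻¹' t) p‖)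
      (fun i _ => norm_nonneg _) (Finset.mem_range.2 (Nat.lt_succ_of_le hi))
    simp only [D]
    linarith
  have hD1 : 1 ≤ D := by
    simp only [D]
    have : 0 ≤ ∑ i ∈ Finset.range (m + 1), ‖iteratedFDerivWithin ℝ i φ (s ∩ φ ⁻¹' t) p‖ :=
      Finset.sum_nonneg fun i _ => norm_nonneg _
    linarith
  have := norm_iteratedFDerivWithin_comp_le (n := m) (N := N) (C := 0) (D := D) ht
    (hs.mono (inter_subset_left (t := φ ⁻¹' t))) hmN ot.uniqueDiffOn os'.uniqueDiffOn
    (fun x hx => hx.2) ⟨ps, pt⟩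
    (fun i hi => by rw [iteratedFDerivWithin_of_isOpen i ot pt, h i (hi.trans hm), norm_zero])
    (fun i h1 hi => (hle i hi).trans (le_self_pow₀ hD1 (by omega)))
  rw [iteratedFDerivWithin_of_isOpen m os' ⟨ps, pt⟩] at this
  simp only [mul_zero, zero_mul] at this
  exact norm_le_zero_iff.1 this

theorem JV.mul_of_lt {N a b : ℕ} {F F' : V → ℂ} {p : V}
    (hFF : ∀ i < a, iteratedFDeriv ℝ i F p = 0) (hFF' : ∀ i < b, iteratedFDeriv ℝ i F' p = 0)
    (hN : N < a + b) (hF : ContDiffAt ℝ ∞ F p) (hF' : ContDiffAt ℝ ∞ F' p) :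
    JV N (fun v => F v * F' v) p := by
  obtain ⟨t, ot, pt, ht⟩ := ContDiffAt.exists_isOpen hF N
  obtain ⟨s, os, ps, hs⟩ := ContDiffAt.exists_isOpen hF' N
  intro m hm
  have hmN : (m : ℕ∞ω) ≤ N := by exact_mod_cast hm
  have h := norm_iteratedFDerivWithin_mul_le (n := m) (ht.mono inter_subset_left)
    (hs.mono (inter_subset_right (s := t))) (ot.inter os).uniqueDiffOn ⟨pt, ps⟩ hmN
  rw [iteratedFDerivWithin_of_isOpen m (ot.inter os) ⟨pt, ps⟩, Finset.sum_eq_zero] at h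
  · exact norm_le_zero_iff.1 h
  · intro i hi
    rw [Finset.mem_range] at hi
    simp only [iteratedFDerivWithin_of_isOpen _ (ot.inter os) (show p ∈ t ∩ s from ⟨pt, ps⟩)]
    by_cases hia : i < a
    · simp [hFF i hia]
    · simp [hFF' (m - i) (by omega)]

theorem JV.mul {a b N : ℕ} {F F' : V → ℂ} {p : V} (h : JV a F p) (h' : JV b F' p)
    (hN : N ≤ a + b + 1) (hF : ContDiffAt ℝ ∞ F p) (hF' : ContDiffAt ℝ ∞ F' p) :
    JV N (fun v => F v * F' v) p :=
  JV.mul_of_lt (a := a + 1) (b := b + 1) (fun i hi => h i (by omega))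
    (fun i hi => h' i (by omega)) (by omega) hF hF'

theorem JV.mul_left {N : ℕ} {F F' : V → ℂ} {p : V} (h : JV N F' p)
    (hF : ContDiffAt ℝ ∞ F p) (hF' : ContDiffAt ℝ ∞ F' p) :
    JV N (fun v => F v * F' v) p :=
  JV.mul_of_lt (a := 0) (b := N + 1) (fun i hi => by omega)
    (fun i hi => h i (by omega)) (by omega) hF hF'

theorem JV.clm_apply {N : ℕ} {F : V → (W →L[ℝ] G)} {p : V} (h : JV N F p)
    (hF : ContDiffAt ℝ ∞ F p) (e : W) : JV N (fun v => F v e) p := by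
  intro m hm
  have := ((ContinuousLinearMap.apply ℝ G e).iteratedFDeriv_comp_left (f := F) (x := p)
    (i := m) (n := ∞) hF (natCast_le_infty m))
  rw [h m hm] at this
  rw [show (fun v => F v e) = (ContinuousLinearMap.apply ℝ G e) ∘ F from rfl, this]
  ext; simp

/-- The iterated derivatives of a smooth function are symmetric. -/
theorem iteratedFDeriv_swap {V : Type u} [NormedAddCommGroup V] [NormedSpace ℝ V] {n : ℕ} :
    ∀ {G : Type u} [NormedAddCommGroup G] [NormedSpace ℝ G]
    {F : V → G} {p : V}, ContDiffAt ℝ (n + 1 : ℕ) F p → ∀ (i : Fin n) (v : Fin (n + 1) → V),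
    iteratedFDeriv ℝ (n + 1) F p (v ∘ Equiv.swap i.castSucc i.succ) =
      iteratedFDeriv ℝ (n + 1) F p v := by
  induction n with
  | zero => intro _ _ _ _ _ _ i; exact i.elim0
  | succ n ih =>
    intro G _ _ F p hF i v
    by_cases hi : i = Fin.last n
    · subst hi
      cases n with
      | zero =>
        rw [iteratedFDeriv_two_apply, iteratedFDeriv_two_apply]
        have := (hF.isSymmSndFDerivAt (by simp)) (v 0) (v 1)
        simp only [Function.comp]
        convert this.symm using 3 <;> simp <;> rfl
      | succ n =>
        have hd : DifferentiableAt ℝ (iteratedFDeriv ℝ (n + 2) F) p :=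
          hF.differentiableAt_iteratedFDeriv (by norm_cast; omega)
        rw [iteratedFDeriv_succ_apply_left, iteratedFDeriv_succ_apply_left]
        set σ := Equiv.swap (Fin.last n).castSucc (Fin.last n).succ with hσ
        have hev : (fun y => iteratedFDeriv ℝ (n + 2) F y (Fin.tail v ∘ σ)) =ᶠ[nhds p]
            fun y => iteratedFDeriv ℝ (n + 2) F y (Fin.tail v) := by
          filter_upwards [(hF.of_le (m := (n + 2 : ℕ)) (by norm_cast; omega)).eventually
            (fun h => ENat.natCast_ne_top (n + 2) (WithTop.coe_inj.1 h))] with y hy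
          exact ih (F := F) hy (Fin.last n) (Fin.tail v)
        have h1 := hev.fderiv_eq (𝕜 := ℝ)
        have h2 : ∀ w : Fin (n + 2) → V,
            fderiv ℝ (fun y => iteratedFDeriv ℝ (n + 2) F y w) p (v 0) =
            fderiv ℝ (iteratedFDeriv ℝ (n + 2) F) p (v 0) w := by
          intro w
          have := (hd.hasFDerivAt.continuousMultilinear_apply_const w).fderiv
          rw [this]; rfl
        have h3 := congrArg (fun A : V →L[ℝ] G => A (v 0)) h1
        simp only [h2] at h3
        have e0 : (v ∘ Equiv.swap (Fin.last (n + 1)).castSucc (Fin.last (n + 1)).succ) 0 = v 0 := by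
          simp only [Function.comp]
          rw [Equiv.swap_apply_of_ne_of_ne]
          · intro h; simp [Fin.ext_iff] at h
          · intro h; simp [Fin.ext_iff] at h
        rw [e0, ← h3]
        congr 1
        ext j
        simp only [Fin.tail, Function.comp, hσ]
        congr 1
        have : (Fin.last (n + 1)).castSucc = ((Fin.last n).castSucc).succ := by
          ext; simp
        rw [this, show (Fin.last (n + 1)).succ = ((Fin.last n).succ).succ by ext; simp,
          (Fin.succ_injective _).swap_apply]
    · obtain ⟨j, rfl⟩ := Fin.exists_castSucc_eq.2 hi
      rw [iteratedFDeriv_succ_apply_right, iteratedFDeriv_succ_apply_right (m := v)]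
      have h1 := ih (hF.fderiv_right (m := (n + 1 : ℕ)) (by norm_cast)) j (Fin.init v)
      have e0 : (v ∘ Equiv.swap j.castSucc.castSucc j.castSucc.succ) (Fin.last _) =
          v (Fin.last _) := by
        simp only [Function.comp]
        rw [Equiv.swap_apply_of_ne_of_ne]
        · intro h; have := j.2; simp [Fin.ext_iff] at h; omega
        · intro h; have := j.2; simp [Fin.ext_iff] at h; omega
      rw [e0]
      convert congrArg (fun A => A (v (Fin.last _))) h1 using 3
      ext k
      simp only [Fin.init, Function.comp]
      congr 1
      rw [show j.castSucc.succ = j.succ.castSucc by ext; simp, (Fin.castSucc_injective _).swap_apply]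

theorem iteratedFDeriv_perm {V G : Type u} [NormedAddCommGroup V] [NormedSpace ℝ V]
    [NormedAddCommGroup G] [NormedSpace ℝ G] {n : ℕ} {F : V → G} {p : V} (hF : ContDiffAt ℝ ∞ F p)
    (σ : Equiv.Perm (Fin n)) (v : Fin n → V) :
    iteratedFDeriv ℝ n F p (v ∘ σ) = iteratedFDeriv ℝ n F p v := by
  cases n with
  | zero => congr 1; ext i; exact i.elim0
  | succ n =>
    have hσ : σ ∈ Submonoid.closure (Set.range fun i : Fin n ↦ Equiv.swap i.castSucc i.succ) := by
      rw [Equiv.Perm.mclosure_swap_castSucc_succ]; trivial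
    induction hσ using Submonoid.closure_induction generalizing v with
    | mem x hx => obtain ⟨i, rfl⟩ := hx; exact iteratedFDeriv_swap (hF.of_le (natCast_le_infty _)) i v
    | one => rfl
    | mul x y _ _ hx hy =>
      have : v ∘ (x * y : Equiv.Perm (Fin (n+1))) = (v ∘ x) ∘ y := by ext; simp
      rw [this, hy, hx]

end jets

/-! ### Jets of functions on `S × S` -/

/-- The extension of `f` to `E × E` that is homogeneous of degree `0` in both variables. -/
def Ext (f : S d × S d → ℂ) (v : E d × E d) : ℂ := f (proj v.1, proj v.2)

theorem contMDiffAt_proj_prod {v : E d × E d} (h1 : v.1 ≠ 0) (h2 : v.2 ≠ 0) :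
    ContMDiffAt 𝓘(ℝ, E d × E d) ((𝓡 d).prod (𝓡 d)) ∞
      (fun v : E d × E d => (proj v.1, proj v.2)) v := by
  have ha : ContMDiffAt 𝓘(ℝ, E d × E d) (𝓡 d) ∞ (fun v : E d × E d => proj v.1) v :=
    ContMDiffAt.comp v (contMDiffAt_proj h1) contDiff_fst.contMDiff.contMDiffAt
  have hb : ContMDiffAt 𝓘(ℝ, E d × E d) (𝓡 d) ∞ (fun v : E d × E d => proj v.2) v :=
    ContMDiffAt.comp v (contMDiffAt_proj h2) contDiff_snd.contMDiff.contMDiffAt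
  exact ha.prodMk hb

theorem contDiffAt_Ext (f : CSS d) {v : E d × E d} (h1 : v.1 ≠ 0) (h2 : v.2 ≠ 0) :
    ContDiffAt ℝ ∞ (Ext f.1) v := by
  rw [← contMDiffAt_iff_contDiffAt]
  exact ContMDiffAt.comp v f.2.contMDiffAt (contMDiffAt_proj_prod h1 h2)

theorem contDiffAt_Ext_coe (f : CSS d) (p : S d × S d) :
    ContDiffAt ℝ ∞ (Ext f.1) ((p.1 : E d), (p.2 : E d)) :=
  contDiffAt_Ext f (coe_ne_zero _) (coe_ne_zero _)

theorem Ext_coe (f : S d × S d → ℂ) (p : S d × S d) :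
    Ext f ((p.1 : E d), (p.2 : E d)) = f p := by simp [Ext, proj_coe]

/-- The jet condition on `S × S` read off on the homogeneous extension. -/
theorem JetVanishes.JV {N : ℕ} {f : CSS d} {p : S d × S d}
    (h : JetVanishes ((𝓡 d).prod (𝓡 d)) N f.1 p) :
    JV N (Ext f.1) ((p.1 : E d), (p.2 : E d)) := by
  set J := (𝓡 d).prod (𝓡 d)
  set e := extChartAt J p
  have hsm : ContDiffAt ℝ ∞ (f.1 ∘ e.symm) (e p) := by
    have := (contMDiffOn_extChartAt_symm (I := J) (n := ∞) p).contMDiffAt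
      (extChartAt_target_mem_nhds (I := J) p)
    rw [← contMDiffAt_iff_contDiffAt]
    exact ContMDiffAt.comp (e p) f.2.contMDiffAt this
  have hpr : ContMDiffAt 𝓘(ℝ, E d × E d) J ∞ (fun v : E d × E d => (proj v.1, proj v.2))
      ((p.1 : E d), (p.2 : E d)) :=
    contMDiffAt_proj_prod (coe_ne_zero _) (coe_ne_zero _)
  have hpp : (proj (p.1 : E d), proj (p.2 : E d)) = p := by simp [proj_coe]
  have hφ : ContDiffAt ℝ ∞ (fun v : E d × E d => e (proj v.1, proj v.2))
      ((p.1 : E d), (p.2 : E d)) := by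
    rw [← contMDiffAt_iff_contDiffAt]
    refine ContMDiffAt.comp (I' := J) ((p.1 : E d), (p.2 : E d)) ?_ hpr
    simp only [hpp]
    exact contMDiffAt_extChartAt
  have hev : ∀ᶠ v in nhds ((p.1 : E d), (p.2 : E d)),
      (proj v.1, proj v.2) ∈ e.source := by
    refine hpr.continuousAt.eventually ?_
    simp only [hpp]
    exact extChartAt_source_mem_nhds (I := J) p
  have h2 := JV.comp (N := N) (F := f.1 ∘ e.symm)
    (φ := fun v : E d × E d => e (proj v.1, proj v.2)) (p := ((p.1 : E d), (p.2 : E d)))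
    (by simp only [hpp]; exact hsm) hφ (by simp only [hpp]; exact h)
  refine h2.congr ?_
  filter_upwards [hev] with v hv
  simp only [Function.comp, Ext, e.left_inv hv]

theorem JV_sub_of_eventually {N : ℕ} {f : CSS d} {P : E d × E d → ℂ} {p : S d × S d}
    (hP : ContDiffAt ℝ ∞ P ((p.1 : E d), (p.2 : E d)))
    (h : JV N (fun v => Ext f.1 v + P v) ((p.1 : E d), (p.2 : E d))) {g : CSS d}
    (hg : ∀ q : S d × S d, g.1 q = f.1 q + P ((q.1 : E d), (q.2 : E d))) :
    JV N (Ext g.1) ((p.1 : E d), (p.2 : E d)) := by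
  have hφ : ContDiffAt ℝ ∞ (fun v : E d × E d => (‖v.1‖⁻¹ • v.1, ‖v.2‖⁻¹ • v.2))
      ((p.1 : E d), (p.2 : E d)) :=
    ((contDiffAt_coe_proj (coe_ne_zero p.1)).comp (((p.1 : E d), (p.2 : E d)) : E d × E d)
      contDiffAt_fst).prodMk
    ((contDiffAt_coe_proj (coe_ne_zero p.2)).comp (((p.1 : E d), (p.2 : E d)) : E d × E d)
      contDiffAt_snd)
  have hφp : ((‖(p.1 : E d)‖⁻¹ • (p.1 : E d), ‖(p.2 : E d)‖⁻¹ • (p.2 : E d)) : E d × E d) =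
      ((p.1 : E d), (p.2 : E d)) := by simp
  have h2 := JV.comp (N := N) (φ := fun v : E d × E d => (‖v.1‖⁻¹ • v.1, ‖v.2‖⁻¹ • v.2))
    (F := fun v => Ext f.1 v + P v) (p := ((p.1 : E d), (p.2 : E d)))
    (by simp only [hφp]; exact (contDiffAt_Ext_coe f p).add hP) hφ
    (by simp only [hφp]; exact h)
  refine h2.congr ?_
  have e1 : ∀ᶠ v in nhds (((p.1 : E d), (p.2 : E d)) : E d × E d), v.1 ≠ 0 ∧ v.2 ≠ 0 :=
    (continuousAt_fst.eventually_ne (coe_ne_zero p.1)).and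
      (continuousAt_snd.eventually_ne (coe_ne_zero p.2))
  filter_upwards [e1] with v hv
  simp only [Ext, hg, coe_proj hv.1, coe_proj hv.2]
  rw [proj_smul (inv_pos.2 (norm_pos_iff.2 hv.1)), proj_smul (inv_pos.2 (norm_pos_iff.2 hv.2))]

section lowering

theorem Ext_ddx_sd (f : CSS d) {N : ℕ} {p : S d × S d} (e : E d)
    (h : JV (N + 1) (Ext f.1) ((p.1 : E d), (p.2 : E d))) {g : CSS d}
    (hg : ∀ q : S d × S d, g.1 q = sd e (fun x => f.1 (x, q.2)) q.1) :
    JV N (Ext g.1) ((p.1 : E d), (p.2 : E d)) := by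
  have h1 : JV N (fun v => fderiv ℝ (Ext f.1) v (e, 0)) ((p.1 : E d), (p.2 : E d)) :=
    (JV_succ_iff.1 h).2.clm_apply ((contDiffAt_Ext_coe f p).fderiv_right le_rfl) _
  have h2 : ContDiffAt ℝ ∞ (fun v => fderiv ℝ (Ext f.1) v (e, 0)) ((p.1 : E d), (p.2 : E d)) :=
    ((contDiffAt_Ext_coe f p).fderiv_right le_rfl).clm_apply contDiffAt_const
  refine JV_sub_of_eventually (f := 0) (P := fun v => fderiv ℝ (Ext f.1) v (e, 0)) h2
    (h1.congr (Filter.Eventually.of_forall fun v => by simp [Ext])) (fun q => ?_)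
  rw [hg, sd]
  have h3 : HasFDerivAt (fun v : E d => ((v, (q.2 : E d)) : E d × E d))
      (ContinuousLinearMap.inl ℝ (E d) (E d)) (q.1 : E d) := hasFDerivAt_prodMk_left _ _
  have h4 := HasFDerivAt.comp (g := Ext f.1) (q.1 : E d)
    ((contDiffAt_Ext_coe f q).differentiableAt (by simp)).hasFDerivAt h3
  have h5 : (Ext f.1 ∘ fun v : E d => ((v, (q.2 : E d)) : E d × E d)) =
      fun v => f.1 (proj v, q.2) := by ext v; simp [Ext, proj_coe]
  rw [h5] at h4
  rw [h4.fderiv]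
  simp

/-- The exchange of the two variables. -/
def swapCSS : CSS d →ₗ[ℂ] CSS d where
  toFun f := ⟨fun p => f.1 (p.2, p.1), f.2.comp (contMDiff_snd.prodMk contMDiff_fst)⟩
  map_add' f g := by ext x; simp
  map_smul' c f := by ext x; simp

theorem JV_swapCSS {f : CSS d} {N : ℕ} {p : S d × S d}
    (h : JV N (Ext f.1) ((p.1 : E d), (p.2 : E d))) :
    JV N (Ext (swapCSS f).1) ((p.2 : E d), (p.1 : E d)) :=
  JV.comp (F := Ext f.1) (φ := fun v : E d × E d => (v.2, v.1))
    (contDiffAt_Ext_coe f p) (contDiffAt_snd.prodMk contDiffAt_fst) h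

/-- Multiplication by a smooth function. -/
def mulCSS (a : CSS d) : Module.End ℂ (CSS d) where
  toFun f := ⟨fun p => a.1 p * f.1 p, contMDiff_mul_complex a.2 f.2⟩
  map_add' f g := by ext x; simp [mul_add]
  map_smul' c f := by ext x; simp; ring

theorem JV_mulCSS {a f : CSS d} {N : ℕ} {p : S d × S d}
    (h : JV N (Ext f.1) ((p.1 : E d), (p.2 : E d))) :
    JV N (Ext (mulCSS a f).1) ((p.1 : E d), (p.2 : E d)) :=
  JV.mul_left h (contDiffAt_Ext_coe a p) (contDiffAt_Ext_coe f p)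

theorem JV_addCSS {f g : CSS d} {N : ℕ} {p : S d × S d}
    (h : JV N (Ext f.1) ((p.1 : E d), (p.2 : E d))) (h' : JV N (Ext g.1) ((p.1 : E d), (p.2 : E d))) :
    JV N (Ext (f + g).1) ((p.1 : E d), (p.2 : E d)) :=
  JV.add h h' (contDiffAt_Ext_coe f p) (contDiffAt_Ext_coe g p)

/-- The functions whose `N`-jet at `p` vanishes. -/
def jetIdeal (N : ℕ) (p : S d × S d) : Submodule ℂ (CSS d) where
  carrier := {f | JV N (Ext f.1) ((p.1 : E d), (p.2 : E d))}
  add_mem' h h' := JV_addCSS h h'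
  zero_mem' := fun m hm => by
    have : Ext (0 : CSS d).1 = fun _ : E d × E d => (0 : ℂ) := rfl
    rw [this]
    exact congrFun iteratedFDeriv_fun_zero _
  smul_mem' c f h := JV_mulCSS (a := ⟨fun _ => c, contMDiff_const⟩) h

theorem mulCSS_mem {a f : CSS d} {N : ℕ} {p : S d × S d} (h : f ∈ jetIdeal N p) :
    mulCSS a f ∈ jetIdeal N p := JV_mulCSS h

theorem jetIdeal_mono {N N' : ℕ} (hN : N' ≤ N) {p : S d × S d} :
    jetIdeal N p ≤ jetIdeal N' p := fun _ h => JV.mono h hN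

theorem swapCSS_mem {f : CSS d} {N : ℕ} {p : S d × S d} (h : f ∈ jetIdeal N p) :
    swapCSS f ∈ jetIdeal N p.swap := JV_swapCSS h

/-- The derivation of `f` in the first variable. -/
def sdx (e : E d) : Module.End ℂ (CSS d) where
  toFun f := ⟨fun p => sd e (fun x => f.1 (x, p.2)) p.1,
    (contMDiff_sd_param (I := 𝓡 d) e (f := fun x y => f.1 (x, y)) f.2)⟩
  map_add' f g := by
    ext p
    exact sd_add e (.of_contMDiff (smooth_slice_left f p.2) (by simp) _)
      (.of_contMDiff (smooth_slice_left g p.2) (by simp) _)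
  map_smul' c f := by
    ext p
    exact sd_const_mul e c (.of_contMDiff (smooth_slice_left f p.2) (by simp) _)

theorem sdx_mem {f : CSS d} {N : ℕ} {p : S d × S d} (e : E d) (h : f ∈ jetIdeal (N + 1) p) :
    sdx e f ∈ jetIdeal N p := Ext_ddx_sd f e h fun _ => rfl

/-- A smooth function of the first variable. -/
def constX (a : CS d) : CSS d := ⟨fun p => a.1 p.1, a.2.comp contMDiff_fst⟩

/-- A linear function as a smooth function on the sphere. -/
def coordCS (e : E d) : CS d := ⟨fun x => ((inner ℝ (x : E d) e : ℝ) : ℂ), contMDiff_coord e⟩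

theorem ddx_eq (s : ℂ) (w : ℝ × E d) (f : CSS d) :
    ddx s w f = (rho d - 1 - s) • (sdx w.2 f - s • mulCSS (constX (coordCS w.2)) f) +
      mulCSS (constX ((1 / 2 : ℂ) • ((w.1 : ℂ) • ⟨fun _ => 1, contMDiff_const⟩ - coordCS w.2)))
        (∑ i, sdx (bv i) (sdx (bv i) f) + (s * (s + 1 - d)) • f) := by
  ext p
  have : (∑ i, sdx (bv i) (sdx (bv i) f) : CSS d).1 p =
      ∑ i, (sdx (bv i) (sdx (bv i) f)).1 p := by
    simp only [Submodule.coe_sum, Finset.sum_apply]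
  simp only [Submodule.coe_add, Pi.add_apply, Submodule.coe_smul, Pi.smul_apply, smul_eq_mul,
    Submodule.coe_sub, Pi.sub_apply, mulCSS, LinearMap.coe_mk, AddHom.coe_mk]
  simp only [Submodule.coe_sum, Finset.sum_apply]
  simp only [ddx, dd, constX, coordCS, sdx, LinearMap.coe_mk, AddHom.coe_mk, Lap,
    Submodule.coe_sub, Pi.sub_apply, Submodule.coe_smul, Pi.smul_apply, smul_eq_mul]
  push_cast
  ring

theorem ddx_mem {f : CSS d} {N : ℕ} {p : S d × S d} (s : ℂ) (w : ℝ × E d)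
    (h : f ∈ jetIdeal (N + 2) p) : ddx s w f ∈ jetIdeal N p := by
  have h1 : f ∈ jetIdeal (N + 1) p := jetIdeal_mono (by omega) h
  have h0 : f ∈ jetIdeal N p := jetIdeal_mono (by omega) h
  rw [ddx_eq]
  refine add_mem (Submodule.smul_mem _ _ ?_) (mulCSS_mem ?_)
  · exact sub_mem (sdx_mem _ h1) (Submodule.smul_mem _ _ (mulCSS_mem h0))
  · exact add_mem (sum_mem fun i _ => sdx_mem _ (sdx_mem _ h)) (Submodule.smul_mem _ _ h0)

theorem ddy_eq_swap (s : ℂ) (w : ℝ × E d) (f : CSS d) :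
    ddy s w f = swapCSS (ddx s w (swapCSS f)) := rfl

theorem ddy_mem {f : CSS d} {N : ℕ} {p : S d × S d} (s : ℂ) (w : ℝ × E d)
    (h : f ∈ jetIdeal (N + 2) p) : ddy s w f ∈ jetIdeal N p := by
  rw [ddy_eq_swap]
  exact swapCSS_mem (p := p.swap) (ddx_mem s w (swapCSS_mem h))

theorem DD_mem {f : CSS d} {N : ℕ} {p : S d × S d} (s t : ℂ)
    (h : f ∈ jetIdeal (N + 4) p) : DD s t f ∈ jetIdeal N p := by
  simp only [DD, LinearMap.sub_apply, LinearMap.sum_apply, Module.End.mul_apply]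
  exact sub_mem (ddx_mem _ _ (ddy_mem _ _ h))
    (sum_mem fun i _ => ddx_mem _ _ (ddy_mem _ _ h))

theorem DDpow_mem {f : CSS d} {p : S d × S d} (s t : ℂ) (k : ℕ) : ∀ {N : ℕ},
    f ∈ jetIdeal (N + 4 * k) p → DDpow s t k f ∈ jetIdeal N p := by
  induction k with
  | zero => intro N h; exact h
  | succ k ih =>
    intro N h
    rw [DDpow, Module.End.mul_apply]
    refine DD_mem _ _ (ih ?_)
    rwa [show N + 4 + 4 * k = N + 4 * (k + 1) by ring]

theorem BB_eq_zero {f : CSS d} {x : S d} (s t : ℂ) (k : ℕ) (h : f ∈ jetIdeal (4 * k) (x, x)) :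
    (BB k s t f).1 x = 0 := by
  have h1 : DDpow s t k f ∈ jetIdeal 0 (x, x) := DDpow_mem s t k (by simpa using h)
  have h2 := JV_zero_iff.1 (show JV 0 _ _ from h1)
  rwa [Ext_coe (p := (x, x))] at h2

end lowering

/-! ### Taylor polynomials and functionals on jets -/

section taylor

variable {V : Type} [NormedAddCommGroup V] [NormedSpace ℝ V]

theorem JV_prod_sub {p : V} {n : ℕ} (g : Fin (n + 1) → V → ℂ)
    (hg : ∀ i, ContDiff ℝ ∞ (g i)) (h0 : ∀ i, g i p = 0) : JV n (fun v => ∏ i, g i v) p := by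
  induction n with
  | zero => simpa using JV_zero_iff.2 (h0 0)
  | succ n ih =>
    have h := ih (fun i => g i.castSucc) (fun i => hg _) (fun i => h0 _)
    simp only [Fin.prod_univ_castSucc (n := n + 1)]
    exact h.mul (JV_zero_iff.2 (h0 (Fin.last _))) (by omega)
      (contDiff_prod fun i _ => hg _).contDiffAt (hg _).contDiffAt

theorem JV.sum {ι : Type*} (s : Finset ι) {N : ℕ} {p : V} {g : ι → V → ℂ}
    (hg : ∀ i ∈ s, ContDiffAt ℝ ∞ (g i) p) (h : ∀ i ∈ s, JV N (g i) p) :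
    JV N (fun v => ∑ i ∈ s, g i v) p := by
  classical
  induction s using Finset.induction_on with
  | empty =>
    intro m _
    simp only [Finset.sum_empty]
    exact congrFun iteratedFDeriv_fun_zero _
  | insert a s ha ih =>
    simp only [Finset.sum_insert ha]
    exact JV.add (h a (by simp)) (ih (fun i hi => hg i (by simp [hi])) fun i hi => h i (by simp [hi]))
      (hg a (by simp)) (ContDiffAt.sum fun i hi => hg i (by simp [hi]))

/-- A smooth function agrees to any finite order with an element of an algebra of smooth functions
that contains the coordinates. -/
theorem exists_taylor {ι : Type*} [Fintype ι] (b : Module.Basis ι ℝ V)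
    (A : Subalgebra ℂ (V → ℂ)) (hA : ∀ P ∈ A, ContDiff ℝ ∞ P)
    (hb : ∀ i, (fun v => ((b.repr v i : ℝ) : ℂ)) ∈ A) {F : V → ℂ} {p : V}
    (hF : ContDiffAt ℝ ∞ F p) (N : ℕ) : ∃ P ∈ A, JV N (fun v => F v + P v) p := by
  classical
  have hconst : ∀ c : ℂ, (fun _ : V => c) ∈ A := fun c => A.algebraMap_mem c
  have hco : ∀ i, (fun v => ((b.repr (v - p) i : ℝ) : ℂ)) ∈ A := by
    intro i
    have := A.sub_mem (hb i) (hconst (b.repr p i))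
    convert this using 1
    ext v; simp
  induction N with
  | zero => exact ⟨fun _ => -F p, hconst _, JV_zero_iff.2 (by simp)⟩
  | succ N ih =>
    obtain ⟨P, hP, hJ⟩ := ih
    set G : V → ℂ := fun v => F v + P v with hG
    have hGs : ContDiffAt ℝ ∞ G p := hF.add (hA P hP).contDiffAt
    set c := iteratedFDeriv ℝ (N + 1) G p with hc
    set r : ℝ := -((N + 1).factorial : ℝ)⁻¹ with hr
    set Q : V → ℂ := fun v => r • c (fun _ => v - p) with hQ
    have hex : Q = fun v => ∑ I : Fin (N + 1) → ι,
        ((r : ℂ) * c (fun i => b (I i))) * ∏ i, ((b.repr (v - p) (I i) : ℝ) : ℂ) := by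
      ext v
      simp only [hQ]
      conv_lhs => rw [← b.sum_repr (v - p)]
      rw [c.map_sum, Finset.smul_sum]
      refine Finset.sum_congr rfl fun I _ => ?_
      rw [c.map_smul_univ, Complex.real_smul, Complex.real_smul]
      push_cast; ring
    have hprod : ∀ I : Fin (N + 1) → ι,
        (fun v => ∏ i, ((b.repr (v - p) (I i) : ℝ) : ℂ)) ∈ A := by
      intro I
      have := A.prod_mem (t := Finset.univ) (f := fun i v => ((b.repr (v - p) (I i) : ℝ) : ℂ))
        fun i _ => hco (I i)
      convert this using 1
      ext v; simp
    have hQA : Q ∈ A := by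
      rw [hex]
      have := A.sum_mem (t := Finset.univ) (f := fun (I : Fin (N + 1) → ι) v =>
        ((r : ℂ) * c (fun i => b (I i))) * ∏ i, ((b.repr (v - p) (I i) : ℝ) : ℂ))
        fun I _ => A.mul_mem (hconst _) (hprod I)
      convert this using 1
      ext v; simp
    have hQs : ContDiff ℝ ∞ Q := hA Q hQA
    refine ⟨fun v => P v + Q v, A.add_mem hP hQA, ?_⟩
    have e : (fun v => F v + (P v + Q v)) = fun v => G v + Q v := by
      ext v; simp only [hG]; ring
    rw [e]
    intro m hm
    have hadd : iteratedFDeriv ℝ m (fun v => G v + Q v) p =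
        iteratedFDeriv ℝ m G p + iteratedFDeriv ℝ m Q p :=
      iteratedFDeriv_add_apply (hGs.of_le (natCast_le_infty m))
        (hQs.contDiffAt.of_le (natCast_le_infty m))
    rw [hadd]
    rcases Nat.lt_or_ge m (N + 1) with hlt | hge
    · have hQJ : JV N Q p := by
        rw [hex]
        refine JV.sum _ (fun I _ => ?_) (fun I _ => ?_)
        · exact contDiffAt_const.mul (hA _ (hprod I)).contDiffAt
        · exact JV.mul_left (JV_prod_sub _ (fun i => hA _ (hco (I i))) (by simp))
            contDiffAt_const (hA _ (hprod I)).contDiffAt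
      rw [hJ m (by omega), hQJ m (by omega), add_zero]
    · obtain rfl : m = N + 1 := by omega
      have hd : ContDiff ℝ ∞ (fun v : V => c (fun _ => v)) :=
        c.contDiff.comp (contDiff_pi.2 fun _ => contDiff_id)
      ext w
      have hs : ContDiff ℝ ∞ (fun v : V => c (fun _ => v - p)) :=
        hd.comp (contDiff_id.sub contDiff_const)
      have h1 : iteratedFDeriv ℝ (N + 1) Q p =
          r • iteratedFDeriv ℝ (N + 1) (fun v => c (fun _ => v - p)) p :=
        iteratedFDeriv_const_smul_apply' (hs.contDiffAt.of_le (natCast_le_infty _))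
      have h2 := congrFun (iteratedFDeriv_comp_sub' (𝕜 := ℝ) (f := fun v : V => c (fun _ => v))
        (N + 1) p) p
      have h3 : ∀ σ : Equiv.Perm (Fin (N + 1)), c (fun i => w (σ i)) = c w :=
        fun σ => iteratedFDeriv_perm hGs σ w
      rw [h1, h2, _root_.add_apply, _root_.smul_apply, c.iteratedFDeriv_comp_diagonal]
      simp only [h3, Finset.sum_const, Finset.card_univ, Fintype.card_perm, Fintype.card_fin, hr]
      have h4 : ((N + 1).factorial : ℝ) ≠ 0 := by exact_mod_cast (N + 1).factorial_ne_zero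
      rw [← Nat.cast_smul_eq_nsmul ℝ, smul_smul, neg_mul, inv_mul_cancel₀ h4]
      simp [hc]

end taylor

section functionals

/-- Differentiation with respect to a parameter commutes with iterated derivatives. -/
theorem hasDerivAt_iteratedFDeriv {V : Type} [NormedAddCommGroup V] [NormedSpace ℝ V] (m : ℕ) :
    ∀ {G : Type} [NormedAddCommGroup G] [NormedSpace ℝ G] {F : ℝ × V → G} {τ : ℝ} {p : V},
    ContDiffAt ℝ ∞ F (τ, p) →
    HasDerivAt (fun t => iteratedFDeriv ℝ m (fun v => F (t, v)) p)
      (iteratedFDeriv ℝ m (fun v => deriv (fun t => F (t, v)) τ) p) τ := by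
  induction m with
  | zero =>
    intro G _ _ F τ p hF
    have h1 : HasDerivAt (fun t => F (t, p)) (deriv (fun t => F (t, p)) τ) τ := by
      refine DifferentiableAt.hasDerivAt ?_
      exact DifferentiableAt.comp (g := F) (f := fun t : ℝ => (t, p)) τ
        (hF.differentiableAt (by simp)) (by fun_prop)
    simp only [iteratedFDeriv_zero_eq_comp]
    exact (continuousMultilinearCurryFin0 ℝ V G).symm.toContinuousLinearEquiv.hasFDerivAt.comp_hasDerivAt τ h1
  | succ m ih =>
    intro G _ _ F τ p hF
    set F1 : ℝ × V → (V →L[ℝ] G) := fun q => (fderiv ℝ F q).comp (ContinuousLinearMap.inr ℝ ℝ V)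
      with hF1
    have hF1s : ContDiffAt ℝ ∞ F1 (τ, p) :=
      (hF.fderiv_right (m := ∞) le_rfl).clm_comp contDiffAt_const
    have h2 : ∀ᶠ q in nhds (τ, p), ContDiffAt ℝ 2 F q :=
      (hF.of_le two_le_infty).eventually (by simp)
    have hpart : ∀ q : ℝ × V, ContDiffAt ℝ 2 F q → fderiv ℝ (fun v => F (q.1, v)) q.2 = F1 q := by
      intro q hq
      have h3 : HasFDerivAt (fun v : V => (q.1, v)) (ContinuousLinearMap.inr ℝ ℝ V) q.2 :=
        hasFDerivAt_prodMk_right _ _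
      exact (HasFDerivAt.comp (g := F) (f := fun v : V => (q.1, v)) q.2
        (hq.differentiableAt (by simp)).hasFDerivAt h3).fderiv
    have hpart' : ∀ q : ℝ × V, ContDiffAt ℝ 2 F q →
        deriv (fun t => F (t, q.2)) q.1 = fderiv ℝ F q (1, 0) := by
      intro q hq
      have h3 : HasDerivAt (fun t : ℝ => (t, q.2)) ((1 : ℝ), (0 : V)) q.1 :=
        (hasDerivAt_id q.1).prodMk (hasDerivAt_const _ _)
      exact ((hq.differentiableAt (by simp)).hasFDerivAt.comp_hasDerivAt q.1 h3).deriv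
    have hL : ∀ᶠ t in nhds τ, (fun v => fderiv ℝ (fun v => F (t, v)) v) =ᶠ[nhds p]
        fun v => F1 (t, v) := by
      rw [nhds_prod_eq] at h2
      filter_upwards [h2.curry] with t ht
      filter_upwards [ht] with v hv
      exact hpart (t, v) hv
    have hR : (fun v => fderiv ℝ (fun v => deriv (fun t => F (t, v)) τ) v) =ᶠ[nhds p]
        fun v => deriv (fun t => F1 (t, v)) τ := by
      have h3 : ∀ᶠ v in nhds p, ∀ᶠ v' in nhds v, ContDiffAt ℝ 2 F (τ, v') := by
        have h4 := h2.eventually_nhds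
        have : Continuous fun v : V => (τ, v) := by fun_prop
        have h5 := this.continuousAt.eventually h4
        filter_upwards [h5] with v hv
        exact this.continuousAt.eventually hv
      filter_upwards [h3] with v hv
      have hv0 := hv.self_of_nhds
      have e1 : (fun v => deriv (fun t => F (t, v)) τ) =ᶠ[nhds v]
          fun v => fderiv ℝ F (τ, v) (1, 0) := by
        filter_upwards [hv] with v' hv'
        exact hpart' (τ, v') hv'
      have hd2 : DifferentiableAt ℝ (fderiv ℝ F) (τ, v) :=
        (hv0.fderiv_right (m := 1) (by norm_num)).differentiableAt (by simp)
      have h6 : HasFDerivAt (fun v : V => (τ, v)) (ContinuousLinearMap.inr ℝ ℝ V) v :=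
        hasFDerivAt_prodMk_right _ _
      have h7 := HasFDerivAt.comp (g := fderiv ℝ F) (f := fun v : V => (τ, v)) v hd2.hasFDerivAt h6
      have h8 : HasDerivAt (fun t : ℝ => (t, v)) ((1 : ℝ), (0 : V)) τ :=
        (hasDerivAt_id τ).prodMk (hasDerivAt_const _ _)
      have h9 := HasFDerivAt.comp_hasDerivAt (l := fderiv ℝ F) (f := fun t : ℝ => (t, v)) τ
        hd2.hasFDerivAt h8
      have h10 := (h7.clm_apply (hasFDerivAt_const ((1 : ℝ), (0 : V)) v)).fderiv
      have h11 := (h9.clm_comp (hasDerivAt_const τ (ContinuousLinearMap.inr ℝ ℝ V))).deriv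
      simp only [Function.comp_def] at h10 h11
      rw [e1.fderiv_eq, h10, hF1, h11]
      ext w
      have hsym := hv0.isSymmSndFDerivAt (by simp) (0, w) (1, 0)
      simpa using hsym
    have key := ih hF1s
    have hc := (continuousMultilinearCurryRightEquiv' ℝ m V G).symm.toContinuousLinearEquiv.hasFDerivAt.comp_hasDerivAt τ key
    have e1 : iteratedFDeriv ℝ (m + 1) (fun v => deriv (fun t => F (t, v)) τ) p =
        (continuousMultilinearCurryRightEquiv' ℝ m V G).symm
          (iteratedFDeriv ℝ m (fun v => deriv (fun t => F1 (t, v)) τ) p) := by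
      rw [iteratedFDeriv_succ_eq_comp_right, Function.comp_apply,
        (hR.iteratedFDeriv ℝ m).eq_of_nhds]
    rw [e1]
    refine hc.congr_of_eventuallyEq ?_
    filter_upwards [hL] with t ht
    rw [iteratedFDeriv_succ_eq_comp_right, Function.comp_apply, (ht.iteratedFDeriv ℝ m).eq_of_nhds]
    rfl

/-- A basis of `E × E`. -/
def pairBasis (d : ℕ) : Module.Basis (Fin (d + 1) ⊕ Fin (d + 1)) ℝ (E d × E d) :=
  (EuclideanSpace.basisFun (Fin (d + 1)) ℝ).toBasis.prod
    (EuclideanSpace.basisFun (Fin (d + 1)) ℝ).toBasis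

/-- A coordinate of the jet of a function. -/
def jetCoord (p : S d × S d) (I : Σ m : ℕ, Fin m → Fin (d + 1) ⊕ Fin (d + 1)) :
    CSS d →ₗ[ℂ] ℂ where
  toFun f := iteratedFDeriv ℝ I.1 (Ext f.1) ((p.1 : E d), (p.2 : E d)) (fun i => pairBasis d (I.2 i))
  map_add' f g := by
    have := iteratedFDeriv_add_apply (x := ((p.1 : E d), (p.2 : E d))) (i := I.1)
      ((contDiffAt_Ext_coe f p).of_le (natCast_le_infty _))
      ((contDiffAt_Ext_coe g p).of_le (natCast_le_infty _))
    have e : Ext (f + g).1 = Ext f.1 + Ext g.1 := rfl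
    rw [e, this]; rfl
  map_smul' c f := by
    have := ((ContinuousLinearMap.mul ℝ ℂ c).iteratedFDeriv_comp_left (f := Ext f.1)
      (x := ((p.1 : E d), (p.2 : E d))) (i := I.1) (n := ∞) (contDiffAt_Ext_coe f p)
      (natCast_le_infty _))
    have e : Ext (c • f).1 = (ContinuousLinearMap.mul ℝ ℂ c) ∘ Ext f.1 := rfl
    rw [e, this]; rfl

theorem mem_jetIdeal_of_jetCoord {N : ℕ} {p : S d × S d} {f : CSS d}
    (h : ∀ m ≤ N, ∀ I : Fin m → Fin (d + 1) ⊕ Fin (d + 1), jetCoord p ⟨m, I⟩ f = 0) :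
    f ∈ jetIdeal N p := by
  intro m hm
  apply ContinuousMultilinearMap.toMultilinearMap_injective
  exact Module.Basis.ext_multilinear (fun _ => pairBasis d) fun I => h m hm I

theorem exists_jetCoord_expansion {N : ℕ} {p : S d × S d} {T : CSS d →ₗ[ℂ] ℂ}
    (hT : ∀ f ∈ jetIdeal N p, T f = 0) :
    ∃ c : (Σ m : Fin (N + 1), Fin m → Fin (d + 1) ⊕ Fin (d + 1)) → ℂ,
      ∀ f, T f = ∑ I, c I * jetCoord p ⟨I.1, I.2⟩ f := by
  have h := mem_span_of_iInf_ker_le_ker (𝕜 := ℂ)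
    (L := fun I : (Σ m : Fin (N + 1), Fin m → Fin (d + 1) ⊕ Fin (d + 1)) =>
      jetCoord p ⟨I.1, I.2⟩) (K := T) (by
    intro f hf
    refine hT f (mem_jetIdeal_of_jetCoord fun m hm I => ?_)
    simp only [Submodule.mem_iInf, LinearMap.mem_ker] at hf
    exact hf ⟨⟨m, by omega⟩, I⟩)
  obtain ⟨c, hc⟩ := (Submodule.mem_span_range_iff_exists_fun ℂ).1 h
  refine ⟨c, fun f => ?_⟩
  rw [← hc]
  simp [LinearMap.sum_apply]

/-- A functional on jets can be differentiated along smooth families. -/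
theorem hasDerivAt_functional {N : ℕ} {p : S d × S d} {T : CSS d →ₗ[ℂ] ℂ}
    (hT : ∀ f ∈ jetIdeal N p, T f = 0) {F : ℝ → CSS d} {F' : CSS d} {τ : ℝ}
    (hF : ContDiffAt ℝ ∞ (fun q : ℝ × (E d × E d) => Ext (F q.1).1 q.2)
      (τ, ((p.1 : E d), (p.2 : E d))))
    (hF' : ∀ q, F'.1 q = deriv (fun t => (F t).1 q) τ) :
    HasDerivAt (fun t => T (F t)) (T F') τ := by
  obtain ⟨c, hc⟩ := exists_jetCoord_expansion hT
  simp only [hc]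
  refine HasDerivAt.fun_sum fun I _ => HasDerivAt.const_mul _ ?_
  have h1 := hasDerivAt_iteratedFDeriv (I.1 : ℕ) hF
  have e : (fun v => deriv (fun t => Ext (F t).1 v) τ) = Ext F'.1 := by
    ext v; simp only [Ext, hF']
  simp only [e] at h1
  have h2 := (ContinuousMultilinearMap.apply ℝ (fun _ : Fin I.1 => E d × E d) ℂ
    (fun i => pairBasis d (I.2 i))).hasFDerivAt.comp_hasDerivAt τ h1
  exact h2

end functionals

section polynomial

open MvPolynomial

/-- The coordinate functions on `E × E`. -/
def coordFn (d : ℕ) : Fin (d + 1) ⊕ Fin (d + 1) → (E d × E d → ℂ)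
  | .inl i => fun v => ((v.1 i : ℝ) : ℂ)
  | .inr i => fun v => ((v.2 i : ℝ) : ℂ)

theorem contDiff_coordFn (i : Fin (d + 1) ⊕ Fin (d + 1)) : ContDiff ℝ ∞ (coordFn d i) := by
  cases i with
  | inl i =>
    have : ContDiff ℝ ∞ (fun v : E d × E d => v.1 i) :=
      (contDiff_euclidean.1 contDiff_fst) i
    exact Complex.ofRealCLM.contDiff.comp this
  | inr i =>
    have : ContDiff ℝ ∞ (fun v : E d × E d => v.2 i) :=
      (contDiff_euclidean.1 contDiff_snd) i
    exact Complex.ofRealCLM.contDiff.comp this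

theorem contDiff_aeval_coordFn (P : MvPolynomial (Fin (d + 1) ⊕ Fin (d + 1)) ℂ) :
    ContDiff ℝ ∞ (aeval (coordFn d) P) := by
  induction P using MvPolynomial.induction_on with
  | C a => rw [aeval_C]; exact contDiff_const
  | add p q hp hq => rw [map_add]; exact hp.add hq
  | mul_X p i hp => rw [map_mul, aeval_X]; exact hp.mul (contDiff_coordFn i)

theorem contMDiff_coe_prod :
    ContMDiff ((𝓡 d).prod (𝓡 d)) 𝓘(ℝ, E d × E d) ∞
      (fun p : S d × S d => ((p.1 : E d), (p.2 : E d))) :=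
  (contMDiff_coe.comp contMDiff_fst).prodMk_space (contMDiff_coe.comp contMDiff_snd)

/-- The restriction of a polynomial function to `S × S`. -/
def polyCSS : MvPolynomial (Fin (d + 1) ⊕ Fin (d + 1)) ℂ →ₗ[ℂ] CSS d where
  toFun P := ⟨fun p => aeval (coordFn d) P ((p.1 : E d), (p.2 : E d)),
    (contDiff_aeval_coordFn P).contMDiff.comp contMDiff_coe_prod⟩
  map_add' P Q := by ext p; simp
  map_smul' c P := by ext p; simp

theorem pairBasis_repr (v : E d × E d) (i : Fin (d + 1) ⊕ Fin (d + 1)) :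
    (((pairBasis d).repr v i : ℝ) : ℂ) = coordFn d i v := by
  cases i <;> simp [pairBasis, coordFn]

/-- Polynomials are dense in the space of jets. -/
theorem exists_poly_mem_jetIdeal (f : CSS d) (N : ℕ) (p : S d × S d) :
    ∃ P, f + polyCSS P ∈ jetIdeal N p := by
  obtain ⟨P, ⟨Q, rfl⟩, hJ⟩ := exists_taylor (pairBasis d) (aeval (R := ℂ) (coordFn d)).range
    (by rintro _ ⟨Q, rfl⟩; exact contDiff_aeval_coordFn Q)
    (fun i => ⟨X i, by ext v; simp [pairBasis_repr]⟩) (contDiffAt_Ext_coe f p) N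
  exact ⟨Q, JV_sub_of_eventually (contDiff_aeval_coordFn Q).contDiffAt hJ fun q => rfl⟩

end polynomial

/-! ### One-parameter subgroups -/

section oneParameter

/-- A one-parameter group of linear maps of `ℝ × E` that preserve the Lorentzian form and the
forward cone, and that a reflection conjugates to the opposite one-parameter group. -/
structure LorentzFlow (d : ℕ) where
  toFun : ℝ → (ℝ × E d) →ₗ[ℝ] (ℝ × E d)
  gen : (ℝ × E d) → (ℝ × E d)
  refl : (ℝ × E d) →ₗ[ℝ] (ℝ × E d)
  zero' : toFun 0 = LinearMap.id
  add' : ∀ s t, toFun (s + t) = toFun s ∘ₗ toFun t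
  form' : ∀ t p, lorentzForm d (toFun t p) = lorentzForm d p
  cone' : ∀ t p, 0 < p.1 → 0 ≤ lorentzForm d p → 0 < (toFun t p).1
  refl' : refl ∘ₗ refl = LinearMap.id
  conj' : ∀ t, refl ∘ₗ toFun t ∘ₗ refl = toFun (-t)
  smooth' : ContDiff ℝ ∞ fun q : ℝ × (ℝ × E d) => toFun q.1 q.2
  deriv' : ∀ p, HasDerivAt (fun t => toFun t p) (gen p) 0

namespace LorentzFlow

variable (G : LorentzFlow d)

theorem det_eq_one (t : ℝ) : LinearMap.det (G.toFun t) = 1 := by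
  have h1 : ∀ t, LinearMap.det (G.toFun (-t)) = LinearMap.det (G.toFun t) := by
    intro t
    have h2 := congrArg LinearMap.det G.refl'
    rw [LinearMap.det_comp, LinearMap.det_id] at h2
    rw [← G.conj', LinearMap.det_comp, LinearMap.det_comp]
    linear_combination LinearMap.det (G.toFun t) * h2
  have h3 : LinearMap.det (G.toFun (t / 2)) * LinearMap.det (G.toFun (t / 2)) = 1 := by
    nth_rewrite 1 [← h1]
    rw [← LinearMap.det_comp, ← G.add', neg_add_cancel, G.zero', LinearMap.det_id]
  rw [show t = t / 2 + t / 2 by ring, G.add', LinearMap.det_comp, h3]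

theorem apply_neg (t : ℝ) : G.toFun t ∘ₗ G.toFun (-t) = LinearMap.id := by
  rw [← G.add', add_neg_cancel, G.zero']

/-- The elements of the one-parameter group. -/
def elt (t : ℝ) : SO0 d :=
  ⟨LinearEquiv.ofLinearMap (G.toFun t) (G.toFun (-t)) (G.apply_neg t)
    (by simpa using G.apply_neg (-t)), G.form' t, by
      rw [← G.det_eq_one t]; rfl, G.cone' t⟩

theorem elt_inv_apply (t : ℝ) (p : ℝ × E d) : (G.elt t)⁻¹.1 p = G.toFun (-t) p := rfl

end LorentzFlow

theorem inner_coord_sq_le (e : E d) (he : inner ℝ e e = 1) (p : ℝ × E d) (h1 : 0 < p.1)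
    (h2 : 0 ≤ lorentzForm d p) : |inner ℝ e p.2| ≤ p.1 := by
  have he' : ‖e‖ = 1 := by
    rw [real_inner_self_eq_norm_sq] at he
    nlinarith [norm_nonneg e]
  have h3 := abs_real_inner_le_norm e p.2
  rw [he', one_mul] at h3
  refine h3.trans ?_
  unfold lorentzForm at h2
  exact (sq_le_sq₀ (norm_nonneg _) h1.le).1 (by linarith)

theorem lorentzForm_eq (p : ℝ × E d) : lorentzForm d p = p.1 ^ 2 - inner ℝ p.2 p.2 := by
  rw [lorentzForm, real_inner_self_eq_norm_sq]

/-- The boosts in the direction `e`. -/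
def boost (e : E d) (he : inner ℝ e e = 1) : LorentzFlow d where
  toFun t :=
    { toFun := fun p => (p.1 * Real.cosh t + Real.sinh t * inner ℝ e p.2,
        p.2 + ((Real.cosh t - 1) * inner ℝ e p.2 + Real.sinh t * p.1) • e)
      map_add' := fun p q => by
        ext1
        · simp only [Prod.fst_add, Prod.snd_add, inner_add_right]; ring
        · simp only [Prod.fst_add, Prod.snd_add, inner_add_right]; module
      map_smul' := fun c p => by
        ext1
        · simp only [Prod.smul_fst, Prod.smul_snd, inner_smul_right, smul_eq_mul,
            RingHom.id_apply]; ring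
        · simp only [Prod.smul_fst, Prod.smul_snd, inner_smul_right, smul_eq_mul,
            RingHom.id_apply]; module }
  gen p := (inner ℝ e p.2, p.1 • e)
  refl :=
    { toFun := fun p => (p.1, p.2 - (2 * inner ℝ e p.2) • e)
      map_add' := fun p q => by
        ext1
        · simp
        · simp only [Prod.snd_add, inner_add_right]; module
      map_smul' := fun c p => by
        ext1
        · simp
        · simp only [Prod.smul_snd, inner_smul_right, RingHom.id_apply]; module }
  zero' := by refine LinearMap.ext fun p => Prod.ext ?_ ?_ <;> simp
  add' s t := by
    refine LinearMap.ext fun p => Prod.ext ?_ ?_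
    · simp only [LinearMap.coe_mk, AddHom.coe_mk, LinearMap.comp_apply, inner_add_right,
        inner_smul_right, he, Real.cosh_add, Real.sinh_add]
      ring
    · simp only [LinearMap.coe_mk, AddHom.coe_mk, LinearMap.comp_apply, inner_add_right,
        inner_smul_right, he, Real.cosh_add, Real.sinh_add]
      module
  form' t p := by
    have h := Real.cosh_sq t
    simp only [lorentzForm_eq, LinearMap.coe_mk, AddHom.coe_mk, inner_add_right, inner_add_left,
      inner_smul_right, inner_smul_left, he, real_inner_comm e p.2, conj_trivial]
    linear_combination (p.1 ^ 2 - inner ℝ e p.2 ^ 2) * h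
  cone' t p h1 h2 := by
    have h3 := inner_coord_sq_le e he p h1 h2
    have h4 : |Real.sinh t| < Real.cosh t := by
      rw [abs_lt]
      constructor
      · have := Real.sinh_lt_cosh (-t)
        rw [Real.sinh_neg, Real.cosh_neg] at this
        linarith
      · exact Real.sinh_lt_cosh t
    have h5 : |Real.sinh t * inner ℝ e p.2| < p.1 * Real.cosh t := by
      rw [abs_mul]
      nlinarith [abs_nonneg (Real.sinh t), abs_nonneg (inner ℝ e p.2)]
    have := (abs_lt.1 h5).1
    simp only [LinearMap.coe_mk, AddHom.coe_mk]
    linarith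
  refl' := by
    refine LinearMap.ext fun p => Prod.ext ?_ ?_
    · simp
    · simp only [LinearMap.coe_mk, AddHom.coe_mk, LinearMap.comp_apply, inner_sub_right,
        inner_smul_right, he, LinearMap.id_apply]
      module
  conj' t := by
    refine LinearMap.ext fun p => Prod.ext ?_ ?_
    · simp only [LinearMap.coe_mk, AddHom.coe_mk, LinearMap.comp_apply, inner_sub_right,
        inner_smul_right, he, Real.cosh_neg, Real.sinh_neg]
      ring
    · simp only [LinearMap.coe_mk, AddHom.coe_mk, LinearMap.comp_apply, inner_sub_right,
        inner_add_right, inner_smul_right, he, Real.cosh_neg, Real.sinh_neg]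
      module
  smooth' := by
    simp only [LinearMap.coe_mk, AddHom.coe_mk]
    have h1 : ContDiff ℝ ∞ fun q : ℝ × (ℝ × E d) => inner ℝ e q.2.2 :=
      contDiff_const.inner ℝ (contDiff_snd.comp contDiff_snd)
    have h2 : ContDiff ℝ ∞ fun q : ℝ × (ℝ × E d) => q.2.1 := contDiff_fst.comp contDiff_snd
    have h3 : ContDiff ℝ ∞ fun q : ℝ × (ℝ × E d) => Real.cosh q.1 := Real.contDiff_cosh.comp contDiff_fst
    have h4 : ContDiff ℝ ∞ fun q : ℝ × (ℝ × E d) => Real.sinh q.1 := Real.contDiff_sinh.comp contDiff_fst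
    exact ((h2.mul h3).add (h4.mul h1)).prodMk ((contDiff_snd.comp contDiff_snd).add
      ((((h3.sub contDiff_const).mul h1).add (h4.mul h2)).smul contDiff_const))
  deriv' p := by
    simp only [LinearMap.coe_mk, AddHom.coe_mk]
    have hc := Real.hasDerivAt_cosh 0
    have hs := Real.hasDerivAt_sinh 0
    have h1 := (hc.const_mul p.1).add (hs.mul_const (inner ℝ e p.2))
    have h2 := ((((hc.sub_const 1).mul_const (inner ℝ e p.2)).add (hs.mul_const p.1)).smul_const
      e).const_add p.2
    convert h1.prodMk h2 using 1 <;> simp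

/-- The rotations in the plane spanned by `e` and `f`. -/
def rot (e f : E d) (he : inner ℝ e e = 1) (hf : inner ℝ f f = 1) (hef : inner ℝ e f = 0) :
    LorentzFlow d where
  toFun t :=
    { toFun := fun p => (p.1, p.2 + ((Real.cos t - 1) * inner ℝ e p.2 - Real.sin t * inner ℝ f p.2) • e
        + ((Real.cos t - 1) * inner ℝ f p.2 + Real.sin t * inner ℝ e p.2) • f)
      map_add' := fun p q => by
        ext1
        · simp
        · simp only [Prod.snd_add, inner_add_right]; module
      map_smul' := fun c p => by
        ext1
        · simp
        · simp only [Prod.smul_snd, inner_smul_right, RingHom.id_apply]; module }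
  gen p := (0, inner ℝ e p.2 • f - inner ℝ f p.2 • e)
  refl :=
    { toFun := fun p => (p.1, p.2 - (2 * inner ℝ e p.2) • e)
      map_add' := fun p q => by
        ext1
        · simp
        · simp only [Prod.snd_add, inner_add_right]; module
      map_smul' := fun c p => by
        ext1
        · simp
        · simp only [Prod.smul_snd, inner_smul_right, RingHom.id_apply]; module }
  zero' := by refine LinearMap.ext fun p => Prod.ext ?_ ?_ <;> simp
  add' s t := by
    have hfe : inner ℝ f e = 0 := by rw [real_inner_comm, hef]
    refine LinearMap.ext fun p => Prod.ext ?_ ?_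
    · simp
    · simp only [LinearMap.coe_mk, AddHom.coe_mk, LinearMap.comp_apply, inner_add_right,
        inner_smul_right, he, hf, hef, hfe, Real.cos_add, Real.sin_add]
      module
  form' t p := by
    have hfe : inner ℝ f e = 0 := by rw [real_inner_comm, hef]
    have h := Real.sin_sq_add_cos_sq t
    simp only [lorentzForm_eq, LinearMap.coe_mk, AddHom.coe_mk, inner_add_right, inner_add_left,
      inner_smul_right, inner_smul_left, he, hf, hef, hfe, real_inner_comm e p.2,
      real_inner_comm f p.2, conj_trivial]
    linear_combination (-inner ℝ e p.2 ^ 2 - inner ℝ f p.2 ^ 2) * h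
  cone' t p h1 h2 := h1
  refl' := by
    refine LinearMap.ext fun p => Prod.ext ?_ ?_
    · simp
    · simp only [LinearMap.coe_mk, AddHom.coe_mk, LinearMap.comp_apply, inner_sub_right,
        inner_smul_right, he, LinearMap.id_apply]
      module
  conj' t := by
    have hfe : inner ℝ f e = 0 := by rw [real_inner_comm, hef]
    refine LinearMap.ext fun p => Prod.ext ?_ ?_
    · simp
    · simp only [LinearMap.coe_mk, AddHom.coe_mk, LinearMap.comp_apply, inner_sub_right,
        inner_add_right, inner_smul_right, he, hef, hfe, Real.cos_neg, Real.sin_neg]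
      module
  smooth' := by
    simp only [LinearMap.coe_mk, AddHom.coe_mk]
    have h1 : ∀ e : E d, ContDiff ℝ ∞ fun q : ℝ × (ℝ × E d) => inner ℝ e q.2.2 :=
      fun e => contDiff_const.inner ℝ (contDiff_snd.comp contDiff_snd)
    have h2 : ContDiff ℝ ∞ fun q : ℝ × (ℝ × E d) => q.2.1 := contDiff_fst.comp contDiff_snd
    have h3 : ContDiff ℝ ∞ fun q : ℝ × (ℝ × E d) => Real.cos q.1 := Real.contDiff_cos.comp contDiff_fst
    have h4 : ContDiff ℝ ∞ fun q : ℝ × (ℝ × E d) => Real.sin q.1 := Real.contDiff_sin.comp contDiff_fst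
    exact h2.prodMk (((contDiff_snd.comp contDiff_snd).add
      ((((h3.sub contDiff_const).mul (h1 e)).sub (h4.mul (h1 f))).smul contDiff_const)).add
      ((((h3.sub contDiff_const).mul (h1 f)).add (h4.mul (h1 e))).smul contDiff_const))
  deriv' p := by
    simp only [LinearMap.coe_mk, AddHom.coe_mk]
    have hc := Real.hasDerivAt_cos 0
    have hs := Real.hasDerivAt_sin 0
    have h2 := (((((hc.sub_const 1).mul_const (inner ℝ e p.2)).sub
      (hs.mul_const (inner ℝ f p.2))).smul_const e).const_add p.2).add
      ((((hc.sub_const 1).mul_const (inner ℝ f p.2)).add (hs.mul_const (inner ℝ e p.2))).smul_const f)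
    convert (hasDerivAt_const (0 : ℝ) p.1).prodMk h2 using 1
    ext1
    · rfl
    · simp [sub_eq_add_neg, add_comm]

end oneParameter

/-! ### Infinitesimal covariance -/

section infinitesimal

theorem act_eq_proj (g : SO0 d) (x : S d) : act g x = proj (lift g x).2 := by
  have h : (lift g x).2 ≠ 0 := by
    intro h
    have := norm_lift_snd g x
    rw [h, norm_zero] at this
    exact (lift_fst_pos g x).ne this
  apply Subtype.ext
  rw [coe_proj h, norm_lift_snd]
  rfl

theorem lift_snd_ne_zero (g : SO0 d) (x : S d) : (lift g x).2 ≠ 0 := by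
  intro h
  have := norm_lift_snd g x
  rw [h, norm_zero] at this
  exact (lift_fst_pos g x).ne this

theorem piRep_eq (l : ℂ) (g : SO0 d) (f : CS d) (x : S d) :
    (piRep l g f).1 x = wext (rho d + l) f.1 (lift g⁻¹ x) := by
  simp only [piRep, LinearMap.coe_mk, AddHom.coe_mk, wext, kappa,
    ofReal_inv_cpow (lift_fst_pos _ _), act_eq_proj]

/-- The extension to the product of two cones, homogeneous in both variables. -/
def wext2 (s t : ℂ) (f : S d × S d → ℂ) (q : (ℝ × E d) × (ℝ × E d)) : ℂ :=
  (q.1.1 : ℂ) ^ (-s) * (q.2.1 : ℂ) ^ (-t) * f (proj q.1.2, proj q.2.2)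

theorem piTensor_eq (l m : ℂ) (g : SO0 d) (f : CSS d) (p : S d × S d) :
    (piTensor l m g f).1 p = wext2 (rho d + l) (rho d + m) f.1 (lift g⁻¹ p.1, lift g⁻¹ p.2) := by
  simp only [piTensor, LinearMap.coe_mk, AddHom.coe_mk, wext2, kappa,
    ofReal_inv_cpow (lift_fst_pos _ _), act_eq_proj]

theorem contDiffAt_wext2 (s t : ℂ) (f : CSS d) {q : (ℝ × E d) × (ℝ × E d)} (h1 : 0 < q.1.1)
    (h2 : 0 < q.2.1) (h3 : q.1.2 ≠ 0) (h4 : q.2.2 ≠ 0) : ContDiffAt ℝ ∞ (wext2 s t f.1) q := by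
  have ha : ContDiffAt ℝ ∞ (fun q : (ℝ × E d) × (ℝ × E d) => (q.1.1 : ℂ) ^ (-s)) q :=
    (contDiffAt_ofReal_cpow h1 (-s)).comp q (contDiffAt_fst.comp q contDiffAt_fst)
  have hb : ContDiffAt ℝ ∞ (fun q : (ℝ × E d) × (ℝ × E d) => (q.2.1 : ℂ) ^ (-t)) q :=
    (contDiffAt_ofReal_cpow h2 (-t)).comp q (contDiffAt_fst.comp q contDiffAt_snd)
  have hc : ContDiffAt ℝ ∞ (fun q : (ℝ × E d) × (ℝ × E d) => Ext f.1 (q.1.2, q.2.2)) q :=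
    ContDiffAt.comp (g := Ext f.1)
      (f := fun q : (ℝ × E d) × (ℝ × E d) => (q.1.2, q.2.2)) q
      (contDiffAt_Ext f (v := (q.1.2, q.2.2)) h3 h4)
      ((contDiffAt_snd.comp q contDiffAt_fst).prodMk (contDiffAt_snd.comp q contDiffAt_snd))
  exact (ha.mul hb).mul hc

theorem fderiv_wext {s : ℂ} {f : S d → ℂ} (hf : ContMDiff (𝓡 d) 𝓘(ℝ, ℂ) ∞ f) (x : S d)
    (w : ℝ × E d) : fderiv ℝ (wext s f) (1, (x : E d)) w = -s * w.1 * f x + sd w.2 f x := by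
  have h1 := (contDiffAt_ofReal_cpow one_pos (-s) (m := 1)).differentiableAt (by simp)
  have h1' : HasDerivAt (fun r : ℝ => (r : ℂ) ^ (-s)) (-s) 1 := by
    by_cases hs : s = 0
    · simpa [hs] using hasDerivAt_const (1 : ℝ) (1 : ℂ)
    have := (hasDerivAt_id (1 : ℂ)).cpow_const (c := -s) (by simp)
    simpa using this.comp_ofReal (z := 1)
  have h2 : HasFDerivAt (fun p : ℝ × E d => (p.1 : ℂ) ^ (-s))
      ((ContinuousLinearMap.toSpanSingleton ℝ (-s)).comp (ContinuousLinearMap.fst ℝ ℝ (E d)))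
      (1, (x : E d)) :=
    HasFDerivAt.comp (g := fun r : ℝ => (r : ℂ) ^ (-s)) (1, (x : E d))
      (by simpa using h1'.hasFDerivAt) hasFDerivAt_fst
  have h3 : HasFDerivAt (fun p : ℝ × E d => f (proj p.2))
      ((fderiv ℝ (fun v => f (proj v)) (x : E d)).comp (ContinuousLinearMap.snd ℝ ℝ (E d)))
      (1, (x : E d)) :=
    HasFDerivAt.comp (g := fun v => f (proj v)) (1, (x : E d))
      ((contDiffAt_comp_proj (hf x)).differentiableAt (by simp)).hasFDerivAt hasFDerivAt_snd
  have h4 := (h2.fun_mul h3).fderiv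
  have e : wext s f = fun p : ℝ × E d => (p.1 : ℂ) ^ (-s) * f (proj p.2) := rfl
  rw [e, h4]
  simp [proj_coe, sd]
  ring

theorem fderiv_wext2 (s t : ℂ) (f : CSS d) (x y : S d) (w w' : ℝ × E d) :
    fderiv ℝ (wext2 s t f.1) ((1, (x : E d)), (1, (y : E d))) (w, w') =
      (-s * w.1 * f.1 (x, y) + sd w.2 (fun x => f.1 (x, y)) x) +
      (-t * w'.1 * f.1 (x, y) + sd w'.2 (fun y => f.1 (x, y)) y) := by
  have hd := ((contDiffAt_wext2 s t f (q := ((1, (x : E d)), (1, (y : E d)))) one_pos one_pos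
    (coe_ne_zero x) (coe_ne_zero y)).differentiableAt (by simp)).hasFDerivAt
  rw [← fderiv_wext (smooth_slice_left f y), ← fderiv_wext (smooth_slice_right f x)]
  have h1 := HasFDerivAt.comp (g := wext2 s t f.1)
    (f := fun p : ℝ × E d => (p, ((1 : ℝ), (y : E d)))) ((1 : ℝ), (x : E d)) hd
    (hasFDerivAt_prodMk_left ((1 : ℝ), (x : E d)) ((1 : ℝ), (y : E d)))
  have h2 := HasFDerivAt.comp (g := wext2 s t f.1)
    (f := fun p : ℝ × E d => (((1 : ℝ), (x : E d)), p)) ((1 : ℝ), (y : E d)) hd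
    (hasFDerivAt_prodMk_right ((1 : ℝ), (x : E d)) ((1 : ℝ), (y : E d)))
  have e1 : (wext2 s t f.1 ∘ fun p => (p, ((1 : ℝ), (y : E d)))) = wext s (fun x => f.1 (x, y)) := by
    ext p; simp [wext2, wext, proj_coe]
  have e2 : (wext2 s t f.1 ∘ fun p => (((1 : ℝ), (x : E d)), p)) = wext t (fun y => f.1 (x, y)) := by
    ext p; simp [wext2, wext, proj_coe]
  rw [← e1, ← e2, h1.fderiv, h2.fderiv]
  simp only [ContinuousLinearMap.comp_apply, ContinuousLinearMap.inl_apply,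
    ContinuousLinearMap.inr_apply]
  rw [← map_add]
  simp

/-- `f'` is the derivative of `f` along the flow, with weights `s` and `t`. -/
def IsFlowDeriv (G : LorentzFlow d) (s t : ℂ) (f f' : CSS d) : Prop :=
  ∀ x y : S d, f'.1 (x, y) =
    (-s * (G.gen (1, (x : E d))).1 * f.1 (x, y) +
      sd (G.gen (1, (x : E d))).2 (fun x => f.1 (x, y)) x) +
    (-t * (G.gen (1, (y : E d))).1 * f.1 (x, y) +
      sd (G.gen (1, (y : E d))).2 (fun y => f.1 (x, y)) y)

theorem LorentzFlow.hasDerivAt_toFun_neg (G : LorentzFlow d) (p : ℝ × E d) :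
    HasDerivAt (fun τ => G.toFun (-τ) p) (-G.gen p) 0 := by
  have h := G.deriv' p
  rw [← neg_zero] at h
  simpa using! h.scomp (0 : ℝ) (_root_.hasDerivAt_neg (0 : ℝ))

theorem LorentzFlow.toFun_neg_zero (G : LorentzFlow d) (p : ℝ × E d) : G.toFun (-0) p = p := by
  rw [neg_zero, G.zero']; rfl

theorem hasDerivAt_piTensor (G : LorentzFlow d) (l m : ℂ) {f f' : CSS d}
    (h : IsFlowDeriv G (rho d + l) (rho d + m) f f') (p : S d × S d) :
    HasDerivAt (fun τ => (piTensor l m (G.elt τ) f).1 p) (-f'.1 p) 0 := by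
  obtain ⟨x, y⟩ := p
  have hd := ((contDiffAt_wext2 (rho d + l) (rho d + m) f (q := ((1, (x : E d)), (1, (y : E d))))
    one_pos one_pos (coe_ne_zero x) (coe_ne_zero y)).differentiableAt (by simp)).hasFDerivAt
  have h1 := (G.hasDerivAt_toFun_neg (1, (x : E d))).prodMk (G.hasDerivAt_toFun_neg (1, (y : E d)))
  have hd' : HasFDerivAt (𝕜 := ℝ) (wext2 (rho d + l) (rho d + m) f.1)
      (fderiv ℝ (wext2 (rho d + l) (rho d + m) f.1) ((1, (x : E d)), (1, (y : E d))))
      (G.toFun (-0) (1, (x : E d)), G.toFun (-0) (1, (y : E d))) := by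
    rw [G.toFun_neg_zero, G.toFun_neg_zero]; exact hd
  have h2 := HasFDerivAt.comp_hasDerivAt (0 : ℝ) hd' h1
  rw [← Prod.neg_mk, map_neg, fderiv_wext2, ← h x y] at h2
  refine h2.congr_of_eventuallyEq (Filter.Eventually.of_forall fun τ => ?_)
  dsimp only
  rw [piTensor_eq]
  rfl

theorem hasDerivAt_piRep (G : LorentzFlow d) (l : ℂ) (f : CS d) (x : S d) :
    HasDerivAt (fun τ => (piRep l (G.elt τ) f).1 x)
      (-(-(rho d + l) * (G.gen (1, (x : E d))).1 * f.1 x +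
        sd (G.gen (1, (x : E d))).2 f.1 x)) 0 := by
  have hd := ((contDiffAt_wext (s := rho d + l) f.2 (p := (1, (x : E d))) one_pos
    (coe_ne_zero x)).differentiableAt (by simp)).hasFDerivAt
  have hd' : HasFDerivAt (𝕜 := ℝ) (wext (rho d + l) f.1)
      (fderiv ℝ (wext (rho d + l) f.1) (1, (x : E d))) (G.toFun (-0) (1, (x : E d))) := by
    rw [G.toFun_neg_zero]; exact hd
  have h2 := HasFDerivAt.comp_hasDerivAt (0 : ℝ) hd' (G.hasDerivAt_toFun_neg (1, (x : E d)))
  rw [map_neg, fderiv_wext f.2] at h2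
  refine h2.congr_of_eventuallyEq (Filter.Eventually.of_forall fun τ => ?_)
  dsimp only
  rw [piRep_eq]
  rfl

theorem contDiffAt_flow (G : LorentzFlow d) (l m : ℂ) (f : CSS d) (p : S d × S d) (τ : ℝ) :
    ContDiffAt ℝ ∞ (fun q : ℝ × (E d × E d) => Ext (piTensor l m (G.elt q.1) f).1 q.2)
      (τ, ((p.1 : E d), (p.2 : E d))) := by
  set c : ℝ × (E d × E d) := (τ, ((p.1 : E d), (p.2 : E d))) with hc
  have hn : ∀ x : S d, ContDiffAt ℝ ∞ (fun v : E d => ((1 : ℝ), ‖v‖⁻¹ • v)) (x : E d) :=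
    fun x => contDiffAt_const.prodMk (contDiffAt_coe_proj (coe_ne_zero x))
  have hneg : ContDiffAt ℝ ∞ (fun q : ℝ × (E d × E d) => -q.1) c := contDiffAt_fst.neg
  have hx : ContDiffAt ℝ ∞ (fun q : ℝ × (E d × E d) => G.toFun (-q.1) (1, ‖q.2.1‖⁻¹ • q.2.1)) c :=
    ContDiffAt.comp (g := fun q : ℝ × (ℝ × E d) => G.toFun q.1 q.2)
      (f := fun q : ℝ × (E d × E d) => (-q.1, ((1 : ℝ), ‖q.2.1‖⁻¹ • q.2.1))) c
      G.smooth'.contDiffAt (hneg.prodMk (ContDiffAt.comp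
        (g := fun v : E d => ((1 : ℝ), ‖v‖⁻¹ • v)) (f := fun q : ℝ × (E d × E d) => q.2.1) c
        (hn p.1) (contDiffAt_fst.comp c contDiffAt_snd)))
  have hy : ContDiffAt ℝ ∞ (fun q : ℝ × (E d × E d) => G.toFun (-q.1) (1, ‖q.2.2‖⁻¹ • q.2.2)) c :=
    ContDiffAt.comp (g := fun q : ℝ × (ℝ × E d) => G.toFun q.1 q.2)
      (f := fun q : ℝ × (E d × E d) => (-q.1, ((1 : ℝ), ‖q.2.2‖⁻¹ • q.2.2))) c
      G.smooth'.contDiffAt (hneg.prodMk (ContDiffAt.comp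
        (g := fun v : E d => ((1 : ℝ), ‖v‖⁻¹ • v)) (f := fun q : ℝ × (E d × E d) => q.2.2) c
        (hn p.2) (contDiffAt_snd.comp c contDiffAt_snd)))
  have hl : ∀ x : S d, G.toFun (-τ) (1, ‖(x : E d)‖⁻¹ • (x : E d)) = lift (G.elt τ)⁻¹ x := by
    intro x
    rw [norm_coe, inv_one, one_smul]
    rfl
  have h0 : ContDiffAt ℝ ∞ (wext2 (rho d + l) (rho d + m) f.1)
      (G.toFun (-c.1) (1, ‖c.2.1‖⁻¹ • c.2.1), G.toFun (-c.1) (1, ‖c.2.2‖⁻¹ • c.2.2)) := by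
    simp only [hc, hl]
    exact contDiffAt_wext2 _ _ f (lift_fst_pos _ _) (lift_fst_pos _ _) (lift_snd_ne_zero _ _)
      (lift_snd_ne_zero _ _)
  refine (h0.comp c (hx.prodMk hy)).congr_of_eventuallyEq ?_
  have e1 : ∀ᶠ q in nhds c, q.2.1 ≠ 0 ∧ q.2.2 ≠ 0 :=
    (ContinuousAt.eventually_ne (g := fun q : ℝ × (E d × E d) => q.2.1)
      (continuous_fst.comp continuous_snd).continuousAt (coe_ne_zero p.1)).and
    (ContinuousAt.eventually_ne (g := fun q : ℝ × (E d × E d) => q.2.2)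
      (continuous_snd.comp continuous_snd).continuousAt (coe_ne_zero p.2))
  filter_upwards [e1] with q hq
  simp only [Ext, Function.comp, piTensor_eq]
  rw [show lift (G.elt q.1)⁻¹ (proj q.2.1) = G.toFun (-q.1) (1, (proj q.2.1 : E d)) from rfl,
    show lift (G.elt q.1)⁻¹ (proj q.2.2) = G.toFun (-q.1) (1, (proj q.2.2 : E d)) from rfl,
    coe_proj hq.1, coe_proj hq.2]

/-- The infinitesimal form of covariance. -/
theorem covariant_flowDeriv {B : CSS d →ₗ[ℂ] CS d} {N : ℕ} {z : S d}
    (hB : ∀ f ∈ jetIdeal N (z, z), (B f).1 z = 0) (G : LorentzFlow d) {l m n : ℂ}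
    (hG : ∀ τ f, B (piTensor l m (G.elt τ) f) = piRep n (G.elt τ) (B f)) {f f' : CSS d}
    (h : IsFlowDeriv G (rho d + l) (rho d + m) f f') :
    (B f').1 z = -(rho d + n) * (G.gen (1, (z : E d))).1 * (B f).1 z +
        sd (G.gen (1, (z : E d))).2 (B f).1 z := by
  let T : CSS d →ₗ[ℂ] ℂ :=
    { toFun := fun f => (B f).1 z, map_add' := fun f g => by simp, map_smul' := fun c f => by simp }
  have h1 := hasDerivAt_functional (T := T) hB (F := fun τ => piTensor l m (G.elt τ) f) (F' := -f')
    (contDiffAt_flow G l m f (z, z) 0) (fun q => (hasDerivAt_piTensor G l m h q).deriv.symm)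
  have h2 := hasDerivAt_piRep G n (B f) z
  have e : (fun τ => T (piTensor l m (G.elt τ) f)) = fun τ => (piRep n (G.elt τ) (B f)).1 z := by
    ext τ; exact congrArg (fun a : CS d => a.1 z) (hG τ f)
  simp only [e] at h1
  have h3 := h1.unique h2
  rw [map_neg, neg_inj] at h3
  exact h3

end infinitesimal

/-! ### Invariants of two vectors -/

namespace TwoVectors

open MvPolynomial

variable {ι : Type}

/-- Polynomials in two vectors. -/
abbrev Pol (ι : Type) := MvPolynomial (ι ⊕ ι) ℂ

/-- The coordinates of the first vector. -/
abbrev vx (i : ι) : Pol ι := X (Sum.inl i)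

/-- The coordinates of the second vector. -/
abbrev vy (i : ι) : Pol ι := X (Sum.inr i)

/-- The weights of the bidegree. -/
def wt : ι ⊕ ι → ℤ × ℤ
  | .inl _ => (1, 0)
  | .inr _ => (0, 1)

/-- The polynomials of bidegree `(i, j)`. -/
abbrev Bi (G : Pol ι) (i j : ℤ) : Prop := IsWeightedHomogeneous wt G (i, j)

theorem Bi.smul {G : Pol ι} {i j : ℤ} (h : Bi G i j) (c : ℂ) : Bi (c • G) i j :=
  (weightedHomogeneousSubmodule ℂ wt (i, j)).smul_mem c h

theorem Bi.vx_mul {G : Pol ι} {i j : ℤ} (h : Bi G i j) (l : ι) : Bi (vx l * G) (i + 1) j := by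
  have := (isWeightedHomogeneous_X ℂ wt (Sum.inl l : ι ⊕ ι)).mul h
  rwa [show wt (Sum.inl l : ι ⊕ ι) + (i, j) = (i + 1, j) by simp [wt, add_comm]] at this

theorem Bi.vy_mul {G : Pol ι} {i j : ℤ} (h : Bi G i j) (l : ι) : Bi (vy l * G) i (j + 1) := by
  have := (isWeightedHomogeneous_X ℂ wt (Sum.inr l : ι ⊕ ι)).mul h
  rwa [show wt (Sum.inr l : ι ⊕ ι) + (i, j) = (i, j + 1) by simp [wt, add_comm]] at this

theorem Bi.dx {G : Pol ι} {i j : ℤ} (h : Bi G i j) (l : ι) : Bi (pderiv (Sum.inl l) G) (i - 1) j :=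
  h.pderiv (by simp [wt])

theorem Bi.dy {G : Pol ι} {i j : ℤ} (h : Bi G i j) (l : ι) : Bi (pderiv (Sum.inr l) G) i (j - 1) :=
  h.pderiv (by simp [wt])

/-- The infinitesimal rotation in the plane of the coordinates `l` and `m`. -/
def rL (l m : ι) : Derivation ℂ (Pol ι) (Pol ι) :=
  (vx l : Pol ι) • pderiv (Sum.inl m) - (vx m : Pol ι) • pderiv (Sum.inl l) +
    (vy l : Pol ι) • pderiv (Sum.inr m) - (vy m : Pol ι) • pderiv (Sum.inr l)

theorem rL_apply (l m : ι) (G : Pol ι) : rL l m G = vx l * pderiv (Sum.inl m) G -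
    vx m * pderiv (Sum.inl l) G + vy l * pderiv (Sum.inr m) G - vy m * pderiv (Sum.inr l) G := by
  simp [rL]

theorem derivation_sum_apply {s : Finset ι} (D : ι → Derivation ℂ (Pol ι) (Pol ι)) (G : Pol ι) :
    (∑ m ∈ s, D m) G = ∑ m ∈ s, D m G := by
  classical
  induction s using Finset.induction_on with
  | empty => simp
  | insert a s ha ih => rw [Finset.sum_insert ha, Finset.sum_insert ha, Derivation.add_apply, ih]

variable [Fintype ι]

/-- The polarization `y · ∂_x`. -/
def pE : Derivation ℂ (Pol ι) (Pol ι) := ∑ m, (vy m : Pol ι) • pderiv (Sum.inl m)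

/-- The polarization `x · ∂_y`. -/
def pF : Derivation ℂ (Pol ι) (Pol ι) := ∑ m, (vx m : Pol ι) • pderiv (Sum.inr m)

/-- The Euler operator in the first vector. -/
def nX : Derivation ℂ (Pol ι) (Pol ι) := ∑ m, (vx m : Pol ι) • pderiv (Sum.inl m)

/-- The Euler operator in the second vector. -/
def nY : Derivation ℂ (Pol ι) (Pol ι) := ∑ m, (vy m : Pol ι) • pderiv (Sum.inr m)

theorem pE_apply (G : Pol ι) : pE G = ∑ m, vy m * pderiv (Sum.inl m) G := by
  simp [pE, derivation_sum_apply]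

theorem pF_apply (G : Pol ι) : pF G = ∑ m, vx m * pderiv (Sum.inr m) G := by
  simp [pF, derivation_sum_apply]

theorem nX_apply (G : Pol ι) : nX G = ∑ m, vx m * pderiv (Sum.inl m) G := by
  simp [nX, derivation_sum_apply]

theorem nY_apply (G : Pol ι) : nY G = ∑ m, vy m * pderiv (Sum.inr m) G := by
  simp [nY, derivation_sum_apply]

theorem pE_pF_comm (G : Pol ι) : pE (pF G) = pF (pE G) + nY G - nX G := by
  classical
  have h : ⁅(pE : Derivation ℂ (Pol ι) (Pol ι)), (pF : Derivation ℂ (Pol ι) (Pol ι))⁆ = nY - nX := by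
    apply MvPolynomial.derivation_ext
    rintro (i | i)
    · simp only [Derivation.commutator_apply, Derivation.sub_apply, pE_apply, pF_apply, nX_apply,
        nY_apply, pderiv_X]
      simp [Pi.single_apply]
    · simp only [Derivation.commutator_apply, Derivation.sub_apply, pE_apply, pF_apply, nX_apply,
        nY_apply, pderiv_X]
      simp [Pi.single_apply]
  have h2 := congrArg (fun D : Derivation ℂ (Pol ι) (Pol ι) => D G) h
  rw [Derivation.commutator_apply, Derivation.sub_apply] at h2
  linear_combination h2

theorem Bi.pE {G : Pol ι} {i j : ℤ} (h : Bi G i j) : Bi (pE G) (i - 1) (j + 1) := by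
  rw [pE_apply]
  exact IsWeightedHomogeneous.sum _ _ _ fun m _ => (h.dx m).vy_mul m

theorem Bi.pF {G : Pol ι} {i j : ℤ} (h : Bi G i j) : Bi (pF G) (i + 1) (j - 1) := by
  rw [pF_apply]
  exact IsWeightedHomogeneous.sum _ _ _ fun m _ => (h.dy m).vx_mul m

theorem weight_wt (s : ι ⊕ ι →₀ ℕ) : Finsupp.weight wt s =
    (((∑ m, s (Sum.inl m) : ℕ) : ℤ), ((∑ m, s (Sum.inr m) : ℕ) : ℤ)) := by
  rw [Finsupp.weight_apply, Finsupp.sum_fintype _ _ (by simp), Fintype.sum_sum_type]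
  ext <;> simp [wt, Prod.fst_sum, Prod.snd_sum]

theorem Bi.eq_zero {G : Pol ι} {i j : ℤ} (h : Bi G i j) (hi : i < 0) : G = 0 := by
  ext s
  rw [coeff_zero]
  refine h.coeff_eq_zero s fun hs => ?_
  rw [weight_wt, Prod.mk.injEq] at hs
  have := hs.1
  omega

theorem nX_monomial (s : ι ⊕ ι →₀ ℕ) (r : ℂ) :
    nX (monomial s r) = ((∑ m, s (Sum.inl m) : ℕ) : ℂ) • monomial s r := by
  rw [nX_apply]
  simp only [X_mul_pderiv_monomial]
  rw [← Finset.sum_smul, Nat.cast_smul_eq_nsmul]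

theorem nY_monomial (s : ι ⊕ ι →₀ ℕ) (r : ℂ) :
    nY (monomial s r) = ((∑ m, s (Sum.inr m) : ℕ) : ℂ) • monomial s r := by
  rw [nY_apply]
  simp only [X_mul_pderiv_monomial]
  rw [← Finset.sum_smul, Nat.cast_smul_eq_nsmul]

theorem Bi.sum_monomial {G : Pol ι} {i j : ℤ} (h : Bi G i j) {s : ι ⊕ ι →₀ ℕ}
    (hs : s ∈ G.support) :
    ((∑ m, s (Sum.inl m) : ℕ) : ℤ) = i ∧ ((∑ m, s (Sum.inr m) : ℕ) : ℤ) = j := by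
  have := h (mem_support_iff.1 hs)
  rw [weight_wt, Prod.mk.injEq] at this
  exact this

theorem Bi.nX {G : Pol ι} {i j : ℤ} (h : Bi G i j) : nX G = (i : ℂ) • G := by
  conv_lhs => rw [G.as_sum]
  conv_rhs => rw [G.as_sum]
  rw [map_sum, Finset.smul_sum]
  refine Finset.sum_congr rfl fun s hs => ?_
  rw [nX_monomial, ← (h.sum_monomial hs).1]
  norm_cast

theorem Bi.nY {G : Pol ι} {i j : ℤ} (h : Bi G i j) : nY G = (j : ℂ) • G := by
  conv_lhs => rw [G.as_sum]
  conv_rhs => rw [G.as_sum]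
  rw [map_sum, Finset.smul_sum]
  refine Finset.sum_congr rfl fun s hs => ?_
  rw [nY_monomial, ← (h.sum_monomial hs).2]
  norm_cast

/-- The operator `(x · ∂_y) (y · ∂_x) - c` is onto on the polynomials of bidegree `(i, j)` when `c`
is not one of its eigenvalues. -/
theorem exists_pF_pE_sub (i : ℕ) : ∀ (j : ℤ) (c : ℂ),
    (∀ r : ℕ, r ≤ i → c ≠ r * (j - i + 1 + r)) → ∀ G : Pol ι, Bi G i j →
    ∃ H, Bi H i j ∧ pF (pE H) - c • H = G := by
  induction i with
  | zero =>
    intro j c hc G hG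
    have hc0 : c ≠ 0 := by simpa using hc 0 le_rfl
    refine ⟨(-c⁻¹) • G, hG.smul _, ?_⟩
    have h0 : pE G = 0 := hG.pE.eq_zero (by simp)
    rw [Derivation.map_smul, h0, smul_zero, map_zero, smul_smul]
    simp [hc0]
  | succ i ih =>
    intro j c hc G hG
    have hc0 : c ≠ 0 := by simpa using hc 0 (by omega)
    have hE : Bi (c⁻¹ • pE G) i (j + 1) := by
      have := hG.pE.smul c⁻¹
      simpa using this
    obtain ⟨H', hH', he⟩ := ih (j + 1) (c - (j + 1 - i)) (by
      intro r hr h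
      refine hc (r + 1) (by omega) ?_
      push_cast at h ⊢
      linear_combination h) _ hE
    have hF : Bi (pF H') (i + 1 : ℕ) j := by
      have := hH'.pF
      simpa using this
    refine ⟨(-c⁻¹) • G + pF H', (hG.smul _).add hF, ?_⟩
    have h1 := pE_pF_comm H'
    rw [hH'.nX, hH'.nY] at h1
    have h2 := congrArg pF he
    rw [map_add, map_add, h1, Derivation.map_smul, Derivation.map_smul]
    rw [map_sub, Derivation.map_smul, Derivation.map_smul] at h2
    rw [map_sub, map_add, Derivation.map_smul, Derivation.map_smul, smul_add, smul_smul]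
    have h3 : c * -c⁻¹ = -1 := by field_simp
    rw [h3]
    have h4 : pF (pF (pE H')) = (c - (j + 1 - i)) • pF H' + c⁻¹ • pF (pE G) := by
      rw [← h2]; abel
    rw [h4]
    push_cast
    module

end TwoVectors

namespace TwoVectors

open MvPolynomial

variable {ι : Type} [Fintype ι]

/-- The square of the first vector. -/
def qx (ι : Type) [Fintype ι] : Pol ι := ∑ m, vx m * vx m

/-- The square of the second vector. -/
def qy (ι : Type) [Fintype ι] : Pol ι := ∑ m, vy m * vy m

/-- The inner product of the two vectors. -/
def qxy (ι : Type) [Fintype ι] : Pol ι := ∑ m, vx m * vy m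

theorem rL_qy (l m : ι) : rL l m (qy ι) = 0 := by
  classical
  simp only [qy, map_sum, Derivation.leibniz, smul_eq_mul]
  simp only [rL_apply, pderiv_X]
  simp [Pi.single_apply, Finset.sum_add_distrib, mul_sub]
  ring

theorem rL_qxy (l m : ι) : rL l m (qxy ι) = 0 := by
  classical
  simp only [qxy, map_sum, Derivation.leibniz, smul_eq_mul]
  simp only [rL_apply, pderiv_X]
  simp [Pi.single_apply, Finset.sum_add_distrib, mul_sub]
  ring

/-- A functional that is invariant under rotations and vanishes on the invariants. -/
def Good (φ : Pol ι →ₗ[ℂ] ℂ) : Prop :=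
  (∀ l m G, φ (rL l m G) = 0) ∧ ∀ a b c : ℕ, φ (qx ι ^ a * qy ι ^ b * qxy ι ^ c) = 0

theorem Good.mul {φ : Pol ι →ₗ[ℂ] ℂ} (h : Good φ) {q : Pol ι} (hq : ∀ l m, rL l m q = 0)
    (hi : ∀ a b c : ℕ, φ (q * (qx ι ^ a * qy ι ^ b * qxy ι ^ c)) = 0) :
    Good (φ ∘ₗ LinearMap.mulLeft ℂ q) := by
  refine ⟨fun l m G => ?_, hi⟩
  have := h.1 l m (q * G)
  rw [Derivation.leibniz, hq] at this
  simpa using this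

theorem Good.mul_qy {φ : Pol ι →ₗ[ℂ] ℂ} (h : Good φ) : Good (φ ∘ₗ LinearMap.mulLeft ℂ (qy ι)) :=
  h.mul rL_qy fun a b c => by
    rw [← h.2 a (b + 1) c]; congr 1; ring

theorem Good.mul_qxy {φ : Pol ι →ₗ[ℂ] ℂ} (h : Good φ) :
    Good (φ ∘ₗ LinearMap.mulLeft ℂ (qxy ι)) :=
  h.mul rL_qxy fun a b c => by
    rw [← h.2 a b (c + 1)]; congr 1; ring

/-- The exchange of the two vectors. -/
def swp (ι : Type) : Pol ι →ₐ[ℂ] Pol ι := rename Sum.swap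

omit [Fintype ι] in
theorem swp_swp (G : Pol ι) : swp ι (swp ι G) = G := by
  rw [swp, rename_rename]
  simp

omit [Fintype ι] in
theorem swp_pderiv (i : ι ⊕ ι) (G : Pol ι) : swp ι (pderiv i G) = pderiv i.swap (swp ι G) := by
  classical
  induction G using MvPolynomial.induction_on with
  | C a => simp [swp]
  | add p q hp hq => simp only [map_add, hp, hq]
  | mul_X p j hp =>
    have hX : swp ι (X j) = X j.swap := by simp [swp]
    simp only [Derivation.leibniz, map_mul, map_add, smul_eq_mul, hp, hX, pderiv_X]
    congr 2
    by_cases h : i = j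
    · subst h; simp
    · have h' : ¬ i.swap = j.swap := fun h' => h (Sum.swap_leftInverse.injective h')
      rw [Pi.single_eq_of_ne (fun h2 => h h2.symm), Pi.single_eq_of_ne (fun h2 => h' h2.symm),
        map_zero]

omit [Fintype ι] in
theorem swp_rL (l m : ι) (G : Pol ι) : swp ι (rL l m G) = rL l m (swp ι G) := by
  have hx : ∀ i, swp ι (vx i) = vy i := by intro i; simp [swp]
  have hy : ∀ i, swp ι (vy i) = vx i := by intro i; simp [swp]
  simp only [rL_apply, map_add, map_sub, map_mul, swp_pderiv, hx, hy, Sum.swap_inl, Sum.swap_inr]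
  ring

theorem Good.swap {φ : Pol ι →ₗ[ℂ] ℂ} (h : Good φ) : Good (φ ∘ₗ (swp ι).toLinearMap) := by
  refine ⟨fun l m G => ?_, fun a b c => ?_⟩
  · simp only [LinearMap.comp_apply, AlgHom.toLinearMap_apply, swp_rL, h.1]
  · have hx : swp ι (qx ι) = qy ι := by simp [swp, qx, qy]
    have hy : swp ι (qy ι) = qx ι := by simp [swp, qx, qy]
    have hxy : swp ι (qxy ι) = qxy ι := by simp [swp, qxy, mul_comm]
    simp only [LinearMap.comp_apply, AlgHom.toLinearMap_apply, map_mul, map_pow, hx, hy, hxy]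
    rw [mul_comm (qy ι ^ a), h.2]

/-- The rotations act on `y_m G`. -/
theorem sum_rL_vy (l : ι) (G : Pol ι) : ∑ m, rL l m (vy m * G) =
    ((Fintype.card ι : ℂ) - 1) • (vy l * G) + vx l * pE G - qxy ι * pderiv (Sum.inl l) G +
      vy l * nY G - qy ι * pderiv (Sum.inr l) G := by
  classical
  have h1 : ∀ m, rL l m (vy m : Pol ι) = vy l - if m = l then vy l else 0 := by
    intro m
    simp only [rL_apply, pderiv_X]
    by_cases h : m = l
    · subst h; simp
    · simp [Pi.single_apply, h]
  have h2 : ∀ m, rL l m (vy m * G) = vy m * rL l m G + G * (vy l - if m = l then vy l else 0) := by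
    intro m
    rw [Derivation.leibniz, h1]; rfl
  simp only [h2, Finset.sum_add_distrib, rL_apply, mul_sub, mul_add, Finset.sum_sub_distrib]
  simp only [pE_apply, nY_apply, qxy, qy, Finset.mul_sum, Finset.sum_mul]
  simp only [Finset.sum_const, Finset.card_univ, mul_ite, mul_zero, Finset.sum_ite_eq',
    Finset.mem_univ, if_true, sub_smul, one_smul]
  have h3 : ((Fintype.card ι : ℂ)) • (vy l * G) = Fintype.card ι • (G * vy l) := by
    rw [Nat.cast_smul_eq_nsmul, mul_comm]
  rw [h3, mul_comm (vy l) G]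
  have e1 : ∑ m, vy m * (vx l * pderiv (Sum.inl m) G) = ∑ m, vx l * (vy m * pderiv (Sum.inl m) G) :=
    Finset.sum_congr rfl fun m _ => by ring
  have e2 : ∑ m, vy m * (vx m * pderiv (Sum.inl l) G) = ∑ m, vx m * vy m * pderiv (Sum.inl l) G :=
    Finset.sum_congr rfl fun m _ => by ring
  have e3 : ∑ m, vy m * (vy l * pderiv (Sum.inr m) G) = ∑ m, vy l * (vy m * pderiv (Sum.inr m) G) :=
    Finset.sum_congr rfl fun m _ => by ring
  have e4 : ∑ m, vy m * (vy m * pderiv (Sum.inr l) G) = ∑ m, vy m * vy m * pderiv (Sum.inr l) G :=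
    Finset.sum_congr rfl fun m _ => by ring
  rw [e1, e2, e3, e4]
  abel

theorem swp_pE (G : Pol ι) : swp ι (pE G) = pF (swp ι G) := by
  have hy : ∀ i, swp ι (vy i) = vx i := by intro i; simp [swp]
  simp only [pE_apply, pF_apply, map_sum, map_mul, hy, swp_pderiv, Sum.swap_inl]

theorem Bi.swp {G : Pol ι} {i j : ℤ} (h : Bi G i j) : Bi (swp ι G) j i := by
  intro s hs
  obtain ⟨u, rfl, hu⟩ := coeff_rename_ne_zero _ _ _ hs
  have := h hu
  rw [weight_wt, Prod.mk.injEq] at this ⊢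
  refine ⟨?_, ?_⟩
  · rw [← this.2]
    congr 1
    refine Finset.sum_congr rfl fun m _ => ?_
    exact Finsupp.mapDomain_apply Sum.swap_leftInverse.injective u (Sum.inr m)
  · rw [← this.1]
    congr 1
    refine Finset.sum_congr rfl fun m _ => ?_
    exact Finsupp.mapDomain_apply Sum.swap_leftInverse.injective u (Sum.inl m)

theorem Good.vy_eq {n : ℤ}
    (ih : ∀ φ : Pol ι →ₗ[ℂ] ℂ, Good φ → ∀ i j : ℤ, i + j < n → ∀ G, Bi G i j → φ G = 0)
    {φ : Pol ι →ₗ[ℂ] ℂ} (h : Good φ) {i j : ℤ} (hij : i + j ≤ n) {G : Pol ι} (hG : Bi G i j)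
    (l : ι) : ((Fintype.card ι : ℂ) - 1 + j) * φ (vy l * G) + φ (vx l * pE G) = 0 := by
  have h1 := congrArg φ (sum_rL_vy l G)
  simp only [map_sum, h.1, Finset.sum_const_zero] at h1
  have h2 := ih _ h.mul_qxy (i - 1) j (by omega) _ (hG.dx l)
  have h3 := ih _ h.mul_qy i (j - 1) (by omega) _ (hG.dy l)
  simp only [LinearMap.comp_apply, LinearMap.mulLeft_apply] at h2 h3
  simp only [map_add, map_sub, h2, h3, hG.nY, mul_smul_comm, map_smul, smul_eq_mul] at h1
  linear_combination -h1

theorem Good.vx_eq {n : ℤ}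
    (ih : ∀ φ : Pol ι →ₗ[ℂ] ℂ, Good φ → ∀ i j : ℤ, i + j < n → ∀ G, Bi G i j → φ G = 0)
    {φ : Pol ι →ₗ[ℂ] ℂ} (h : Good φ) {i j : ℤ} (hij : i + j ≤ n) {G : Pol ι} (hG : Bi G i j)
    (l : ι) : ((Fintype.card ι : ℂ) - 1 + i) * φ (vx l * G) + φ (vy l * pF G) = 0 := by
  have := Good.vy_eq ih h.swap (by omega : j + i ≤ n) hG.swp l
  have hx : swp ι (vx l) = vy l := by simp [TwoVectors.swp]
  have hy : swp ι (vy l) = vx l := by simp [TwoVectors.swp]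
  simpa only [LinearMap.comp_apply, AlgHom.toLinearMap_apply, map_mul, swp_pE, hx, hy,
    swp_swp] using this

theorem Good.vy_mul_eq_zero (hd : 3 ≤ Fintype.card ι) {n : ℤ}
    (ih : ∀ φ : Pol ι →ₗ[ℂ] ℂ, Good φ → ∀ i j : ℤ, i + j < n → ∀ G, Bi G i j → φ G = 0)
    {φ : Pol ι →ₗ[ℂ] ℂ} (h : Good φ) {i j : ℕ} (hij : (i + j : ℤ) ≤ n) {G : Pol ι} (hG : Bi G i j)
    (l : ι) : φ (vy l * G) = 0 := by
  obtain ⟨a, ha⟩ := Nat.exists_eq_add_of_le hd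
  set c : ℂ := ((Fintype.card ι : ℂ) - 1 + j) * ((Fintype.card ι : ℂ) - 2 + i) with hc
  obtain ⟨H, hH, he⟩ := exists_pF_pE_sub i j c (by
    intro r hr h0
    rw [hc, ha] at h0
    have h1 : (((3 + a - 1 + j) * (3 + a - 2 + i) : ℤ) : ℂ) =
        ((r * (j - i + 1 + r) : ℤ) : ℂ) := by
      push_cast at h0 ⊢
      linear_combination h0
    have h2 : ((3 + a - 1 + j) * (3 + a - 2 + i) : ℤ) = r * (j - i + 1 + r) := by exact_mod_cast h1
    have hr' : (r : ℤ) ≤ i := by exact_mod_cast hr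
    have h3 : (r : ℤ) * (j - i + 1 + r) ≤ i * (j + 1) := by
      have : (r : ℤ) * (j - i + 1 + r) ≤ r * (j + 1) :=
        mul_le_mul_of_nonneg_left (by linarith) (by positivity)
      exact this.trans (mul_le_mul_of_nonneg_right hr' (by positivity))
    nlinarith [mul_nonneg (Nat.cast_nonneg (α := ℤ) a) (Nat.cast_nonneg (α := ℤ) i),
      mul_nonneg (Nat.cast_nonneg (α := ℤ) a) (Nat.cast_nonneg (α := ℤ) j),
      mul_nonneg (Nat.cast_nonneg (α := ℤ) a) (Nat.cast_nonneg (α := ℤ) a),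
      mul_nonneg (Nat.cast_nonneg (α := ℤ) i) (Nat.cast_nonneg (α := ℤ) j)]) G hG
  have h1 := h.vy_eq ih hij hH l
  have h2 := h.vx_eq ih (by omega : (i - 1 : ℤ) + (j + 1) ≤ n) hH.pE l
  have h3 := congrArg (fun P => φ (vy l * P)) he
  simp only [mul_sub, map_sub, mul_smul_comm, map_smul, smul_eq_mul] at h3
  push_cast at h1 h2
  rw [← h3, hc]
  linear_combination h2 - ((Fintype.card ι : ℂ) - 2 + i) * h1

theorem Good.eq_zero (hd : 3 ≤ Fintype.card ι) {φ : Pol ι →ₗ[ℂ] ℂ} (h : Good φ) : φ = 0 := by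
  have key : ∀ n : ℕ, ∀ φ : Pol ι →ₗ[ℂ] ℂ, Good φ → ∀ i j : ℤ, i + j < n → ∀ G, Bi G i j →
      φ G = 0 := by
    intro n
    induction n with
    | zero =>
      intro φ h i j hij G hG
      rcases lt_or_ge i 0 with hi | hi
      · rw [hG.eq_zero hi, map_zero]
      · have : swp ι G = 0 := hG.swp.eq_zero (by push_cast at hij; omega)
        rw [← swp_swp G, this, map_zero, map_zero]
    | succ n ih =>
      intro φ h i j hij G hG
      rw [G.as_sum, map_sum]
      refine Finset.sum_eq_zero fun s hs => ?_
      obtain ⟨h1, h2⟩ := hG.sum_monomial hs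
      generalize coeff s G = r
      have hmon : ∀ (k : ι ⊕ ι), s k ≠ 0 → monomial s r = X k * monomial (s - Finsupp.single k 1) r := by
        intro k hk
        rw [X, monomial_mul, one_mul, add_tsub_cancel_of_le
          (Finsupp.single_le_iff.2 (Nat.one_le_iff_ne_zero.2 hk))]
      have hw : ∀ u : ι ⊕ ι →₀ ℕ, Bi (monomial u r) (∑ m, u (Sum.inl m) : ℕ)
          (∑ m, u (Sum.inr m) : ℕ) := fun u => isWeightedHomogeneous_monomial _ _ _ (weight_wt u)
      by_cases hy : ∃ l, s (Sum.inr l) ≠ 0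
      · obtain ⟨l, hl⟩ := hy
        rw [hmon _ hl]
        set u := s - Finsupp.single (Sum.inr l) 1 with hu
        have hb := (hw u).vy_mul l
        rw [← hmon _ hl] at hb
        by_cases hr : r = 0
        · simp [hr]
        have := hb.sum_monomial (s := s) (by classical rw [mem_support_iff, coeff_monomial, if_pos rfl]; exact hr)
        exact h.vy_mul_eq_zero hd ih (by push_cast at *; omega) (hw u) l
      · by_cases hx : ∃ l, s (Sum.inl l) ≠ 0
        · obtain ⟨l, hl⟩ := hx
          rw [hmon _ hl]
          set u := s - Finsupp.single (Sum.inl l) 1 with hu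
          have hb := (hw u).vx_mul l
          rw [← hmon _ hl] at hb
          by_cases hr : r = 0
          · simp [hr]
          have := hb.sum_monomial (s := s) (by classical rw [mem_support_iff, coeff_monomial, if_pos rfl]; exact hr)
          have h3 := h.swap.vy_mul_eq_zero hd ih (by push_cast at *; omega) (hw u).swp l
          have hy' : swp ι (vy l) = vx l := by simp [swp]
          simpa only [LinearMap.comp_apply, AlgHom.toLinearMap_apply, map_mul, hy', swp_swp] using h3
        · push Not at hx hy
          have hs0 : s = 0 := by
            ext (k | k)
            · exact hx k
            · exact hy k
          have := h.2 0 0 0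
          rw [hs0, show monomial (0 : ι ⊕ ι →₀ ℕ) r = r • (1 : Pol ι) by
            rw [← C_1, smul_eq_C_mul, ← C_mul, mul_one]; rfl, map_smul]
          simpa using Or.inr this
  apply LinearMap.ext
  intro G
  rw [G.as_sum, map_sum]
  refine Finset.sum_eq_zero fun s _ => ?_
  exact key ((∑ m, s (Sum.inl m)) + (∑ m, s (Sum.inr m)) + 1) φ h (∑ m, s (Sum.inl m) : ℕ)
    (∑ m, s (Sum.inr m) : ℕ) (by push_cast; omega) _
    (isWeightedHomogeneous_monomial _ _ _ (weight_wt s))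

end TwoVectors

/-! ### A triangular system of recurrence relations -/

namespace Recurrence

/-- The sum of the entries of a multi-index. -/
def len (c : Fin 3 → ℕ) : ℕ := ∑ i, c i

/-- The unit multi-index. -/
abbrev un (i : Fin 3) : Fin 3 → ℕ := Pi.single i 1

theorem len_add (c c' : Fin 3 → ℕ) : len (c + c') = len c + len c' := by
  simp [len, Finset.sum_add_distrib]

theorem len_un (i : Fin 3) : len (un i) = 1 := by simp [len]

/-- The coefficients of the recurrence relations. -/
def coef (X : Fin 3 → ℂ) (c : Fin 3 → ℕ) (i : Fin 3) : ℂ := X i + len c - c i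

/-- The recurrence relations. -/
def Rec (X : Fin 3 → ℂ) (k : ℕ) (t : (Fin 3 → ℕ) → ℂ) : Prop :=
  ∀ c i j, i ≠ j → coef X c j * t (c + un i) + coef X c i * t (c + un j) =
    4 * ((len c : ℂ) - k) * t c

/-- Half of the excess of two of the parameters over the third one. -/
def exc (X : Fin 3 → ℂ) (i : Fin 3) : ℂ := (∑ j, X j) / 2 - X i

/-- The nondegeneracy condition at a multi-index. -/
def Nondeg (X : Fin 3 → ℂ) (a : Fin 3 → ℕ) : Prop :=
  (∀ j, ∀ m < a j, exc X j + m ≠ 0) ∧ ∀ j, ∀ m : ℕ, coef X a j + m ≠ 0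

variable {X : Fin 3 → ℂ} {k : ℕ} {t : (Fin 3 → ℕ) → ℂ}

theorem exists_third {i j : Fin 3} (h : i ≠ j) : ∃ l, l ≠ i ∧ l ≠ j ∧
    ∀ f : Fin 3 → ℂ, ∑ m, f m = f i + f j + f l := by
  revert i j
  simp only [Fin.sum_univ_three]
  intro i j h
  fin_cases i <;> fin_cases j <;> simp at h ⊢
  · exact ⟨2, by simp⟩
  · exact ⟨1, by simp, by simp, fun f => by ring⟩
  · exact ⟨2, by simp, by simp, fun f => by ring⟩
  · exact ⟨0, by simp, by simp, fun f => by ring⟩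
  · exact ⟨1, by simp, by simp, fun f => by ring⟩
  · exact ⟨0, by simp, by simp, fun f => by ring⟩

theorem coef_sum (c : Fin 3 → ℕ) (i : Fin 3) :
    (∑ j, coef X c j) / 2 - coef X c i = exc X i + c i := by
  have : (len c : ℂ) = ∑ j, (c j : ℂ) := by simp [len]
  simp only [coef, exc, Finset.sum_sub_distrib, Finset.sum_add_distrib, Finset.sum_const,
    Finset.card_univ, Fintype.card_fin, this, nsmul_eq_mul]
  push_cast
  ring

theorem Rec.two_term (h : Rec X k t) (c : Fin 3 → ℕ) (i : Fin 3) : ∃ q : ℂ,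
    q * t (c + un i) = 4 * ((len c : ℂ) - k) * (exc X i + c i) * t c := by
  obtain ⟨j, hj⟩ : ∃ j, j ≠ i := ⟨i + 1, by fin_cases i <;> decide⟩
  obtain ⟨l, hli, hlj, hs⟩ := exists_third hj.symm
  have h1 := h c i j hj.symm
  have h2 := h c i l hli.symm
  have h3 := h c j l hlj.symm
  refine ⟨coef X c j * coef X c l, ?_⟩
  rw [← coef_sum, hs]
  linear_combination (coef X c l / 2) * h1 + (coef X c j / 2) * h2 - (coef X c i / 2) * h3

theorem Rec.eq_zero_of_lt (h : Rec X k t) {M : ℕ} (hM : ∀ c, M ≤ len c → t c = 0)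
    (c : Fin 3 → ℕ) (hc : k < len c) : t c = 0 := by
  have key : ∀ n : ℕ, ∀ c, k < len c → M ≤ len c + n → t c = 0 := by
    intro n
    induction n with
    | zero => intro c _ h'; exact hM c h'
    | succ n ih =>
      intro c hc h'
      have h1 := h c 0 1 (by simp)
      rw [ih _ (by rw [len_add]; omega) (by rw [len_add, len_un]; omega),
        ih _ (by rw [len_add]; omega) (by rw [len_add, len_un]; omega)] at h1
      have h2 : ((len c : ℂ) - k) ≠ 0 := sub_ne_zero.2 (by exact_mod_cast hc.ne')
      simpa [h2] using h1
  exact key M c hc (by omega)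

theorem Rec.eq_zero_of_level (h : Rec X k t) (h0 : ∀ c, k = len c → t c = 0)
    (c : Fin 3 → ℕ) (hc : len c ≤ k) : t c = 0 := by
  have key : ∀ n : ℕ, ∀ c, len c + n = k → t c = 0 := by
    intro n
    induction n with
    | zero => intro c h'; exact h0 c h'.symm
    | succ n ih =>
      intro c h'
      have h1 := h c 0 1 (by simp)
      rw [ih _ (by rw [len_add, len_un]; omega), ih _ (by rw [len_add, len_un]; omega)] at h1
      have h2 : ((len c : ℂ) - k) ≠ 0 := sub_ne_zero.2 (by norm_cast; omega)
      simpa [h2] using h1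
  exact key (k - len c) c (by omega)

theorem Nondeg.succ {a : Fin 3 → ℕ} (h : Nondeg X a) : ∃ i, Nondeg X (a + un i) := by
  obtain ⟨i, hi⟩ : ∃ i, exc X i + a i ≠ 0 := by
    by_contra! hcon
    apply h.2 0 0
    have h1 := coef_sum (X := X) a 1
    have h2 := coef_sum (X := X) a 2
    rw [hcon, Fin.sum_univ_three] at h1 h2
    push_cast
    linear_combination h1 + h2
  refine ⟨i, fun j m hm => ?_, fun j m => ?_⟩
  · by_cases hj : j = i
    · subst hj
      simp only [Pi.add_apply, Pi.single_eq_same] at hm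
      rcases Nat.lt_succ_iff_lt_or_eq.1 hm with h' | h'
      · exact h.1 _ _ h'
      · rwa [h']
    · simp only [Pi.add_apply, Pi.single_eq_of_ne hj, add_zero] at hm
      exact h.1 _ _ hm
  · by_cases hj : j = i
    · subst hj
      convert h.2 j m using 2
      simp [coef, len_add, len_un]
      ring
    · convert h.2 j (m + 1) using 1
      simp [coef, len_add, len_un, Pi.single_eq_of_ne hj]
      ring_nf

theorem Nondeg.exists_len_eq {a : Fin 3 → ℕ} (h : Nondeg X a) (ha : len a ≤ k) :
    ∃ b, Nondeg X b ∧ len b = k := by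
  have key : ∀ n : ℕ, ∀ a, Nondeg X a → len a + n = k → ∃ b, Nondeg X b ∧ len b = k := by
    intro n
    induction n with
    | zero => intro a h h'; exact ⟨a, h, h'⟩
    | succ n ih =>
      intro a h h'
      obtain ⟨i, hi⟩ := h.succ
      exact ih _ hi (by rw [len_add, len_un]; omega)
  exact key (k - len a) a h (by omega)

theorem sub_un {b : Fin 3 → ℕ} {i : Fin 3} (h : b i ≠ 0) : ∃ c, b = c + un i := by
  refine ⟨b - un i, ?_⟩
  ext j
  by_cases hj : j = i
  · subst hj; simp; omega
  · simp [Pi.single_eq_of_ne hj]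

theorem Rec.eq_zero_below (h : Rec X k t) {a : Fin 3 → ℕ} (ha : Nondeg X a) (hk : len a = k)
    (h0 : t a = 0) : ∀ c ≤ a, t c = 0 := by
  have key : ∀ n : ℕ, ∀ c ≤ a, len c + n = k → t c = 0 := by
    intro n
    induction n with
    | zero =>
      intro c hc h'
      have : c = a := by
        by_contra hne
        obtain ⟨i, hi⟩ : ∃ i, c i < a i := by
          by_contra! hcon
          exact hne (le_antisymm hc hcon)
        have : len c < len a := Finset.sum_lt_sum (fun j _ => hc j) ⟨i, Finset.mem_univ _, hi⟩
        omega
      rw [this, h0]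
    | succ n ih =>
      intro c hc h'
      obtain ⟨i, hi⟩ : ∃ i, c i < a i := by
        by_contra! hcon
        have : len a ≤ len c := Finset.sum_le_sum fun j _ => hcon j
        omega
      obtain ⟨q, hq⟩ := h.two_term c i
      rw [ih (c + un i) (fun j => by
        by_cases hj : j = i
        · subst hj; simpa using hi
        · simpa [Pi.single_eq_of_ne hj] using hc j) (by rw [len_add, len_un]; omega)] at hq
      have h2 : ((len c : ℂ) - k) ≠ 0 := sub_ne_zero.2 (by norm_cast; omega)
      simpa [h2, ha.1 i _ hi] using hq
  intro c hc
  have : len c ≤ len a := Finset.sum_le_sum fun j _ => hc j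
  exact key (k - len c) c hc (by omega)

theorem Rec.eq_zero_on_level (h : Rec X k t) {a : Fin 3 → ℕ} (ha : Nondeg X a) (hk : len a = k)
    (h0 : t a = 0) : ∀ b, k = len b → t b = 0 := by
  have key : ∀ n : ℕ, ∀ b, k = len b → ∑ i, (b i - a i) = n → t b = 0 := by
    intro n
    induction n with
    | zero =>
      intro b hb h'
      refine h.eq_zero_below ha hk h0 b fun i => ?_
      have := (Finset.sum_eq_zero_iff.1 h') i (Finset.mem_univ _)
      exact Nat.sub_eq_zero_iff_le.1 this
    | succ n ih =>
      intro b hb h'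
      obtain ⟨i, hi⟩ : ∃ i, a i < b i := by
        by_contra! hcon
        rw [Finset.sum_eq_zero fun i _ => Nat.sub_eq_zero_of_le (hcon i)] at h'
        omega
      obtain ⟨j, hj⟩ : ∃ j, b j < a j := by
        by_contra! hcon
        have : len a < len b := Finset.sum_lt_sum (fun j _ => hcon j) ⟨i, Finset.mem_univ _, hi⟩
        omega
      have hij : i ≠ j := by rintro rfl; omega
      obtain ⟨c, rfl⟩ := sub_un (b := b) (i := i) (by omega)
      rw [len_add, len_un] at hb
      simp only [Pi.add_apply, Pi.single_eq_same, Pi.single_eq_of_ne hij.symm, add_zero] at hi hj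
      have h1 : t (c + un j) = 0 := by
        refine ih _ (by rw [len_add, len_un]; omega) ?_
        obtain ⟨l, hli, hlj, -⟩ := exists_third hij
        have hs : ∀ f : Fin 3 → ℕ, ∑ m, f m = f i + f j + f l := by
          intro f
          have hc : ({i, j, l} : Finset (Fin 3)) = Finset.univ :=
            Finset.eq_univ_of_card _ (by
              rw [Finset.card_insert_of_notMem (by simp [hij, hli.symm]),
                Finset.card_insert_of_notMem (by simp [hlj.symm])]; simp)
          rw [← hc, Finset.sum_insert (by simp [hij, hli.symm]),
            Finset.sum_insert (by simp [hlj.symm]), Finset.sum_singleton, add_assoc]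
        rw [hs] at h' ⊢
        simp only [Pi.add_apply, Pi.single_eq_same, Pi.single_eq_of_ne hij,
          Pi.single_eq_of_ne hij.symm, Pi.single_eq_of_ne hli, Pi.single_eq_of_ne hlj] at h' ⊢
        omega
      obtain ⟨q, hq⟩ := h.two_term c j
      have h2 : ((len c : ℂ) - k) ≠ 0 := sub_ne_zero.2 (by norm_cast; omega)
      have h3 : t c = 0 := by simpa [h1, h2, ha.1 j _ hj] using hq
      have h4 := h c i j hij
      rw [h1, h3, mul_zero, mul_zero, add_zero] at h4
      refine (mul_eq_zero.1 h4).resolve_left ?_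
      have h5 := ha.2 j (a j - (c j + 1))
      convert h5 using 1
      rw [Nat.cast_sub (by omega), coef, coef, hk, hb]
      push_cast
      ring
  exact fun b hb => key _ b hb rfl

/-- A finitely supported solution is determined by its value at one multi-index. -/
theorem Rec.eq_zero (h : Rec X k t) {M : ℕ} (hM : ∀ c, M ≤ len c → t c = 0) {a : Fin 3 → ℕ}
    (ha : Nondeg X a) (hk : len a = k) (h0 : t a = 0) : t = 0 := by
  ext c
  rcases lt_or_ge k (len c) with hc | hc
  · exact h.eq_zero_of_lt hM c hc
  · exact h.eq_zero_of_level (h.eq_zero_on_level ha hk h0) c hc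

end Recurrence

/-! ### Functionals on jets at the pole -/

open MvPolynomial

theorem sd_coordFn (e : E d) (x : S d) (i : Fin (d + 1)) :
    SDiff (fun x : S d => (((x : E d) i : ℝ) : ℂ)) x ∧
    sd e (fun x : S d => (((x : E d) i : ℝ) : ℂ)) x =
      ((e i - inner ℝ (x : E d) e * (x : E d) i : ℝ) : ℂ) := by
  have hF : HasFDerivAt (fun v : E d => ((v i : ℝ) : ℂ))
      (Complex.ofRealCLM.comp (EuclideanSpace.proj i : E d →L[ℝ] ℝ)) (x : E d) :=
    (Complex.ofRealCLM.comp (EuclideanSpace.proj i : E d →L[ℝ] ℝ)).hasFDerivAt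
  have := sd_ambient hF.differentiableAt e
  refine ⟨this.1, this.2.trans ?_⟩
  rw [hF.fderiv]
  simp

/-- The polynomial derivative in the first variable. -/
theorem sd_polyCSS (e : E d) (P : MvPolynomial (Fin (d + 1) ⊕ Fin (d + 1)) ℂ) (x y : S d) :
    sd e (fun x => (polyCSS P).1 (x, y)) x =
      ∑ i, ((e i - inner ℝ (x : E d) e * (x : E d) i : ℝ) : ℂ) *
        (polyCSS (pderiv (Sum.inl i) P)).1 (x, y) := by
  classical
  have hS : ∀ P, SDiff (fun x => (polyCSS (d := d) P).1 (x, y)) x := fun P =>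
    .of_contMDiff (smooth_slice_left (polyCSS P) y) (by simp) x
  induction P using MvPolynomial.induction_on with
  | C a =>
    have : (fun x => (polyCSS (d := d) (C a)).1 (x, y)) = fun _ => a := by
      ext x; simp [polyCSS]
    rw [this, sd_const]
    simp
  | add P Q hP hQ =>
    have : (fun x => (polyCSS (d := d) (P + Q)).1 (x, y)) =
        fun x => (polyCSS P).1 (x, y) + (polyCSS Q).1 (x, y) := by
      ext x; simp
    rw [this, sd_add e (hS P) (hS Q), hP, hQ, ← Finset.sum_add_distrib]
    refine Finset.sum_congr rfl fun i _ => ?_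
    simp [mul_add]
  | mul_X P j hP =>
    have hmul : ∀ P Q p, (polyCSS (d := d) (P * Q)).1 p = (polyCSS P).1 p * (polyCSS Q).1 p := by
      intro P Q p; simp [polyCSS]
    have : (fun x => (polyCSS (d := d) (P * X j)).1 (x, y)) =
        fun x => (polyCSS P).1 (x, y) * (polyCSS (X j)).1 (x, y) := by
      ext x; rw [hmul]
    have hj : sd e (fun x => (polyCSS (d := d) (X j)).1 (x, y)) x =
        ∑ i, ((e i - inner ℝ (x : E d) e * (x : E d) i : ℝ) : ℂ) *
        (polyCSS (pderiv (Sum.inl i) (X j))).1 (x, y) := by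
      cases j with
      | inl j =>
        have h1 := (sd_coordFn e x j).2
        have h2 : (fun x => (polyCSS (d := d) (X (Sum.inl j))).1 (x, y)) =
            (fun x : S d => (((x : E d) j : ℝ) : ℂ)) := by
          ext x; simp [polyCSS, coordFn]
        rw [h2, h1, Finset.sum_eq_single j]
        · simp [polyCSS]
        · intro i _ hi
          have : pderiv (Sum.inl i : Fin (d + 1) ⊕ Fin (d + 1)) (X (Sum.inl j) : MvPolynomial _ ℂ)
            = 0 := pderiv_X_of_ne (fun h => hi (Sum.inl_injective h).symm)
          rw [this]
          simp
        · simp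
      | inr j =>
        have h2 : (fun x => (polyCSS (d := d) (X (Sum.inr j))).1 (x, y)) =
            (fun _ : S d => (((y : E d) j : ℝ) : ℂ)) := by
          ext x; simp [polyCSS, coordFn]
        rw [h2, sd_const, Finset.sum_eq_zero]
        intro i _
        have : pderiv (Sum.inl i : Fin (d + 1) ⊕ Fin (d + 1)) (X (Sum.inr j) : MvPolynomial _ ℂ)
            = 0 := pderiv_X_of_ne (by simp)
        rw [this]
        simp
    rw [this, sd_mul e (hS P) (hS (X j)), hP, hj, Finset.mul_sum, Finset.sum_mul,
      ← Finset.sum_add_distrib]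
    refine Finset.sum_congr rfl fun i _ => ?_
    rw [Derivation.leibniz, map_add]
    simp only [smul_eq_mul, Submodule.coe_add, Pi.add_apply, hmul]
    ring

open MvPolynomial

theorem polyCSS_mul (P Q : MvPolynomial (Fin (d + 1) ⊕ Fin (d + 1)) ℂ) (p : S d × S d) :
    (polyCSS (P * Q)).1 p = (polyCSS P).1 p * (polyCSS Q).1 p := by simp [polyCSS]

theorem polyCSS_pow (P : MvPolynomial (Fin (d + 1) ⊕ Fin (d + 1)) ℂ) (n : ℕ) (p : S d × S d) :
    (polyCSS (P ^ n)).1 p = (polyCSS P).1 p ^ n := by simp [polyCSS]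

theorem polyCSS_swp (P : TwoVectors.Pol (Fin (d + 1))) (x y : S d) :
    (polyCSS (TwoVectors.swp _ P)).1 (x, y) = (polyCSS P).1 (y, x) := by
  induction P using MvPolynomial.induction_on with
  | C a => simp [polyCSS, TwoVectors.swp]
  | add P Q hP hQ => simp only [map_add, Submodule.coe_add, Pi.add_apply, hP, hQ]
  | mul_X P j hP =>
    rw [map_mul, polyCSS_mul, polyCSS_mul, hP]
    congr 1
    cases j <;> simp [polyCSS, TwoVectors.swp, coordFn]

theorem sd_polyCSS_right (e : E d) (P : TwoVectors.Pol (Fin (d + 1))) (x y : S d) :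
    sd e (fun y => (polyCSS P).1 (x, y)) y =
      ∑ i, ((e i - inner ℝ (y : E d) e * (y : E d) i : ℝ) : ℂ) *
        (polyCSS (pderiv (Sum.inr i) P)).1 (x, y) := by
  have h : (fun y => (polyCSS P).1 (x, y)) = fun y => (polyCSS (TwoVectors.swp _ P)).1 (y, x) := by
    ext y; rw [polyCSS_swp]
  rw [h, sd_polyCSS]
  refine Finset.sum_congr rfl fun i _ => ?_
  rw [show (Sum.inl i : Fin (d + 1) ⊕ Fin (d + 1)) = Sum.swap (Sum.inr i) from rfl,
    ← TwoVectors.swp_pderiv, polyCSS_swp]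

theorem polyCSS_X_inl (i : Fin (d + 1)) (p : S d × S d) :
    (polyCSS (X (Sum.inl i))).1 p = (((p.1 : E d) i : ℝ) : ℂ) := by simp [polyCSS, coordFn]

theorem polyCSS_X_inr (i : Fin (d + 1)) (p : S d × S d) :
    (polyCSS (X (Sum.inr i))).1 p = (((p.2 : E d) i : ℝ) : ℂ) := by simp [polyCSS, coordFn]

theorem inner_bv_bv (i j : Fin (d + 1)) : inner ℝ (bv i : E d) (bv j) = if i = j then 1 else 0 := by
  rw [inner_bv, bv]
  simp [eq_comm]

theorem bv_apply (i j : Fin (d + 1)) : (bv i : E d) j = if i = j then 1 else 0 := by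
  simp [bv, eq_comm]

/-- The rotation in a coordinate plane. -/
def crot {i j : Fin (d + 1)} (h : i ≠ j) : LorentzFlow d :=
  rot (bv i) (bv j) (by rw [inner_bv_bv, if_pos rfl]) (by rw [inner_bv_bv, if_pos rfl])
    (by rw [inner_bv_bv, if_neg h])

theorem crot_gen {i j : Fin (d + 1)} (h : i ≠ j) (p : ℝ × E d) :
    (crot h).gen p = (0, p.2 i • bv j - p.2 j • bv i) := by
  simp only [crot, rot, real_inner_comm, inner_bv]

theorem isFlowDeriv_crot {i j : Fin (d + 1)} (h : i ≠ j) (s t : ℂ)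
    (P : TwoVectors.Pol (Fin (d + 1))) :
    IsFlowDeriv (crot h) s t (polyCSS P) (polyCSS (TwoVectors.rL i j P)) := by
  intro x y
  have hx : ∀ x : S d, inner ℝ (x : E d) ((x : E d) i • bv j - (x : E d) j • bv i) = 0 := by
    intro x
    rw [inner_sub_right, inner_smul_right, inner_smul_right, inner_bv, inner_bv]; ring
  simp only [crot_gen, sd_polyCSS, sd_polyCSS_right, hx, TwoVectors.rL_apply]
  simp only [map_add, map_sub, Submodule.coe_add, Submodule.coe_sub, Pi.add_apply, Pi.sub_apply,
    polyCSS_mul, polyCSS_X_inl, polyCSS_X_inr]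
  simp [bv_apply, sub_mul, Finset.sum_sub_distrib, apply_ite Complex.ofReal, ite_mul]
  ring

/-- Invariance of a functional under the infinitesimal rotations around the pole. -/
def RotInv (T : CSS d →ₗ[ℂ] ℂ) : Prop :=
  ∀ i j : Fin d, i ≠ j → ∀ P, T (polyCSS (TwoVectors.rL i.succ j.succ P)) = 0

/-- The square distances as polynomials. -/
def sqDist (d : ℕ) : Fin 3 → TwoVectors.Pol (Fin (d + 1)) :=
  ![2 - 2 * X (Sum.inr 0), 2 - 2 * X (Sum.inl 0), 2 - 2 * ∑ i, X (Sum.inl i) * X (Sum.inr i)]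

/-- The monomials in the square distances. -/
def triCSS (c : Fin 3 → ℕ) : CSS d := polyCSS (∏ i, sqDist d i ^ c i)

theorem inner_eq_sum (v w : E d) : inner ℝ v w = ∑ i, v i * w i := by
  rw [PiLp.inner_apply]
  exact Finset.sum_congr rfl fun i _ => by simp [mul_comm]

theorem polyCSS_two (p : S d × S d) : (polyCSS 2).1 p = 2 := by
  have : (2 : TwoVectors.Pol (Fin (d + 1))) = C 2 := (map_ofNat C 2).symm
  rw [this]; simp [polyCSS]

theorem sqDist_zero (p : S d × S d) : (polyCSS (sqDist d 0)).1 p = 2 - 2 * ((p.2 : E d) 0 : ℝ) := by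
  simp [sqDist, polyCSS_mul, polyCSS_two, polyCSS_X_inr]

theorem sqDist_one (p : S d × S d) : (polyCSS (sqDist d 1)).1 p = 2 - 2 * ((p.1 : E d) 0 : ℝ) := by
  simp [sqDist, polyCSS_mul, polyCSS_two, polyCSS_X_inl]

theorem sqDist_two (p : S d × S d) :
    (polyCSS (sqDist d 2)).1 p = 2 - 2 * (inner ℝ (p.1 : E d) (p.2 : E d) : ℝ) := by
  have : ∀ s : Finset (Fin (d + 1)), ∀ f : Fin (d + 1) → TwoVectors.Pol (Fin (d + 1)),
      (polyCSS (∑ i ∈ s, f i)).1 p = ∑ i ∈ s, (polyCSS (f i)).1 p := by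
    intro s f
    rw [map_sum, AddSubmonoidClass.coe_finsetSum, Finset.sum_apply]
  rw [inner_eq_sum]
  simp [sqDist, polyCSS_mul, polyCSS_two, -map_sum, this, polyCSS_X_inl, polyCSS_X_inr]

theorem functional_sqDist {T : CSS d →ₗ[ℂ] ℂ} (h : ∀ c, T (triCSS c) = 0)
    (Q : MvPolynomial (Fin 3) ℂ) : T (polyCSS (aeval (sqDist d) Q)) = 0 := by
  have : T ∘ₗ polyCSS ∘ₗ (aeval (R := ℂ) (sqDist d)).toLinearMap = 0 := by
    ext s
    have : aeval (sqDist d) (monomial s (1 : ℂ)) = ∏ i, sqDist d i ^ s i := by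
      rw [aeval_monomial, map_one, one_mul, Finsupp.prod_fintype _ _ (by simp)]
    change T (polyCSS (aeval (sqDist d) (monomial s (1 : ℂ)))) = 0
    rw [this]
    exact h s
  exact LinearMap.congr_fun this Q

/-- The polynomial ring in all coordinates over the one in the coordinates vanishing at the pole. -/
def shiftPol (a b : ℕ) : TwoVectors.Pol (Fin d) →ₗ[ℂ] TwoVectors.Pol (Fin (d + 1)) :=
  LinearMap.mulLeft ℂ (sqDist d 1 ^ a * sqDist d 0 ^ b) ∘ₗ
    (rename (R := ℂ) (Sum.map Fin.succ Fin.succ)).toLinearMap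

theorem shiftPol_apply (a b : ℕ) (P : TwoVectors.Pol (Fin d)) :
    shiftPol a b P = sqDist d 1 ^ a * sqDist d 0 ^ b * rename (Sum.map Fin.succ Fin.succ) P := rfl

theorem span_shiftPol : ⨆ a, ⨆ b, LinearMap.range (shiftPol (d := d) a b) = ⊤ := by
  set N := ⨆ a, ⨆ b, LinearMap.range (shiftPol (d := d) a b) with hN
  have hmem : ∀ a b P, shiftPol a b P ∈ N := fun a b P =>
    Submodule.mem_iSup_of_mem a (Submodule.mem_iSup_of_mem b ⟨P, rfl⟩)
  have hmul : ∀ j, N ≤ N.comap (LinearMap.mulRight ℂ (X j)) := by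
    intro j
    conv_lhs => rw [hN]
    refine iSup_le fun a => iSup_le fun b => ?_
    rintro _ ⟨P, rfl⟩
    rw [Submodule.mem_comap, LinearMap.mulRight_apply]
    have hs : ∀ j : Fin d ⊕ Fin d, shiftPol a b P * X (Sum.map Fin.succ Fin.succ j) =
        shiftPol a b (P * X j) := by
      intro j
      rw [shiftPol_apply, shiftPol_apply, map_mul, rename_X, mul_assoc]
    have h2 : (2 : TwoVectors.Pol (Fin (d + 1))) = C 2 := (map_ofNat C 2).symm
    have hc : (C (1 / 2) * C 2 : TwoVectors.Pol (Fin (d + 1))) = 1 := by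
      rw [← C_mul]; norm_num
    rcases j with j | j
    · refine Fin.cases ?_ (fun j => ?_) j
      · have : shiftPol a b P * X (Sum.inl 0) = shiftPol a b P -
            (1 / 2 : ℂ) • shiftPol (a + 1) b P := by
          simp only [shiftPol_apply, smul_eq_C_mul, pow_succ]
          have h1 : sqDist d 1 = C 2 - C 2 * X (Sum.inl 0) := by rw [← h2]; rfl
          nth_rewrite 4 [h1]
          linear_combination (1 - X (Sum.inl 0)) * (sqDist d 1 ^ a * sqDist d 0 ^ b * rename (Sum.map Fin.succ Fin.succ) P) * hc
        rw [this]
        exact sub_mem (hmem _ _ _) (N.smul_mem _ (hmem _ _ _))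
      · rw [show (Sum.inl j.succ : Fin (d + 1) ⊕ Fin (d + 1)) =
          Sum.map Fin.succ Fin.succ (Sum.inl j) from rfl, hs]
        exact hmem _ _ _
    · refine Fin.cases ?_ (fun j => ?_) j
      · have : shiftPol a b P * X (Sum.inr 0) = shiftPol a b P -
            (1 / 2 : ℂ) • shiftPol a (b + 1) P := by
          simp only [shiftPol_apply, smul_eq_C_mul, pow_succ]
          have h1 : sqDist d 0 = C 2 - C 2 * X (Sum.inr 0) := by rw [← h2]; rfl
          nth_rewrite 4 [h1]
          linear_combination (1 - X (Sum.inr 0)) * (sqDist d 1 ^ a * sqDist d 0 ^ b * rename (Sum.map Fin.succ Fin.succ) P) * hc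
        rw [this]
        exact sub_mem (hmem _ _ _) (N.smul_mem _ (hmem _ _ _))
      · rw [show (Sum.inr j.succ : Fin (d + 1) ⊕ Fin (d + 1)) =
          Sum.map Fin.succ Fin.succ (Sum.inr j) from rfl, hs]
        exact hmem _ _ _
  rw [eq_top_iff]
  rintro P -
  induction P using MvPolynomial.induction_on with
  | C a =>
    have := hmem 0 0 (C a)
    rwa [shiftPol_apply, rename_C, pow_zero, pow_zero, one_mul, one_mul] at this
  | add P Q hP hQ => exact add_mem hP hQ
  | mul_X P j hP => exact hmul j hP

theorem rL_shiftPol {i j : Fin d} (a b : ℕ) (P : TwoVectors.Pol (Fin d)) :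
    TwoVectors.rL i.succ j.succ (shiftPol a b P) = shiftPol a b (TwoVectors.rL i j P) := by
  have h0 : ∀ m : Fin 3, m ≠ 2 → TwoVectors.rL i.succ j.succ (sqDist d m) = 0 := by
    intro m hm
    have h2 : (2 : TwoVectors.Pol (Fin (d + 1))) = C 2 := (map_ofNat C 2).symm
    have hi : ∀ k : Fin d, pderiv (Sum.inl k.succ : Fin (d + 1) ⊕ Fin (d + 1))
      (X (Sum.inl 0) : TwoVectors.Pol (Fin (d + 1))) = 0 := fun k =>
      pderiv_X_of_ne (by simpa using (Fin.succ_ne_zero k).symm)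
    have hi' : ∀ k : Fin d, pderiv (Sum.inr k.succ : Fin (d + 1) ⊕ Fin (d + 1))
      (X (Sum.inr 0) : TwoVectors.Pol (Fin (d + 1))) = 0 := fun k =>
      pderiv_X_of_ne (by simpa using (Fin.succ_ne_zero k).symm)
    have hi'' : ∀ k : Fin d, pderiv (Sum.inr k.succ : Fin (d + 1) ⊕ Fin (d + 1))
      (X (Sum.inl 0) : TwoVectors.Pol (Fin (d + 1))) = 0 := fun k => pderiv_X_of_ne (by simp)
    have hi3 : ∀ k : Fin d, pderiv (Sum.inl k.succ : Fin (d + 1) ⊕ Fin (d + 1))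
      (X (Sum.inr 0) : TwoVectors.Pol (Fin (d + 1))) = 0 := fun k => pderiv_X_of_ne (by simp)
    fin_cases m
    · simp [sqDist, TwoVectors.rL_apply, h2, hi', hi3]
    · simp [sqDist, TwoVectors.rL_apply, h2, hi, hi'']
    · exact absurd rfl hm
  have hinj : Function.Injective (Sum.map (Fin.succ (n := d)) (Fin.succ (n := d))) :=
    (Fin.succ_injective d).sumMap (Fin.succ_injective d)
  have hr : TwoVectors.rL i.succ j.succ (rename (Sum.map Fin.succ Fin.succ) P) =
      rename (Sum.map Fin.succ Fin.succ) (TwoVectors.rL i j P) := by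
    simp only [TwoVectors.rL_apply, map_add, map_sub, map_mul, rename_X, Sum.map_inl, Sum.map_inr,
      ← pderiv_rename hinj]
  rw [shiftPol_apply, shiftPol_apply, Derivation.leibniz, hr, Derivation.leibniz,
    Derivation.leibniz_pow, Derivation.leibniz_pow, h0 0 (by decide), h0 1 (by decide)]
  simp

/-- A rotation invariant functional on jets is determined by its values on the monomials in the
square distances. -/
theorem RotInv.eq_zero (hd : 3 ≤ d) {T : CSS d →ₗ[ℂ] ℂ} (hT : RotInv T) {N : ℕ}
    (hN : ∀ f ∈ jetIdeal N (pole d, pole d), T f = 0) (h : ∀ c, T (triCSS c) = 0) : T = 0 := by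
  have hgood : ∀ a b, TwoVectors.Good (T ∘ₗ polyCSS ∘ₗ shiftPol a b) := by
    intro a b
    constructor
    · intro i j P
      simp only [LinearMap.comp_apply, ← rL_shiftPol]
      by_cases hij : i = j
      · subst hij
        have : TwoVectors.rL i.succ i.succ (shiftPol a b P) = 0 := by
          rw [TwoVectors.rL_apply]; ring
        rw [this, map_zero, map_zero]
      · exact hT i j hij _
    · intro a' b' c'
      have := functional_sqDist h (X 1 ^ a * X 0 ^ b * ((X 1 - C (1 / 4) * X 1 ^ 2) ^ a' *
        (X 0 - C (1 / 4) * X 0 ^ 2) ^ b' * ((1 - C (1 / 2) * X 2) - (1 - C (1 / 2) * X 1) *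
        (1 - C (1 / 2) * X 0)) ^ c'))
      rw [← this]
      simp only [LinearMap.comp_apply]
      congr 1
      ext p
      have hC : ∀ c : ℂ, (polyCSS (d := d) (algebraMap ℂ _ c)).1 p = c := by
        intro c; simp [polyCSS]
      have h1 : (polyCSS (d := d) 1).1 p = 1 := by simp [polyCSS]
      have hq : ∀ f : Fin d → TwoVectors.Pol (Fin (d + 1)),
          (polyCSS (∑ i, f i)).1 p = ∑ i, (polyCSS (f i)).1 p := by
        intro f
        rw [map_sum, AddSubmonoidClass.coe_finsetSum, Finset.sum_apply]
      have hxx : ∀ x y : S d, ∑ i : Fin d, (((x : E d) i.succ : ℝ) : ℂ) * (((y : E d) i.succ : ℝ) : ℂ)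
          = (inner ℝ (x : E d) (y : E d) : ℝ) - (((x : E d) 0 : ℝ) : ℂ) * (((y : E d) 0 : ℝ) : ℂ) := by
        intro x y
        rw [inner_eq_sum, Fin.sum_univ_succ]
        push_cast
        ring
      simp only [shiftPol_apply, map_mul, map_pow, map_sub, map_one, aeval_X, aeval_C, polyCSS_mul,
        polyCSS_pow, Submodule.coe_sub, Pi.sub_apply, hC, h1, TwoVectors.qx, TwoVectors.qy,
        TwoVectors.qxy, map_sum, rename_X, Sum.map_inl, Sum.map_inr, sqDist_zero, sqDist_one,
        sqDist_two]
      simp only [← map_sum, hq, polyCSS_mul, polyCSS_X_inl, polyCSS_X_inr, hxx, inner_self_coe]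
      push_cast
      ring
  have hpoly : ∀ P, T (polyCSS P) = 0 := by
    intro P
    have hle : (⊤ : Submodule ℂ _) ≤ LinearMap.ker (T ∘ₗ polyCSS) := by
      rw [← span_shiftPol]
      refine iSup_le fun a => iSup_le fun b => ?_
      rintro _ ⟨Q, rfl⟩
      exact LinearMap.congr_fun ((hgood a b).eq_zero (by simpa using hd)) Q
    exact hle Submodule.mem_top
  ext f
  obtain ⟨P, hP⟩ := exists_poly_mem_jetIdeal f N (pole d, pole d)
  have := hN _ hP
  rw [map_add, hpoly, add_zero] at this
  exact this

open MvPolynomial TwoVectors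

theorem triCSS_mem {c : Fin 3 → ℕ} {N : ℕ} (h : N < Recurrence.len c) :
    triCSS c ∈ jetIdeal (d := d) N (pole d, pole d) := by
  have hmul : ∀ P Q, polyCSS (P * Q) = mulCSS (polyCSS (d := d) P) (polyCSS Q) := fun P Q => by
    ext p; exact polyCSS_mul P Q p
  have h0 : ∀ i, polyCSS (sqDist d i) ∈ jetIdeal 0 (pole d, pole d) := by
    intro i
    refine JV_zero_iff.2 ?_
    rw [Ext_coe (p := (pole d, pole d))]
    fin_cases i
    · exact (sqDist_zero _).trans (by simp [pole])
    · exact (sqDist_one _).trans (by simp [pole])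
    · exact (sqDist_two _).trans (by simp)
  have key : ∀ N : ℕ, ∀ c, N < Recurrence.len c →
      triCSS c ∈ jetIdeal (d := d) N (pole d, pole d) := by
    intro N
    induction N with
    | zero =>
      intro c hc
      obtain ⟨i, hi⟩ : ∃ i, c i ≠ 0 := by
        by_contra! hcon
        simp [Recurrence.len, hcon] at hc
      rw [triCSS, ← Finset.mul_prod_erase _ _ (Finset.mem_univ i), ← Nat.succ_pred_eq_of_ne_zero hi,
        pow_succ', mul_assoc, mul_comm, hmul]
      exact mulCSS_mem (h0 i)
    | succ N ih =>
      intro c hc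
      obtain ⟨i, hi⟩ : ∃ i, c i ≠ 0 := by
        by_contra! hcon
        simp [Recurrence.len, hcon] at hc
      obtain ⟨b, rfl⟩ := Recurrence.sub_un hi
      have : ∏ j, sqDist d j ^ (b + Recurrence.un i) j = sqDist d i * ∏ j, sqDist d j ^ b j := by
        simp only [Pi.add_apply, pow_add, Finset.prod_mul_distrib]
        rw [mul_comm, Finset.prod_eq_single i (fun j _ hj => by simp [Pi.single_eq_of_ne hj])
          (by simp)]
        simp
      rw [triCSS, this, hmul]
      rw [Recurrence.len_add, Recurrence.len_un] at hc
      exact JV.mul (a := 0) (b := N) (h0 i) (ih b (by omega)) (by omega)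
        (contDiffAt_Ext_coe _ (pole d, pole d)) (contDiffAt_Ext_coe _ (pole d, pole d))
  exact key N c h

theorem triCSS_add_un (c : Fin 3 → ℕ) (i : Fin 3) :
    ∏ j, sqDist d j ^ (c + Recurrence.un i) j = sqDist d i * ∏ j, sqDist d j ^ c j := by
  simp only [Pi.add_apply, pow_add, Finset.prod_mul_distrib]
  rw [mul_comm, Finset.prod_eq_single i (fun j _ hj => by simp [Pi.single_eq_of_ne hj]) (by simp)]
  simp

/-- The infinitesimal boost in a coordinate direction, as a derivation of polynomials. -/
def bD (j : Fin (d + 1)) : Derivation ℂ (Pol (Fin (d + 1))) (Pol (Fin (d + 1))) :=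
  mkDerivation ℂ (Sum.elim (fun i => (if i = j then 1 else 0) - X (Sum.inl j) * X (Sum.inl i))
    (fun i => (if i = j then 1 else 0) - X (Sum.inr j) * X (Sum.inr i)))

theorem bD_X_inl (j i : Fin (d + 1)) :
    bD j (X (Sum.inl i)) = (if i = j then 1 else 0) - X (Sum.inl j) * X (Sum.inl i) := by
  simp [bD, mkDerivation_X]

theorem bD_X_inr (j i : Fin (d + 1)) :
    bD j (X (Sum.inr i)) = (if i = j then 1 else 0) - X (Sum.inr j) * X (Sum.inr i) := by
  simp [bD, mkDerivation_X]

theorem bD_apply (j : Fin (d + 1)) (P : Pol (Fin (d + 1))) : bD j P =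
    ∑ i, ((if i = j then 1 else 0) - X (Sum.inl j) * X (Sum.inl i)) * pderiv (Sum.inl i) P +
    ∑ i, ((if i = j then 1 else 0) - X (Sum.inr j) * X (Sum.inr i)) * pderiv (Sum.inr i) P := by
  classical
  set D : Derivation ℂ (Pol (Fin (d + 1))) (Pol (Fin (d + 1))) :=
    ∑ i, ((if i = j then 1 else 0) - X (Sum.inl j) * X (Sum.inl i) : Pol (Fin (d + 1))) •
      pderiv (Sum.inl i) +
    ∑ i, ((if i = j then 1 else 0) - X (Sum.inr j) * X (Sum.inr i) : Pol (Fin (d + 1))) •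
      pderiv (Sum.inr i) with hD
  have happ : ∀ P, D P =
      ∑ i, ((if i = j then 1 else 0) - X (Sum.inl j) * X (Sum.inl i)) * pderiv (Sum.inl i) P +
      ∑ i, ((if i = j then 1 else 0) - X (Sum.inr j) * X (Sum.inr i)) * pderiv (Sum.inr i) P :=
      fun P => by
    rw [hD, Derivation.add_apply, derivation_sum_apply, derivation_sum_apply]
    rfl
  have : bD j = D := by
    refine MvPolynomial.derivation_ext fun k => ?_
    rw [happ]
    cases k with
    | inl k =>
      rw [bD_X_inl, Finset.sum_eq_single k, Finset.sum_eq_zero, pderiv_X_self]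
      · ring
      · intro i _; rw [pderiv_X_of_ne (by simp), mul_zero]
      · intro i _ hi; rw [pderiv_X_of_ne (fun h => hi (Sum.inl_injective h).symm), mul_zero]
      · simp
    | inr k =>
      rw [bD_X_inr, Finset.sum_eq_zero, Finset.sum_eq_single k, pderiv_X_self]
      · ring
      · intro i _ hi; rw [pderiv_X_of_ne (fun h => hi (Sum.inr_injective h).symm), mul_zero]
      · simp
      · intro i _; rw [pderiv_X_of_ne (by simp), mul_zero]
  rw [this, happ]

theorem polyCSS_sum (f : Fin (d + 1) → Pol (Fin (d + 1))) (p : S d × S d) :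
    (polyCSS (∑ i, f i)).1 p = ∑ i, (polyCSS (f i)).1 p := by
  rw [map_sum, AddSubmonoidClass.coe_finsetSum, Finset.sum_apply]

theorem polyCSS_one (p : S d × S d) : (polyCSS 1).1 p = 1 := by simp [polyCSS]

/-- The boost in a coordinate direction. -/
def cboost (j : Fin (d + 1)) : LorentzFlow d := boost (bv j) (by rw [inner_bv_bv, if_pos rfl])

theorem cboost_gen (j : Fin (d + 1)) (p : ℝ × E d) : (cboost j).gen p = (p.2 j, p.1 • bv j) := by
  simp only [cboost, boost, real_inner_comm, inner_bv]

theorem isFlowDeriv_boost (j : Fin (d + 1)) (s t : ℂ) (P : Pol (Fin (d + 1))) :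
    IsFlowDeriv (cboost j) s t (polyCSS P)
      (polyCSS (bD j P - s • (X (Sum.inl j) * P) - t • (X (Sum.inr j) * P))) := by
  intro x y
  have hite : ∀ i p, (polyCSS (d := d) (if i = j then 1 else 0)).1 p = if i = j then 1 else 0 := by
    intro i p
    split_ifs
    · exact polyCSS_one p
    · simp
  simp only [cboost_gen, one_smul, inner_bv, sd_polyCSS, sd_polyCSS_right, bD_apply, map_add,
    map_sub, map_smul, Submodule.coe_add, Submodule.coe_sub, Submodule.coe_smul, Pi.add_apply,
    Pi.sub_apply, Pi.smul_apply, polyCSS_mul, polyCSS_X_inl, polyCSS_X_inr, polyCSS_sum, bv_apply,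
    smul_eq_mul, hite]
  push_cast
  simp only [eq_comm (a := j), apply_ite Complex.ofReal, Complex.ofReal_one, Complex.ofReal_zero]
  ring

/-- The polynomial form of the invariance under the stabilizer of the pole. -/
structure PoleInv (s t r : ℂ) (T : CSS d →ₗ[ℂ] ℂ) : Prop where
  rotInv : RotInv T
  axial : ∀ P, T (polyCSS (bD 0 P - s • (X (Sum.inl 0) * P) - t • (X (Sum.inr 0) * P))) =
    -r * T (polyCSS P)
  unipotent : ∀ (j : Fin d) P, T (polyCSS (bD j.succ P - rL 0 j.succ P -
    s • (X (Sum.inl j.succ) * P) - t • (X (Sum.inr j.succ) * P))) = 0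

/-- The value at a point as a functional. -/
def evalAt (z : S d) (B : CSS d →ₗ[ℂ] CS d) : CSS d →ₗ[ℂ] ℂ :=
  LinearMap.proj z ∘ₗ (CS d).subtype ∘ₗ B

theorem evalAt_apply (z : S d) (B : CSS d →ₗ[ℂ] CS d) (f : CSS d) : evalAt z B f = (B f).1 z := rfl

theorem pole_zero : (pole d : E d) 0 = 1 := by simp [pole]

theorem pole_succ (j : Fin d) : (pole d : E d) j.succ = 0 := by simp [pole]

theorem pole_eq : (pole d : E d) = bv 0 := rfl

theorem poleInv_of_covariant {B : CSS d →ₗ[ℂ] CS d} {N : ℕ}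
    (hB : ∀ f ∈ jetIdeal N (pole d, pole d), (B f).1 (pole d) = 0) {l m n : ℂ}
    (hG : ∀ g f, B (piTensor l m g f) = piRep n g (B f)) :
    PoleInv (rho d + l) (rho d + m) (rho d + n) (evalAt (pole d) B) where
  rotInv := by
    intro i j hij P
    have hij' : i.succ ≠ j.succ := fun h => hij (Fin.succ_injective d h)
    rw [evalAt_apply, covariant_flowDeriv hB _ (fun τ f => hG _ f)
      (isFlowDeriv_crot hij' (rho d + l) (rho d + m) P), crot_gen]
    simp [pole_succ, sd]
  axial := by
    intro P
    rw [evalAt_apply, covariant_flowDeriv hB _ (fun τ f => hG _ f)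
      (isFlowDeriv_boost 0 (rho d + l) (rho d + m) P)]
    simp only [cboost_gen, one_smul, ← pole_eq, sd_self, pole_zero, evalAt_apply]
    simp
  unipotent := by
    intro j P
    have h0 : (0 : Fin (d + 1)) ≠ j.succ := (Fin.succ_ne_zero j).symm
    have h1 := covariant_flowDeriv hB _ (fun τ f => hG _ f)
      (isFlowDeriv_boost j.succ (rho d + l) (rho d + m) P)
    have h2 := covariant_flowDeriv hB _ (fun τ f => hG _ f)
      (isFlowDeriv_crot h0 (rho d + l) (rho d + m) P)
    rw [crot_gen] at h2
    simp only [cboost_gen, pole_succ, pole_zero, zero_smul, sub_zero, one_smul,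
      Complex.ofReal_zero, mul_zero, zero_mul, zero_add] at h1 h2
    have : bD j.succ P - rL 0 j.succ P - (rho d + l) • (X (Sum.inl j.succ) * P) -
        (rho d + m) • (X (Sum.inr j.succ) * P) =
        (bD j.succ P - (rho d + l) • (X (Sum.inl j.succ) * P) -
        (rho d + m) • (X (Sum.inr j.succ) * P)) - rL 0 j.succ P := by ring
    rw [this, map_sub, map_sub, evalAt_apply, evalAt_apply, h1, h2, sub_self]

open MvPolynomial TwoVectors Recurrence

/-- The monomials in the square distances, as polynomials. -/
abbrev sqMon (c : Fin 3 → ℕ) : Pol (Fin (d + 1)) := ∏ i, sqDist d i ^ c i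

theorem derivation_sqMon (D : Derivation ℂ (Pol (Fin (d + 1))) (Pol (Fin (d + 1))))
    {q : Fin 3 → Pol (Fin (d + 1))} (h : ∀ i, D (sqDist d i) = q i * sqDist d i) (c : Fin 3 → ℕ) :
    D (sqMon c) = ((c 0 : ℂ) • q 0 + (c 1 : ℂ) • q 1 + (c 2 : ℂ) • q 2) * sqMon c := by
  have hp : ∀ i, D (sqDist d i ^ c i) = ((c i : ℂ) • q i) * sqDist d i ^ c i := by
    intro i
    rw [Derivation.leibniz_pow, h]
    rcases Nat.eq_zero_or_pos (c i) with h0 | h0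
    · simp [h0]
    · obtain ⟨n, hn⟩ : ∃ n, c i = n + 1 := ⟨c i - 1, by omega⟩
      simp only [hn, Nat.add_sub_cancel, smul_eq_mul, nsmul_eq_mul, smul_eq_C_mul, map_natCast]
      ring
  simp only [sqMon, Fin.prod_univ_three, Derivation.leibniz, hp, smul_eq_mul]
  ring

theorem sqDist_zero_eq : sqDist d 0 = C 2 - C 2 * X (Sum.inr 0) := by
  simp only [sqDist, ← map_ofNat C 2]; rfl

theorem sqDist_one_eq : sqDist d 1 = C 2 - C 2 * X (Sum.inl 0) := by
  simp only [sqDist, ← map_ofNat C 2]; rfl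

theorem sqDist_two_eq : sqDist d 2 = C 2 - C 2 * ∑ i, X (Sum.inl i) * X (Sum.inr i) := by
  simp only [sqDist, ← map_ofNat C 2]; rfl

theorem bD_inner (j : Fin (d + 1)) :
    bD j (∑ i, X (Sum.inl i) * X (Sum.inr i) : Pol (Fin (d + 1))) =
    (X (Sum.inl j) + X (Sum.inr j)) * (1 - ∑ i, X (Sum.inl i) * X (Sum.inr i)) := by
  have : ∀ i : Fin (d + 1), bD j (X (Sum.inl i) * X (Sum.inr i) : Pol (Fin (d + 1))) =
      (if i = j then X (Sum.inl i) + X (Sum.inr i) else 0) -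
      (X (Sum.inl j) + X (Sum.inr j)) * (X (Sum.inl i) * X (Sum.inr i)) := by
    intro i
    rw [Derivation.leibniz, bD_X_inl, bD_X_inr, smul_eq_mul, smul_eq_mul]
    split_ifs <;> ring
  rw [map_sum, Finset.sum_congr rfl fun i _ => this i, Finset.sum_sub_distrib,
    Finset.sum_ite_eq' Finset.univ j, if_pos (Finset.mem_univ _), ← Finset.mul_sum]
  ring

theorem axial_sqDist (i : Fin 3) : bD 0 (sqDist d i) =
    ![-(1 + X (Sum.inr 0)), -(1 + X (Sum.inl 0)), -(X (Sum.inl 0) + X (Sum.inr 0))] i *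
      sqDist d i := by
  have hC : ∀ P : Pol (Fin (d + 1)), bD 0 (C 2 - C 2 * P) = -(C 2 * bD 0 P) := by
    intro P
    rw [map_sub, ← smul_eq_C_mul, Derivation.map_smul, ← algebraMap_eq, Derivation.map_algebraMap,
      zero_sub, smul_eq_C_mul]
    rfl
  fin_cases i
  · simp only [Fin.zero_eta, Fin.isValue, Matrix.cons_val_zero, sqDist_zero_eq, hC, bD_X_inr,
      if_true]
    ring
  · simp only [Fin.mk_one, Fin.isValue, Matrix.cons_val_one, Matrix.cons_val_zero, sqDist_one_eq,
      hC, bD_X_inl, if_true]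
    ring
  · simp only [Fin.reduceFinMk, Matrix.cons_val, sqDist_two_eq, hC, bD_inner]
    ring

/-- The infinitesimal unipotent transformation fixing the pole. -/
def uD (j : Fin d) : Derivation ℂ (Pol (Fin (d + 1))) (Pol (Fin (d + 1))) :=
  bD j.succ - rL 0 j.succ

theorem rL_X_inl (l m i : Fin (d + 1)) : rL l m (X (Sum.inl i)) =
    (if i = m then X (Sum.inl l) else 0) - (if i = l then X (Sum.inl m) else 0) := by
  rw [rL_apply, pderiv_X_of_ne (show (Sum.inl i : Fin (d + 1) ⊕ Fin (d + 1)) ≠ Sum.inr m by simp),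
    pderiv_X_of_ne (show (Sum.inl i : Fin (d + 1) ⊕ Fin (d + 1)) ≠ Sum.inr l by simp)]
  simp only [pderiv_X, Pi.single_apply, Sum.inl.injEq, eq_comm (a := i)]
  split_ifs <;> simp

theorem rL_X_inr (l m i : Fin (d + 1)) : rL l m (X (Sum.inr i)) =
    (if i = m then X (Sum.inr l) else 0) - (if i = l then X (Sum.inr m) else 0) := by
  rw [rL_apply, pderiv_X_of_ne (show (Sum.inr i : Fin (d + 1) ⊕ Fin (d + 1)) ≠ Sum.inl m by simp),
    pderiv_X_of_ne (show (Sum.inr i : Fin (d + 1) ⊕ Fin (d + 1)) ≠ Sum.inl l by simp)]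
  simp only [pderiv_X, Pi.single_apply, Sum.inr.injEq, eq_comm (a := i)]
  split_ifs <;> simp

theorem uD_inl (j : Fin d) : uD j (X (Sum.inl j.succ)) =
    1 - X (Sum.inl 0) - X (Sum.inl j.succ) * X (Sum.inl j.succ) := by
  rw [uD, Derivation.sub_apply, bD_X_inl, rL_X_inl]
  simp
  ring

theorem uD_inr (j : Fin d) : uD j (X (Sum.inr j.succ)) =
    1 - X (Sum.inr 0) - X (Sum.inr j.succ) * X (Sum.inr j.succ) := by
  rw [uD, Derivation.sub_apply, bD_X_inr, rL_X_inr]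
  simp
  ring

theorem unipotent_sqDist (j : Fin d) (i : Fin 3) : uD j (sqDist d i) =
    ![-X (Sum.inr j.succ), -X (Sum.inl j.succ), -(X (Sum.inl j.succ) + X (Sum.inr j.succ))] i *
      sqDist d i := by
  have h0 : (0 : Fin (d + 1)) ≠ j.succ := (Fin.succ_ne_zero j).symm
  have hC : ∀ P : Pol (Fin (d + 1)), uD j (C 2 - C 2 * P) = -(C 2 * uD j P) := by
    intro P
    rw [map_sub, ← smul_eq_C_mul, Derivation.map_smul, ← algebraMap_eq, Derivation.map_algebraMap,
      zero_sub, smul_eq_C_mul]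
    rfl
  have hq := rL_qxy (ι := Fin (d + 1)) 0 j.succ
  rw [qxy] at hq
  fin_cases i
  · simp only [Fin.zero_eta, Fin.isValue, Matrix.cons_val_zero, sqDist_zero_eq, hC]
    rw [uD, Derivation.sub_apply, bD_X_inr, rL_X_inr, if_neg h0, if_neg h0, if_pos rfl]
    ring
  · simp only [Fin.mk_one, Fin.isValue, Matrix.cons_val_one, Matrix.cons_val_zero, sqDist_one_eq,
      hC]
    rw [uD, Derivation.sub_apply, bD_X_inl, rL_X_inl, if_neg h0, if_neg h0, if_pos rfl]
    ring
  · simp only [Fin.reduceFinMk, Matrix.cons_val, sqDist_two_eq, hC]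
    rw [uD, Derivation.sub_apply, bD_inner, hq]
    ring

theorem sqMon_add_un (c : Fin 3 → ℕ) (i : Fin 3) :
    sqMon (c + un i) = sqDist d i * sqMon c := triCSS_add_un c i

theorem inl_zero_mul (c : Fin 3 → ℕ) : X (Sum.inl 0) * sqMon c =
    sqMon c - (1 / 2 : ℂ) • (sqMon (c + un 1) : Pol (Fin (d + 1))) := by
  have hc : (C (1 / 2) * C 2 : TwoVectors.Pol (Fin (d + 1))) = 1 := by
    rw [← C_mul]; norm_num
  rw [sqMon_add_un, sqDist_one_eq, smul_eq_C_mul]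
  linear_combination ((X (Sum.inl 0) - 1) * -sqMon c) * hc

theorem inr_zero_mul (c : Fin 3 → ℕ) : X (Sum.inr 0) * sqMon c =
    sqMon c - (1 / 2 : ℂ) • (sqMon (c + un 0) : Pol (Fin (d + 1))) := by
  have hc : (C (1 / 2) * C 2 : TwoVectors.Pol (Fin (d + 1))) = 1 := by
    rw [← C_mul]; norm_num
  rw [sqMon_add_un, sqDist_zero_eq, smul_eq_C_mul]
  linear_combination ((X (Sum.inr 0) - 1) * -sqMon c) * hc

theorem PoleInv.rec_axial {s t : ℂ} {k : ℕ} {T : CSS d →ₗ[ℂ] ℂ}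
    (h : PoleInv s t (s + t + 2 * k) T) (c : Fin 3 → ℕ) :
    (t + c 0 + c 2) * T (triCSS (c + un 0)) + (s + c 1 + c 2) * T (triCSS (c + un 1)) =
      4 * ((c 0 : ℂ) + c 1 + c 2 - k) * T (triCSS c) := by
  have h1 := h.axial (sqMon c)
  have h2 : bD 0 (sqMon c) - s • (X (Sum.inl 0) * sqMon c) - t • (X (Sum.inr 0) * sqMon c) =
      -((c 0 + c 1 : ℂ) • sqMon c + (c 0 + c 2 + t : ℂ) • (X (Sum.inr 0) * sqMon c) +
      (c 1 + c 2 + s : ℂ) • (X (Sum.inl 0) * sqMon c) : Pol (Fin (d + 1))) := by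
    rw [derivation_sqMon _ axial_sqDist]
    simp only [Matrix.cons_val, smul_eq_C_mul, map_add]
    ring
  rw [h2, inl_zero_mul, inr_zero_mul] at h1
  simp only [map_neg, map_add, map_smul, map_sub, smul_eq_mul] at h1
  simp only [triCSS]
  linear_combination 2 * h1

theorem polyCSS_ext {P Q : Pol (Fin (d + 1))}
    (h : ∀ p, (polyCSS P).1 p = (polyCSS Q).1 p) : polyCSS P = polyCSS Q := by
  ext p; exact h p

theorem polyCSS_sum_succ (f : Fin d → Pol (Fin (d + 1))) (p : S d × S d) :
    (polyCSS (∑ i, f i)).1 p = ∑ i, (polyCSS (f i)).1 p := by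
  rw [map_sum, AddSubmonoidClass.coe_finsetSum, Finset.sum_apply]

theorem sum_succ_mul (x y : S d) :
    ∑ i : Fin d, (((x : E d) i.succ : ℝ) : ℂ) * (((y : E d) i.succ : ℝ) : ℂ)
      = (inner ℝ (x : E d) (y : E d) : ℝ) - (((x : E d) 0 : ℝ) : ℂ) * (((y : E d) 0 : ℝ) : ℂ) := by
  rw [inner_eq_sum, Fin.sum_univ_succ]
  push_cast
  ring

theorem polyCSS_smul (a : ℂ) (P : Pol (Fin (d + 1))) (p : S d × S d) :
    (polyCSS (a • P)).1 p = a * (polyCSS P).1 p := by simp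

theorem polyCSS_add (P Q : Pol (Fin (d + 1))) (p : S d × S d) :
    (polyCSS (P + Q)).1 p = (polyCSS P).1 p + (polyCSS Q).1 p := by simp

theorem polyCSS_sub (P Q : Pol (Fin (d + 1))) (p : S d × S d) :
    (polyCSS (P - Q)).1 p = (polyCSS P).1 p - (polyCSS Q).1 p := by simp

theorem polyCSS_inl_sq (c : Fin 3 → ℕ) :
    polyCSS (∑ j : Fin d, X (Sum.inl j.succ) * (X (Sum.inl j.succ) * sqMon c)) =
      polyCSS (sqMon (c + un 1) - (1 / 4 : ℂ) • sqMon (c + un 1 + un 1)) := by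
  refine polyCSS_ext fun p => ?_
  simp only [polyCSS_sum_succ, polyCSS_mul, polyCSS_sub, polyCSS_smul, sqMon_add_un, sqDist_one,
    polyCSS_X_inl, ← mul_assoc, ← Finset.sum_mul, sum_succ_mul, inner_self_coe]
  push_cast
  ring

theorem polyCSS_inr_sq (c : Fin 3 → ℕ) :
    polyCSS (∑ j : Fin d, X (Sum.inr j.succ) * (X (Sum.inr j.succ) * sqMon c)) =
      polyCSS (sqMon (c + un 0) - (1 / 4 : ℂ) • sqMon (c + un 0 + un 0)) := by
  refine polyCSS_ext fun p => ?_
  simp only [polyCSS_sum_succ, polyCSS_mul, polyCSS_sub, polyCSS_smul, sqMon_add_un, sqDist_zero,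
    polyCSS_X_inr, ← mul_assoc, ← Finset.sum_mul, sum_succ_mul, inner_self_coe]
  push_cast
  ring

theorem polyCSS_inl_inr (c : Fin 3 → ℕ) :
    polyCSS (∑ j : Fin d, X (Sum.inl j.succ) * (X (Sum.inr j.succ) * sqMon c)) =
      polyCSS ((1 / 2 : ℂ) • sqMon (c + un 0) + (1 / 2 : ℂ) • sqMon (c + un 1) -
        (1 / 4 : ℂ) • sqMon (c + un 0 + un 1) - (1 / 2 : ℂ) • sqMon (c + un 2)) := by
  refine polyCSS_ext fun p => ?_
  simp only [polyCSS_sum_succ, polyCSS_mul, polyCSS_sub, polyCSS_add, polyCSS_smul, sqMon_add_un,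
    sqDist_zero, sqDist_one, sqDist_two, polyCSS_X_inl, polyCSS_X_inr, ← mul_assoc,
    ← Finset.sum_mul, sum_succ_mul]
  ring

theorem PoleInv.sum_inl {s t r : ℂ} {T : CSS d →ₗ[ℂ] ℂ} (h : PoleInv s t r T) (c : Fin 3 → ℕ) :
    1 / 2 * (d * T (triCSS (c + un 1))) -
      (s + c 1 + c 2 + 1) * T (polyCSS (sqMon (c + un 1) - (1 / 4 : ℂ) • sqMon (c + un 1 + un 1))) -
      (t + c 0 + c 2) * T (polyCSS ((1 / 2 : ℂ) • sqMon (c + un 0) + (1 / 2 : ℂ) • sqMon (c + un 1) -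
        (1 / 4 : ℂ) • sqMon (c + un 0 + un 1) - (1 / 2 : ℂ) • sqMon (c + un 2))) = 0 := by
  rw [← polyCSS_inl_sq, ← polyCSS_inl_inr]
  have h1 : ∀ j : Fin d, 1 / 2 * T (triCSS (c + un 1)) -
      (s + c 1 + c 2 + 1) * T (polyCSS (X (Sum.inl j.succ) * (X (Sum.inl j.succ) * sqMon c))) -
      (t + c 0 + c 2) * T (polyCSS (X (Sum.inl j.succ) * (X (Sum.inr j.succ) * sqMon c))) = 0 := by
    intro j
    have h2 := h.unipotent j (X (Sum.inl j.succ) * sqMon c)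
    rw [← Derivation.sub_apply, ← uD] at h2
    have h3 : uD j (X (Sum.inl j.succ) * sqMon c) -
        s • (X (Sum.inl j.succ) * (X (Sum.inl j.succ) * sqMon c)) -
        t • (X (Sum.inr j.succ) * (X (Sum.inl j.succ) * sqMon c)) =
        (1 / 2 : ℂ) • sqMon (c + un 1) -
        (s + c 1 + c 2 + 1) • (X (Sum.inl j.succ) * (X (Sum.inl j.succ) * sqMon c)) -
        (t + c 0 + c 2) • (X (Sum.inl j.succ) * (X (Sum.inr j.succ) * sqMon c)) := by
      rw [Derivation.leibniz, derivation_sqMon _ (unipotent_sqDist j), uD_inl]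
      have := inl_zero_mul (d := d) c
      simp only [Matrix.cons_val, smul_eq_C_mul, map_add, smul_eq_mul, map_one] at this ⊢
      linear_combination -this
    rw [h3] at h2
    simpa only [map_sub, map_smul, smul_eq_mul, triCSS] using h2
  have h4 := Finset.sum_eq_zero fun j (_ : j ∈ Finset.univ) => h1 j
  simp only [Finset.sum_sub_distrib, ← Finset.mul_sum, Finset.sum_const, Finset.card_univ,
    Fintype.card_fin, nsmul_eq_mul] at h4
  simpa only [map_sum] using h4

theorem PoleInv.sum_inr {s t r : ℂ} {T : CSS d →ₗ[ℂ] ℂ} (h : PoleInv s t r T) (c : Fin 3 → ℕ) :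
    1 / 2 * (d * T (triCSS (c + un 0))) -
      (t + c 0 + c 2 + 1) * T (polyCSS (sqMon (c + un 0) - (1 / 4 : ℂ) • sqMon (c + un 0 + un 0))) -
      (s + c 1 + c 2) * T (polyCSS ((1 / 2 : ℂ) • sqMon (c + un 0) + (1 / 2 : ℂ) • sqMon (c + un 1) -
        (1 / 4 : ℂ) • sqMon (c + un 0 + un 1) - (1 / 2 : ℂ) • sqMon (c + un 2))) = 0 := by
  rw [← polyCSS_inr_sq, ← polyCSS_inl_inr]
  have h1 : ∀ j : Fin d, 1 / 2 * T (triCSS (c + un 0)) -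
      (t + c 0 + c 2 + 1) * T (polyCSS (X (Sum.inr j.succ) * (X (Sum.inr j.succ) * sqMon c))) -
      (s + c 1 + c 2) * T (polyCSS (X (Sum.inl j.succ) * (X (Sum.inr j.succ) * sqMon c))) = 0 := by
    intro j
    have h2 := h.unipotent j (X (Sum.inr j.succ) * sqMon c)
    rw [← Derivation.sub_apply, ← uD] at h2
    have h3 : uD j (X (Sum.inr j.succ) * sqMon c) -
        s • (X (Sum.inl j.succ) * (X (Sum.inr j.succ) * sqMon c)) -
        t • (X (Sum.inr j.succ) * (X (Sum.inr j.succ) * sqMon c)) =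
        (1 / 2 : ℂ) • sqMon (c + un 0) -
        (t + c 0 + c 2 + 1) • (X (Sum.inr j.succ) * (X (Sum.inr j.succ) * sqMon c)) -
        (s + c 1 + c 2) • (X (Sum.inl j.succ) * (X (Sum.inr j.succ) * sqMon c)) := by
      rw [Derivation.leibniz, derivation_sqMon _ (unipotent_sqDist j), uD_inr]
      have := inr_zero_mul (d := d) c
      simp only [Matrix.cons_val, smul_eq_C_mul, map_add, smul_eq_mul, map_one] at this ⊢
      linear_combination -this
    rw [h3] at h2
    simpa only [map_sub, map_smul, smul_eq_mul, triCSS] using h2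
  have h4 := Finset.sum_eq_zero fun j (_ : j ∈ Finset.univ) => h1 j
  simp only [Finset.sum_sub_distrib, ← Finset.mul_sum, Finset.sum_const, Finset.card_univ,
    Fintype.card_fin, nsmul_eq_mul] at h4
  simpa only [map_sum] using h4

theorem PoleInv.recurrence {s t : ℂ} {k : ℕ} {T : CSS d →ₗ[ℂ] ℂ}
    (h : PoleInv s t (s + t + 2 * k) T) :
    Rec ![s, t, d - s - t - 2 * k] k (fun c => T (triCSS c)) := by
  have hlen : ∀ c : Fin 3 → ℕ, (len c : ℂ) = c 0 + c 1 + c 2 := fun c => by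
    simp [len, Fin.sum_univ_three]
  have e0 : ∀ (c : Fin 3 → ℕ), (c + un 0) 0 = c 0 + 1 ∧ (c + un 0) 1 = c 1 ∧ (c + un 0) 2 = c 2 :=
    fun c => by simp
  have e1 : ∀ (c : Fin 3 → ℕ), (c + un 1) 0 = c 0 ∧ (c + un 1) 1 = c 1 + 1 ∧ (c + un 1) 2 = c 2 :=
    fun c => by simp
  have r1 := h.rec_axial
  have r2 : ∀ c : Fin 3 → ℕ, (d - s - t - 2 * k + c 0 + c 1) * T (triCSS (c + un 1)) +
      (t + c 0 + c 2) * T (triCSS (c + un 2)) =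
      4 * ((c 0 : ℂ) + c 1 + c 2 - k) * T (triCSS c) := by
    intro c
    have h1 := h.sum_inl c
    have h2 := r1 (c + un 1)
    have h3 := r1 c
    simp only [(e1 c).1, (e1 c).2.1, (e1 c).2.2] at h2
    rw [add_right_comm c (un 1) (un 0)] at h2
    push_cast at h2
    simp only [map_sub, map_add, map_smul, smul_eq_mul] at h1
    simp only [triCSS] at h1 h2 h3 ⊢
    linear_combination 2 * h1 - (1 / 2) * h2 + h3
  have r3 : ∀ c : Fin 3 → ℕ, (d - s - t - 2 * k + c 0 + c 1) * T (triCSS (c + un 0)) +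
      (s + c 1 + c 2) * T (triCSS (c + un 2)) =
      4 * ((c 0 : ℂ) + c 1 + c 2 - k) * T (triCSS c) := by
    intro c
    have h1 := h.sum_inr c
    have h2 := r1 (c + un 0)
    have h3 := r1 c
    simp only [(e0 c).1, (e0 c).2.1, (e0 c).2.2] at h2
    push_cast at h2
    simp only [map_sub, map_add, map_smul, smul_eq_mul] at h1
    simp only [triCSS] at h1 h2 h3 ⊢
    linear_combination 2 * h1 - (1 / 2) * h2 + h3
  intro c i j hij
  fin_cases i <;> fin_cases j <;> simp [coef, hlen] at hij ⊢
  · linear_combination r1 c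
  · linear_combination r3 c
  · linear_combination r1 c
  · linear_combination r2 c
  · linear_combination r3 c
  · linear_combination r2 c

open TwoVectors Recurrence

theorem JV.jetVanishes {N : ℕ} {f : CSS d} {p : S d × S d} (h : f ∈ jetIdeal N p) :
    JetVanishes ((𝓡 d).prod (𝓡 d)) N f.1 p := by
  set J := (𝓡 d).prod (𝓡 d)
  set e := extChartAt J p
  have h1 : ContDiffAt ℝ ∞ (fun w => (((e.symm w).1 : E d), ((e.symm w).2 : E d))) (e p) := by
    have h3 : ContMDiffAt 𝓘(ℝ, EuclideanSpace ℝ (Fin d) × EuclideanSpace ℝ (Fin d)) J ∞ e.symm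
        (e p) := by
      have := contMDiffOn_extChartAt_symm (I := J) (n := ∞) p
      exact (this (e p) (mem_extChartAt_target p)).contMDiffAt (extChartAt_target_mem_nhds p)
    have h4 := ContMDiffAt.comp (e p) (contMDiff_coe_prod (d := d) _) h3
    rw [← contMDiffAt_iff_contDiffAt]
    exact h4
  have hp : (((e.symm (e p)).1 : E d), ((e.symm (e p)).2 : E d)) = ((p.1 : E d), (p.2 : E d)) := by
    rw [extChartAt_to_inv]
  have h2 := JV.comp (F := Ext f.1) (N := N)
    (φ := fun w => (((e.symm w).1 : E d), ((e.symm w).2 : E d))) (p := e p)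
    (by rw [hp]; exact contDiffAt_Ext_coe f p) h1 (by rw [hp]; exact h)
  intro m hm
  have := h2 m hm
  simp only [Ext_coe] at this
  exact this

theorem exists_act_pole (hd : 1 ≤ d) (z : S d) : ∃ g : SO0 d,
    (∀ p, (g.1 p).1 = p.1) ∧ act g⁻¹ (pole d) = z := by
  set c : ℝ := inner ℝ (z : E d) (pole d : E d) with hc
  set v : E d := (z : E d) - c • (pole d : E d) with hv
  have hvp : inner ℝ (pole d : E d) v = 0 := by
    rw [hv, inner_sub_right, inner_smul_right, inner_self_coe, real_inner_comm, ← hc]; ring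
  have hvn : ‖v‖ ^ 2 = 1 - c ^ 2 := by
    have : inner ℝ v v = 1 - c ^ 2 := by
      rw [hv, inner_sub_left, inner_smul_left, ← hv, hvp, hv, inner_sub_right, inner_smul_right,
        inner_self_coe, ← hc]
      simp
      ring
    rw [← this, real_inner_self_eq_norm_sq]
  obtain ⟨f, hf, hpf, hvf⟩ : ∃ f : E d, inner ℝ f f = 1 ∧ inner ℝ (pole d : E d) f = 0 ∧
      v = ‖v‖ • f := by
    by_cases h0 : v = 0
    · refine ⟨bv ⟨1, by omega⟩, by rw [inner_bv_bv, if_pos rfl], ?_, by simp [h0]⟩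
      rw [pole_eq, inner_bv_bv, if_neg]
      intro h
      simpa using congrArg Fin.val h
    · have hn : ‖v‖ ≠ 0 := norm_ne_zero_iff.2 h0
      refine ⟨‖v‖⁻¹ • v, ?_, ?_, ?_⟩
      · rw [real_inner_self_eq_norm_sq, norm_smul, norm_inv, norm_norm, inv_mul_cancel₀ hn, one_pow]
      · rw [inner_smul_right, hvp, mul_zero]
      · rw [smul_smul, mul_inv_cancel₀ hn, one_smul]
  have hsin : Real.sin (Real.arccos c) = ‖v‖ := by
    rw [Real.sin_arccos, ← hvn, Real.sqrt_sq (norm_nonneg _)]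
  have hcos : Real.cos (Real.arccos c) = c := by
    have : c ^ 2 ≤ 1 := by nlinarith [sq_nonneg ‖v‖]
    exact Real.cos_arccos (by nlinarith) (by nlinarith)
  set G := rot (pole d : E d) f (inner_self_coe _) hf hpf
  refine ⟨G.elt (-(Real.arccos c)), fun _ => rfl, ?_⟩
  have h1 : lift (G.elt (-(Real.arccos c)))⁻¹ (pole d) = (1, (z : E d)) := by
    rw [lift, LorentzFlow.elt_inv_apply, neg_neg]
    change ((1 : ℝ), (pole d : E d) + ((Real.cos (Real.arccos c) - 1) * inner ℝ (pole d : E d) (pole d : E d) -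
      Real.sin (Real.arccos c) * inner ℝ f (pole d : E d)) • (pole d : E d) +
      ((Real.cos (Real.arccos c) - 1) * inner ℝ f (pole d : E d) +
      Real.sin (Real.arccos c) * inner ℝ (pole d : E d) (pole d : E d)) • f) = _
    rw [inner_self_coe, real_inner_comm, hpf, hsin, hcos]
    ext1
    · rfl
    · calc _ = c • (pole d : E d) + ‖v‖ • f := by module
        _ = (z : E d) := by rw [← hvf, hv]; module
  apply Subtype.ext
  simp [act, h1]

theorem BD.exists_jet {l m : ℂ} {k : ℕ} {B : CSS d →ₗ[ℂ] CS d} (hB : B ∈ BD d l m k) :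
    ∃ N, ∀ f ∈ jetIdeal N (pole d, pole d), (B f).1 (pole d) = 0 := by
  obtain ⟨⟨N, hN⟩, -⟩ := hB
  exact ⟨N, fun f hf => hN f _ (JV.jetVanishes hf)⟩

theorem BD.poleInv {l m : ℂ} {k : ℕ} {B : CSS d →ₗ[ℂ] CS d} (hB : B ∈ BD d l m k) :
    PoleInv (rho d + l) (rho d + m) ((rho d + l) + (rho d + m) + 2 * k) (evalAt (pole d) B) := by
  obtain ⟨N, hN⟩ := BD.exists_jet hB
  have := poleInv_of_covariant hN hB.2
  convert this using 1
  ring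

theorem BD.eq_zero_of_evalAt (hd : 1 ≤ d) {l m : ℂ} {k : ℕ} {B : CSS d →ₗ[ℂ] CS d}
    (hB : B ∈ BD d l m k) (h : evalAt (pole d) B = 0) : B = 0 := by
  ext f z
  obtain ⟨g, -, rfl⟩ := exists_act_pole hd z
  have h1 := LinearMap.congr_fun h (piTensor l m g f)
  rw [evalAt_apply, hB.2] at h1
  have h2 : (kappa g⁻¹ (pole d) : ℂ) ^ (rho d + (l + m + rho d + 2 * k)) ≠ 0 := by
    rw [Ne, Complex.cpow_eq_zero_iff, not_and_or]
    left
    exact_mod_cast (kappa_pos _ _).ne'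
  exact (mul_eq_zero.1 h1).resolve_left h2

/-- The parameters of the recurrence relations. -/
def recParam (d : ℕ) (l m : ℂ) (k : ℕ) : Fin 3 → ℂ :=
  ![rho d + l, rho d + m, d - (rho d + l) - (rho d + m) - 2 * k]

theorem BD.eq_zero_of_triCSS (hd : 3 ≤ d) {l m : ℂ} {k : ℕ} {B : CSS d →ₗ[ℂ] CS d}
    (hB : B ∈ BD d l m k) {a : Fin 3 → ℕ} (ha : Nondeg (recParam d l m k) a) (hk : len a = k)
    (h0 : (B (triCSS a)).1 (pole d) = 0) : B = 0 := by
  obtain ⟨N, hN⟩ := BD.exists_jet hB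
  have hP := BD.poleInv hB
  have h1 := Rec.eq_zero hP.recurrence (M := N + 1)
    (fun c hc => hN _ (triCSS_mem (by omega))) ha hk h0
  exact BD.eq_zero_of_evalAt (by omega) hB
    (hP.rotInv.eq_zero hd hN fun c => congrFun h1 c)

/-- Uniqueness of covariant bi-differential operators. -/
theorem BD.rank_le_one (hd : 3 ≤ d) {l m : ℂ} {k : ℕ} {a : Fin 3 → ℕ}
    (ha : Nondeg (recParam d l m k) a) (hk : len a ≤ k) : Module.rank ℂ (BD d l m k) ≤ 1 := by
  obtain ⟨b, hb, hbk⟩ := ha.exists_len_eq hk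
  let φ : BD d l m k →ₗ[ℂ] ℂ :=
    { toFun := fun B => (B.1 (triCSS b)).1 (pole d)
      map_add' := fun B C => by simp
      map_smul' := fun c B => by simp }
  have hφ : Function.Injective φ := by
    intro B C hBC
    have h1 := BD.eq_zero_of_triCSS hd
      ((BD d l m k).add_mem B.2 ((BD d l m k).smul_mem (-1) C.2)) hb hbk (by
        have : (B.1 (triCSS b)).1 (pole d) = (C.1 (triCSS b)).1 (pole d) := hBC
        simp [this])
    refine Subtype.ext (LinearMap.ext fun f => Subtype.ext (funext fun z => ?_))
    have h2 := congrFun (congrArg Subtype.val (LinearMap.congr_fun h1 f)) z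
    simpa [add_neg_eq_zero] using h2
  simpa using LinearMap.rank_le_of_injective φ hφ

/-! ### The Bernstein-Sato identity -/

section bernstein

/-- The linear functional of the Lorentzian pairing. -/
def lzL (Y : ℝ × E d) : (ℝ × E d) →L[ℝ] ℂ :=
  Complex.ofRealCLM ∘L (Y.1 • ContinuousLinearMap.fst ℝ ℝ (E d) -
    innerSL ℝ Y.2 ∘L ContinuousLinearMap.snd ℝ ℝ (E d))

theorem lzL_apply (Y p : ℝ × E d) : lzL Y p = (lz p Y : ℂ) := by
  simp [lzL, lz, mul_comm, real_inner_comm]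

theorem continuous_lz (Y : ℝ × E d) : Continuous fun p => lz p Y := by
  unfold lz; fun_prop

theorem ctr_lz (Y Z : ℝ × E d) : ctr (fun u v => (lz u Y : ℂ) * (lz v Z : ℂ)) = lz Y Z := by
  simp only [ctr, lz]
  simp only [inner_zero_left, real_inner_comm, inner_bv, one_mul, sub_zero, zero_mul, zero_sub]
  rw [inner_eq_sum]
  push_cast
  simp

theorem ctr_add (b b' : (ℝ × E d) → (ℝ × E d) → ℂ) :
    ctr (fun u v => b u v + b' u v) = ctr b + ctr b' := by
  simp only [ctr, Finset.sum_add_distrib]; ring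

theorem ctr_mul (c : ℂ) (b : (ℝ × E d) → (ℝ × E d) → ℂ) :
    ctr (fun u v => c * b u v) = c * ctr b := by
  simp only [ctr, Finset.mul_sum, mul_sub]

/-- The contraction of a linear functional with the pairing. -/
theorem ctr_lz_apply (L : (ℝ × E d) →L[ℝ] ℂ) (Y : ℝ × E d) :
    ctr (fun u v => L u * (lz v Y : ℂ)) = L Y := by
  conv_rhs => rw [coord_expand Y, map_sub, map_sum]
  simp only [ctr, map_smul, Complex.real_smul, lz_comm Y, mul_comm]

theorem ctr_swap (b : (ℝ × E d) → (ℝ × E d) → ℂ) : ctr (fun u v => b v u) = ctr b := rfl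

theorem ctr_lz_self : ctr (fun u v : ℝ × E d => (lz u v : ℂ)) = d + 2 := by
  simp only [ctr, lz]
  simp [bv]
  ring

/-- The Todorov operator on functions on the cone. -/
def ddA (s : ℂ) (w : ℝ × E d) (F : ℝ × E d → ℂ) (p : ℝ × E d) : ℂ :=
  (rho d - 1 - s) * fderiv ℝ F p w - 1 / 2 * (lz p w : ℂ) * Box F p

theorem ContDiffAt.eventually_differentiableAt {V W : Type*} [NormedAddCommGroup V]
    [NormedSpace ℝ V] [NormedAddCommGroup W] [NormedSpace ℝ W] {F : V → W} {p : V}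
    (h : ContDiffAt ℝ 2 F p) : ∀ᶠ q in nhds p, DifferentiableAt ℝ F q :=
  (h.eventually (by simp)).mono fun _ h => h.differentiableAt (by simp)

theorem ContDiffAt.differentiableAt_fderiv {V W : Type*} [NormedAddCommGroup V]
    [NormedSpace ℝ V] [NormedAddCommGroup W] [NormedSpace ℝ W] {F : V → W} {p : V}
    (h : ContDiffAt ℝ 2 F p) : DifferentiableAt ℝ (fderiv ℝ F) p :=
  (h.fderiv_right (m := 1) (by norm_num)).differentiableAt (by simp)

variable {F G : ℝ × E d → ℂ} {p : ℝ × E d}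

theorem Box_add (hF : ContDiffAt ℝ 2 F p) (hG : ContDiffAt ℝ 2 G p) :
    Box (fun q => F q + G q) p = Box F p + Box G p := by
  have h : fderiv ℝ (fun q => F q + G q) =ᶠ[nhds p] fun q => fderiv ℝ F q + fderiv ℝ G q := by
    filter_upwards [ContDiffAt.eventually_differentiableAt hF,
      ContDiffAt.eventually_differentiableAt hG] with q h1 h2
    exact fderiv_fun_add h1 h2
  rw [Box, Box, Box, ← ctr_add, h.fderiv_eq, fderiv_fun_add (ContDiffAt.differentiableAt_fderiv hF)
    (ContDiffAt.differentiableAt_fderiv hG)]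
  rfl

theorem Box_const_mul (c : ℂ) (hF : ContDiffAt ℝ 2 F p) :
    Box (fun q => c * F q) p = c * Box F p := by
  have h : fderiv ℝ (fun q => c * F q) =ᶠ[nhds p] fun q => c • fderiv ℝ F q := by
    filter_upwards [ContDiffAt.eventually_differentiableAt hF] with q h1
    exact fderiv_const_mul h1 c
  rw [Box, Box, ← ctr_mul, h.fderiv_eq, fderiv_fun_const_smul (ContDiffAt.differentiableAt_fderiv hF)]
  rfl

theorem ddA_add (s : ℂ) (w : ℝ × E d) (hF : ContDiffAt ℝ 2 F p) (hG : ContDiffAt ℝ 2 G p) :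
    ddA s w (fun q => F q + G q) p = ddA s w F p + ddA s w G p := by
  rw [ddA, ddA, ddA, Box_add hF hG, fderiv_fun_add (hF.differentiableAt (by simp))
    (hG.differentiableAt (by simp)), _root_.add_apply]
  ring

theorem ddA_const_mul (s : ℂ) (w : ℝ × E d) (c : ℂ) (hF : ContDiffAt ℝ 2 F p) :
    ddA s w (fun q => c * F q) p = c * ddA s w F p := by
  rw [ddA, ddA, Box_const_mul c hF, fderiv_const_mul (hF.differentiableAt (by simp)),
    _root_.smul_apply, smul_eq_mul]
  ring

theorem contDiffAt_lz_mul (w : ℝ × E d) (hG : ContDiffAt ℝ 2 G p) :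
    ContDiffAt ℝ 2 (fun q => (lz q w : ℂ) * G q) p := by
  simp only [← lzL_apply]
  exact (lzL w).contDiff.contDiffAt.mul hG

theorem fderiv_lz_mul (w : ℝ × E d) (hG : DifferentiableAt ℝ G p) :
    fderiv ℝ (fun q => (lz q w : ℂ) * G q) p = (lz p w : ℂ) • fderiv ℝ G p + G p • lzL w := by
  simp only [← lzL_apply]
  exact ((lzL w).hasFDerivAt.fun_mul hG.hasFDerivAt).fderiv

theorem Box_lz_mul (w : ℝ × E d) (hG : ContDiffAt ℝ 2 G p) :
    Box (fun q => (lz q w : ℂ) * G q) p = lz p w * Box G p + 2 * fderiv ℝ G p w := by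
  have h : fderiv ℝ (fun q => (lz q w : ℂ) * G q) =ᶠ[nhds p]
      fun q => lzL w q • fderiv ℝ G q + G q • lzL w := by
    filter_upwards [ContDiffAt.eventually_differentiableAt hG] with q h1
    rw [fderiv_lz_mul w h1, lzL_apply]
  have h2 : HasFDerivAt (fun q => lzL w q • fderiv ℝ G q + G q • lzL w) _ p :=
    ((lzL w).hasFDerivAt.smul (ContDiffAt.differentiableAt_fderiv hG).hasFDerivAt).add
      ((hG.differentiableAt (by simp)).hasFDerivAt.smul_const (lzL w))
  rw [Box, h.fderiv_eq, h2.fderiv, Box]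
  have h3 := ctr_lz_apply (fderiv ℝ G p) w
  have h4 := ctr_swap (fun u v => fderiv ℝ G p u * (lz v w : ℂ))
  have : (fun u v => (lzL w p • fderiv ℝ (fderiv ℝ G) p + (lzL w).smulRight (fderiv ℝ G p) +
      (fderiv ℝ G p).smulRight (lzL w)) u v) = fun u v =>
      ((lz p w : ℂ) * fderiv ℝ (fderiv ℝ G) p u v + fderiv ℝ G p v * (lz u w : ℂ)) +
      fderiv ℝ G p u * (lz v w : ℂ) := by
    ext u v
    simp [lzL_apply]
    ring
  rw [this, ctr_add, ctr_add, ctr_mul, h4, h3]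
  ring

/-- The contraction of the Todorov operators with the position vector. -/
theorem ctr_ddA_lz_mul (s : ℂ) (hp : lz p p = 0) (hG : ContDiffAt ℝ 2 G p)
    (hE : fderiv ℝ G p p = -(s + 1) * G p) :
    ctr (fun w w' => ddA s w (fun q => (lz q w' : ℂ) * G q) p) =
      (s - rho d) * (s - d + 1) * G p := by
  have h : (fun w w' => ddA s w (fun q => (lz q w' : ℂ) * G q) p) = fun w w' =>
      ((rho d - 1 - s) * (fderiv ℝ G p w * (lz w' p : ℂ)) +
      (rho d - 1 - s) * G p * (lz w w' : ℂ)) +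
      (-(1 / 2 * Box G p) * ((lz w p : ℂ) * (lz w' p : ℂ)) + -1 * (fderiv ℝ G p w' * (lz w p : ℂ))) := by
    ext w w'
    rw [ddA, fderiv_lz_mul w' (hG.differentiableAt (by simp)), Box_lz_mul w' hG, lz_comm p w,
      lz_comm p w']
    simp only [_root_.add_apply, _root_.smul_apply, smul_eq_mul, lzL_apply]
    ring
  have h4 := ctr_swap (fun u v => fderiv ℝ G p u * (lz v p : ℂ))
  rw [h, ctr_add, ctr_add, ctr_add, ctr_mul, ctr_mul, ctr_mul, ctr_mul, h4, ctr_lz_apply, ctr_lz, hp,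
    ctr_lz_self, hE, rho]
  push_cast
  ring

/-- Products of powers of two linear functions. -/
def pw (Y Z : ℝ × E d) (c a : ℂ) (p : ℝ × E d) : ℂ := (lz p Y : ℂ) ^ c * (lz p Z : ℂ) ^ a

variable {Y Z : ℝ × E d}

theorem hasFDerivAt_lz_cpow (c : ℂ) (hY : 0 < lz p Y) :
    HasFDerivAt (fun q => (lz q Y : ℂ) ^ c) ((c * (lz p Y : ℂ) ^ (c - 1)) • lzL Y) p := by
  have h1 := ((Complex.hasStrictDerivAt_cpow_const (c := c) (x := (lz p Y : ℂ))
    (Complex.ofReal_mem_slitPlane.2 hY)).hasDerivAt.hasFDerivAt).restrictScalars ℝ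
  rw [← lzL_apply] at h1
  have h2 := HasFDerivAt.comp p h1 (lzL Y).hasFDerivAt
  simp only [← lzL_apply]
  refine h2.congr_fderiv ?_
  ext v
  all_goals simp [mul_comm]

theorem hasFDerivAt_pw (c a : ℂ) (hY : 0 < lz p Y) (hZ : 0 < lz p Z) :
    HasFDerivAt (pw Y Z c a)
      ((c * pw Y Z (c - 1) a p) • lzL Y + (a * pw Y Z c (a - 1) p) • lzL Z) p := by
  refine ((hasFDerivAt_lz_cpow c hY).fun_mul (hasFDerivAt_lz_cpow a hZ)).congr_fderiv ?_
  ext v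
  all_goals
    simp [pw]
    ring

theorem eventually_lz_pos (hY : 0 < lz p Y) : ∀ᶠ q in nhds p, 0 < lz q Y :=
  (continuous_lz Y).continuousAt.eventually (lt_mem_nhds hY)

theorem contDiffAt_lz_cpow (c : ℂ) (hY : 0 < lz p Y) :
    ContDiffAt ℝ 2 (fun q => (lz q Y : ℂ) ^ c) p := by
  have h : ContDiff ℝ 2 (fun q => lz q Y) := by
    unfold lz
    exact (contDiff_fst.mul contDiff_const).sub (contDiff_snd.inner ℝ contDiff_const)
  exact ContDiffAt.comp (g := fun t : ℝ => (t : ℂ) ^ c) p (contDiffAt_ofReal_cpow hY c) h.contDiffAt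

theorem contDiffAt_pw (c a : ℂ) (hY : 0 < lz p Y) (hZ : 0 < lz p Z) :
    ContDiffAt ℝ 2 (pw Y Z c a) p :=
  (contDiffAt_lz_cpow c hY).mul (contDiffAt_lz_cpow a hZ)

theorem pw_succ_left (c a : ℂ) (hY : 0 < lz p Y) : pw Y Z c a p = lz p Y * pw Y Z (c - 1) a p := by
  have : (lz p Y : ℂ) ≠ 0 := by exact_mod_cast hY.ne'
  rw [pw, pw, Complex.cpow_sub _ _ this, Complex.cpow_one]
  field_simp

theorem pw_succ_right (c a : ℂ) (hZ : 0 < lz p Z) : pw Y Z c a p = lz p Z * pw Y Z c (a - 1) p := by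
  have : (lz p Z : ℂ) ≠ 0 := by exact_mod_cast hZ.ne'
  rw [pw, pw, Complex.cpow_sub _ _ this, Complex.cpow_one]
  field_simp

theorem fderiv_pw_self (c a : ℂ) (hY : 0 < lz p Y) (hZ : 0 < lz p Z) :
    fderiv ℝ (pw Y Z c a) p p = (a + c) * pw Y Z c a p := by
  rw [(hasFDerivAt_pw c a hY hZ).fderiv]
  simp only [_root_.add_apply, _root_.smul_apply, smul_eq_mul, lzL_apply]
  have h1 := pw_succ_left (Z := Z) c a hY
  have h2 := pw_succ_right (Y := Y) c a hZ
  linear_combination -c * h1 - a * h2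

theorem Box_pw (c a : ℂ) (hY : 0 < lz p Y) (hZ : 0 < lz p Z) (hYY : lz Y Y = 0)
    (hZZ : lz Z Z = 0) :
    Box (pw Y Z c a) p = 2 * c * a * lz Y Z * pw Y Z (c - 1) (a - 1) p := by
  have h : fderiv ℝ (pw Y Z c a) =ᶠ[nhds p] fun q =>
      (c * pw Y Z (c - 1) a q) • lzL Y + (a * pw Y Z c (a - 1) q) • lzL Z := by
    filter_upwards [eventually_lz_pos hY, eventually_lz_pos hZ] with q h1 h2
    exact (hasFDerivAt_pw c a h1 h2).fderiv
  have h2 := HasFDerivAt.fun_add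
    (((hasFDerivAt_pw (c - 1) a hY hZ).const_mul c).smul_const (lzL Y))
    (((hasFDerivAt_pw c (a - 1) hY hZ).const_mul a).smul_const (lzL Z))
  rw [Box, h.fderiv_eq, h2.fderiv]
  set p1 := pw Y Z (c - 1 - 1) a p
  set p2 := pw Y Z (c - 1) (a - 1) p
  set p3 := pw Y Z c (a - 1 - 1) p
  have : (fun u v => ((c • (((c - 1) * p1) • lzL Y + (a * p2) • lzL Z)).smulRight (lzL Y) +
      (a • ((c * p2) • lzL Y + ((a - 1) * p3) • lzL Z)).smulRight (lzL Z)) u v) = fun u v =>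
      (c * (c - 1) * p1 * ((lz u Y : ℂ) * (lz v Y : ℂ)) + c * a * p2 * ((lz u Z : ℂ) * (lz v Y : ℂ)))
      + (a * c * p2 * ((lz u Y : ℂ) * (lz v Z : ℂ)) +
      a * (a - 1) * p3 * ((lz u Z : ℂ) * (lz v Z : ℂ))) := by
    ext u v
    simp [lzL_apply]
    ring
  rw [this, ctr_add, ctr_add, ctr_add, ctr_mul, ctr_mul, ctr_mul, ctr_mul, ctr_lz, ctr_lz, ctr_lz,
    ctr_lz, hYY, hZZ, lz_comm Z Y]
  push_cast
  ring

/-- The Todorov operator on products of powers. -/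
theorem ddA_pw {s : ℂ} (w : ℝ × E d) (c a : ℂ) (hY : 0 < lz p Y) (hZ : 0 < lz p Z)
    (hYY : lz Y Y = 0) (hZZ : lz Z Z = 0) :
    ddA s w (pw Y Z c a) p =
      (rho d - 1 - s) * (c * lz w Y * pw Y Z (c - 1) a p + a * lz w Z * pw Y Z c (a - 1) p) -
      c * a * lz Y Z * lz w p * pw Y Z (c - 1) (a - 1) p := by
  rw [ddA, Box_pw c a hY hZ hYY hZZ, (hasFDerivAt_pw c a hY hZ).fderiv, lz_comm p w]
  simp only [_root_.add_apply, _root_.smul_apply, smul_eq_mul, lzL_apply]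
  ring

theorem lz_light (x : S d) : lz (1, (x : E d)) (1, (x : E d)) = 0 := by
  simp [lz]

/-- The Todorov operator in terms of an extension to the cone. -/
theorem dd_eq_ddA {x : S d} {s : ℂ} (hF : ContDiffAt ℝ 2 F (1, (x : E d)))
    (hE : ∀ᶠ p in nhds ((1 : ℝ), (x : E d)), fderiv ℝ F p p = -s * F p)
    {f : S d → ℂ} (hf : f =ᶠ[nhds x] fun y => F (1, (y : E d))) (w : ℝ × E d) :
    dd s w f x = ddA s w F (1, (x : E d)) := dd_ambient hF hE hf w

theorem fderiv_lz_mul_self (w : ℝ × E d) {r : ℂ} (hG : DifferentiableAt ℝ G p)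
    (hE : fderiv ℝ G p p = r * G p) :
    fderiv ℝ (fun q => (lz q w : ℂ) * G q) p p = (1 + r) * ((lz p w : ℂ) * G p) := by
  rw [fderiv_lz_mul w hG]
  simp only [_root_.add_apply, _root_.smul_apply, smul_eq_mul, lzL_apply, hE]
  ring

/-- The light-like vector over a point of the sphere. -/
abbrev lv (x : S d) : ℝ × E d := (1, (x : E d))

theorem eventually_lv_pos {x y : S d} (h : 0 < lz (lv x) (lv y)) :
    ∀ᶠ x' : S d in nhds x, 0 < lz (lv x') (lv y) := by
  have : Continuous fun x' : S d => lz (lv x') (lv y) :=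
    (continuous_lz (lv y)).comp (continuous_const.prodMk continuous_subtype_val)
  exact this.continuousAt.eventually (lt_mem_nhds h)

/-- The Bernstein-Sato identity for the product of powers of the distances. -/
theorem ctr_dd_dd {x y z : S d} (hxy : 0 < lz (lv x) (lv y)) (hxz : 0 < lz (lv x) (lv z))
    (hyz : 0 < lz (lv y) (lv z)) {a b c s t : ℂ} (hs : s = -(a + c)) (ht : t = -(b + c)) :
    (ctr fun w w' => dd s w (fun x => dd t w' (fun y => (lz (lv x) (lv y) : ℂ) ^ c *
      (lz (lv x) (lv z) : ℂ) ^ a * (lz (lv y) (lv z) : ℂ) ^ b) y) x) =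
    c * (c + rho d - 1) * (a + b + c + 2 * rho d - 1) * (a + b + c + rho d) *
      ((lz (lv x) (lv y) : ℂ) ^ (c - 1) * (lz (lv x) (lv z) : ℂ) ^ a *
      (lz (lv y) (lv z) : ℂ) ^ b) := by
  set X := lv x with hX
  set Y := lv y with hY
  set Z := lv z with hZ
  set A := (rho d - 1 - t) * c * (lz Y Z : ℂ) ^ b with hA
  set B := (rho d - 1 - t) * b * (lz Y Z : ℂ) ^ (b - 1) with hB
  set D := -(b * c * (lz Y Z : ℂ) ^ (b - 1)) with hD
  have hYY : lz Y Y = 0 := lz_light y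
  have hZZ : lz Z Z = 0 := lz_light z
  have hXX : lz X X = 0 := lz_light x
  have hpos : ∀ᶠ q in nhds X, 0 < lz q Y ∧ 0 < lz q Z :=
    (eventually_lz_pos hxy).and (eventually_lz_pos hxz)
  -- the inner operator
  have hin : ∀ w', (fun x => dd t w' (fun y => (lz (lv x) (lv y) : ℂ) ^ c *
      (lz (lv x) Z : ℂ) ^ a * (lz (lv y) Z : ℂ) ^ b) y) =ᶠ[nhds x] fun x =>
      (fun q => (A * ((lz q w' : ℂ) * pw Y Z (c - 1) a q) + (B * lz w' Z) * pw Y Z c a q) +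
        (D * lz w' Y) * pw Y Z (c - 1) (a + 1) q) (lv x) := by
    intro w'
    filter_upwards [eventually_lv_pos hxy, eventually_lv_pos hxz] with x' h1 h2
    have h1' : 0 < lz Y (lv x') := by rwa [lz_comm]
    have hcd : ContDiffAt ℝ 2 (pw (lv x') Z c b) Y := contDiffAt_pw c b h1' hyz
    rw [dd_eq_ddA (F := fun q => (lz (lv x') Z : ℂ) ^ a * pw (lv x') Z c b q)
      (contDiffAt_const.mul hcd) ?_ ?_, ddA_const_mul t w' _ hcd,
      ddA_pw w' c b h1' hyz (lz_light x') hZZ]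
    · simp only [pw, hA, hB, hD]
      rw [lz_comm Y (lv x'), lz_comm w' (lv x'),
        Complex.cpow_add _ _ (by exact_mod_cast h2.ne' : (lz (lv x') Z : ℂ) ≠ 0), Complex.cpow_one]
      ring
    · filter_upwards [eventually_lz_pos h1', eventually_lz_pos hyz] with q h3 h4
      rw [fderiv_const_mul ((contDiffAt_pw c b h3 h4).differentiableAt (by simp)),
        _root_.smul_apply, fderiv_pw_self c b h3 h4, ht, smul_eq_mul]
      ring
    · refine Filter.Eventually.of_forall fun y' => ?_
      simp only [pw]
      rw [lz_comm (lv x') (1, (y' : E d))]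
      ring
  have c1 := contDiffAt_pw (c - 1) a hxy hxz
  have c2 := contDiffAt_pw c a hxy hxz
  have c3 := contDiffAt_pw (c - 1) (a + 1) hxy hxz
  have e1 : ∀ w', ContDiffAt ℝ 2 (fun q => A * ((lz q w' : ℂ) * pw Y Z (c - 1) a q)) X :=
    fun w' => contDiffAt_const.mul (contDiffAt_lz_mul w' c1)
  have e2 : ∀ w', ContDiffAt ℝ 2 (fun q => (B * lz w' Z) * pw Y Z c a q) X :=
    fun w' => contDiffAt_const.mul c2
  have e3 : ∀ w', ContDiffAt ℝ 2 (fun q => (D * lz w' Y) * pw Y Z (c - 1) (a + 1) q) X :=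
    fun w' => contDiffAt_const.mul c3
  have hmain : (fun w w' => dd s w (fun x => dd t w' (fun y => (lz (lv x) (lv y) : ℂ) ^ c *
      (lz (lv x) Z : ℂ) ^ a * (lz (lv y) Z : ℂ) ^ b) y) x) = fun w w' =>
      (A * ddA s w (fun q => (lz q w' : ℂ) * pw Y Z (c - 1) a q) X +
      B * (ddA s w (pw Y Z c a) X * lz w' Z)) + D * (ddA s w (pw Y Z (c - 1) (a + 1)) X * lz w' Y)
      := by
    ext w w'
    rw [dd_eq_ddA (((e1 w').add (e2 w')).add (e3 w')) ?_ (hin w') w]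
    · rw [ddA_add s w ((e1 w').add (e2 w')) (e3 w'), ddA_add s w (e1 w') (e2 w'),
        ddA_const_mul s w _ (contDiffAt_lz_mul w' c1), ddA_const_mul s w _ c2,
        ddA_const_mul s w _ c3]
      ring
    · filter_upwards [hpos] with q hq
      have k1 := (contDiffAt_pw (c - 1) a hq.1 hq.2).differentiableAt (by simp)
      have k2 := (contDiffAt_pw c a hq.1 hq.2).differentiableAt (by simp)
      have k3 := (contDiffAt_pw (c - 1) (a + 1) hq.1 hq.2).differentiableAt (by simp)
      have k4 := (contDiffAt_lz_mul w' (contDiffAt_pw (c - 1) a hq.1 hq.2)).differentiableAt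
        (by simp)
      rw [fderiv_fun_add ((k4.const_mul _).fun_add (k2.const_mul _)) (k3.const_mul _),
        fderiv_fun_add (k4.const_mul _) (k2.const_mul _), fderiv_const_mul k4, fderiv_const_mul k2,
        fderiv_const_mul k3]
      simp only [_root_.add_apply, _root_.smul_apply, smul_eq_mul]
      rw [fderiv_lz_mul_self w' k1 (fderiv_pw_self _ _ hq.1 hq.2), fderiv_pw_self _ _ hq.1 hq.2,
        fderiv_pw_self _ _ hq.1 hq.2, hs]
      ring
  have hL : ∀ c a : ℂ, ∀ V : ℝ × E d, ctr (fun w w' => ddA s w (pw Y Z c a) X * lz w' V) =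
      ddA s V (pw Y Z c a) X := by
    intro c a V
    have := ctr_lz_apply ((rho d - 1 - s) • fderiv ℝ (pw Y Z c a) X -
      (1 / 2 * Box (pw Y Z c a) X) • lzL X) V
    simp only [_root_.sub_apply, _root_.smul_apply, smul_eq_mul, lzL_apply] at this
    simp only [ddA, lz_comm X]
    rw [← sub_eq_zero] at this ⊢
    rw [← this]
    congr 1
    · congr 1
      ext w w'
      ring
    · ring
  rw [hmain, ctr_add, ctr_add, ctr_mul, ctr_mul, ctr_mul, hL, hL, ctr_ddA_lz_mul s hXX c1 (by
      rw [fderiv_pw_self _ _ hxy hxz, hs]; ring),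
    ddA_pw Z c a hxy hxz hYY hZZ, ddA_pw Y (c - 1) (a + 1) hxy hxz hYY hZZ, hYY, hZZ,
    lz_comm Z Y, lz_comm Z X, lz_comm Y X]
  have p1 : pw Y Z (c - 1) a X = lz X Z * pw Y Z (c - 1) (a - 1) X := pw_succ_right _ _ hxz
  have p2 : pw Y Z (c - 1) a X = lz X Y * pw Y Z (c - 1 - 1) a X := pw_succ_left _ _ hxy
  have p3 : (lz Y Z : ℂ) ^ b = lz Y Z * (lz Y Z : ℂ) ^ (b - 1) := by
    have : (lz Y Z : ℂ) ≠ 0 := by exact_mod_cast hyz.ne'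
    rw [Complex.cpow_sub _ _ this, Complex.cpow_one]
    field_simp
  have p4 : (lz X Y : ℂ) ^ (c - 1) * (lz X Z : ℂ) ^ a = pw Y Z (c - 1) a X := rfl
  rw [p4, add_sub_cancel_right, hA, hB, hD]
  simp only [Complex.ofReal_zero, mul_zero, zero_mul, add_zero]
  have hd2 : (d : ℂ) = 2 * rho d := by simp [rho]; ring
  generalize pw Y Z (c - 1) (a - 1) X = q1 at *
  generalize pw Y Z (c - 1 - 1) a X = q2 at *
  generalize pw Y Z (c - 1) a X = q at *
  generalize (lz Y Z : ℂ) ^ (b - 1) = r1 at *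
  generalize (lz Y Z : ℂ) ^ b = r at *
  generalize (lz X Z : ℂ) = u at *
  generalize (lz X Y : ℂ) = v at *
  generalize (lz Y Z : ℂ) = w at *
  subst p3
  have e4 : w * u * q1 = w * q := by rw [p1]; ring
  have e5 : v * q2 = q := p2.symm
  rw [hd2, hs, ht]
  linear_combination (-(rho d - 1 + (b + c)) * b * r1 * c * a) * e4 +
    (b * c * r1 * (c - 1) * (a + 1) * w) * e5

end bernstein

/-! ### Existence of covariant operators -/

open MvPolynomial TwoVectors

/-- Half of the square distance of the two variables. -/
def halfSq (d : ℕ) : Pol (Fin (d + 1)) := C (1 / 2) * sqDist d 2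

theorem halfSq_apply (x y : S d) : (polyCSS (halfSq d)).1 (x, y) = (lz (lv x) (lv y) : ℂ) := by
  rw [halfSq, ← smul_eq_C_mul, polyCSS_smul, sqDist_two, lz]
  push_cast
  ring

theorem lz_lv_eq (x y : S d) : lz (lv x) (lv y) = ‖(x : E d) - y‖ ^ 2 / 2 := by
  rw [norm_sub_sq_real, norm_coe, norm_coe, lz]
  ring

theorem lz_lv_pos {x y : S d} (h : x ≠ y) : 0 < lz (lv x) (lv y) := by
  rw [lz_lv_eq]
  have : (x : E d) - y ≠ 0 := sub_ne_zero.2 fun h' => h (Subtype.ext h')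
  positivity

theorem exists_ne_pair (hd : 1 ≤ d) (x y : S d) : ∃ z : S d, x ≠ z ∧ y ≠ z := by
  have h01 : (pole d) ≠ ⟨bv ⟨1, by omega⟩, by simp [bv]⟩ := fun h => by
    have h2 : ((pole d : S d) : E d) 0 = bv (d := d) ⟨1, by omega⟩ 0 :=
      congrArg (fun z : S d => (z : E d) 0) h
    rw [pole_zero, bv_apply, if_neg (by intro h; simpa using congrArg Fin.val h)] at h2
    exact one_ne_zero h2
  by_contra! hcon
  have hz : ∀ z : S d, z = x ∨ z = y := fun z => by
    by_cases h : x = z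
    · exact .inl h.symm
    · exact .inr (hcon z h).symm
  have hneg : ∀ z : S d, -z ≠ z := fun z h => by
    have : -(z : E d) = z := congrArg Subtype.val h
    have h2 : (2 : ℝ) • (z : E d) = 0 := by
      rw [two_smul]; nth_rewrite 1 [← this]; exact neg_add_cancel _
    exact coe_ne_zero z ((smul_eq_zero.1 h2).resolve_left two_ne_zero)
  set u : S d := ⟨bv ⟨1, by omega⟩, by simp [bv]⟩ with hu
  have hup : -pole d ≠ u := fun h => by
    have h2 : (((-pole d : S d)) : E d) 0 = bv (d := d) ⟨1, by omega⟩ 0 :=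
      congrArg (fun z : S d => (z : E d) 0) h
    rw [bv_apply, if_neg (by intro h; simpa using congrArg Fin.val h)] at h2
    have h3 : (-(pole d : E d)) 0 = 0 := h2
    simp [pole_zero] at h3
  rcases hz (pole d) with h1 | h1 <;> rcases hz u with h2 | h2 <;> rcases hz (-pole d) with h3 | h3
  · exact h01 (h1.trans h2.symm)
  · exact h01 (h1.trans h2.symm)
  · exact hneg _ (h3.trans h1.symm)
  · exact hup (h3.trans h2.symm)
  · exact hup (h3.trans h2.symm)
  · exact hneg _ (h3.trans h1.symm)
  · exact h01 (h1.trans h2.symm)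
  · exact h01 (h1.trans h2.symm)

/-- The constant of the Bernstein-Sato identity. -/
def bernConst (d : ℕ) (c : ℂ) : ℂ := c * (c + rho d - 1) * (c + 2 * rho d - 1) * (c + rho d)

theorem continuous_CSS (f : CSS d) : Continuous f.1 := f.2.continuous

theorem CSS_ext_off_diagonal (hd : 1 ≤ d) {f g : CSS d}
    (h : ∀ x y : S d, x ≠ y → f.1 (x, y) = g.1 (x, y)) : f = g := by
  ext ⟨x, y⟩
  by_cases hxy : x = y
  swap
  · exact h x y hxy
  subst hxy
  obtain ⟨F, hF⟩ : ∃ F : ℝ → S d, ContinuousAt F 0 ∧ F 0 = x ∧ ∀ᶠ t in nhdsWithin 0 {0}ᶜ, x ≠ F t := by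
    obtain ⟨z, hz, hz'⟩ := exists_ne_pair hd x (-x)
    have hlin : ∀ t : ℝ, t ≠ 0 → ∀ r : ℝ, (x : E d) + t • (z : E d) ≠ r • (x : E d) := by
      intro t ht r h
      have h1 : (z : E d) = ((r - 1) / t) • (x : E d) := by
        have : t • (z : E d) = (r - 1) • (x : E d) := by
          rw [sub_smul, one_smul, ← h]; abel
        rw [div_eq_inv_mul, mul_smul, ← this, smul_smul, inv_mul_cancel₀ ht, one_smul]
      have h2 : |(r - 1) / t| = 1 := by
        have := congrArg norm h1
        rwa [norm_smul, norm_coe, norm_coe, mul_one, Real.norm_eq_abs, eq_comm] at this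
      rcases abs_eq_abs.1 (h2.trans abs_one.symm) with h3 | h3
      · rw [h3, one_smul] at h1
        exact hz (Subtype.ext h1.symm)
      · rw [h3, neg_one_smul] at h1
        exact hz' (Subtype.ext h1.symm)
    refine ⟨fun t => proj ((x : E d) + t • (z : E d)), ?_, by simp [proj_coe], ?_⟩
    · have h1 : ContinuousAt (proj (d := d)) ((x : E d) + (0 : ℝ) • (z : E d)) := by
        rw [zero_smul, add_zero]
        exact (contMDiffAt_proj (coe_ne_zero x) (m := 0)).continuousAt
      exact ContinuousAt.comp (f := fun t : ℝ => (x : E d) + t • (z : E d)) (x := (0 : ℝ)) h1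
        (by fun_prop)
    · filter_upwards [self_mem_nhdsWithin] with t ht h
      have h0 : (x : E d) + t • (z : E d) ≠ 0 := by simpa using hlin t ht 0
      have h1 : (x : E d) = ‖(x : E d) + t • (z : E d)‖⁻¹ • ((x : E d) + t • (z : E d)) := by
        rw [← coe_proj h0, ← h]
      apply hlin t ht ‖(x : E d) + t • (z : E d)‖
      nth_rewrite 3 [h1]
      rw [smul_smul, mul_inv_cancel₀ (norm_ne_zero_iff.2 h0), one_smul]
  obtain ⟨hc, h0, hne⟩ := hF
  have hl : ∀ f : CSS d, Filter.Tendsto (fun t => f.1 (x, F t)) (nhdsWithin 0 {0}ᶜ)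
      (nhds (f.1 (x, x))) := by
    intro f
    have h1 : ContinuousAt (fun t => f.1 (x, F t)) 0 :=
      ContinuousAt.comp (g := f.1) (f := fun t => (x, F t)) (continuous_CSS f).continuousAt
        (continuousAt_const.prodMk hc)
    have := h1.tendsto
    rw [h0] at this
    exact this.mono_left nhdsWithin_le_nhds
  refine tendsto_nhds_unique ((hl f).congr' ?_) (hl g)
  filter_upwards [hne] with t ht
  exact h x (F t) ht

theorem DD_halfSq (hd : 1 ≤ d) (j : ℕ) :
    DD (-(j + 1 : ℂ)) (-(j + 1 : ℂ)) (polyCSS (halfSq d ^ (j + 1))) =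
      bernConst d (j + 1) • polyCSS (halfSq d ^ j) := by
  refine CSS_ext_off_diagonal hd fun x y hxy => ?_
  obtain ⟨z, hxz, hyz⟩ := exists_ne_pair hd x y
  have h := ctr_dd_dd (a := 0) (b := 0) (c := (j + 1 : ℂ)) (lz_lv_pos hxy) (lz_lv_pos hxz)
    (lz_lv_pos hyz) (s := -(j + 1 : ℂ)) (t := -(j + 1 : ℂ)) (by ring) (by ring)
  rw [DD_apply]
  have hp : ∀ x y : S d, (polyCSS (halfSq d ^ (j + 1))).1 (x, y) = (lz (lv x) (lv y) : ℂ) ^ (j + 1 : ℂ) *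
      (lz (lv x) (lv z) : ℂ) ^ (0 : ℂ) * (lz (lv y) (lv z) : ℂ) ^ (0 : ℂ) := by
    intro x y
    rw [polyCSS_pow, halfSq_apply, Complex.cpow_zero, Complex.cpow_zero, mul_one, mul_one]
    exact_mod_cast rfl
  simp only [hp]
  rw [h, add_sub_cancel_right, Complex.cpow_natCast, Complex.cpow_zero, Complex.cpow_zero]
  have : (bernConst d (j + 1) • polyCSS (halfSq d ^ j)).1 (x, y) =
    bernConst d (j + 1) * (polyCSS (halfSq d ^ j)).1 (x, y) := rfl
  rw [this, polyCSS_pow, halfSq_apply, bernConst]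
  ring

theorem bernConst_ne_zero (hd : 1 ≤ d) (j : ℕ) : bernConst d (j + 1) ≠ 0 := by
  have h1 : (bernConst d (j + 1)) =
      (((j + 1 : ℝ) * (j + d / 2) * (j + d) * (j + 1 + d / 2) : ℝ) : ℂ) := by
    simp only [bernConst, rho]; push_cast; ring
  have : (0 : ℝ) < d := by exact_mod_cast hd
  rw [h1]
  exact_mod_cast (by positivity : (0 : ℝ) < (j + 1 : ℝ) * (j + d / 2) * (j + d) * (j + 1 + d / 2)).ne'

theorem DDpow_halfSq (hd : 1 ≤ d) (k : ℕ) : ∀ i ≤ k, ∃ c : ℂ, c ≠ 0 ∧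
    DDpow (-(k : ℂ)) (-(k : ℂ)) i (polyCSS (halfSq d ^ k)) = c • polyCSS (halfSq d ^ (k - i)) := by
  intro i
  induction i with
  | zero => exact fun _ => ⟨1, one_ne_zero, by simp [DDpow]⟩
  | succ i ih =>
    intro hi
    obtain ⟨c, hc, h⟩ := ih (by omega)
    obtain ⟨j, rfl⟩ : ∃ j, k = j + 1 + i := ⟨k - i - 1, by omega⟩
    have e1 : j + 1 + i - i = j + 1 := by omega
    have e2 : j + 1 + i - (i + 1) = j := by omega
    have e3 : (-((j + 1 + i : ℕ) : ℂ) + i) = -(j + 1 : ℂ) := by push_cast; ring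
    refine ⟨c * bernConst d (j + 1), mul_ne_zero hc (bernConst_ne_zero hd j), ?_⟩
    rw [DDpow, Module.End.mul_apply, h, map_smul, e1, e2, e3, DD_halfSq hd, smul_smul]

theorem BB_base_ne_zero (hd : 1 ≤ d) (k : ℕ) : (BB k (-(k : ℂ)) (-(k : ℂ)) : CSS d →ₗ[ℂ] CS d) ≠ 0 := by
  intro h
  obtain ⟨c, hc, h1⟩ := DDpow_halfSq (d := d) hd k k le_rfl
  have h2 := congrFun (congrArg Subtype.val (LinearMap.congr_fun h (polyCSS (halfSq d ^ k)))) (pole d)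
  rw [BB, LinearMap.comp_apply, h1] at h2
  have h3 : c * (polyCSS (halfSq d ^ (k - k))).1 (pole d, pole d) = 0 := h2
  rw [Nat.sub_self, pow_zero, polyCSS_one, mul_one] at h3
  exact hc h3

section polyFam

variable {L L' L'' : Type*} [AddCommMonoid L] [Module ℂ L] [AddCommMonoid L'] [Module ℂ L']
  [AddCommMonoid L''] [Module ℂ L'']

/-- A family that depends polynomially on a parameter, with coefficients in a subspace. -/
def PolyFam (W : Submodule ℂ L) (A : ℂ → L) : Prop :=
  ∃ n, ∃ C : ℕ → L, (∀ j, C j ∈ W) ∧ ∀ ε, A ε = ∑ j ∈ Finset.range n, ε ^ j • C j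

variable {W : Submodule ℂ L} {W' : Submodule ℂ L'} {W'' : Submodule ℂ L''}

theorem PolyFam.monomial (j : ℕ) {c : L} (hc : c ∈ W) : PolyFam W fun ε => ε ^ j • c := by
  refine ⟨j + 1, fun i => if i = j then c else 0, fun i => ?_, fun ε => ?_⟩
  · dsimp only
    split_ifs
    exacts [hc, W.zero_mem]
  · rw [Finset.sum_eq_single j]
    · simp
    · intro i _ hi; simp [hi]
    · simp

theorem PolyFam.const {c : L} (hc : c ∈ W) : PolyFam W fun _ => c := by
  simpa using PolyFam.monomial (W := W) 0 hc

theorem PolyFam.add {A A' : ℂ → L} (h : PolyFam W A) (h' : PolyFam W A') :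
    PolyFam W fun ε => A ε + A' ε := by
  obtain ⟨n, C, hC, hA⟩ := h
  obtain ⟨n', C', hC', hA'⟩ := h'
  refine ⟨n + n', fun j => (if j < n then C j else 0) + (if j < n' then C' j else 0), fun j => ?_,
    fun ε => ?_⟩
  · refine W.add_mem ?_ ?_
    · split_ifs
      exacts [hC j, W.zero_mem]
    · split_ifs
      exacts [hC' j, W.zero_mem]
  · have key : ∀ (m : ℕ) (D : ℕ → L), m ≤ n + n' → ∑ j ∈ Finset.range m, ε ^ j • D j =
        ∑ j ∈ Finset.range (n + n'), ε ^ j • (if j < m then D j else 0) := by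
      intro m D hm
      rw [← Finset.sum_subset (Finset.range_mono hm)]
      · refine Finset.sum_congr rfl fun j hj => ?_
        rw [if_pos (Finset.mem_range.1 hj)]
      · intro j _ hj
        rw [if_neg (by simpa using hj), smul_zero]
    dsimp only
    rw [hA, hA', key n C (by omega), key n' C' (by omega), ← Finset.sum_add_distrib]
    simp only [smul_add]

theorem PolyFam.sum {ι : Type*} (s : Finset ι) {A : ι → ℂ → L} (h : ∀ i ∈ s, PolyFam W (A i)) :
    PolyFam W fun ε => ∑ i ∈ s, A i ε := by
  classical
  induction s using Finset.induction_on with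
  | empty => simpa using PolyFam.const W.zero_mem
  | insert i s hi ih =>
    simp only [Finset.sum_insert hi]
    exact (h i (by simp)).add (ih fun j hj => h j (by simp [hj]))

theorem PolyFam.map {A : ℂ → L} (h : PolyFam W A) (g : L →ₗ[ℂ] L') (hg : ∀ c ∈ W, g c ∈ W') :
    PolyFam W' fun ε => g (A ε) := by
  obtain ⟨n, C, hC, hA⟩ := h
  exact ⟨n, fun j => g (C j), fun j => hg _ (hC j), fun ε => by simp [hA]⟩

theorem PolyFam.map₂ {A : ℂ → L} {A' : ℂ → L'} (h : PolyFam W A) (h' : PolyFam W' A')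
    (g : L →ₗ[ℂ] L' →ₗ[ℂ] L'') (hg : ∀ c ∈ W, ∀ c' ∈ W', g c c' ∈ W'') :
    PolyFam W'' fun ε => g (A ε) (A' ε) := by
  obtain ⟨n, C, hC, hA⟩ := h
  obtain ⟨n', C', hC', hA'⟩ := h'
  have : (fun ε => g (A ε) (A' ε)) = fun ε => ∑ i ∈ Finset.range n, ∑ j ∈ Finset.range n',
      ε ^ (i + j) • g (C i) (C' j) := by
    ext ε
    rw [hA, hA']
    simp only [map_sum, LinearMap.sum_apply, map_smul, LinearMap.smul_apply, Finset.smul_sum,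
      smul_smul, pow_add]
    rw [Finset.sum_comm]
    simp only [mul_comm]
  rw [this]
  exact PolyFam.sum _ fun i _ => PolyFam.sum _ fun j _ =>
    PolyFam.monomial _ (hg _ (hC i) _ (hC' j))

theorem PolyFam.exists_lowest {A : ℂ → L} (h : PolyFam W A) {ε₀ : ℂ} (h0 : A ε₀ ≠ 0) :
    ∃ j₀ n, ∃ C : ℕ → L, C 0 ≠ 0 ∧ (∀ j, C j ∈ W) ∧
      ∀ ε, A ε = ε ^ j₀ • ∑ j ∈ Finset.range (n + 1), ε ^ j • C j := by
  classical
  obtain ⟨n, C, hC, hA⟩ := h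
  have hex : ∃ j, j < n ∧ C j ≠ 0 := by
    by_contra! hcon
    apply h0
    rw [hA]
    exact Finset.sum_eq_zero fun j hj => by rw [hcon j (Finset.mem_range.1 hj), smul_zero]
  obtain ⟨h1, h2⟩ := Nat.find_spec hex
  set j₀ := Nat.find hex with hj
  obtain ⟨m, hm⟩ : ∃ m, n = j₀ + (m + 1) := ⟨n - j₀ - 1, by omega⟩
  refine ⟨j₀, m, fun j => C (j₀ + j), h2, fun j => hC _, fun ε => ?_⟩
  rw [hA, hm, Finset.sum_range_add, Finset.sum_eq_zero, zero_add, Finset.smul_sum]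
  · simp only [pow_add, smul_smul]
  · intro j hj'
    have hlt := Finset.mem_range.1 hj'
    have := Nat.find_min hex hlt
    rw [not_and, not_not] at this
    rw [this (by omega), smul_zero]

end polyFam

/-- The operators that lower the order of vanishing by at most `M`. -/
def jetOps (d M : ℕ) : Submodule ℂ (Module.End ℂ (CSS d)) where
  carrier := {A | ∀ N p f, f ∈ jetIdeal (N + M) p → A f ∈ jetIdeal N p}
  add_mem' {A B} hA hB N p f hf := add_mem (hA N p f hf) (hB N p f hf)
  zero_mem' N p f _ := zero_mem _
  smul_mem' c A hA N p f hf := Submodule.smul_mem _ c (hA N p f hf)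

theorem jetOps_mul {M M' : ℕ} {A A' : Module.End ℂ (CSS d)} (hA : A ∈ jetOps d M)
    (hA' : A' ∈ jetOps d M') : A * A' ∈ jetOps d (M + M') := by
  intro N p f hf
  exact hA N p _ (hA' (N + M) p f (by rwa [add_assoc]))

theorem ddx_quadratic (s : ℂ) (w : ℝ × E d) : ddx s w = ddx 0 w +
    s • ((1 / 2 : ℂ) • (ddx 1 w + (-1 : ℂ) • ddx (-1) w)) +
    s ^ 2 • ((1 / 2 : ℂ) • (ddx 1 w + ddx (-1) w) + (-1 : ℂ) • ddx 0 w) := by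
  ext f p
  have : ∀ s, (ddx s w f).1 p = dd s w (fun x => f.1 (x, p.2)) p.1 := fun _ => rfl
  simp only [LinearMap.add_apply, LinearMap.smul_apply, Submodule.coe_add, Submodule.coe_smul,
    Pi.add_apply, Pi.smul_apply, this, dd, smul_eq_mul]
  ring

theorem ddy_quadratic (s : ℂ) (w : ℝ × E d) : ddy s w = ddy 0 w +
    s • ((1 / 2 : ℂ) • (ddy 1 w + (-1 : ℂ) • ddy (-1) w)) +
    s ^ 2 • ((1 / 2 : ℂ) • (ddy 1 w + ddy (-1) w) + (-1 : ℂ) • ddy 0 w) := by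
  ext f p
  have : ∀ s, (ddy s w f).1 p = dd s w (fun y => f.1 (p.1, y)) p.2 := fun _ => rfl
  simp only [LinearMap.add_apply, LinearMap.smul_apply, Submodule.coe_add, Submodule.coe_smul,
    Pi.add_apply, Pi.smul_apply, this, dd, smul_eq_mul]
  ring

theorem PolyFam.quadratic {L : Type*} [AddCommMonoid L] [Module ℂ L] {W : Submodule ℂ L}
    {a b c : L} (ha : a ∈ W) (hb : b ∈ W) (hc : c ∈ W) (s₀ s₁ : ℂ) :
    PolyFam W fun ε => a + (s₀ + ε * s₁) • b + (s₀ + ε * s₁) ^ 2 • c := by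
  have h := (PolyFam.const (W := W) (add_mem (add_mem ha (W.smul_mem s₀ hb))
    (W.smul_mem (s₀ ^ 2) hc))).add ((PolyFam.monomial (W := W) 1
    (add_mem (W.smul_mem s₁ hb) (W.smul_mem (2 * s₀ * s₁) hc))).add
    (PolyFam.monomial (W := W) 2 (W.smul_mem (s₁ ^ 2) hc)))
  refine Eq.mp (congrArg _ ?_) h
  ext ε
  module

theorem polyFam_ddx (s₀ s₁ : ℂ) (w : ℝ × E d) : PolyFam (jetOps d 2) fun ε => ddx (s₀ + ε * s₁) w := by
  have h : ∀ s, ddx s w ∈ jetOps d 2 := fun s N p f hf => ddx_mem s w hf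
  simp only [ddx_quadratic (_ + _)]
  exact PolyFam.quadratic (h _) (Submodule.smul_mem _ _ (add_mem (h _) (Submodule.smul_mem _ _ (h _))))
    (add_mem (Submodule.smul_mem _ _ (add_mem (h _) (h _))) (Submodule.smul_mem _ _ (h _))) _ _

theorem polyFam_ddy (s₀ s₁ : ℂ) (w : ℝ × E d) : PolyFam (jetOps d 2) fun ε => ddy (s₀ + ε * s₁) w := by
  have h : ∀ s, ddy s w ∈ jetOps d 2 := fun s N p f hf => ddy_mem s w hf
  simp only [ddy_quadratic (_ + _)]
  exact PolyFam.quadratic (h _) (Submodule.smul_mem _ _ (add_mem (h _) (Submodule.smul_mem _ _ (h _))))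
    (add_mem (Submodule.smul_mem _ _ (add_mem (h _) (h _))) (Submodule.smul_mem _ _ (h _))) _ _

theorem PolyFam.mul {M M' : ℕ} {A A' : ℂ → Module.End ℂ (CSS d)} (h : PolyFam (jetOps d M) A)
    (h' : PolyFam (jetOps d M') A') : PolyFam (jetOps d (M + M')) fun ε => A ε * A' ε :=
  h.map₂ h' (LinearMap.mul ℂ _) fun _ hc _ hc' => jetOps_mul hc hc'

theorem DD_eq_add (s t : ℂ) : DD s t = ddx s (1, (0 : E d)) * ddy t (1, (0 : E d)) +
    (-1 : ℂ) • ∑ i, ddx s ((0 : ℝ), bv (d := d) i) * ddy t (0, bv i) := by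
  ext f p
  have : (DD s t f).1 p = ((ddx s (1, (0 : E d)) * ddy t (1, (0 : E d))) f).1 p -
      ((∑ i, ddx s ((0 : ℝ), bv (d := d) i) * ddy t (0, bv i)) f).1 p := rfl
  rw [this, sub_eq_add_neg, ← neg_one_mul]
  rfl

theorem polyFam_DD (s₀ s₁ t₀ t₁ : ℂ) :
    PolyFam (jetOps d 4) fun ε => DD (s₀ + ε * s₁) (t₀ + ε * t₁) := by
  simp only [DD_eq_add]
  exact ((polyFam_ddx s₀ s₁ (1, (0 : E d))).mul (polyFam_ddy t₀ t₁ (1, (0 : E d)))).add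
    ((PolyFam.sum Finset.univ fun i _ => (polyFam_ddx s₀ s₁ _).mul (polyFam_ddy t₀ t₁ _)).map
      ((-1 : ℂ) • LinearMap.id) fun c hc => Submodule.smul_mem _ _ hc)

theorem polyFam_DDpow (s₀ s₁ t₀ t₁ : ℂ) (k : ℕ) :
    PolyFam (jetOps d (4 * k)) fun ε => DDpow (s₀ + ε * s₁) (t₀ + ε * t₁) k := by
  induction k with
  | zero => exact PolyFam.const (fun N p f hf => by simpa using hf)
  | succ k ih =>
    have h := (polyFam_DD (s₀ + k) s₁ (t₀ + k) t₁).mul ih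
    rw [show 4 * (k + 1) = 4 + 4 * k by ring]
    refine Eq.mp (congrArg _ ?_) h
    ext1 ε
    rw [DDpow, add_right_comm, add_right_comm t₀]

/-- The operators that factor through jets on the diagonal. -/
def diagOps (d M : ℕ) : Submodule ℂ (CSS d →ₗ[ℂ] CS d) where
  carrier := {B | ∀ x, ∀ f ∈ jetIdeal M (x, x), (B f).1 x = 0}
  add_mem' {A B} hA hB x f hf := by
    have : ((A + B) f).1 x = (A f).1 x + (B f).1 x := rfl
    rw [this, hA x f hf, hB x f hf, add_zero]
  zero_mem' x f _ := rfl
  smul_mem' c A hA x f hf := by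
    have : ((c • A) f).1 x = c * (A f).1 x := rfl
    rw [this, hA x f hf, mul_zero]

theorem polyFam_BB (s₀ s₁ t₀ t₁ : ℂ) (k : ℕ) :
    PolyFam (diagOps d (4 * k)) fun ε => BB k (s₀ + ε * s₁) (t₀ + ε * t₁) := by
  refine (polyFam_DDpow s₀ s₁ t₀ t₁ k).map (LinearMap.llcomp ℂ _ _ _ resDiag) fun A hA x f hf => ?_
  have h1 := hA 0 (x, x) f (by simpa using hf)
  have h2 := JV_zero_iff.1 (show JV 0 _ _ from h1)
  rwa [Ext_coe (p := (x, x))] at h2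

theorem contMDiff_log_kappa (g : SO0 d) :
    ContMDiff (𝓡 d) 𝓘(ℝ, ℂ) ∞ (fun x => ((Real.log (kappa g x) : ℝ) : ℂ)) := by
  intro x
  have h : ContDiffAt ℝ ∞ (fun t : ℝ => ((Real.log t : ℝ) : ℂ)) (kappa g x) :=
    Complex.ofRealCLM.contDiff.contDiffAt.comp (kappa g x)
      (Real.contDiffAt_log.2 (kappa_pos g x).ne')
  exact h.contMDiffAt.comp x (contMDiff_kappa g x)

/-- The logarithmic derivative of the factor of automorphy along a line of parameters. -/
def logKappa (l m : ℂ) (g : SO0 d) : CSS d :=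
  ⟨fun p => l * ((Real.log (kappa g p.1) : ℝ) : ℂ) + m * ((Real.log (kappa g p.2) : ℝ) : ℂ),
    (contMDiff_mul_complex contMDiff_const ((contMDiff_log_kappa g).comp contMDiff_fst)).add
      (contMDiff_mul_complex contMDiff_const ((contMDiff_log_kappa g).comp contMDiff_snd))⟩

/-- The exponential of a smooth function. -/
def expCSS (φ : CSS d) (ε : ℝ) : CSS d :=
  ⟨fun p => Complex.exp (ε * φ.1 p), by
    have h : ContDiff ℝ ∞ (fun z : ℂ => Complex.exp (ε * z)) :=
      (contDiff_const.mul contDiff_id).cexp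
    exact h.contMDiff.comp φ.2⟩

theorem piTensor_line (l m l' m' : ℂ) (g : SO0 d) (f : CSS d) (ε : ℝ) :
    piTensor (l + ε * l') (m + ε * m') g f =
      mulCSS (expCSS (logKappa l' m' g⁻¹) ε) (piTensor l m g f) := by
  have hk : ∀ (x : S d) (a b : ℂ), (kappa g⁻¹ x : ℂ) ^ (a + ε * b) =
      (kappa g⁻¹ x : ℂ) ^ a * Complex.exp (ε * (b * ((Real.log (kappa g⁻¹ x) : ℝ) : ℂ))) := by
    intro x a b
    have h0 : (kappa g⁻¹ x : ℂ) ≠ 0 := by exact_mod_cast (kappa_pos g⁻¹ x).ne'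
    rw [Complex.cpow_add _ _ h0, Complex.cpow_def_of_ne_zero h0 (ε * b),
      ← Complex.ofReal_log (kappa_pos g⁻¹ x).le]
    ring_nf
  ext ⟨x, y⟩
  change (kappa g⁻¹ x : ℂ) ^ (rho d + (l + ε * l')) * (kappa g⁻¹ y : ℂ) ^ (rho d + (m + ε * m')) * _ =
    Complex.exp (ε * (l' * ((Real.log (kappa g⁻¹ x) : ℝ) : ℂ) +
      m' * ((Real.log (kappa g⁻¹ y) : ℝ) : ℂ))) *
    ((kappa g⁻¹ x : ℂ) ^ (rho d + l) * (kappa g⁻¹ y : ℂ) ^ (rho d + m) * _)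
  rw [← add_assoc, ← add_assoc, hk, hk, mul_add, Complex.exp_add]
  ring

theorem continuousAt_functional_expCSS {N : ℕ} {p : S d × S d} {T : CSS d →ₗ[ℂ] ℂ}
    (hT : ∀ f ∈ jetIdeal N p, T f = 0) (φ f : CSS d) :
    ContinuousAt (fun ε => T (mulCSS (expCSS φ ε) f)) 0 := by
  refine (hasDerivAt_functional hT (F' := mulCSS φ f) ?_ ?_).continuousAt
  · have h1 : ContDiffAt ℝ ∞ (fun q : ℝ × (E d × E d) => Complex.exp ((q.1 : ℂ) * Ext φ.1 q.2))
        ((0 : ℝ), ((p.1 : E d), (p.2 : E d))) :=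
      ((Complex.ofRealCLM.contDiff.contDiffAt.comp _ contDiffAt_fst).mul
        (ContDiffAt.comp (g := Ext φ.1) _ (contDiffAt_Ext_coe φ p) contDiffAt_snd)).cexp
    exact h1.mul (ContDiffAt.comp (g := Ext f.1) _ (contDiffAt_Ext_coe f p) contDiffAt_snd)
  · intro q
    have h1 : HasDerivAt (fun t : ℝ => (t : ℂ) * φ.1 q) (1 * φ.1 q) 0 :=
      (Complex.ofRealCLM.hasDerivAt (x := (0 : ℝ))).mul_const _
    have h2 := (h1.cexp.mul_const (f.1 q)).deriv
    have h3 : (fun t => (mulCSS (expCSS φ t) f).1 q) =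
      fun t : ℝ => Complex.exp ((t : ℂ) * φ.1 q) * f.1 q := rfl
    rw [h3, h2]
    simp
    rfl

/-- Existence of covariant bi-differential operators. -/
theorem BD.exists_ne_zero (hd : 1 ≤ d) (l m : ℂ) (k : ℕ) : ∃ B ∈ BD d l m k, B ≠ 0 := by
  set l' : ℂ := -k - (rho d + l) with hl'
  set m' : ℂ := -k - (rho d + m) with hm'
  have hfam := polyFam_BB (d := d) (rho d + l) l' (rho d + m) m' k
  obtain ⟨j₀, n, C, hC0, hC, hA⟩ := hfam.exists_lowest (ε₀ := 1) (by
    have h1 : rho d + l + 1 * l' = -(k : ℂ) := by rw [hl']; ring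
    have h2 : rho d + m + 1 * m' = -(k : ℂ) := by rw [hm']; ring
    rw [h1, h2]
    exact BB_base_ne_zero hd k)
  refine ⟨C 0, ⟨⟨4 * k, fun f x h => hC 0 x f h.JV⟩, fun g f => ?_⟩, hC0⟩
  ext x
  set φ := logKappa l' m' g⁻¹ with hφ
  set f₀ := piTensor l m g f with hf₀
  have hval : ∀ (ε : ℂ) (f : CSS d) (x : S d),
      (BB k (rho d + l + ε * l') (rho d + m + ε * m') f).1 x =
      ε ^ j₀ * ∑ j ∈ Finset.range (n + 1), ε ^ j * (C j f).1 x := by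
    intro ε f x
    rw [hA]
    simp only [LinearMap.smul_apply, LinearMap.sum_apply, Submodule.coe_smul, Pi.smul_apply,
      AddSubmonoidClass.coe_finsetSum, Finset.sum_apply, smul_eq_mul]
  set e₀ : ℂ := rho d + (l + m + rho d + 2 * k) with he₀
  set κ : ℂ := (kappa g⁻¹ x : ℂ) with hκ
  have hκ0 : κ ≠ 0 := by rw [hκ]; exact_mod_cast (kappa_pos g⁻¹ x).ne'
  have heq : ∀ ε : ℝ, ε ≠ 0 →
      ∑ j ∈ Finset.range (n + 1), (ε : ℂ) ^ j * (C j (mulCSS (expCSS φ ε) f₀)).1 x =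
      κ ^ (e₀ + ε * (l' + m')) *
        ∑ j ∈ Finset.range (n + 1), (ε : ℂ) ^ j * (C j f).1 (act g⁻¹ x) := by
    intro ε hε
    have h1 := congrFun (congrArg Subtype.val
      (BB_covariant (l + ε * l') (m + ε * m') k g f)) x
    have h2 : ((piRep ((l + ε * l') + (m + ε * m') + rho d + 2 * k) g)
        (BB k (rho d + (l + ε * l')) (rho d + (m + ε * m')) f)).1 x =
        κ ^ (rho d + ((l + ε * l') + (m + ε * m') + rho d + 2 * k)) *
        (BB k (rho d + (l + ε * l')) (rho d + (m + ε * m')) f).1 (act g⁻¹ x) := rfl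
    rw [h2, ← add_assoc, ← add_assoc, hval, hval, piTensor_line] at h1
    have h3 : rho d + ((l + ε * l') + (m + ε * m') + rho d + 2 * k) = e₀ + ε * (l' + m') := by
      rw [he₀]; ring
    rw [h3] at h1
    have h4 : (ε : ℂ) ^ j₀ ≠ 0 := pow_ne_zero _ (by exact_mod_cast hε)
    apply mul_left_cancel₀ h4
    rw [h1]
    ring
  have hpow : ∀ j, ContinuousAt (fun ε : ℝ => (ε : ℂ) ^ j) 0 := fun j =>
    (Complex.continuous_ofReal.pow j).continuousAt
  have hL : ContinuousAt (fun ε : ℝ => ∑ j ∈ Finset.range (n + 1),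
      (ε : ℂ) ^ j * (C j (mulCSS (expCSS φ ε) f₀)).1 x) 0 := by
    refine tendsto_finsetSum _ fun j _ => (hpow j).mul ?_
    exact continuousAt_functional_expCSS (T := evalAt x (C j)) (fun f hf => hC j x f hf) φ f₀
  have hR : ContinuousAt (fun ε : ℝ => κ ^ (e₀ + ε * (l' + m')) *
      ∑ j ∈ Finset.range (n + 1), (ε : ℂ) ^ j * (C j f).1 (act g⁻¹ x)) 0 := by
    refine ContinuousAt.mul ?_ (tendsto_finsetSum _ fun j _ => (hpow j).mul continuousAt_const)
    exact (continuousAt_const_cpow hκ0).comp (f := fun ε : ℝ => e₀ + ε * (l' + m')) (by fun_prop)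
  have hlim := tendsto_nhds_unique
    ((hL.tendsto.mono_left (nhdsWithin_le_nhds (s := {0}ᶜ))).congr' (by
      filter_upwards [self_mem_nhdsWithin] with ε hε
      exact heq ε hε)) (hR.tendsto.mono_left nhdsWithin_le_nhds)
  simp only [Finset.sum_range_succ', Complex.ofReal_zero, pow_succ, mul_zero, zero_mul,
    Finset.sum_const_zero, pow_zero, one_mul, zero_add, add_zero] at hlim
  have h0 : mulCSS (expCSS φ 0) f₀ = f₀ := by
    ext p
    change Complex.exp (((0 : ℝ) : ℂ) * φ.1 p) * f₀.1 p = f₀.1 p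
    simp
  rw [h0] at hlim
  exact hlim

/-- The dimension formula in terms of the nondegeneracy condition. -/
theorem BD.rank_eq_one (hd : 3 ≤ d) {l m : ℂ} {k : ℕ} {a : Fin 3 → ℕ}
    (ha : Recurrence.Nondeg (recParam d l m k) a) (hk : Recurrence.len a ≤ k) :
    Module.rank ℂ (BD d l m k) = 1 := by
  refine le_antisymm (BD.rank_le_one hd ha hk) ?_
  obtain ⟨B, hB, hB0⟩ := BD.exists_ne_zero (by omega : 1 ≤ d) l m k
  obtain ⟨f, x, hx⟩ : ∃ f x, (B f).1 x ≠ 0 := by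
    by_contra! hcon
    exact hB0 (LinearMap.ext fun f => Subtype.ext (funext fun x => hcon f x))
  have hinj : Function.Injective (LinearMap.toSpanSingleton ℂ (BD d l m k) ⟨B, hB⟩) := by
    intro c c' h
    have h1 : c * (B f).1 x = c' * (B f).1 x :=
      congrFun (congrArg Subtype.val (LinearMap.congr_fun (congrArg Subtype.val h) f)) x
    exact mul_right_cancel₀ hx h1
  simpa using LinearMap.rank_le_of_injective _ hinj

open scoped Pointwise

/-! ### The measure on the sphere -/

/-- The elements of the group that fix the time axis. -/
def IsRot (g : SO0 d) : Prop := ∀ p, (g.1 p).1 = p.1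

theorem SO0_apply_inv (g : SO0 d) (p : ℝ × E d) : g.1 ((g⁻¹).1 p) = p :=
  LinearEquiv.apply_symm_apply g.1 p

theorem IsRot.inv {g : SO0 d} (h : IsRot g) : IsRot g⁻¹ := fun p => by
  rw [← h, SO0_apply_inv]

theorem IsRot.kappa {g : SO0 d} (h : IsRot g) (x : S d) : kappa g x = 1 := by
  rw [ConformalSphere.kappa, lift, h]; simp

theorem IsRot.lv_act {g : SO0 d} (h : IsRot g) (x : S d) : lv (act g x) = g.1 (lv x) := by
  have := lift_eq g x
  rw [lift, h] at this
  simpa using this.symm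

theorem IsRot.lz_act {g : SO0 d} (h : IsRot g) (x y : S d) :
    lz (lv (act g x)) (lv (act g y)) = lz (lv x) (lv y) := by
  rw [h.lv_act, h.lv_act, ConformalSphere.lz_act]

theorem isRot_elt (e f : E d) (he : inner ℝ e e = 1) (hf : inner ℝ f f = 1) (hef : inner ℝ e f = 0)
    (t : ℝ) : IsRot ((rot e f he hf hef).elt t) := fun _ => rfl

/-- The isometry of the Euclidean space given by a rotation. -/
def IsRot.isom {g : SO0 d} (h : IsRot g) : E d ≃ₗᵢ[ℝ] E d :=
  LinearIsometry.toLinearIsometryEquiv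
    { toFun := fun v => (g.1 (0, v)).2
      map_add' := fun v w => by rw [← Prod.snd_add, ← map_add]; simp
      map_smul' := fun c v => by rw [RingHom.id_apply, ← Prod.smul_snd, ← map_smul]; simp
      norm_map' := fun v => by
        have h1 := g.2.1 (0, v)
        simp only [lorentzForm, h (0, v)] at h1
        change ‖(g.1 (0, v)).2‖ = ‖v‖
        rw [← sq_eq_sq₀ (norm_nonneg _) (norm_nonneg _)]
        linarith } rfl

theorem IsRot.fix {g : SO0 d} (h : IsRot g) : g.1 (1, 0) = (1, 0) := by
  have h1 := g.2.1 (1, 0)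
  simp only [lorentzForm, h (1, 0)] at h1
  refine Prod.ext (h _) ?_
  have : ‖(g.1 (1, 0)).2‖ ^ 2 = 0 := by rw [norm_zero] at h1; linarith
  simpa using this

theorem IsRot.coe_act {g : SO0 d} (h : IsRot g) (x : S d) : (act g x : E d) = h.isom (x : E d) := by
  have h1 := congrArg Prod.snd (h.lv_act x)
  have h2 : lv x = (1, 0) + (0, (x : E d)) := by simp
  rw [h2, map_add, h.fix] at h1
  have h3 : (act g x : E d) = (g.1 (0, (x : E d))).2 := by simpa using h1
  exact h3

theorem act_inv_act (g : SO0 d) (h : IsRot g) (x : S d) : act g (act g⁻¹ x) = x := by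
  have h1 : lv (act g (act g⁻¹ x)) = lv x := by rw [h.lv_act, h.inv.lv_act, SO0_apply_inv]
  exact Subtype.ext (congrArg Prod.snd h1)

theorem continuous_act (g : SO0 d) : Continuous (act g) := (contMDiff_act g).continuous

theorem IsRot.measurePreserving {g : SO0 d} (h : IsRot g) :
    MeasurePreserving (act g) (sigma d) (sigma d) := by
  refine ⟨(continuous_act g).measurable, Measure.ext fun s hs => ?_⟩
  rw [Measure.map_apply (continuous_act g).measurable hs, sigma,
    Measure.toSphere_apply' _ ((continuous_act g).measurable hs), Measure.toSphere_apply' _ hs]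
  congr 1
  have h1 := h.isom.measurePreserving.measure_preimage_emb
    h.isom.toHomeomorph.measurableEmbedding (Ioo (0 : ℝ) 1 • ((↑) '' s : Set (E d)))
  rw [← h1]
  congr 1
  ext v
  simp only [Set.mem_smul, mem_image, mem_preimage]
  constructor
  · rintro ⟨r, hr, _, ⟨x, hx, rfl⟩, rfl⟩
    exact ⟨r, hr, _, ⟨_, hx, rfl⟩, by rw [map_smul, h.coe_act]⟩
  · rintro ⟨r, hr, _, ⟨x, hx, rfl⟩, hv⟩
    refine ⟨r, hr, _, ⟨act g⁻¹ x, by rwa [act_inv_act g h], rfl⟩, h.isom.injective ?_⟩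
    rw [map_smul, ← h.coe_act, act_inv_act g h, hv]

theorem IsRot.integral_comp {g : SO0 d} (h : IsRot g) {f : S d → ℂ} (hf : Continuous f) :
    ∫ x, f (act g x) ∂sigma d = ∫ x, f x ∂sigma d := by
  rw [← integral_map (φ := act g) (continuous_act g).aemeasurable
    (by rw [h.measurePreserving.map_eq]; exact hf.aestronglyMeasurable), h.measurePreserving.map_eq]

theorem exists_rot_pole (hd : 1 ≤ d) (z : S d) : ∃ g : SO0 d, IsRot g ∧ act g (pole d) = z := by
  obtain ⟨g, hg, h⟩ := exists_act_pole hd z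
  exact ⟨g⁻¹, IsRot.inv hg, h⟩

instance : IsFiniteMeasure (sigma d) := by unfold sigma; infer_instance

theorem sigma_singleton (hd : 1 ≤ d) (x : S d) : sigma d {x} = 0 := by
  rw [sigma, Measure.toSphere_apply' _ (measurableSet_singleton x), image_singleton]
  have h1 : Ioo (0 : ℝ) 1 • ({(x : E d)} : Set (E d)) ⊆ (ℝ ∙ (x : E d) : Submodule ℝ (E d)) := by
    rintro _ ⟨r, -, _, rfl, rfl⟩
    exact Submodule.smul_mem _ _ (Submodule.mem_span_singleton_self _)
  have h2 : (ℝ ∙ (x : E d) : Submodule ℝ (E d)) ≠ ⊤ := fun h => by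
    have h3 := finrank_span_singleton (K := ℝ) (coe_ne_zero x)
    rw [h, finrank_top, finrank_euclideanSpace_fin] at h3
    omega
  rw [measure_mono_null h1 (Measure.addHaar_submodule _ _ h2), mul_zero]

theorem integrable_of_continuous {X : Type*} [TopologicalSpace X] [CompactSpace X]
    [MeasurableSpace X] [OpensMeasurableSpace X] {μ : Measure X} [IsFiniteMeasure μ]
    {f : X → ℂ} (hf : Continuous f) : Integrable f μ :=
  hf.integrable_of_hasCompactSupport (HasCompactSupport.of_compactSpace f)

theorem exists_bound_of_continuous {X : Type*} [TopologicalSpace X] [CompactSpace X]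
    {f : X → ℂ} (hf : Continuous f) : ∃ C, ∀ x, ‖f x‖ ≤ C := by
  obtain ⟨C, hC⟩ := (isCompact_range hf).isBounded.exists_norm_le
  exact ⟨C, fun x => hC _ ⟨x, rfl⟩⟩

theorem continuous_sd (e : E d) {H : S d → ℂ} (hH : ContMDiff (𝓡 d) 𝓘(ℝ, ℂ) 1 H) :
    Continuous (sd e H) := (contMDiff_sd (m := 0) (by simp) e hH).continuous

theorem continuous_coord (i : Fin (d + 1)) : Continuous fun x : S d => (((x : E d) i : ℝ) : ℂ) := by
  fun_prop

theorem act_add (G : LorentzFlow d) (s t : ℝ) (x : S d) (h : ∀ t, IsRot (G.elt t)) :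
    act (G.elt (s + t)) x = act (G.elt s) (act (G.elt t) x) := by
  have h1 : lv (act (G.elt (s + t)) x) = lv (act (G.elt s) (act (G.elt t) x)) := by
    rw [(h _).lv_act, (h _).lv_act, (h _).lv_act]
    exact LinearMap.congr_fun (G.add' s t) _
  exact Subtype.ext (congrArg Prod.snd h1)

theorem hasDerivAt_comp_rot (G : LorentzFlow d) (h : ∀ t, IsRot (G.elt t)) {H : S d → ℂ}
    (hH : ContMDiff (𝓡 d) 𝓘(ℝ, ℂ) 1 H) (x : S d) (t : ℝ) :
    HasDerivAt (fun t => H (act (G.elt t) x))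
      (sd (G.gen (lv (act (G.elt t) x))).2 H (act (G.elt t) x)) t := by
  have key : ∀ x : S d, HasDerivAt (fun t => H (act (G.elt t) x)) (sd (G.gen (lv x)).2 H x) 0 := by
    intro x
    have h1 : HasDerivAt (fun t => (G.toFun t (lv x)).2) (G.gen (lv x)).2 0 :=
      (ContinuousLinearMap.snd ℝ ℝ (E d)).hasFDerivAt.comp_hasDerivAt 0 (G.deriv' (lv x))
    have h2 : DifferentiableAt ℝ (fun v => H (proj v)) (G.toFun 0 (lv x)).2 := by
      rw [G.zero']
      exact SDiff.of_contMDiff hH (by simp) x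
    have h3 := h2.hasFDerivAt.comp_hasDerivAt 0 h1
    have h4 : ∀ t, (G.toFun t (lv x)).2 = (act (G.elt t) x : E d) := fun t =>
      (congrArg Prod.snd ((h t).lv_act x)).symm
    have h5 : (fun v => H (proj v)) ∘ (fun t => (G.toFun t (lv x)).2) =
        fun t => H (act (G.elt t) x) := by
      ext t
      simp only [Function.comp_apply, h4, proj_coe]
    rw [h5, G.zero'] at h3
    exact h3
  have h1 := key (act (G.elt t) x)
  rw [← sub_self t] at h1
  have h2 := HasDerivAt.scomp (h := fun r : ℝ => r - t) t h1 ((hasDerivAt_id t).sub_const t)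
  rw [one_smul] at h2
  refine h2.congr_of_eventuallyEq (Filter.Eventually.of_forall fun r => ?_)
  simp only [Function.comp_apply]
  rw [← act_add G _ _ x h, sub_add_cancel]

theorem isRot_crot {i j : Fin (d + 1)} (h : i ≠ j) (t : ℝ) : IsRot ((crot h).elt t) :=
  isRot_elt _ _ _ _ _ t

theorem integral_rot {i j : Fin (d + 1)} {H : S d → ℂ} (hH : ContMDiff (𝓡 d) 𝓘(ℝ, ℂ) 1 H) :
    ∫ x, (((x : E d) i : ℝ) * sd (bv j) H x - ((x : E d) j : ℝ) * sd (bv i) H x) ∂sigma d = 0 := by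
  by_cases h : i = j
  · simp [h]
  set G := crot h
  set D : S d → ℂ := fun x => ((x : E d) i : ℝ) * sd (bv j) H x - ((x : E d) j : ℝ) * sd (bv i) H x
  have hgen : ∀ x : S d, sd (G.gen (lv x)).2 H x = D x := by
    intro x
    simp only [G, crot_gen, sub_eq_add_neg, sd_vadd, ← neg_smul, sd_vsmul, D]
    push_cast
    ring
  have hD : Continuous D := ((continuous_coord i).mul (continuous_sd _ hH)).sub
    ((continuous_coord j).mul (continuous_sd _ hH))
  obtain ⟨C, hC⟩ := exists_bound_of_continuous hD
  have h1 := hasDerivAt_integral_of_dominated_loc_of_deriv_le (μ := sigma d) (x₀ := (0 : ℝ))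
    (F := fun t x => H (act (G.elt t) x)) (F' := fun t x => D (act (G.elt t) x))
    (bound := fun _ => C) (s := univ) Filter.univ_mem
    (Filter.Eventually.of_forall fun t =>
      (hH.continuous.comp (continuous_act _)).aestronglyMeasurable)
    (integrable_of_continuous (hH.continuous.comp (continuous_act _)))
    (hD.comp (continuous_act _)).aestronglyMeasurable
    (ae_of_all _ fun x t _ => hC _) (integrable_const C)
    (ae_of_all _ fun x t _ => by
      have := hasDerivAt_comp_rot G (isRot_crot h) hH x t
      rwa [hgen] at this)
  have h2 : ∀ t, ∫ x, H (act (G.elt t) x) ∂sigma d = ∫ x, H x ∂sigma d := fun t =>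
    (isRot_crot h t).integral_comp hH.continuous
  have h3 := h1.2
  simp only [h2] at h3
  rw [← (isRot_crot h 0).integral_comp hD]
  exact h3.unique (hasDerivAt_const _ _)

theorem contMDiff_mul_complex_of {m : ℕ∞ω} {f g : S d → ℂ} (hf : ContMDiff (𝓡 d) 𝓘(ℝ, ℂ) m f)
    (hg : ContMDiff (𝓡 d) 𝓘(ℝ, ℂ) m g) : ContMDiff (𝓡 d) 𝓘(ℝ, ℂ) m (fun x => f x * g x) :=
  (contDiff_mul (𝕜 := ℝ) (𝔸 := ℂ) (n := m)).contMDiff.comp (hf.prodMk_space hg)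

theorem contMDiff_coordFn (i : Fin (d + 1)) {m : ℕ∞ω} :
    ContMDiff (𝓡 d) 𝓘(ℝ, ℂ) m (fun x : S d => (((x : E d) i : ℝ) : ℂ)) := by
  have h : ContDiff ℝ m (fun v : E d => ((v i : ℝ) : ℂ)) :=
    Complex.ofRealCLM.contDiff.comp (contDiff_piLp_apply (p := 2))
  exact h.contMDiff.comp contMDiff_coe

theorem sum_coord_sd {H : S d → ℂ} (x : S d) : ∑ i, ((x : E d) i : ℝ) * sd (bv i) H x = 0 := by
  have h := sd_self (f := H) (x := x)
  have h2 : ∀ s : Finset (Fin (d + 1)), sd (∑ i ∈ s, (x : E d) i • bv i) H x =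
      ∑ i ∈ s, ((x : E d) i : ℝ) * sd (bv i) H x := by
    intro s
    simp only [sd, map_sum, map_smul, Complex.real_smul]
  rw [← h2, sum_bv, h]

/-- Integration by parts on the sphere. -/
theorem integral_sd (e : E d) {H : S d → ℂ} (hH : ContMDiff (𝓡 d) 𝓘(ℝ, ℂ) 1 H) :
    ∫ x, sd e H x ∂sigma d = d * ∫ x, (inner ℝ (x : E d) e : ℝ) * H x ∂sigma d := by
  have key : ∀ j, ∫ x, sd (bv j) H x ∂sigma d = d * ∫ x, ((x : E d) j : ℝ) * H x ∂sigma d := by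
    intro j
    have hm : ∀ i : Fin (d + 1), ContMDiff (𝓡 d) 𝓘(ℝ, ℂ) 1 (fun x : S d => (((x : E d) i : ℝ) : ℂ) * H x) :=
      fun i => contMDiff_mul_complex_of (contMDiff_coordFn i) hH
    have h1 : ∑ i, ∫ x, (((x : E d) i : ℝ) * sd (bv j) (fun x : S d => (((x : E d) i : ℝ) : ℂ) * H x) x -
        ((x : E d) j : ℝ) * sd (bv i) (fun x : S d => (((x : E d) i : ℝ) : ℂ) * H x) x) ∂sigma d = 0 :=
      Finset.sum_eq_zero fun i _ => integral_rot (hm i)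
    rw [← integral_finsetSum _ fun i _ => integrable_of_continuous
      (((continuous_coord i).fun_mul (continuous_sd _ (hm i))).fun_sub
      ((continuous_coord j).fun_mul (continuous_sd _ (hm i))))] at h1
    have h2 : ∀ x : S d, ∑ i, (((x : E d) i : ℝ) * sd (bv j) (fun x : S d => (((x : E d) i : ℝ) : ℂ) * H x) x -
        ((x : E d) j : ℝ) * sd (bv i) (fun x : S d => (((x : E d) i : ℝ) : ℂ) * H x) x) =
        sd (bv j) H x - d * (((x : E d) j : ℝ) * H x) := by
      intro x
      have hs : ∑ i, (((x : E d) i : ℝ) : ℂ) ^ 2 = 1 := by exact_mod_cast sum_coord_sq x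
      have h0 := sum_coord_sd (H := H) x
      have hx : ∀ i l, sd (bv l) (fun x : S d => (((x : E d) i : ℝ) : ℂ) * H x) x =
          ((x : E d) i : ℝ) * sd (bv l) H x +
          ((if l = i then 1 else 0) - ((x : E d) l : ℝ) * ((x : E d) i : ℝ)) * H x := by
        intro i l
        rw [sd_mul _ (sd_coordFn (bv l) x i).1 (.of_contMDiff hH (by simp) x),
          (sd_coordFn (bv l) x i).2, bv_apply, inner_bv]
        push_cast
        split_ifs <;> simp
      simp only [hx, if_true]
      have h3 : ∀ i, (((x : E d) i : ℝ) : ℂ) * (((x : E d) i : ℝ) * sd (bv j) H x +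
          ((if j = i then 1 else 0) - ((x : E d) j : ℝ) * ((x : E d) i : ℝ)) * H x) -
          ((x : E d) j : ℝ) * (((x : E d) i : ℝ) * sd (bv i) H x +
          (1 - ((x : E d) i : ℝ) * ((x : E d) i : ℝ)) * H x) =
          (((x : E d) i : ℝ) : ℂ) ^ 2 * sd (bv j) H x +
            (if j = i then (((x : E d) i : ℝ) : ℂ) else 0) * H x -
          ((x : E d) j : ℝ) * (((x : E d) i : ℝ) * sd (bv i) H x) - ((x : E d) j : ℝ) * H x := by
        intro i
        split_ifs <;> ring
      refine (Finset.sum_congr rfl fun i _ => h3 i).trans ?_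
      simp only [Finset.sum_sub_distrib, Finset.sum_add_distrib, ← Finset.sum_mul, hs,
        ← Finset.mul_sum, h0, Finset.sum_ite_eq, Finset.mem_univ, if_true, Finset.sum_const,
        Finset.card_univ, Fintype.card_fin, nsmul_eq_mul]
      push_cast
      ring
    simp only [h2] at h1
    rw [integral_sub (integrable_of_continuous (continuous_sd _ hH)) (integrable_of_continuous
      (continuous_const.fun_mul ((continuous_coord j).fun_mul hH.continuous))), integral_const_mul] at h1
    exact sub_eq_zero.1 h1
  have h1 : ∀ x : S d, sd e H x = ∑ j, ((e j : ℝ) : ℂ) * sd (bv j) H x := by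
    intro x
    conv_lhs => rw [← sum_bv e]
    simp only [sd, map_sum, map_smul, Complex.real_smul]
  have h2 : ∀ x : S d, ((inner ℝ (x : E d) e : ℝ) : ℂ) * H x =
      ∑ j, ((e j : ℝ) : ℂ) * (((x : E d) j : ℝ) * H x) := by
    intro x
    rw [inner_eq_sum]
    push_cast
    rw [Finset.sum_mul]
    exact Finset.sum_congr rfl fun j _ => by ring
  simp only [h1, h2]
  rw [integral_finsetSum _ fun j _ => integrable_of_continuous
    (continuous_const.fun_mul (continuous_sd _ hH)), integral_finsetSum _ fun j _ =>
    integrable_of_continuous (continuous_const.fun_mul ((continuous_coord j).fun_mul hH.continuous)),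
    Finset.mul_sum]
  refine Finset.sum_congr rfl fun j _ => ?_
  rw [integral_const_mul, integral_const_mul, key]
  ring

/-! ### Powers of the distance -/

section posPow

open Filter Topology

/-- The complex power of a positive number, extended by zero. -/
def posPow (c : ℂ) (t : ℝ) : ℂ := if 0 < t then (t : ℂ) ^ c else 0

theorem posPow_of_pos {c : ℂ} {t : ℝ} (h : 0 < t) : posPow c t = (t : ℂ) ^ c := if_pos h

theorem posPow_of_nonpos {c : ℂ} {t : ℝ} (h : t ≤ 0) : posPow c t = 0 := if_neg h.not_gt

theorem norm_posPow_of_pos {c : ℂ} {t : ℝ} (h : 0 < t) : ‖posPow c t‖ = t ^ c.re := by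
  rw [posPow_of_pos h, Complex.norm_cpow_eq_rpow_re_of_pos h]

theorem norm_posPow_le (c : ℂ) (t : ℝ) : ‖posPow c t‖ ≤ |t| ^ c.re := by
  rcases lt_or_ge 0 t with h | h
  · rw [norm_posPow_of_pos h, abs_of_pos h]
  · rw [posPow_of_nonpos h, norm_zero]; positivity

theorem posPow_add (c c' : ℂ) (t : ℝ) : posPow (c + c') t = posPow c t * posPow c' t := by
  rcases lt_or_ge 0 t with h | h
  · rw [posPow_of_pos h, posPow_of_pos h, posPow_of_pos h, Complex.cpow_add]
    exact_mod_cast h.ne'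
  · simp [posPow_of_nonpos h]

theorem mul_posPow (c : ℂ) {t : ℝ} (h : 0 ≤ t) : (t : ℂ) * posPow c t = posPow (c + 1) t := by
  rcases h.lt_or_eq with h | rfl
  · rw [posPow_add, posPow_of_pos (c := 1) h, Complex.cpow_one, mul_comm]
  · simp [posPow_of_nonpos le_rfl]

theorem tendsto_abs_rpow {r : ℝ} (hr : 0 < r) : Tendsto (fun t : ℝ => |t| ^ r) (𝓝 0) (𝓝 0) := by
  have h := (continuous_abs.rpow_const fun _ => Or.inr hr.le).tendsto (0 : ℝ)
  rwa [abs_zero, Real.zero_rpow hr.ne'] at h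

theorem hasDerivAt_posPow {c : ℂ} (hc : 1 < c.re) (t : ℝ) :
    HasDerivAt (posPow c) (c * posPow (c - 1) t) t := by
  rcases lt_trichotomy t 0 with h | rfl | h
  · rw [posPow_of_nonpos h.le, mul_zero]
    refine (hasDerivAt_const t (0 : ℂ)).congr_of_eventuallyEq ?_
    filter_upwards [eventually_lt_nhds h] with s hs using posPow_of_nonpos hs.le
  · rw [posPow_of_nonpos le_rfl, mul_zero, hasDerivAt_iff_isLittleO_nhds_zero]
    simp only [zero_add, posPow_of_nonpos le_rfl, sub_zero, smul_zero]
    rw [Asymptotics.isLittleO_iff]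
    intro ε hε
    have h1 := tendsto_abs_rpow (r := c.re - 1) (by linarith)
    filter_upwards [h1.eventually (ge_mem_nhds hε)] with s hs
    refine (norm_posPow_le c s).trans ?_
    by_cases h0 : s = 0
    · simp [h0, Real.zero_rpow (by linarith : c.re ≠ 0)]
    · have h2 : |s| ^ c.re = |s| ^ (c.re - 1) * |s| := by
        rw [← Real.rpow_add_one (abs_ne_zero.2 h0)]; ring_nf
      rw [h2, Real.norm_eq_abs]
      gcongr
  · rw [posPow_of_pos h]
    have h1 := ((Complex.hasStrictDerivAt_cpow_const (c := c) (x := (t : ℂ))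
      (Complex.ofReal_mem_slitPlane.2 h)).hasDerivAt).comp_ofReal
    refine h1.congr_of_eventuallyEq ?_
    filter_upwards [eventually_gt_nhds h] with s hs using posPow_of_pos hs

theorem continuous_posPow {c : ℂ} (hc : 0 < c.re) : Continuous (posPow c) := by
  refine continuous_iff_continuousAt.2 fun t => ?_
  rcases lt_trichotomy t 0 with h | rfl | h
  · refine (continuousAt_const (y := (0 : ℂ))).congr ?_
    filter_upwards [eventually_lt_nhds h] with s hs using (posPow_of_nonpos hs.le).symm
  · rw [ContinuousAt, posPow_of_nonpos le_rfl]
    exact squeeze_zero_norm (norm_posPow_le c) (tendsto_abs_rpow hc)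
  · refine (contDiffAt_ofReal_cpow (m := 0) h c).continuousAt.congr ?_
    filter_upwards [eventually_gt_nhds h] with s hs using (posPow_of_pos hs).symm

theorem contDiff_posPow (n : ℕ) : ∀ {c : ℂ}, n < c.re → ContDiff ℝ n (posPow c) := by
  induction n with
  | zero =>
    intro c hc
    exact contDiff_zero.2 (continuous_posPow (by simpa using hc))
  | succ n ih =>
    intro c hc
    push_cast at hc
    have hn : (0 : ℝ) ≤ n := by positivity
    have h := fun t => hasDerivAt_posPow (c := c) (by linarith) t
    push_cast
    refine contDiff_succ_iff_deriv.2 ⟨fun t => (h t).differentiableAt, by simp, ?_⟩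
    rw [funext fun t => (h t).deriv]
    exact contDiff_const.mul (ih (by simp; linarith))

theorem measurable_posPow (c : ℂ) : Measurable (posPow c) :=
  Measurable.ite measurableSet_Ioi (Complex.measurable_ofReal.pow_const c) measurable_const

end posPow

/-- Half of the square distance. -/
abbrev ww (x y : S d) : ℝ := lz (lv x) (lv y)

theorem ww_comm (x y : S d) : ww x y = ww y x := lz_comm _ _

theorem ww_nonneg (x y : S d) : 0 ≤ ww x y := by rw [ww, lz_lv_eq]; positivity

theorem ww_le_two (x y : S d) : ww x y ≤ 2 := by
  rw [ww, lz_lv_eq]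
  have h := norm_sub_le (x : E d) (y : E d)
  rw [norm_coe, norm_coe] at h
  nlinarith [norm_nonneg ((x : E d) - y)]

theorem inner_eq_ww (x y : S d) : inner ℝ (x : E d) (y : E d) = 1 - ww x y := by
  simp [ww, lz]

theorem continuous_ww : Continuous fun p : S d × S d => ww p.1 p.2 := by
  unfold ww lz; fun_prop

theorem contDiff_lz_one (Y : ℝ × E d) {m : ℕ∞ω} : ContDiff ℝ m fun v : E d => lz (1, v) Y := by
  unfold lz
  exact (contDiff_const (c := (1 : ℝ) * Y.1)).sub (contDiff_id.inner ℝ contDiff_const)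

theorem contMDiff_posPow (n : ℕ) {c : ℂ} (hc : n < c.re) (Y : ℝ × E d) :
    ContMDiff (𝓡 d) 𝓘(ℝ, ℂ) n fun x : S d => posPow c (lz (lv x) Y) := by
  have h : ContDiff ℝ n fun v : E d => posPow c (lz (1, v) Y) :=
    (contDiff_posPow n hc).comp (contDiff_lz_one Y)
  exact h.contMDiff.comp contMDiff_coe

theorem sd_posPow {c : ℂ} (hc : 1 < c.re) (e : E d) (x y : S d) :
    sd e (fun x => posPow c (ww x y)) x = -(c * posPow (c - 1) (ww x y) *
      ((inner ℝ e (y : E d) - inner ℝ (x : E d) e * inner ℝ (x : E d) (y : E d) : ℝ) : ℂ)) := by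
  have h1 : HasFDerivAt (fun v : E d => lz (1, v) (lv y)) (-(innerSL ℝ (y : E d))) (x : E d) := by
    have : (fun v : E d => lz (1, v) (lv y)) = fun v => 1 - innerSL ℝ (y : E d) v := by
      ext v; simp [lz, real_inner_comm]
    rw [this]
    exact (innerSL ℝ (y : E d)).hasFDerivAt.const_sub 1
  have h2 := (hasDerivAt_posPow hc (lz (1, (x : E d)) (lv y))).hasFDerivAt.comp (x : E d) h1
  have h3 := (sd_ambient (F := fun v : E d => posPow c (lz (1, v) (lv y))) h2.differentiableAt e).2
  rw [h3]
  refine (DFunLike.congr_fun h2.fderiv (e - inner ℝ (x : E d) e • (x : E d))).trans ?_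
  simp [ww, inner_sub_right, inner_smul_right, real_inner_comm, mul_comm]

/-! ### The triple kernel -/

/-- The invariant measure on the triple product of the sphere. -/
abbrev sig3 (d : ℕ) : Measure (S d × S d × S d) := (sigma d).prod ((sigma d).prod (sigma d))

/-- The trilinear kernel, with half exponents and half square distances. -/
def tk (a b c : ℂ) (p : S d × S d × S d) : ℂ :=
  posPow a (ww p.2.1 p.2.2) * posPow b (ww p.1 p.2.2) * posPow c (ww p.1 p.2.1)

/-- The integral of the trilinear kernel. -/
def tj (d : ℕ) (a b c : ℂ) : ℂ := ∫ p, tk a b c p ∂sig3 d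

/-- The transposition of the last two variables. -/
def swap23 (d : ℕ) : (S d × S d × S d) ≃ᵐ (S d × S d × S d) :=
  MeasurableEquiv.prodCongr (MeasurableEquiv.refl _) MeasurableEquiv.prodComm

/-- The cyclic permutation of the variables. -/
def cyc3 (d : ℕ) : (S d × S d × S d) ≃ᵐ (S d × S d × S d) :=
  MeasurableEquiv.prodComm.trans MeasurableEquiv.prodAssoc

theorem measurePreserving_swap23 : MeasurePreserving (swap23 d) (sig3 d) (sig3 d) :=
  (MeasurePreserving.id (sigma d)).prod Measure.measurePreserving_swap

theorem measurePreserving_cyc3 : MeasurePreserving (cyc3 d) (sig3 d) (sig3 d) :=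
  (measurePreserving_prodAssoc (sigma d) (sigma d) (sigma d)).comp Measure.measurePreserving_swap

theorem tk_swap23 (a b c : ℂ) (p : S d × S d × S d) : tk a b c (swap23 d p) = tk a c b p := by
  change posPow a (ww p.2.2 p.2.1) * posPow b (ww p.1 p.2.1) * posPow c (ww p.1 p.2.2) = _
  rw [tk, ww_comm p.2.2]; ring

theorem tk_cyc3 (a b c : ℂ) (p : S d × S d × S d) : tk a b c (cyc3 d p) = tk c a b p := by
  change posPow a (ww p.2.2 p.1) * posPow b (ww p.2.1 p.1) * posPow c (ww p.2.1 p.2.2) = _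
  rw [tk, ww_comm p.2.2, ww_comm p.2.1 p.1]; ring

theorem tj_swap23 (a b c : ℂ) : tj d a c b = tj d a b c := by
  simp only [tj, ← tk_swap23 a b c]
  exact measurePreserving_swap23.integral_comp' (tk a b c)

theorem tj_cyc3 (a b c : ℂ) : tj d c a b = tj d a b c := by
  simp only [tj, ← tk_cyc3 a b c]
  exact measurePreserving_cyc3.integral_comp' (tk a b c)

theorem tj_swap12 (a b c : ℂ) : tj d b a c = tj d a b c := by
  rw [tj_swap23, tj_cyc3, tj_cyc3]

theorem continuous_tk {a b c : ℂ} (ha : 0 < a.re) (hb : 0 < b.re) (hc : 0 < c.re) :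
    Continuous (tk (d := d) a b c) :=
  (((continuous_posPow ha).comp (continuous_ww.comp continuous_snd)).mul
    ((continuous_posPow hb).comp (continuous_ww.comp (continuous_fst.prodMk
      (continuous_snd.comp continuous_snd))))).mul
    ((continuous_posPow hc).comp (continuous_ww.comp (continuous_fst.prodMk
      (continuous_fst.comp continuous_snd))))

theorem integrable_tk {a b c : ℂ} (ha : 0 < a.re) (hb : 0 < b.re) (hc : 0 < c.re) :
    Integrable (tk (d := d) a b c) (sig3 d) := integrable_of_continuous (continuous_tk ha hb hc)

theorem integral_sig3_eq {f : S d × S d × S d → ℂ} (hf : Integrable f (sig3 d)) :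
    ∫ p, f p ∂sig3 d = ∫ q, ∫ x, f (x, q) ∂sigma d ∂(sigma d).prod (sigma d) :=
  integral_prod_symm f hf

theorem tj_ibp {a b c : ℂ} (ha : 0 < a.re) (hb : 1 < b.re) (hc : 1 < c.re) :
    (d + b + c) * tj d a (b + 1) c + c * (tj d (a + 1) b (c - 1) - tj d a (b + 1) (c - 1)) -
      (c + 2 * b + d) * tj d a b c = 0 := by
  have i1 : Integrable (tk (d := d) a (b + 1) c) (sig3 d) := integrable_tk ha (by simp; linarith) (by linarith)
  have i2 : Integrable (tk (d := d) (a + 1) b (c - 1)) (sig3 d) :=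
    integrable_tk (by simp; linarith) (by linarith) (by simp; linarith)
  have i3 : Integrable (tk (d := d) a (b + 1) (c - 1)) (sig3 d) :=
    integrable_tk ha (by simp; linarith) (by simp; linarith)
  have i4 : Integrable (tk (d := d) a b c) (sig3 d) := integrable_tk ha (by linarith) (by linarith)
  have j1 : Integrable (fun p => (d + b + c) * tk a (b + 1) c p) (sig3 d) := i1.const_mul _
  have j2 : Integrable (fun p => c * (tk (a + 1) b (c - 1) p - tk a (b + 1) (c - 1) p)) (sig3 d) :=
    (i2.sub i3).const_mul _
  have j3 : Integrable (fun p => (c + 2 * b + d) * tk a b c p) (sig3 d) := i4.const_mul _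
  have j4 : Integrable (fun p => (d + b + c) * tk a (b + 1) c p +
    c * (tk (a + 1) b (c - 1) p - tk a (b + 1) (c - 1) p)) (sig3 d) := j1.add j2
  have hI : (d + b + c) * tj d a (b + 1) c + c * (tj d (a + 1) b (c - 1) - tj d a (b + 1) (c - 1)) -
      (c + 2 * b + d) * tj d a b c = ∫ p, ((d + b + c) * tk a (b + 1) c p +
        c * (tk (a + 1) b (c - 1) p - tk a (b + 1) (c - 1) p) - (c + 2 * b + d) * tk a b c p) ∂sig3 d := by
    simp only [tj]
    rw [integral_sub j4 j3, integral_add j1 j2, integral_const_mul, integral_const_mul,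
      integral_const_mul, integral_sub i2 i3]
  rw [hI]
  refine (integral_sig3_eq (j4.sub j3)).trans ?_
  refine integral_eq_zero_of_ae (ae_of_all _ fun q => ?_)
  obtain ⟨y, z⟩ := q
  have hb1 : ContMDiff (𝓡 d) 𝓘(ℝ, ℂ) 1 fun x : S d => posPow b (ww x z) :=
    contMDiff_posPow 1 (by simpa using hb) _
  have hc1 : ContMDiff (𝓡 d) 𝓘(ℝ, ℂ) 1 fun x : S d => posPow c (ww x y) :=
    contMDiff_posPow 1 (by simpa using hc) _
  have hm := contMDiff_mul_complex_of hb1 hc1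
  have h1 := integral_sd (z : E d) hm
  have hsd : ∀ x : S d, sd (z : E d) (fun x => posPow b (ww x z) * posPow c (ww x y)) x =
      posPow b (ww x z) * (c * posPow (c - 1) (ww x y) *
        (ww y z - ww x z - ww x y + ww x z * ww x y)) +
      b * posPow (b - 1) (ww x z) * (ww x z * ww x z - 2 * ww x z) * posPow c (ww x y) := by
    intro x
    rw [sd_mul _ (.of_contMDiff hb1 (by simp) x) (.of_contMDiff hc1 (by simp) x), sd_posPow hc,
      sd_posPow hb, inner_self_coe, inner_eq_ww, inner_eq_ww, inner_eq_ww, ww_comm z y]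
    push_cast
    ring
  have hint : Integrable (fun x : S d => sd (z : E d) (fun x => posPow b (ww x z) * posPow c (ww x y)) x)
      (sigma d) := integrable_of_continuous (continuous_sd _ hm)
  have hint' : Integrable (fun x : S d => ((inner ℝ (x : E d) (z : E d) : ℝ) : ℂ) *
      (posPow b (ww x z) * posPow c (ww x y))) (sigma d) :=
    integrable_of_continuous ((contMDiff_coord _).continuous.fun_mul hm.continuous)
  rw [← integral_const_mul, ← sub_eq_zero, ← integral_sub hint (hint'.const_mul _)] at h1
  have h2 : ∫ x, ((d + b + c) * tk a (b + 1) c (x, y, z) +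
        c * (tk (a + 1) b (c - 1) (x, y, z) - tk a (b + 1) (c - 1) (x, y, z)) -
        (c + 2 * b + d) * tk a b c (x, y, z)) ∂sigma d = posPow a (ww y z) * 0 := by
    rw [← h1, ← integral_const_mul]
    refine integral_congr_ae (ae_of_all _ fun x => ?_)
    have e1 := mul_posPow a (ww_nonneg y z)
    have e2 := mul_posPow b (ww_nonneg x z)
    have e3 := mul_posPow (b - 1) (ww_nonneg x z)
    have e4 := mul_posPow (c - 1) (ww_nonneg x y)
    rw [sub_add_cancel] at e3 e4
    simp only [hsd, tk, inner_eq_ww, ← e1, ← e2, ← e3, ← e4]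
    push_cast
    ring
  exact h2.trans (mul_zero _)

theorem tj_add {a b c : ℂ} (ha : 1 < a.re) (hb : 1 < b.re) (hc : 1 < c.re) :
    (d + b + c) * tj d a (b + 1) c + (d + a + c) * tj d (a + 1) b c =
      2 * (a + b + c + d) * tj d a b c := by
  have h1 := tj_ibp (d := d) (by linarith : 0 < a.re) hb hc
  have h2 := tj_ibp (d := d) (by linarith : 0 < b.re) ha hc
  rw [tj_swap12 (a + 1) b, tj_swap12 a (b + 1) (c - 1), tj_swap12 (a + 1) b (c - 1),
    tj_swap12 a b] at h2
  linear_combination h1 + h2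

theorem tj_shift {a b c : ℂ} (ha : 1 < a.re) (hb : 1 < b.re) (hc : 1 < c.re) :
    (d + a + c) * (d + a + b) * tj d (a + 1) b c =
      2 * (a + b + c + d) * (rho d + a) * tj d a b c := by
  have h1 := tj_add (d := d) ha hb hc
  have h2 := tj_add (d := d) ha hc hb
  have h3 := tj_add (d := d) hb hc ha
  rw [tj_swap23 a b (c + 1), tj_swap23 (a + 1) b c, tj_swap23 a b c] at h2
  rw [tj_cyc3 (c + 1) a b, tj_cyc3 a b (c + 1), tj_cyc3 c a (b + 1), tj_cyc3 a (b + 1) c,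
    tj_cyc3 c a b, tj_cyc3 a b c] at h3
  rw [rho]
  linear_combination (1 / 2 : ℂ) * (d + a + b) * h1 + (1 / 2 : ℂ) * (d + a + c) * h2 -
    (1 / 2 : ℂ) * (d + b + c) * h3

/-! ### Adjoints of the Todorov operators -/

section adjoint

variable {f g : S d → ℂ}

theorem continuous_sd_sd (hf : ContMDiff (𝓡 d) 𝓘(ℝ, ℂ) 2 f) (e e' : E d) :
    Continuous (sd e (sd e' f)) :=
  continuous_sd e (contMDiff_sd (m := 1) (by norm_num) e' hf)

theorem continuous_Lap (hf : ContMDiff (𝓡 d) 𝓘(ℝ, ℂ) 2 f) : Continuous (Lap f) :=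
  continuous_finsetSum _ fun _ _ => continuous_sd_sd hf _ _

theorem continuous_sd_two (hf : ContMDiff (𝓡 d) 𝓘(ℝ, ℂ) 2 f) (e : E d) : Continuous (sd e f) :=
  continuous_sd e (hf.of_le (by norm_num))

theorem integral_Lap_mul (hf : ContMDiff (𝓡 d) 𝓘(ℝ, ℂ) 2 f) (hg : ContMDiff (𝓡 d) 𝓘(ℝ, ℂ) 1 g) :
    ∫ x, Lap f x * g x ∂sigma d = -∫ x, ∑ i, sd (bv i) f x * sd (bv i) g x ∂sigma d := by
  have hf1 : ∀ i : Fin (d + 1), ContMDiff (𝓡 d) 𝓘(ℝ, ℂ) 1 (sd (bv i) f) := fun i =>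
    contMDiff_sd (m := 1) (by norm_num) _ hf
  have h1 : ∀ i : Fin (d + 1), ∫ x, sd (bv i) (fun x => sd (bv i) f x * g x) x ∂sigma d =
      d * ∫ x, ((x : E d) i : ℝ) * (sd (bv i) f x * g x) ∂sigma d := fun i => by
    have := integral_sd (bv i) (contMDiff_mul_complex_of (hf1 i) hg)
    simpa only [inner_bv] using this
  have h2 := Finset.sum_congr rfl fun i (_ : i ∈ Finset.univ) => h1 i
  rw [← integral_finsetSum _ fun i _ => integrable_of_continuous
    (continuous_sd (bv i) (contMDiff_mul_complex_of (hf1 i) hg)), ← Finset.mul_sum,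
    ← integral_finsetSum _ fun i _ => integrable_of_continuous ((continuous_coord i).fun_mul
      ((continuous_sd_two hf (bv i)).fun_mul hg.continuous))] at h2
  have h3 : ∀ x : S d, ∑ i, (((x : E d) i : ℝ) : ℂ) * (sd (bv i) f x * g x) = 0 := fun x => by
    simp only [← mul_assoc, ← Finset.sum_mul, sum_coord_sd, zero_mul]
  have h4 : ∀ x : S d, ∑ i, sd (bv i) (fun x => sd (bv i) f x * g x) x =
      ∑ i, sd (bv i) f x * sd (bv i) g x + Lap f x * g x := fun x => by
    rw [Lap, Finset.sum_mul, ← Finset.sum_add_distrib]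
    exact Finset.sum_congr rfl fun i _ => sd_mul _ (.of_contMDiff (hf1 i) (by simp) x)
      (.of_contMDiff hg (by simp) x)
  simp only [h3, h4, integral_zero, mul_zero] at h2
  rw [integral_add (integrable_of_continuous (continuous_finsetSum _ fun i _ =>
    (continuous_sd_two hf _).fun_mul (continuous_sd _ hg)))
    (integrable_of_continuous ((continuous_Lap hf).fun_mul hg.continuous))] at h2
  linear_combination h2

/-- An affine function on the sphere. -/
def affineCS (w : ℝ × E d) (x : S d) : ℂ := ((w.1 - inner ℝ (x : E d) w.2 : ℝ) : ℂ)

theorem contMDiff_affineCS (w : ℝ × E d) : ContMDiff (𝓡 d) 𝓘(ℝ, ℂ) ∞ (affineCS w) := by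
  have h : ContDiff ℝ ∞ (fun v : E d => ((w.1 - inner ℝ v w.2 : ℝ) : ℂ)) :=
    Complex.ofRealCLM.contDiff.comp (contDiff_const.sub (contDiff_id.inner ℝ contDiff_const))
  exact h.contMDiff.comp contMDiff_coe

theorem sd_affineCS (e : E d) (w : ℝ × E d) (x : S d) :
    sd e (affineCS w) x = -((inner ℝ e w.2 - inner ℝ (x : E d) e * inner ℝ (x : E d) w.2 : ℝ) : ℂ) := by
  have h1 : HasFDerivAt (fun v : E d => ((w.1 - inner ℝ v w.2 : ℝ) : ℂ))
      (Complex.ofRealCLM ∘L (-(innerSL ℝ w.2))) (x : E d) := by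
    have : (fun v : E d => ((w.1 - inner ℝ v w.2 : ℝ) : ℂ)) =
        fun v => Complex.ofRealCLM (w.1 - innerSL ℝ w.2 v) := by
      ext v; simp [real_inner_comm]
    rw [this]
    exact Complex.ofRealCLM.hasFDerivAt.comp (x : E d) ((innerSL ℝ w.2).hasFDerivAt.const_sub w.1)
  refine (sd_ambient h1.differentiableAt e).2.trans ?_
  rw [h1.fderiv]
  simp [inner_sub_right, inner_smul_right, real_inner_comm]

theorem sum_sd_mul_sd_affineCS (w : ℝ × E d) (x : S d) :
    ∑ i, sd (bv i) f x * sd (bv i) (affineCS w) x = -sd w.2 f x := by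
  have h1 : sd w.2 f x = ∑ i, ((w.2 i : ℝ) : ℂ) * sd (bv i) f x := by
    conv_lhs => rw [← sum_bv w.2]
    simp only [sd, map_sum, map_smul, Complex.real_smul]
  have h2 : ∀ i, sd (bv i) f x * sd (bv i) (affineCS w) x = (inner ℝ (x : E d) w.2 : ℝ) *
      (((x : E d) i : ℝ) * sd (bv i) f x) - ((w.2 i : ℝ) : ℂ) * sd (bv i) f x := by
    intro i
    rw [sd_affineCS, real_inner_comm, inner_bv, inner_bv]
    push_cast
    ring
  simp only [h2, Finset.sum_sub_distrib, ← Finset.mul_sum, sum_coord_sd, h1]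
  ring

theorem integral_affineCS_Lap (hf : ContMDiff (𝓡 d) 𝓘(ℝ, ℂ) 2 f) (hg : ContMDiff (𝓡 d) 𝓘(ℝ, ℂ) 1 g)
    (w : ℝ × E d) : ∫ x, affineCS w x * (Lap f x * g x) ∂sigma d =
      ∫ x, sd w.2 f x * g x ∂sigma d -
      ∫ x, affineCS w x * ∑ i, sd (bv i) f x * sd (bv i) g x ∂sigma d := by
  have hc : ContMDiff (𝓡 d) 𝓘(ℝ, ℂ) 1 (affineCS w) :=
    (contMDiff_affineCS w).of_le (by exact_mod_cast le_top)
  have h1 := integral_Lap_mul hf (contMDiff_mul_complex_of hc hg)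
  have h2 : ∀ x, Lap f x * (affineCS w x * g x) = affineCS w x * (Lap f x * g x) := fun x => by ring
  have h3 : ∀ x, ∑ i, sd (bv i) f x * sd (bv i) (fun x => affineCS w x * g x) x =
      affineCS w x * (∑ i, sd (bv i) f x * sd (bv i) g x) - sd w.2 f x * g x := by
    intro x
    rw [sub_eq_add_neg, ← neg_mul, ← sum_sd_mul_sd_affineCS, Finset.mul_sum, Finset.sum_mul, ← Finset.sum_add_distrib]
    refine Finset.sum_congr rfl fun i _ => ?_
    rw [sd_mul _ (.of_contMDiff hc (by simp) x) (.of_contMDiff hg (by simp) x)]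
    ring
  simp only [h2, h3] at h1
  rw [h1, integral_sub (integrable_of_continuous (hc.continuous.fun_mul (continuous_finsetSum _
    fun i _ => (continuous_sd_two hf _).fun_mul (continuous_sd _ hg))))
    (integrable_of_continuous ((continuous_sd_two hf _).fun_mul hg.continuous))]
  ring

theorem integral_combination {X : Type*} [MeasurableSpace X] {μ : Measure X} {f₁ f₂ f₃ f₄ : X → ℂ}
    (h₁ : Integrable f₁ μ) (h₂ : Integrable f₂ μ) (h₃ : Integrable f₃ μ) (h₄ : Integrable f₄ μ)
    {a b c e : ℂ} : ∫ x, (a * f₁ x - b * f₂ x + c * f₃ x + e * f₄ x) ∂μ =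
      a * ∫ x, f₁ x ∂μ - b * ∫ x, f₂ x ∂μ + c * ∫ x, f₃ x ∂μ + e * ∫ x, f₄ x ∂μ := by
  have i₁ : Integrable (fun x => a * f₁ x - b * f₂ x) μ := (h₁.const_mul a).sub (h₂.const_mul b)
  have i₂ : Integrable (fun x => a * f₁ x - b * f₂ x + c * f₃ x) μ := i₁.add (h₃.const_mul c)
  rw [integral_add i₂ (h₄.const_mul e), integral_add i₁ (h₃.const_mul c),
    integral_sub (h₁.const_mul a) (h₂.const_mul b)]
  simp only [integral_const_mul]

theorem integral_dd_mul (hf : ContMDiff (𝓡 d) 𝓘(ℝ, ℂ) 2 f) (hg : ContMDiff (𝓡 d) 𝓘(ℝ, ℂ) 2 g)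
    {s t : ℂ} (hst : s + t = d - 1) (w : ℝ × E d) :
    ∫ x, dd s w f x * g x ∂sigma d = ∫ x, f x * dd t w g x ∂sigma d := by
  obtain rfl : t = d - 1 - s := by linear_combination hst
  have hf1 := hf.of_le (show (1 : ℕ∞ω) ≤ 2 by norm_num)
  have hg1 := hg.of_le (show (1 : ℕ∞ω) ≤ 2 by norm_num)
  have hc := (contMDiff_affineCS w).continuous
  have iA := integrable_of_continuous (μ := sigma d) ((continuous_sd w.2 hf1).fun_mul hg.continuous)
  have iB := integrable_of_continuous (μ := sigma d) (hf.continuous.fun_mul (continuous_sd w.2 hg1))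
  have iC := integrable_of_continuous (μ := sigma d)
    ((contMDiff_coord w.2).continuous.fun_mul (hf.continuous.fun_mul hg.continuous))
  have iL := integrable_of_continuous (μ := sigma d) (hc.fun_mul ((continuous_Lap hf).fun_mul hg.continuous))
  have iM := integrable_of_continuous (μ := sigma d) (hc.fun_mul ((continuous_Lap hg).fun_mul hf.continuous))
  have iP := integrable_of_continuous (μ := sigma d) (hc.fun_mul (hf.continuous.fun_mul hg.continuous))
  have h1 := integral_affineCS_Lap hf hg1 w
  have h2 := integral_affineCS_Lap hg hf1 w
  have h3 := integral_sd w.2 (contMDiff_mul_complex_of hf1 hg1)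
  have h4 : ∀ x, sd w.2 (fun x => f x * g x) x = f x * sd w.2 g x + sd w.2 f x * g x := fun x =>
    sd_mul _ (.of_contMDiff hf1 (by simp) x) (.of_contMDiff hg1 (by simp) x)
  simp only [h4] at h3
  rw [integral_add iB iA] at h3
  have h5 : ∀ x, ∑ i, sd (bv i) g x * sd (bv i) f x = ∑ i, sd (bv i) f x * sd (bv i) g x := fun x =>
    Finset.sum_congr rfl fun i _ => mul_comm _ _
  have h6 : ∀ x, sd w.2 g x * f x = f x * sd w.2 g x := fun x => mul_comm _ _
  simp only [h5, h6] at h2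
  have e1 : ∫ x, dd s w f x * g x ∂sigma d = (rho d - 1 - s) * ∫ x, sd w.2 f x * g x ∂sigma d -
      (rho d - 1 - s) * s * ∫ x, (inner ℝ (x : E d) w.2 : ℝ) * (f x * g x) ∂sigma d +
      1 / 2 * ∫ x, affineCS w x * (Lap f x * g x) ∂sigma d +
      1 / 2 * s * (s + 1 - d) * ∫ x, affineCS w x * (f x * g x) ∂sigma d := by
    rw [← integral_combination iA iC iL iP]
    refine integral_congr_ae (ae_of_all _ fun x => ?_)
    simp only [dd, affineCS]
    ring
  have e2 : ∫ x, f x * dd (d - 1 - s) w g x ∂sigma d =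
      (rho d - 1 - (d - 1 - s)) * ∫ x, f x * sd w.2 g x ∂sigma d -
      (rho d - 1 - (d - 1 - s)) * (d - 1 - s) *
        ∫ x, (inner ℝ (x : E d) w.2 : ℝ) * (f x * g x) ∂sigma d +
      1 / 2 * ∫ x, affineCS w x * (Lap g x * f x) ∂sigma d +
      1 / 2 * s * (s + 1 - d) * ∫ x, affineCS w x * (f x * g x) ∂sigma d := by
    rw [← integral_combination iB iC iM iP]
    refine integral_congr_ae (ae_of_all _ fun x => ?_)
    simp only [dd, affineCS]
    ring
  rw [e1, e2, h1, h2, rho]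
  linear_combination ((d : ℂ) / 2 - 1 - s + 1 / 2) * h3

end adjoint

/-! ### The integrated Bernstein identity -/

section bernsteinIntegral

open Filter

theorem dd_congr {f g : S d → ℂ} {x : S d} (h : f =ᶠ[nhds x] g) (t : ℂ) (w : ℝ × E d) :
    dd t w f x = dd t w g x := by
  have h1 : ∀ e : E d, sd e f =ᶠ[nhds x] sd e g := fun e =>
    h.eventually_nhds.mono fun _ h' => (sd_congr h' e).1
  have h2 : Lap f x = Lap g x := Finset.sum_congr rfl fun i _ => (sd_congr (h1 _) _).1
  rw [dd, dd, (sd_congr h _).1, h2, h.eq_of_nhds]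

theorem continuous_dd {g : S d → ℂ} (hg : ContMDiff (𝓡 d) 𝓘(ℝ, ℂ) 2 g) (t : ℂ) (w : ℝ × E d) :
    Continuous (dd t w g) :=
  (continuous_const.mul ((continuous_sd_two hg _).sub ((continuous_const.mul
    (contMDiff_coord w.2).continuous).mul hg.continuous))).add
    ((continuous_const.mul (contMDiff_affineCS w).continuous).mul
      ((continuous_Lap hg).add (continuous_const.mul hg.continuous)))

theorem integrable_ctr {X : Type*} [MeasurableSpace X] {μ : Measure X}
    {b : (ℝ × E d) → (ℝ × E d) → X → ℂ} (h : ∀ w w', Integrable (b w w') μ) :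
    Integrable (fun x => ctr fun w w' => b w w' x) μ :=
  (h _ _).sub (integrable_finsetSum _ fun _ _ => h _ _)

theorem integral_ctr {X : Type*} [MeasurableSpace X] {μ : Measure X}
    {b : (ℝ × E d) → (ℝ × E d) → X → ℂ} (h : ∀ w w', Integrable (b w w') μ) :
    ∫ x, (ctr fun w w' => b w w' x) ∂μ = ctr fun w w' => ∫ x, b w w' x ∂μ := by
  simp only [ctr]
  rw [integral_sub (h _ _) (integrable_finsetSum _ fun _ _ => h _ _),
    integral_finsetSum _ fun _ _ => h _ _]

/-- The result of the application of a Todorov operator to the triple kernel. -/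
def ddK (a b c s : ℂ) (w : ℝ × E d) (p : S d × S d × S d) : ℂ :=
  (rho d - 1 - s) * (c * lz w (lv p.2.1) * tk a b (c - 1) p + b * lz w (lv p.2.2) * tk a (b - 1) c p) -
    c * b * lz w (lv p.1) * tk (a + 1) (b - 1) (c - 1) p

theorem tk_of_ne {x y z : S d} (hxy : x ≠ y) (hxz : x ≠ z) (hyz : y ≠ z) (a b c : ℂ) :
    tk a b c (x, y, z) = (ww y z : ℂ) ^ a * (ww x z : ℂ) ^ b * (ww x y : ℂ) ^ c := by
  simp only [tk, posPow_of_pos (lz_lv_pos hxy), posPow_of_pos (lz_lv_pos hxz),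
    posPow_of_pos (lz_lv_pos hyz)]

theorem dd_cpow_eq_ddK {x y z : S d} (hxy : x ≠ y) (hxz : x ≠ z) (hyz : y ≠ z) {a b c s : ℂ}
    (hs : s = -(b + c)) (w : ℝ × E d) :
    dd s w (fun x => (lz (lv y) (lv x) : ℂ) ^ c * (lz (lv y) (lv z) : ℂ) ^ a *
      (lz (lv x) (lv z) : ℂ) ^ b) x = ddK a b c s w (x, y, z) := by
  have hxy' := lz_lv_pos hxy
  have hxz' := lz_lv_pos hxz
  have hF := contDiffAt_pw c b hxy' hxz'
  have h1 := dd_eq_ddA (s := s) (f := fun x => (lz (lv y) (lv x) : ℂ) ^ c * (lz (lv y) (lv z) : ℂ) ^ a *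
    (lz (lv x) (lv z) : ℂ) ^ b) (F := fun p => (lz (lv y) (lv z) : ℂ) ^ a * pw (lv y) (lv z) c b p)
    (contDiffAt_const.mul hF)
    (by
      filter_upwards [eventually_lz_pos hxy', eventually_lz_pos hxz'] with p h1 h2
      rw [fderiv_const_mul ((contDiffAt_pw c b h1 h2).differentiableAt (by simp)),
        _root_.smul_apply, smul_eq_mul, fderiv_pw_self c b h1 h2, hs]
      ring)
    (Filter.Eventually.of_forall fun x => by
      simp only [pw, lz_comm (lv y) (lv x)]
      ring) w
  rw [h1, ddA_const_mul _ _ _ hF, ddA_pw w c b hxy' hxz' (lz_light y) (lz_light z)]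
  have h2 := mul_posPow a (ww_nonneg y z)
  rw [posPow_of_pos (lz_lv_pos hyz), posPow_of_pos (lz_lv_pos hyz)] at h2
  rw [ddK, tk_of_ne hxy hxz hyz, tk_of_ne hxy hxz hyz, tk_of_ne hxy hxz hyz, ← h2]
  simp only [pw]
  ring

theorem dd_tk {x y z : S d} (hxy : x ≠ y) (hxz : x ≠ z) (hyz : y ≠ z) {a b c s : ℂ}
    (hs : s = -(b + c)) (w : ℝ × E d) :
    dd s w (fun x => tk a b c (x, y, z)) x = ddK a b c s w (x, y, z) := by
  rw [← dd_cpow_eq_ddK hxy hxz hyz hs]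
  refine dd_congr ?_ s w
  filter_upwards [eventually_lv_pos (lz_lv_pos hxy), eventually_lv_pos (lz_lv_pos hxz)] with x' h1 h2
  simp only [tk, posPow_of_pos h1, posPow_of_pos h2, posPow_of_pos (lz_lv_pos hyz),
    lz_comm (lv y) (lv x')]
  ring

theorem ctr_dd_ddK {x y z : S d} (hxy : x ≠ y) (hxz : x ≠ z) (hyz : y ≠ z) {a b c s t : ℂ}
    (hs : s = -(b + c)) (ht : t = -(a + c)) :
    (ctr fun w w' => dd t w' (fun y => ddK a b c s w (x, y, z)) y) =
      c * (c + rho d - 1) * (a + b + c + 2 * rho d - 1) * (a + b + c + rho d) *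
        tk a b (c - 1) (x, y, z) := by
  have h := ctr_dd_dd (lz_lv_pos hxy.symm) (lz_lv_pos hyz) (lz_lv_pos hxz) (a := a) (b := b) (c := c)
    ht hs
  rw [← ctr_swap] at h
  have h2 : ∀ w w', dd t w (fun y => dd s w' (fun x => (lz (lv y) (lv x) : ℂ) ^ c *
      (lz (lv y) (lv z) : ℂ) ^ a * (lz (lv x) (lv z) : ℂ) ^ b) x) y =
      dd t w (fun y => ddK a b c s w' (x, y, z)) y := by
    intro w w'
    refine dd_congr ?_ t w
    filter_upwards [isOpen_ne.mem_nhds hxy.symm, isOpen_ne.mem_nhds hyz] with y' h1 h2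
    exact dd_cpow_eq_ddK (Ne.symm h1) hxz h2 hs w'
  simp only [h2] at h
  rw [h, tk_of_ne hxy hxz hyz, ww_comm x y]
  ring

theorem contMDiff_tk_fst {a b c : ℂ} (hb : 2 < b.re) (hc : 2 < c.re) (y z : S d) :
    ContMDiff (𝓡 d) 𝓘(ℝ, ℂ) 2 fun x => tk a b c (x, y, z) :=
  contMDiff_mul_complex_of (contMDiff_mul_complex_of
    (contMDiff_const (c := posPow a (ww y z)))
    (contMDiff_posPow 2 (by exact_mod_cast hb) (lv z))) (contMDiff_posPow 2 (by exact_mod_cast hc) (lv y))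

theorem contMDiff_tk_snd {a b c : ℂ} (ha : 2 < a.re) (hc : 2 < c.re) (x z : S d) :
    ContMDiff (𝓡 d) 𝓘(ℝ, ℂ) 2 fun y => tk a b c (x, y, z) := by
  simp only [tk, ww_comm x]
  exact contMDiff_mul_complex_of (contMDiff_mul_complex_of
    (contMDiff_posPow 2 (by exact_mod_cast ha) (lv z)) (contMDiff_const (c := posPow b (ww z x))))
    (contMDiff_posPow 2 (by exact_mod_cast hc) (lv x))

theorem contMDiff_ddK_snd {a b c : ℂ} (ha : 2 < a.re) (hc : 3 < c.re) (s : ℂ) (w : ℝ × E d) (x z : S d) :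
    ContMDiff (𝓡 d) 𝓘(ℝ, ℂ) 2 fun y => ddK a b c s w (x, y, z) := by
  have hl : ContMDiff (𝓡 d) 𝓘(ℝ, ℂ) 2 fun y : S d => (lz w (lv y) : ℂ) := by
    have h : ContDiff ℝ 2 fun v : E d => ((lz w (1, v) : ℝ) : ℂ) := by
      simp only [lz_comm w]
      exact Complex.ofRealCLM.contDiff.comp (contDiff_lz_one w)
    exact h.contMDiff.comp contMDiff_coe
  have hc1 : 2 < (c - 1).re := by simp; linarith
  have ha1 : 2 < (a + 1).re := by simp; linarith
  have h1 := contMDiff_tk_snd (b := b) ha hc1 x z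
  have h2 := contMDiff_tk_snd (b := b - 1) ha (by linarith : 2 < c.re) x z
  have h3 := contMDiff_tk_snd (b := b - 1) ha1 hc1 x z
  have g1 := contMDiff_mul_complex_of (contMDiff_mul_complex_of (contMDiff_const (c := c)) hl) h1
  have g2 := contMDiff_mul_complex_of (contMDiff_const (c := b * (lz w (lv z) : ℂ))) h2
  have g3 := contMDiff_mul_complex_of (contMDiff_const (c := c * b * (lz w (lv x) : ℂ))) h3
  exact (contMDiff_mul_complex_of (contMDiff_const (c := rho d - 1 - s)) (g1.add g2)).sub g3

theorem continuous_ddK {a b c : ℂ} (ha : 2 < a.re) (hb : 2 < b.re) (hc : 3 < c.re) (s : ℂ)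
    (w : ℝ × E d) : Continuous (ddK (d := d) a b c s w) := by
  have h1 : Continuous (tk (d := d) a b (c - 1)) :=
    continuous_tk (by linarith) (by linarith) (by simp; linarith)
  have h2 : Continuous (tk (d := d) a (b - 1) c) :=
    continuous_tk (by linarith) (by simp; linarith) (by linarith)
  have h3 : Continuous (tk (d := d) (a + 1) (b - 1) (c - 1)) :=
    continuous_tk (by simp; linarith) (by simp; linarith) (by simp; linarith)
  have hl : Continuous fun y : S d => (lz w (lv y) : ℂ) := by unfold lz; fun_prop
  exact (continuous_const.mul (((continuous_const.mul (hl.comp (continuous_fst.comp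
    continuous_snd))).mul h1).add ((continuous_const.mul (hl.comp (continuous_snd.comp
    continuous_snd))).mul h2))).sub ((continuous_const.mul (hl.comp continuous_fst)).mul h3)

theorem ae_ne (hd : 1 ≤ d) (y : S d) : ∀ᵐ x ∂sigma d, x ≠ y :=
  compl_mem_ae_iff.2 (sigma_singleton hd y)

theorem continuous_slice3 {F : S d × S d × S d → ℂ} (hF : Continuous F) (z : S d) :
    Continuous fun q : S d × S d => F (q.1, q.2, z) := by fun_prop

theorem integral_DD_mul (hd : 1 ≤ d) (f : CSS d) (z : S d) {a b c s t : ℂ} (ha : 3 < a.re)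
    (hb : 3 < b.re) (hc : 3 < c.re) (hs : s = d + b + c) (ht : t = d + a + c) :
    ∫ q : S d × S d, (DD s t f).1 q * tk a b (c + 1) (q.1, q.2, z) ∂(sigma d).prod (sigma d) =
      (c + 1) * (c + rho d) * (a + b + c + d) * (a + b + c + rho d + 1) *
      ∫ q : S d × S d, f.1 q * tk a b c (q.1, q.2, z) ∂(sigma d).prod (sigma d) := by
  have hc1 : 3 < (c + 1).re := by simp; linarith
  have hk : Continuous fun q : S d × S d => tk a b (c + 1) (q.1, q.2, z) :=
    continuous_slice3 (continuous_tk (by linarith) (by linarith) (by linarith)) z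
  have hk0 : Continuous fun q : S d × S d => tk a b c (q.1, q.2, z) :=
    continuous_slice3 (continuous_tk (by linarith) (by linarith) (by linarith)) z
  set s' : ℂ := -(b + (c + 1)) with hs'
  set t' : ℂ := -(a + (c + 1)) with ht'
  have hG : ∀ w, Continuous fun q : S d × S d => ddK a b (c + 1) s' w (q.1, q.2, z) := fun w =>
    continuous_slice3 (continuous_ddK (by linarith) (by linarith) hc1 s' w) z
  have step1 : ∀ w w', ∫ q : S d × S d, (ddx s w (ddy t w' f)).1 q * tk a b (c + 1) (q.1, q.2, z)
      ∂(sigma d).prod (sigma d) = ∫ q : S d × S d, (ddy t w' f).1 q *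
        ddK a b (c + 1) s' w (q.1, q.2, z) ∂(sigma d).prod (sigma d) := by
    intro w w'
    rw [integral_prod_symm _ (integrable_of_continuous ((continuous_CSS _).fun_mul hk)),
      integral_prod_symm _ (integrable_of_continuous ((continuous_CSS _).fun_mul (hG w)))]
    refine integral_congr_ae ?_
    filter_upwards [ae_ne hd z] with y hyz
    refine (integral_dd_mul ((smooth_slice_left (ddy t w' f) y).of_le two_le_infty)
      (contMDiff_tk_fst (a := a) (by linarith) (by linarith) y z) (t := s')
      (by rw [hs, hs']; ring) w).trans (integral_congr_ae ?_)
    filter_upwards [ae_ne hd y, ae_ne hd z] with x hxy hxz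
    rw [dd_tk hxy hxz hyz hs']
  have step2 : ∀ x, x ≠ z → ∫ y, (ctr fun w w' => (ddy t w' f).1 (x, y) *
      ddK a b (c + 1) s' w (x, y, z)) ∂sigma d = ∫ y, (c + 1) * (c + rho d) * (a + b + c + d) *
        (a + b + c + rho d + 1) * (f.1 (x, y) * tk a b c (x, y, z)) ∂sigma d := by
    intro x hxz
    have hcg : ∀ w, ContMDiff (𝓡 d) 𝓘(ℝ, ℂ) 2 fun y => ddK a b (c + 1) s' w (x, y, z) := fun w =>
      contMDiff_ddK_snd (by linarith) hc1 s' w x z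
    have hcf := (smooth_slice_right f x).of_le two_le_infty
    rw [integral_ctr fun w w' => integrable_of_continuous
      ((smooth_slice_right (ddy t w' f) x).continuous.fun_mul (hcg w).continuous)]
    have h1 : ∀ w w', ∫ y, (ddy t w' f).1 (x, y) * ddK a b (c + 1) s' w (x, y, z) ∂sigma d =
        ∫ y, f.1 (x, y) * dd t' w' (fun y => ddK a b (c + 1) s' w (x, y, z)) y ∂sigma d := fun w w' =>
      integral_dd_mul hcf (hcg w) (by rw [ht, ht']; ring) w'
    simp only [h1]
    rw [← integral_ctr fun w w' => integrable_of_continuous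
      (hcf.continuous.fun_mul (continuous_dd (hcg w) t' w'))]
    refine integral_congr_ae ?_
    filter_upwards [ae_ne hd x, ae_ne hd z] with y hyx hyz
    rw [ctr_mul, ctr_dd_ddK hyx.symm hxz hyz hs' ht', add_sub_cancel_right, rho]
    ring
  have h1 : ∀ q : S d × S d, (DD s t f).1 q * tk a b (c + 1) (q.1, q.2, z) =
      ctr fun w w' => (ddx s w (ddy t w' f)).1 q * tk a b (c + 1) (q.1, q.2, z) := by
    intro q
    rw [DD_apply, mul_comm, ← ctr_mul]
    simp only [mul_comm (tk a b (c + 1) (q.1, q.2, z))]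
    rfl
  simp only [h1]
  have hi : ∀ w w', Integrable (fun q : S d × S d => (ddy t w' f).1 q *
      ddK a b (c + 1) s' w (q.1, q.2, z)) ((sigma d).prod (sigma d)) := fun w w' =>
    integrable_of_continuous ((continuous_CSS _).fun_mul (hG w))
  rw [integral_ctr fun w w' => integrable_of_continuous ((continuous_CSS _).fun_mul hk)]
  simp only [step1]
  rw [← integral_ctr hi, ← integral_const_mul, integral_prod _ (integrable_ctr hi), integral_prod _
    ((integrable_of_continuous ((continuous_CSS f).fun_mul hk0)).const_mul _)]
  refine integral_congr_ae ?_
  filter_upwards [ae_ne hd z] with x hxz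
  exact step2 x hxz

end bernsteinIntegral

/-! ### Operators on the first two variables -/

section families

/-- A function of three variables as a function of the first two. -/
def slice3 (f : CSSS d) (z : S d) : CSS d :=
  ⟨fun q => f.1 (q.1, q.2, z),
    f.2.comp (contMDiff_fst.prodMk (contMDiff_snd.prodMk contMDiff_const))⟩

/-- The operator on functions of three variables that acts on the first two. -/
def ext3 (A : Module.End ℂ (CSS d)) (f : CSSS d) (p : S d × S d × S d) : ℂ :=
  (A (slice3 f p.2.2)).1 (p.1, p.2.1)

/-- The operators that depend smoothly on the third variable. -/
def opsZ (d : ℕ) : Submodule ℂ (Module.End ℂ (CSS d)) where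
  carrier := {A | ∀ f : CSSS d, ext3 A f ∈ CSSS d}
  add_mem' hA hB f := Submodule.add_mem _ (hA f) (hB f)
  zero_mem' f := Submodule.zero_mem _
  smul_mem' c A hA f := Submodule.smul_mem _ c (hA f)

theorem opsZ_mul {A B : Module.End ℂ (CSS d)} (hA : A ∈ opsZ d) (hB : B ∈ opsZ d) :
    A * B ∈ opsZ d := fun f => hA ⟨ext3 B f, hB f⟩

theorem ddx_mem_opsZ (s : ℂ) (w : ℝ × E d) : ddx s w ∈ opsZ d := fun f =>
  contMDiff_dd_param s w (f := fun x (p : S d × S d × S d) => f.1 (x, p.2.1, p.2.2))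
    (f.2.comp (contMDiff_fst.prodMk (contMDiff_snd.comp contMDiff_snd))) contMDiff_fst

theorem ddy_mem_opsZ (s : ℂ) (w : ℝ × E d) : ddy s w ∈ opsZ d := fun f =>
  contMDiff_dd_param s w (f := fun y (p : S d × S d × S d) => f.1 (p.1, y, p.2.2))
    (f.2.comp ((contMDiff_fst.comp contMDiff_snd).prodMk (contMDiff_fst.prodMk
      (contMDiff_snd.comp (contMDiff_snd.comp contMDiff_snd))))) (contMDiff_fst.comp contMDiff_snd)

theorem DD_mem_opsZ (s t : ℂ) : DD s t ∈ opsZ d := by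
  rw [DD_eq_add]
  exact add_mem (opsZ_mul (ddx_mem_opsZ _ _) (ddy_mem_opsZ _ _)) (Submodule.smul_mem _ _
    (Submodule.sum_mem _ fun i _ => opsZ_mul (ddx_mem_opsZ _ _) (ddy_mem_opsZ _ _)))

theorem DDpow_mem_opsZ (s t : ℂ) (k : ℕ) : DDpow s t k ∈ opsZ d := by
  induction k with
  | zero => exact fun f => f.2
  | succ k ih => exact opsZ_mul (DD_mem_opsZ _ _) ih

theorem polyFam_ddx_opsZ (s₀ s₁ : ℂ) (w : ℝ × E d) : PolyFam (opsZ d) fun ε => ddx (s₀ + ε * s₁) w := by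
  have h : ∀ s, ddx s w ∈ opsZ d := fun s => ddx_mem_opsZ s w
  simp only [ddx_quadratic (_ + _)]
  exact PolyFam.quadratic (h _) (Submodule.smul_mem _ _ (add_mem (h _) (Submodule.smul_mem _ _ (h _))))
    (add_mem (Submodule.smul_mem _ _ (add_mem (h _) (h _))) (Submodule.smul_mem _ _ (h _))) _ _

theorem polyFam_ddy_opsZ (s₀ s₁ : ℂ) (w : ℝ × E d) : PolyFam (opsZ d) fun ε => ddy (s₀ + ε * s₁) w := by
  have h : ∀ s, ddy s w ∈ opsZ d := fun s => ddy_mem_opsZ s w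
  simp only [ddy_quadratic (_ + _)]
  exact PolyFam.quadratic (h _) (Submodule.smul_mem _ _ (add_mem (h _) (Submodule.smul_mem _ _ (h _))))
    (add_mem (Submodule.smul_mem _ _ (add_mem (h _) (h _))) (Submodule.smul_mem _ _ (h _))) _ _

theorem PolyFam.mul_opsZ {A A' : ℂ → Module.End ℂ (CSS d)} (h : PolyFam (opsZ d) A)
    (h' : PolyFam (opsZ d) A') : PolyFam (opsZ d) fun ε => A ε * A' ε :=
  h.map₂ h' (LinearMap.mul ℂ _) fun _ hc _ hc' => opsZ_mul hc hc'

theorem polyFam_DDpow_opsZ (s₀ s₁ t₀ t₁ : ℂ) (k : ℕ) :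
    PolyFam (opsZ d) fun ε => DDpow (s₀ + ε * s₁) (t₀ + ε * t₁) k := by
  induction k with
  | zero => exact PolyFam.const fun f => f.2
  | succ k ih =>
    have h : PolyFam (opsZ d) fun ε => DD (s₀ + k + ε * s₁) (t₀ + k + ε * t₁) := by
      simp only [DD_eq_add]
      exact ((polyFam_ddx_opsZ _ s₁ (1, (0 : E d))).mul_opsZ (polyFam_ddy_opsZ _ t₁ (1, (0 : E d)))).add
        ((PolyFam.sum Finset.univ fun i _ => (polyFam_ddx_opsZ _ s₁ _).mul_opsZ
          (polyFam_ddy_opsZ _ t₁ _)).map ((-1 : ℂ) • LinearMap.id) fun c hc => Submodule.smul_mem _ _ hc)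
    have h2 := h.mul_opsZ ih
    simp only [add_right_comm _ (k : ℂ)] at h2
    exact h2

theorem continuous_CSSS {f : S d × S d × S d → ℂ} (hf : f ∈ CSSS d) : Continuous f :=
  ContMDiff.continuous hf

theorem integral_sig3_last {F : S d × S d × S d → ℂ} (hF : Integrable F (sig3 d)) :
    ∫ p, F p ∂sig3 d =
      ∫ z, ∫ q : S d × S d, F (q.1, q.2, z) ∂(sigma d).prod (sigma d) ∂sigma d := by
  rw [← measurePreserving_cyc3.integral_comp' F]
  exact integral_prod _ ((measurePreserving_cyc3.integrable_comp_emb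
    (cyc3 d).measurableEmbedding).2 hF)

theorem integral_tk_DD (hd : 1 ≤ d) (f : CSSS d) {a b c s t : ℂ} (ha : 3 < a.re)
    (hb : 3 < b.re) (hc : 3 < c.re) (hs : s = d + b + c) (ht : t = d + a + c) :
    ∫ p, ext3 (DD s t) f p * tk a b (c + 1) p ∂sig3 d =
      (c + 1) * (c + rho d) * (a + b + c + d) * (a + b + c + rho d + 1) *
      ∫ p, f.1 p * tk a b c p ∂sig3 d := by
  have h1 : Continuous (tk (d := d) a b (c + 1)) :=
    continuous_tk (by linarith) (by linarith) (by simp; linarith)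
  have h2 : Continuous (tk (d := d) a b c) := continuous_tk (by linarith) (by linarith) (by linarith)
  rw [integral_sig3_last (integrable_of_continuous
    ((continuous_CSSS (DD_mem_opsZ s t f)).fun_mul h1)),
    integral_sig3_last (integrable_of_continuous ((continuous_CSSS f.2).fun_mul h2)),
    ← integral_const_mul]
  exact integral_congr_ae (ae_of_all _ fun z => integral_DD_mul hd (slice3 f z) z ha hb hc hs ht)

/-- The product of the Bernstein factors. -/
def bernProd (d : ℕ) (a b c : ℂ) (k : ℕ) : ℂ := ∏ i ∈ Finset.range k,
  ((c + i + 1) * (c + i + rho d) * (a + b + (c + i) + d) * (a + b + (c + i) + rho d + 1))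

theorem integral_tk_DDpow (hd : 1 ≤ d) (f : CSSS d) {a b c s t : ℂ} (ha : 3 < a.re)
    (hb : 3 < b.re) (hc : 3 < c.re) (hs : s = d + b + c) (ht : t = d + a + c) (k : ℕ) :
    ∫ p, ext3 (DDpow s t k) f p * tk a b (c + k) p ∂sig3 d =
      bernProd d a b c k * ∫ p, f.1 p * tk a b c p ∂sig3 d := by
  induction k with
  | zero => simp [bernProd, DDpow, ext3, slice3]
  | succ k ih =>
    have h := integral_tk_DD hd ⟨ext3 (DDpow s t k) f, DDpow_mem_opsZ s t k f⟩ (a := a) (b := b)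
      (c := c + k) (s := s + k) (t := t + k) ha hb (by simp; linarith) (by rw [hs]; ring)
      (by rw [ht]; ring)
    rw [ih] at h
    rw [bernProd, Finset.prod_range_succ, ← bernProd]
    push_cast
    rw [← add_assoc]
    refine h.trans ?_
    ring

end families

/-! ### Convergence of the trilinear integral -/

section convergence

open Filter Topology

theorem sd_rpow_ww {ε q : ℝ} (hε : 0 < ε) (x y : S d) :
    sd (y : E d) (fun x => (((ww x y + ε) ^ (-q) : ℝ) : ℂ)) x =
      ((q * (ww x y + ε) ^ (-q - 1) * (2 * ww x y - ww x y ^ 2) : ℝ) : ℂ) := by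
  have h1 : HasFDerivAt (fun v : E d => lz (1, v) (lv y) + ε) (-(innerSL ℝ (y : E d))) (x : E d) := by
    have : (fun v : E d => lz (1, v) (lv y) + ε) = fun v => 1 + ε - innerSL ℝ (y : E d) v := by
      ext v; simp [lz, real_inner_comm]; ring
    rw [this]
    exact (innerSL ℝ (y : E d)).hasFDerivAt.const_sub _
  have hpos : lz (1, (x : E d)) (lv y) + ε ≠ 0 := by
    have := ww_nonneg x y
    simp only [ww] at this
    positivity
  have h2 := Complex.ofRealCLM.hasFDerivAt.comp (x : E d) (h1.rpow_const (p := -q) (Or.inl hpos))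
  have h3 := (sd_ambient (F := fun v : E d => (((lz (1, v) (lv y) + ε) ^ (-q) : ℝ) : ℂ))
    h2.differentiableAt (y : E d)).2
  rw [h3]
  refine (DFunLike.congr_fun h2.fderiv ((y : E d) - inner ℝ (x : E d) y • (x : E d))).trans ?_
  have h4 : inner ℝ (y : E d) ((y : E d) - inner ℝ (x : E d) y • (x : E d)) = 2 * ww x y - ww x y ^ 2 := by
    rw [inner_sub_right, inner_smul_right, inner_self_coe, inner_eq_ww, inner_eq_ww, ww_comm y x]
    ring
  simp [h4, ww]

theorem contMDiff_rpow_ww {ε : ℝ} (q : ℝ) (hε : 0 < ε) (y : S d) :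
    ContMDiff (𝓡 d) 𝓘(ℝ, ℂ) 1 (fun x : S d => (((ww x y + ε) ^ (-q) : ℝ) : ℂ)) := by
  intro x
  have h1 : ContDiffAt ℝ 1 (fun v : E d => (((lz (1, v) (lv y) + ε) ^ (-q) : ℝ) : ℂ)) (x : E d) := by
    refine Complex.ofRealCLM.contDiff.contDiffAt.comp (x : E d)
      (ContDiffAt.rpow_const_of_ne ((contDiff_lz_one _).contDiffAt.add contDiffAt_const) ?_)
    have := ww_nonneg x y
    simp only [ww] at this
    positivity
  exact h1.contMDiffAt.comp x (contMDiff_coe x)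

theorem continuous_rpow_ww {ε : ℝ} (q : ℝ) (hε : 0 < ε) (y : S d) :
    Continuous fun x : S d => (ww x y + ε) ^ q :=
  ((continuous_ww.comp (continuous_id.prodMk continuous_const)).add continuous_const).rpow_const
    fun x => Or.inl (add_pos_of_nonneg_of_pos (ww_nonneg x y) hε).ne'

theorem integrable_real_of_continuous {f : S d → ℝ} (hf : Continuous f) : Integrable f (sigma d) :=
  hf.integrable_of_hasCompactSupport (HasCompactSupport.of_compactSpace f)

theorem integral_rpow_ww_le {ε q : ℝ} (hε : 0 < ε) (hq : 0 ≤ q) (hqd : q ≤ d) (y : S d) :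
    (d - 2 * q) * ∫ x, (ww x y + ε) ^ (-q) ∂sigma d ≤
      (d - q) * ∫ x, (ww x y + ε) ^ (-(q - 1)) ∂sigma d := by
  have h1 := integral_sd (y : E d) (contMDiff_rpow_ww q hε y)
  have hw : Continuous fun x : S d => ww x y := continuous_ww.comp (continuous_id.prodMk continuous_const)
  simp only [sd_rpow_ww hε, inner_eq_ww, ← Complex.ofReal_mul] at h1
  rw [integral_complex_ofReal, integral_complex_ofReal, ← Complex.ofReal_natCast, ← Complex.ofReal_mul,
    Complex.ofReal_inj] at h1
  have c0 := continuous_rpow_ww (-q) hε y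
  have c1 := continuous_rpow_ww (-q - 1) hε y
  have c2 := continuous_rpow_ww (-(q - 1)) hε y
  have i1 : Integrable (fun x => d * ((1 - ww x y) * (ww x y + ε) ^ (-q))) (sigma d) :=
    integrable_real_of_continuous (by fun_prop)
  have i2 : Integrable (fun x => q * (ww x y + ε) ^ (-q - 1) * (2 * ww x y - ww x y ^ 2)) (sigma d) :=
    integrable_real_of_continuous (by fun_prop)
  have i3 : Integrable (fun x => (d - 2 * q) * (ww x y + ε) ^ (-q)) (sigma d) :=
    integrable_real_of_continuous (by fun_prop)
  have i4 : Integrable (fun x => (d - q) * (ww x y + ε) ^ (-(q - 1))) (sigma d) :=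
    integrable_real_of_continuous (by fun_prop)
  rw [← integral_const_mul, ← integral_const_mul]
  have h2 : ∫ x, ((d - 2 * q) * (ww x y + ε) ^ (-q) - (d - q) * (ww x y + ε) ^ (-(q - 1))) ∂sigma d ≤
      ∫ x, (d * ((1 - ww x y) * (ww x y + ε) ^ (-q)) -
        q * (ww x y + ε) ^ (-q - 1) * (2 * ww x y - ww x y ^ 2)) ∂sigma d := by
    refine integral_mono (i3.sub i4) (i1.sub i2) fun x => ?_
    have hw0 := ww_nonneg x y
    have hw2 := ww_le_two x y
    have hp : 0 < ww x y + ε := by positivity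
    have e1 : (ww x y + ε) ^ (-q) = (ww x y + ε) ^ (-q - 1) * (ww x y + ε) := by
      rw [← Real.rpow_add_one hp.ne', sub_add_cancel]
    have e2 : (ww x y + ε) ^ (-(q - 1)) = (ww x y + ε) ^ (-q - 1) * (ww x y + ε) * (ww x y + ε) := by
      rw [← e1, ← Real.rpow_add_one hp.ne']; ring_nf
    have hA : 0 ≤ (ww x y + ε) ^ (-q - 1) := by positivity
    have key : 0 ≤ (ww x y + ε) ^ (-q - 1) * (q * (2 - ww x y) * ε + (d - q) * (ww x y + ε) * ε) := by
      have : 0 ≤ (d : ℝ) - q := by linarith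
      have : 0 ≤ 2 - ww x y := by linarith
      positivity
    simp only [e1, e2]
    nlinarith [key]
  rw [integral_sub i3 i4, integral_sub i1 i2, integral_const_mul (d : ℝ)] at h2
  linarith

theorem exists_bound_rpow_ww (n : ℕ) : ∀ q : ℝ, q ≤ n → q < d / 2 →
    ∃ C : ℝ, ∀ (y : S d) (ε : ℝ), 0 < ε → ε ≤ 1 → ∫ x, (ww x y + ε) ^ (-q) ∂sigma d ≤ C := by
  have hneg : ∀ q : ℝ, q ≤ 0 → ∃ C : ℝ, ∀ (y : S d) (ε : ℝ), 0 < ε → ε ≤ 1 →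
      ∫ x, (ww x y + ε) ^ (-q) ∂sigma d ≤ C := by
    intro q hq
    refine ⟨∫ _, (3 : ℝ) ^ (-q) ∂sigma d, fun y ε h0 h1 => ?_⟩
    refine integral_mono (integrable_real_of_continuous (continuous_rpow_ww _ h0 y))
      (integrable_const _) fun x => ?_
    have := ww_nonneg x y
    have := ww_le_two x y
    exact Real.rpow_le_rpow (by positivity) (by linarith) (by linarith)
  induction n with
  | zero => exact fun q hq _ => hneg q (by simpa using hq)
  | succ n ih =>
    intro q hq hqd
    rcases le_or_gt q 0 with h | h
    · exact hneg q h
    obtain ⟨C, hC⟩ := ih (q - 1) (by push_cast at hq; linarith) (by linarith)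
    refine ⟨(d - q) / (d - 2 * q) * C, fun y ε h0 h1 => ?_⟩
    have h2 := integral_rpow_ww_le h0 h.le (by linarith) y
    have h3 : (0 : ℝ) < d - 2 * q := by linarith
    rw [div_mul_eq_mul_div, le_div_iff₀ h3, mul_comm]
    exact h2.trans (mul_le_mul_of_nonneg_left (hC y ε h0 h1) (by linarith))

theorem exists_bound_lintegral_posPow {q : ℝ} (hq : q < d / 2) :
    ∃ C : NNReal, ∀ y : S d, ∫⁻ x, ‖posPow (-q : ℝ) (ww x y)‖ₑ ∂sigma d ≤ C := by
  obtain ⟨n, hn⟩ := exists_nat_ge q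
  obtain ⟨C, hC⟩ := exists_bound_rpow_ww n q hn hq
  refine ⟨C.toNNReal, fun y => ?_⟩
  have h1 : ∀ x : S d, ‖posPow (-q : ℝ) (ww x y)‖ₑ ≤
      liminf (fun n : ℕ => ENNReal.ofReal ((ww x y + 1 / ((n : ℝ) + 1)) ^ (-q))) atTop := by
    intro x
    rcases (ww_nonneg x y).lt_or_eq with h | h
    · refine le_of_eq (Tendsto.liminf_eq ?_).symm
      rw [← ofReal_norm, norm_posPow_of_pos h, Complex.ofReal_re]
      refine (ENNReal.continuous_ofReal.tendsto _).comp ?_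
      have h2 : Tendsto (fun n : ℕ => ww x y + 1 / ((n : ℝ) + 1)) atTop (𝓝 (ww x y)) := by
        simpa using (tendsto_const_nhds (x := ww x y)).add (tendsto_one_div_add_atTop_nhds_zero_nat (𝕜 := ℝ))
      exact h2.rpow_const (Or.inl h.ne')
    · rw [posPow_of_nonpos h.symm.le]; simp
  refine (lintegral_mono h1).trans ((lintegral_liminf_le fun n => ?_).trans ?_)
  · exact ENNReal.measurable_ofReal.comp (continuous_rpow_ww _ (by positivity) y).measurable
  · refine liminf_le_of_le (by isBoundedDefault) fun b hb => ?_
    obtain ⟨n, hn⟩ := hb.exists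
    refine hn.trans ?_
    rw [← ofReal_integral_eq_lintegral_ofReal (integrable_real_of_continuous
      (continuous_rpow_ww _ (by positivity) y)) (ae_of_all _ fun x => by
        have := ww_nonneg x y; positivity)]
    refine ENNReal.ofReal_le_ofReal (hC y _ (by positivity) ?_)
    rw [div_le_one (by positivity)]
    linarith [(Nat.cast_nonneg n : (0 : ℝ) ≤ n)]

theorem measurable_ww : Measurable fun p : S d × S d => ww p.1 p.2 := continuous_ww.measurable

theorem measurable_tk (a b c : ℂ) : Measurable (tk (d := d) a b c) := by
  have h1 : Measurable fun p : S d × S d × S d => ww p.2.1 p.2.2 :=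
    (continuous_ww.comp continuous_snd).measurable
  have h2 : Measurable fun p : S d × S d × S d => ww p.1 p.2.2 :=
    (continuous_ww.comp (continuous_fst.prodMk (continuous_snd.comp continuous_snd))).measurable
  have h3 : Measurable fun p : S d × S d × S d => ww p.1 p.2.1 :=
    (continuous_ww.comp (continuous_fst.prodMk (continuous_fst.comp continuous_snd))).measurable
  have g1 := (measurable_posPow a).comp h1
  have g2 := (measurable_posPow b).comp h2
  have g3 := (measurable_posPow c).comp h3
  have : tk (d := d) a b c = fun p => (posPow a ∘ fun p : S d × S d × S d => ww p.2.1 p.2.2) p *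
    (posPow b ∘ fun p : S d × S d × S d => ww p.1 p.2.2) p *
    (posPow c ∘ fun p : S d × S d × S d => ww p.1 p.2.1) p := rfl
  rw [this]
  exact (g1.mul g2).mul g3

theorem enorm_posPow_zero_le (t : ℝ) : ‖posPow 0 t‖ₑ ≤ 1 := by
  rcases lt_or_ge 0 t with h | h
  · simp [posPow_of_pos h]
  · simp [posPow_of_nonpos h]

theorem integrable_tk_pair {q : ℝ} (hq : q < d / 2) :
    Integrable (tk (d := d) (-q : ℝ) (-q : ℝ) 0) (sig3 d) := by
  obtain ⟨C, hC⟩ := exists_bound_lintegral_posPow (d := d) hq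
  refine ⟨(measurable_tk _ _ _).aestronglyMeasurable, ?_⟩
  rw [hasFiniteIntegral_iff_enorm, lintegral_prod_symm _ (measurable_tk _ _ _).enorm.aemeasurable]
  have h1 : ∀ q' : S d × S d, ∫⁻ x, ‖tk (-q : ℝ) (-q : ℝ) 0 (x, q')‖ₑ ∂sigma d ≤
      ‖posPow (-q : ℝ) (ww q'.1 q'.2)‖ₑ * C := by
    intro q'
    refine le_trans ?_ (mul_le_mul_right (hC q'.2) _)
    rw [← lintegral_const_mul' _ _ enorm_ne_top]
    refine lintegral_mono fun x => ?_
    rw [tk, enorm_mul, enorm_mul]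
    exact mul_le_of_le_one_right' (enorm_posPow_zero_le _)
  refine (lintegral_mono h1).trans_lt ?_
  have hm : Measurable fun q' : S d × S d => ‖posPow (-q : ℝ) (ww q'.1 q'.2)‖ₑ :=
    ((measurable_posPow _).comp measurable_ww).enorm
  rw [lintegral_mul_const _ hm, lintegral_prod_symm _ hm.aemeasurable]
  refine ENNReal.mul_lt_top ((lintegral_mono fun y => hC y).trans_lt ?_) ENNReal.coe_lt_top
  rw [lintegral_const]
  exact ENNReal.mul_lt_top ENNReal.coe_lt_top (measure_lt_top _ _)

theorem integrable_tk_swap23 {a b c : ℂ} (h : Integrable (tk (d := d) a b c) (sig3 d)) :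
    Integrable (tk (d := d) a c b) (sig3 d) := by
  have := (measurePreserving_swap23.integrable_comp_emb (swap23 d).measurableEmbedding).2 h
  exact this.congr (ae_of_all _ fun p => tk_swap23 a b c p)

theorem integrable_tk_cyc3 {a b c : ℂ} (h : Integrable (tk (d := d) a b c) (sig3 d)) :
    Integrable (tk (d := d) c a b) (sig3 d) := by
  have := (measurePreserving_cyc3.integrable_comp_emb (cyc3 d).measurableEmbedding).2 h
  exact this.congr (ae_of_all _ fun p => tk_cyc3 a b c p)

theorem integrable_tk_of_re {a b c : ℂ} {q : ℝ} (hq : a.re + b.re + c.re = -2 * q) (h0 : 0 < q)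
    (hqd : q < d / 2) (ha : -a.re ≤ q) (hb : -b.re ≤ q) (hc : -c.re ≤ q) :
    Integrable (tk (d := d) a b c) (sig3 d) := by
  have i3 := integrable_tk_pair (d := d) hqd
  have i2 := integrable_tk_swap23 i3
  have i1 := integrable_tk_cyc3 i3
  refine (((i1.norm.const_mul (1 + a.re / q)).add (i2.norm.const_mul (1 + b.re / q))).add
    (i3.norm.const_mul (1 + c.re / q))).mono' (measurable_tk _ _ _).aestronglyMeasurable
    (ae_of_all _ fun p => ?_)
  have wa : 0 ≤ 1 + a.re / q := by rw [← neg_le_iff_add_nonneg', le_div_iff₀ h0]; linarith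
  have wb : 0 ≤ 1 + b.re / q := by rw [← neg_le_iff_add_nonneg', le_div_iff₀ h0]; linarith
  have wc : 0 ≤ 1 + c.re / q := by rw [← neg_le_iff_add_nonneg', le_div_iff₀ h0]; linarith
  have hsum : 1 + a.re / q + (1 + b.re / q) + (1 + c.re / q) = 1 := by
    field_simp
    linarith
  simp only [tk, Pi.add_apply, norm_mul]
  rcases (ww_nonneg p.2.1 p.2.2).lt_or_eq with hV | hV
  swap
  · rw [posPow_of_nonpos hV.symm.le]; simp only [norm_zero, zero_mul]; positivity
  rcases (ww_nonneg p.1 p.2.2).lt_or_eq with hU | hU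
  swap
  · rw [posPow_of_nonpos hU.symm.le]; simp only [norm_zero, zero_mul, mul_zero]; positivity
  rcases (ww_nonneg p.1 p.2.1).lt_or_eq with hW | hW
  swap
  · rw [posPow_of_nonpos hW.symm.le]; simp only [norm_zero, mul_zero]; positivity
  simp only [norm_posPow_of_pos hV, norm_posPow_of_pos hU, norm_posPow_of_pos hW, Complex.ofReal_re,
    Complex.zero_re, Real.rpow_zero, one_mul, mul_one]
  set V := ww p.2.1 p.2.2
  set U := ww p.1 p.2.2
  set W := ww p.1 p.2.1
  have h1 := Real.geom_mean_le_arith_mean3_weighted wa wb wc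
    (by positivity : 0 ≤ U ^ (-q) * W ^ (-q)) (by positivity : 0 ≤ V ^ (-q) * W ^ (-q))
    (by positivity : 0 ≤ V ^ (-q) * U ^ (-q)) hsum
  refine le_trans (le_of_eq ?_) h1
  have hm : ∀ {s t : ℝ}, 0 < s → 0 < t → ∀ r : ℝ, (s ^ (-q) * t ^ (-q)) ^ r =
      s ^ (-q * r) * t ^ (-q * r) := by
    intro s t hs ht r
    rw [Real.mul_rpow (by positivity) (by positivity), ← Real.rpow_mul hs.le, ← Real.rpow_mul ht.le]
  rw [hm hU hW, hm hV hW, hm hV hU]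
  have ea : a.re = -q * (1 + b.re / q) + -q * (1 + c.re / q) := by field_simp; linarith
  have eb : b.re = -q * (1 + a.re / q) + -q * (1 + c.re / q) := by field_simp; linarith
  have ec : c.re = -q * (1 + a.re / q) + -q * (1 + b.re / q) := by field_simp; linarith
  have fa : V ^ a.re = V ^ (-q * (1 + b.re / q)) * V ^ (-q * (1 + c.re / q)) := by
    rw [← Real.rpow_add hV, ← ea]
  have fb : U ^ b.re = U ^ (-q * (1 + a.re / q)) * U ^ (-q * (1 + c.re / q)) := by
    rw [← Real.rpow_add hU, ← eb]
  have fc : W ^ c.re = W ^ (-q * (1 + a.re / q)) * W ^ (-q * (1 + b.re / q)) := by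
    rw [← Real.rpow_add hW, ← ec]
  rw [fa, fb, fc]
  ring

end convergence

/-! ### Holomorphic dependence on the exponents -/

section holomorphic

open Filter Topology

theorem norm_posPow_le_mul {a α : ℂ} {M : ℝ} (h : α.re ≤ a.re) (h' : a.re ≤ α.re + M) {t : ℝ}
    (ht : t ≤ 2) : ‖posPow a t‖ ≤ 2 ^ M * ‖posPow α t‖ := by
  rcases le_or_gt t 0 with h0 | h0
  · simp [posPow_of_nonpos h0]
  rw [norm_posPow_of_pos h0, norm_posPow_of_pos h0]
  have h1 : t ^ a.re = t ^ (a.re - α.re) * t ^ α.re := by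
    rw [← Real.rpow_add h0, sub_add_cancel]
  rw [h1]
  refine mul_le_mul_of_nonneg_right ?_ (by positivity)
  calc t ^ (a.re - α.re) ≤ 2 ^ (a.re - α.re) := Real.rpow_le_rpow h0.le ht (by linarith)
    _ ≤ 2 ^ M := Real.rpow_le_rpow_of_exponent_le (by norm_num) (by linarith)

theorem norm_tk_le_mul {a b c α β γ : ℂ} {M : ℝ} (ha : α.re ≤ a.re) (ha' : a.re ≤ α.re + M)
    (hb : β.re ≤ b.re) (hb' : b.re ≤ β.re + M) (hc : γ.re ≤ c.re) (hc' : c.re ≤ γ.re + M)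
    (p : S d × S d × S d) : ‖tk a b c p‖ ≤ 2 ^ M * 2 ^ M * 2 ^ M * ‖tk α β γ p‖ := by
  have h1 := norm_posPow_le_mul ha ha' (ww_le_two p.2.1 p.2.2)
  have h2 := norm_posPow_le_mul hb hb' (ww_le_two p.1 p.2.2)
  have h3 := norm_posPow_le_mul hc hc' (ww_le_two p.1 p.2.1)
  rw [tk, tk, norm_mul, norm_mul, norm_mul, norm_mul]
  calc _ ≤ 2 ^ M * ‖posPow α (ww p.2.1 p.2.2)‖ * (2 ^ M * ‖posPow β (ww p.1 p.2.2)‖) *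
      (2 ^ M * ‖posPow γ (ww p.1 p.2.1)‖) := by gcongr
    _ = _ := by ring

theorem integrable_tk_zero : Integrable (tk (d := d) 0 0 0) (sig3 d) := by
  refine Integrable.of_bound (measurable_tk _ _ _).aestronglyMeasurable 1 (ae_of_all _ fun p => ?_)
  have h : ∀ t, ‖posPow 0 t‖ ≤ 1 := fun t => by
    rcases lt_or_ge 0 t with h | h
    · simp [posPow_of_pos h]
    · simp [posPow_of_nonpos h]
  rw [tk, norm_mul, norm_mul]
  exact mul_le_one₀ (mul_le_one₀ (h _) (norm_nonneg _) (h _)) (norm_nonneg _) (h _)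

theorem hasDerivAt_posPow_exponent (a a' ξ : ℂ) (t : ℝ) :
    HasDerivAt (fun ξ => posPow (a + ξ * a') t) (posPow (a + ξ * a') t * (Real.log t * a')) ξ := by
  rcases lt_or_ge 0 t with h | h
  · simp only [posPow_of_pos h]
    have h1 : HasDerivAt (fun ξ => a + ξ * a') a' ξ := by
      simpa using ((hasDerivAt_id ξ).mul_const a').const_add a
    have h2 := h1.const_cpow (c := (t : ℂ)) (Or.inl (by exact_mod_cast h.ne'))
    rw [Complex.ofReal_log h.le, ← mul_assoc]
    exact h2
  · simp only [posPow_of_nonpos h, zero_mul]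
    exact hasDerivAt_const _ _

/-- The logarithmic derivative of the triple kernel. -/
def tkLog (a' b' c' : ℂ) (p : S d × S d × S d) : ℂ :=
  Real.log (ww p.2.1 p.2.2) * a' + Real.log (ww p.1 p.2.2) * b' + Real.log (ww p.1 p.2.1) * c'

theorem hasDerivAt_tk (a a' b b' c c' ξ : ℂ) (p : S d × S d × S d) :
    HasDerivAt (fun ξ => tk (a + ξ * a') (b + ξ * b') (c + ξ * c') p)
      (tk (a + ξ * a') (b + ξ * b') (c + ξ * c') p * tkLog a' b' c' p) ξ := by
  have h := ((hasDerivAt_posPow_exponent a a' ξ (ww p.2.1 p.2.2)).mul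
    (hasDerivAt_posPow_exponent b b' ξ (ww p.1 p.2.2))).mul
    (hasDerivAt_posPow_exponent c c' ξ (ww p.1 p.2.1))
  refine h.congr_deriv ?_
  simp only [tkLog, tk, Pi.mul_apply]
  ring

theorem measurable_tkLog (a' b' c' : ℂ) : Measurable (tkLog (d := d) a' b' c') := by
  have h1 : Measurable fun p : S d × S d × S d => ww p.2.1 p.2.2 :=
    (continuous_ww.comp continuous_snd).measurable
  have h2 : Measurable fun p : S d × S d × S d => ww p.1 p.2.2 :=
    (continuous_ww.comp (continuous_fst.prodMk (continuous_snd.comp continuous_snd))).measurable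
  have h3 : Measurable fun p : S d × S d × S d => ww p.1 p.2.1 :=
    (continuous_ww.comp (continuous_fst.prodMk (continuous_fst.comp continuous_snd))).measurable
  have g : ∀ {f : S d × S d × S d → ℝ} (e : ℂ), Measurable f →
      Measurable fun p => (Real.log (f p) : ℂ) * e := fun e hf =>
    (Complex.measurable_ofReal.comp (Real.measurable_log.comp hf)).mul_const e
  exact ((g a' h1).add (g b' h2)).add (g c' h3)

theorem differentiableAt_integral_tk {a a' b b' c c' ξ₀ α β γ : ℂ} {φ : S d × S d × S d → ℂ}
    (hφ : Continuous φ) (hi : Integrable (tk (d := d) α β γ) (sig3 d))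
    (ha : α.re < (a + ξ₀ * a').re) (hb : β.re < (b + ξ₀ * b').re) (hc : γ.re < (c + ξ₀ * c').re) :
    DifferentiableAt ℂ
      (fun ξ => ∫ p, φ p * tk (a + ξ * a') (b + ξ * b') (c + ξ * c') p ∂sig3 d) ξ₀ := by
  obtain ⟨C, hC⟩ := exists_bound_of_continuous hφ
  set M : ℝ := |(a + ξ₀ * a').re - α.re| + |(b + ξ₀ * b').re - β.re| + |(c + ξ₀ * c').re - γ.re| + 1
  have hM : ∀ {e e' ε : ℂ}, ε.re < (e + ξ₀ * e').re → (e + ξ₀ * e').re < ε.re + M →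
      ∀ᶠ ξ in 𝓝 ξ₀, ε.re ≤ (e + ξ * e').re ∧ (e + ξ * e').re ≤ ε.re + M := by
    intro e e' ε h1 h2
    have hcont : ContinuousAt (fun ξ : ℂ => (e + ξ * e').re) ξ₀ := by fun_prop
    exact ((hcont.eventually (lt_mem_nhds h1)).and (hcont.eventually (gt_mem_nhds h2))).mono
      fun _ h => ⟨h.1.le, h.2.le⟩
  have n1 := abs_nonneg ((a + ξ₀ * a').re - α.re)
  have n2 := abs_nonneg ((b + ξ₀ * b').re - β.re)
  have n3 := abs_nonneg ((c + ξ₀ * c').re - γ.re)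
  have m1 := le_abs_self ((a + ξ₀ * a').re - α.re)
  have m2 := le_abs_self ((b + ξ₀ * b').re - β.re)
  have m3 := le_abs_self ((c + ξ₀ * c').re - γ.re)
  obtain ⟨r, hr, hball⟩ := Metric.eventually_nhds_iff_ball.1
    ((hM ha (by simp only [M]; linarith)).and ((hM hb (by simp only [M]; linarith)).and
      (hM hc (by simp only [M]; linarith))))
  set B : S d × S d × S d → ℝ := fun p => C * (2 ^ M * 2 ^ M * 2 ^ M * ‖tk α β γ p‖) with hB
  have hBi : Integrable B (sig3 d) := (hi.norm.const_mul _).const_mul _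
  set F : ℂ → S d × S d × S d → ℂ := fun ξ p =>
    φ p * tk (a + ξ * a') (b + ξ * b') (c + ξ * c') p with hF
  have hFB : ∀ ξ ∈ Metric.ball ξ₀ r, ∀ p, ‖F ξ p‖ ≤ B p := by
    intro ξ hξ p
    obtain ⟨⟨h1, h2⟩, ⟨h3, h4⟩, h5, h6⟩ := hball ξ hξ
    rw [hF, norm_mul]
    exact mul_le_mul (hC p) (norm_tk_le_mul h1 h2 h3 h4 h5 h6 p) (norm_nonneg _)
      ((norm_nonneg _).trans (hC p))
  have hFm : ∀ ξ, AEStronglyMeasurable (F ξ) (sig3 d) := fun ξ =>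
    (hφ.measurable.mul (measurable_tk _ _ _)).aestronglyMeasurable
  have hFd : ∀ ξ p, HasDerivAt (fun ξ => F ξ p) (F ξ p * tkLog a' b' c' p) ξ := by
    intro ξ p
    refine ((hasDerivAt_tk a a' b b' c c' ξ p).const_mul (φ p)).congr_deriv ?_
    simp only [hF]; ring
  refine (hasDerivAt_integral_of_dominated_loc_of_deriv_le (μ := sig3 d) (F := F)
    (F' := fun ξ p => F ξ p * tkLog a' b' c' p) (bound := fun p => B p / (r / 2))
    (Metric.ball_mem_nhds ξ₀ (half_pos hr)) (Eventually.of_forall hFm)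
    (hBi.mono' (hFm ξ₀) (ae_of_all _ (hFB ξ₀ (Metric.mem_ball_self hr))))
    ((hFm ξ₀).mul (measurable_tkLog _ _ _).aestronglyMeasurable)
    (ae_of_all _ fun p ξ hξ => ?_) (hBi.div_const _)
    (ae_of_all _ fun p ξ _ => hFd ξ p)).2.differentiableAt
  rw [← (hFd ξ p).deriv]
  refine Complex.norm_deriv_le_of_forall_mem_sphere_norm_le (half_pos hr)
    (Differentiable.diffContOnCl fun ξ => (hFd ξ p).differentiableAt) fun z hz => hFB z ?_ p
  rw [Metric.mem_ball] at hξ ⊢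
  rw [mem_sphere_iff_norm, ← dist_eq_norm] at hz
  linarith [dist_triangle z ξ ξ₀]

end holomorphic

/-! ### Reduction to the monomials in the square distances -/

section reduction

theorem IsRot.inv_act_act {g : SO0 d} (h : IsRot g) (x : S d) : act g⁻¹ (act g x) = x := by
  simpa using act_inv_act g⁻¹ h.inv x

/-- The rotation invariant operators that factor through jets on the diagonal and that act
continuously on families. -/
def rotOps (d M : ℕ) : Submodule ℂ (CSS d →ₗ[ℂ] CS d) where
  carrier := {B | B ∈ diagOps d M ∧
    (∀ g, IsRot g → ∀ f z, (B (piTensor 0 0 g f)).1 z = (B f).1 (act g⁻¹ z)) ∧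
    ∀ f : CSSS d, Continuous fun z => (B (slice3 f z)).1 z}
  add_mem' {A B} hA hB := by
    refine ⟨add_mem hA.1 hB.1, fun g hg f z => ?_, fun f => (hA.2.2 f).add (hB.2.2 f)⟩
    exact congrArg₂ (· + ·) (hA.2.1 g hg f z) (hB.2.1 g hg f z)
  zero_mem' := ⟨zero_mem _, fun _ _ _ _ => rfl, fun _ => continuous_const⟩
  smul_mem' c A hA := by
    refine ⟨Submodule.smul_mem _ c hA.1, fun g hg f z => ?_, fun f => (hA.2.2 f).const_smul c⟩
    exact congrArg (c * ·) (hA.2.1 g hg f z)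

theorem piTensor_rot {g : SO0 d} (hg : IsRot g) (l m : ℂ) (f : CSS d) :
    piTensor l m g f = piTensor 0 0 g f := by
  ext p
  change (kappa g⁻¹ p.1 : ℂ) ^ (rho d + l) * (kappa g⁻¹ p.2 : ℂ) ^ (rho d + m) * _ =
    (kappa g⁻¹ p.1 : ℂ) ^ (rho d + 0) * (kappa g⁻¹ p.2 : ℂ) ^ (rho d + 0) * _
  simp [hg.inv.kappa]

theorem piTensor_rot_apply {g : SO0 d} (hg : IsRot g) (f : CSS d) (p : S d × S d) :
    (piTensor 0 0 g f).1 p = f.1 (act g⁻¹ p.1, act g⁻¹ p.2) := by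
  change (kappa g⁻¹ p.1 : ℂ) ^ (rho d + 0) * (kappa g⁻¹ p.2 : ℂ) ^ (rho d + 0) * _ = _
  simp [hg.inv.kappa]

theorem piRep_rot_apply {g : SO0 d} (hg : IsRot g) (l : ℂ) (f : CS d) (z : S d) :
    (piRep l g f).1 z = f.1 (act g⁻¹ z) := by
  change (kappa g⁻¹ z : ℂ) ^ (rho d + l) * _ = _
  simp [hg.inv.kappa]

theorem BB_mem_rotOps (k : ℕ) (s t : ℂ) : BB (d := d) k s t ∈ rotOps d (4 * k) := by
  refine ⟨fun x f hf => BB_eq_zero s t k hf, fun g hg f z => ?_, fun f => ?_⟩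
  · have h := BB_covariant (s - rho d) (t - rho d) k g f
    rw [piTensor_rot hg, add_sub_cancel, add_sub_cancel] at h
    rw [h, piRep_rot_apply hg]
  · exact (continuous_CSSS (DDpow_mem_opsZ s t k f)).comp
      (continuous_id.prodMk (continuous_id.prodMk continuous_id))

theorem rotInv_of_mem_rotOps {M : ℕ} {B : CSS d →ₗ[ℂ] CS d} (hB : B ∈ rotOps d M) :
    RotInv (evalAt (pole d) B) := by
  intro i j hij P
  have hij' : i.succ ≠ j.succ := fun h => hij (Fin.succ_injective d h)
  rw [evalAt_apply, covariant_flowDeriv (l := 0) (m := 0) (n := 0) (hB.1 (pole d)) _ (fun τ f => ?_)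
    (isFlowDeriv_crot hij' (rho d + 0) (rho d + 0) P), crot_gen]
  · simp [pole_succ, sd]
  · ext z
    rw [piRep_rot_apply (isRot_crot _ _), hB.2.1 _ (isRot_crot _ _)]

theorem eq_zero_of_mem_rotOps (hd : 3 ≤ d) {M : ℕ} {B : CSS d →ₗ[ℂ] CS d} (hB : B ∈ rotOps d M)
    (h : ∀ a, Recurrence.len a ≤ M → (B (triCSS a)).1 (pole d) = 0) (f : CSS d) (z : S d) :
    (B f).1 z = 0 := by
  have h1 := (rotInv_of_mem_rotOps hB).eq_zero hd (hB.1 (pole d)) fun a => by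
    rcases le_or_gt (Recurrence.len a) M with ha | ha
    · exact h a ha
    · exact hB.1 _ _ (triCSS_mem ha)
  obtain ⟨g, hg, rfl⟩ := exists_rot_pole (by omega : 1 ≤ d) z
  have h2 := hB.2.1 _ hg.inv f (pole d)
  rw [inv_inv] at h2
  rw [← h2]
  exact LinearMap.congr_fun h1 _

theorem contMDiff_two_mul_ww {M : Type*} [TopologicalSpace M] {V H : Type*} [NormedAddCommGroup V]
    [NormedSpace ℝ V] [TopologicalSpace H] {I : ModelWithCorners ℝ V H} [ChartedSpace H M]
    {u v : M → S d} (hu : ContMDiff I (𝓡 d) ∞ u) (hv : ContMDiff I (𝓡 d) ∞ v) (n : ℕ) :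
    ContMDiff I 𝓘(ℝ, ℂ) ∞ fun p => (2 * (ww (u p) (v p) : ℂ)) ^ n := by
  have := Fact.mk (finrank_euclideanSpace_fin (𝕜 := ℝ) (n := d + 1))
  have h1 : ContMDiff I 𝓘(ℝ, E d × E d) ∞ fun p => ((u p : E d), (v p : E d)) :=
    ((contMDiff_coe_sphere (n := d)).comp hu).prodMk_space ((contMDiff_coe_sphere (n := d)).comp hv)
  have h2 : ContDiff ℝ ∞ fun q : E d × E d => (2 * ((1 - inner ℝ q.1 q.2 : ℝ) : ℂ)) ^ n :=
    (contDiff_const.mul (Complex.ofRealCLM.contDiff.comp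
      (contDiff_const.sub (contDiff_fst.inner ℝ contDiff_snd)))).pow n
  refine (h2.contMDiff.comp h1).congr fun p => ?_
  simp [inner_eq_ww]

/-- The monomials in the square distances of three points. -/
def triMon (d : ℕ) (a : Fin 3 → ℕ) : CSSS d :=
  ⟨fun p => (2 * (ww p.2.1 p.2.2 : ℂ)) ^ a 0 * (2 * (ww p.1 p.2.2 : ℂ)) ^ a 1 *
    (2 * (ww p.1 p.2.1 : ℂ)) ^ a 2,
    contMDiff_mul_complex (contMDiff_mul_complex
      (contMDiff_two_mul_ww (contMDiff_fst.comp contMDiff_snd) (contMDiff_snd.comp contMDiff_snd) _)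
      (contMDiff_two_mul_ww contMDiff_fst (contMDiff_snd.comp contMDiff_snd) _))
      (contMDiff_two_mul_ww contMDiff_fst (contMDiff_fst.comp contMDiff_snd) _)⟩

theorem slice3_triMon {g : SO0 d} (hg : IsRot g) (a : Fin 3 → ℕ) :
    slice3 (triMon d a) (act g (pole d)) = piTensor 0 0 g (triCSS a) := by
  ext p
  rw [piTensor_rot_apply hg]
  have h0 : ∀ x : S d, (ww x (act g (pole d)) : ℂ) = 1 - ((act g⁻¹ x : E d) 0 : ℝ) := by
    intro x
    have h1 : ww x (act g (pole d)) = ww (act g⁻¹ x) (pole d) := by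
      have h := hg.inv.lz_act x (act g (pole d))
      rwa [hg.inv_act_act, eq_comm] at h
    have h2 := inner_eq_ww (act g⁻¹ x) (pole d)
    rw [h1]
    have h3 : inner ℝ (act g⁻¹ x : E d) (pole d : E d) = (act g⁻¹ x : E d) 0 := by
      rw [pole_eq, inner_bv]
    rw [h3] at h2
    rw [h2]; push_cast; ring
  have h3 : ww p.1 p.2 = ww (act g⁻¹ p.1) (act g⁻¹ p.2) := (hg.inv.lz_act _ _).symm
  change (2 * (ww p.2 (act g (pole d)) : ℂ)) ^ a 0 * (2 * (ww p.1 (act g (pole d)) : ℂ)) ^ a 1 *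
    (2 * (ww p.1 p.2 : ℂ)) ^ a 2 = _
  have hprod : ∀ P Q (q : S d × S d), (polyCSS (P * Q)).1 q = (polyCSS P).1 q * (polyCSS Q).1 q :=
    fun P Q q => polyCSS_mul P Q q
  have hpow : ∀ P (n : ℕ) (q : S d × S d), (polyCSS (P ^ n)).1 q = (polyCSS P).1 q ^ n := by
    intro P n q
    induction n with
    | zero => simpa using polyCSS_one q
    | succ n ih => rw [pow_succ, hprod, ih, pow_succ]
  rw [triCSS, Fin.prod_univ_three, hprod, hprod, hpow, hpow, hpow, sqDist_zero, sqDist_one,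
    sqDist_two, h0, h0, h3]
  have h4 := inner_eq_ww (act g⁻¹ p.1) (act g⁻¹ p.2)
  rw [h4]
  push_cast
  ring

theorem sigma_univ_ne_zero : (sigma d).real univ ≠ 0 := by
  rw [measureReal_def, ENNReal.toReal_ne_zero]
  refine ⟨?_, measure_ne_top _ _⟩
  rw [sigma, Measure.toSphere_apply_univ]
  simp [(Metric.measure_ball_pos (volume : Measure (E d)) 0 one_pos).ne']

theorem integral_slice3_triMon (hd : 1 ≤ d) {M : ℕ} {B : CSS d →ₗ[ℂ] CS d} (hB : B ∈ rotOps d M)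
    (a : Fin 3 → ℕ) : ∫ z, (B (slice3 (triMon d a) z)).1 z ∂sigma d =
      (sigma d).real univ * (B (triCSS a)).1 (pole d) := by
  have h : ∀ z, (B (slice3 (triMon d a) z)).1 z = (B (triCSS a)).1 (pole d) := by
    intro z
    obtain ⟨g, hg, rfl⟩ := exists_rot_pole hd z
    rw [slice3_triMon hg, hB.2.1 g hg, hg.inv_act_act]
  simp only [h, integral_const, Complex.real_smul]

/-- The values of an operator, as a function. -/
def opFun (d : ℕ) : (CSS d →ₗ[ℂ] CS d) →ₗ[ℂ] (CSS d → S d → ℂ) where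
  toFun B f x := (B f).1 x
  map_add' _ _ := rfl
  map_smul' _ _ := rfl

/-- The integral of the diagonal values of an operator that is applied to a family. -/
def diagInt (M : ℕ) (f : CSSS d) : (rotOps d M).map (opFun d) →ₗ[ℂ] ℂ where
  toFun φ := ∫ z, φ.1 (slice3 f z) z ∂sigma d
  map_add' φ ψ := by
    obtain ⟨_, A, hA, rfl⟩ := φ
    obtain ⟨_, B, hB, rfl⟩ := ψ
    exact integral_add (integrable_of_continuous (hA.2.2 f)) (integrable_of_continuous (hB.2.2 f))
  map_smul' c φ := integral_const_mul _ _

theorem exists_combination (hd : 3 ≤ d) (f : CSSS d) (k : ℕ) :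
    ∃ c : (Fin 3 → Fin (4 * k + 1)) → ℂ, ∀ s t,
      ∫ z, (BB k s t (slice3 f z)).1 z ∂sigma d =
        ∑ a, c a * ∫ z, (BB k s t (slice3 (triMon d fun j => a j) z)).1 z ∂sigma d := by
  have h := mem_span_of_iInf_ker_le_ker
    (L := fun a : Fin 3 → Fin (4 * k + 1) => diagInt (4 * k) (triMon d fun j => a j))
    (K := diagInt (4 * k) f) ?_
  · obtain ⟨c, hc⟩ := (Submodule.mem_span_range_iff_exists_fun ℂ).1 h
    refine ⟨c, fun s t => ?_⟩
    have := LinearMap.congr_fun hc ⟨_, _, BB_mem_rotOps k s t, rfl⟩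
    simp only [LinearMap.sum_apply, LinearMap.smul_apply, smul_eq_mul] at this
    exact this.symm
  · rintro ⟨_, B, hB, rfl⟩ hφ
    simp only [Submodule.mem_iInf, LinearMap.mem_ker] at hφ ⊢
    have h0 : ∀ f z, (B f).1 z = 0 := by
      refine eq_zero_of_mem_rotOps hd hB fun a ha => ?_
      have hlt : ∀ j, a j < 4 * k + 1 := fun j =>
        Nat.lt_succ_of_le ((Finset.single_le_sum (fun i _ => Nat.zero_le (a i))
          (Finset.mem_univ j)).trans ha)
      have h1 := hφ fun j => ⟨a j, hlt j⟩
      have h2 := integral_slice3_triMon (by omega : 1 ≤ d) hB a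
      have h3 : (0 : ℂ) = (sigma d).real univ * (B (triCSS a)).1 (pole d) := h1.symm.trans h2
      exact (mul_eq_zero.1 h3.symm).resolve_left (by exact_mod_cast sigma_univ_ne_zero)
    change ∫ z, (B (slice3 f z)).1 z ∂sigma d = 0
    simp [h0]

end reduction

/-! ### The values on the monomials in the square distances -/

section monomials

/-- The rising factorial. -/
def poch (x : ℂ) (n : ℕ) : ℂ := ∏ i ∈ Finset.range n, (x + i)

theorem poch_succ (x : ℂ) (n : ℕ) : poch x (n + 1) = poch x n * (x + n) := Finset.prod_range_succ _ _

theorem poch_add_two (x : ℂ) (n : ℕ) : poch x (n + 2) = x * (x + 1) * poch (x + 2) n := by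
  rw [poch, Finset.prod_range_succ', Finset.prod_range_succ', poch]
  push_cast
  simp only [add_assoc, add_comm (_ : ℂ) 2, add_zero]
  ring_nf

theorem poch_ne_zero {x : ℂ} {n : ℕ} (h : poch x n ≠ 0) {i : ℕ} (hi : i < n) : x + i ≠ 0 :=
  Finset.prod_ne_zero_iff.1 h i (Finset.mem_range.2 hi)

theorem differentiable_poch (n : ℕ) : Differentiable ℂ fun x => poch x n := by
  unfold poch; fun_prop

theorem inv_Gamma_eq_poch (s : ℂ) (n : ℕ) :
    (Complex.Gamma s)⁻¹ = poch s n * (Complex.Gamma (s + n))⁻¹ := by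
  induction n with
  | zero => simp [poch]
  | succ n ih =>
    rw [ih, poch_succ, Complex.one_div_Gamma_eq_self_mul_one_div_Gamma_add_one (s + n), Nat.cast_succ,
      ← add_assoc, mul_assoc]

/-- The inverse of the product of the Gamma factors in terms of the half exponents. -/
def invGam (d : ℕ) (e : Fin 3 → ℂ) : ℂ :=
  (∏ j, (Complex.Gamma (rho d + e j))⁻¹) * (Complex.Gamma (∑ j, e j + d))⁻¹

/-- The normalized integral of the trilinear kernel. -/
def nj (d : ℕ) (e : Fin 3 → ℂ) : ℂ := invGam d e * tj d (e 0) (e 1) (e 2)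

/-- The spectral parameters in terms of the half exponents. -/
def specParam (d : ℕ) (e : Fin 3 → ℂ) (j : Fin 3) : ℂ := d + ∑ i, e i - e j

theorem tj_shift_one {a b c : ℂ} (ha : 1 < a.re) (hb : 1 < b.re) (hc : 1 < c.re) :
    (d + b + c) * (d + b + c + 1) * ((d + a + c) * (d + a + c + 1)) *
      ((d + a + b) * (d + a + b + 1)) * tj d (a + 1) (b + 1) (c + 1) =
    8 * ((rho d + a) * (rho d + b) * (rho d + c)) *
      ((a + b + c + d) * (a + b + c + d + 1) * (a + b + c + d + 2)) * tj d a b c := by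
  have ha' : 1 < (a + 1).re := by simp; linarith
  have hb' : 1 < (b + 1).re := by simp; linarith
  have h1 := tj_shift (d := d) ha hb hc
  have h2 := tj_shift (d := d) hb ha' hc
  have h3 := tj_shift (d := d) hc ha' hb'
  rw [tj_swap12, tj_swap12 (a + 1)] at h2
  rw [tj_cyc3 (a + 1), tj_cyc3 (a + 1)] at h3
  linear_combination (d + b + c) * (d + a + c) * (d + a + b) * (d + a + b + 1) * h3 +
    2 * (a + b + c + d + 2) * (rho d + c) * (d + a + c) * (d + a + b) * h2 +
    4 * (a + b + c + d + 2) * (a + b + c + d + 1) * (rho d + c) * (rho d + b) * h1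

theorem nj_shift {e : Fin 3 → ℂ} (he : ∀ j, 1 < (e j).re) :
    nj d e = 8⁻¹ * (∏ j, (specParam d e j * (specParam d e j + 1))) * nj d fun j => e j + 1 := by
  have h := tj_shift_one (d := d) (he 0) (he 1) (he 2)
  have g1 : ∀ j, (Complex.Gamma (rho d + e j))⁻¹ =
      (rho d + e j) * (Complex.Gamma (rho d + (e j + 1)))⁻¹ := fun j => by
    rw [← add_assoc]; exact Complex.one_div_Gamma_eq_self_mul_one_div_Gamma_add_one _
  have g2 := inv_Gamma_eq_poch (e 0 + e 1 + e 2 + d) 3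
  simp only [poch, Finset.prod_range_succ, Finset.prod_range_zero] at g2
  have e3 : e 0 + 1 + (e 1 + 1) + (e 2 + 1) + d = e 0 + e 1 + e 2 + d + (3 : ℕ) := by
    push_cast; ring
  simp only [nj, invGam, Fin.prod_univ_three, Fin.sum_univ_three, specParam, g1, g2, e3]
  push_cast
  linear_combination (-8⁻¹ * ((Complex.Gamma (rho d + (e 0 + 1)))⁻¹ *
    (Complex.Gamma (rho d + (e 1 + 1)))⁻¹ * (Complex.Gamma (rho d + (e 2 + 1)))⁻¹ *
    (Complex.Gamma (e 0 + e 1 + e 2 + d + 3))⁻¹)) * h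

theorem nj_shift_iter (N : ℕ) {e : Fin 3 → ℂ} (he : ∀ j, 1 < (e j).re) :
    nj d e = 8⁻¹ ^ N * (∏ j, poch (specParam d e j) (2 * N)) * nj d fun j => e j + N := by
  induction N generalizing e with
  | zero => simp [poch]
  | succ N ih =>
    rw [nj_shift he, ih (e := fun j => e j + 1) fun j => by simp; linarith [he j]]
    have h1 : ∀ j, specParam d (fun j => e j + 1) j = specParam d e j + 2 := fun j => by
      simp only [specParam, Fin.sum_univ_three]; ring
    have h2 : (fun j => e j + 1 + (N : ℂ)) = fun j => e j + ((N + 1 : ℕ) : ℂ) := by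
      ext j; push_cast; ring
    simp only [h1, h2, mul_add, mul_one, poch_add_two, Finset.prod_mul_distrib]
    ring

/-- The normalized integral of the trilinear kernel against a monomial in the square distances,
continued analytically to the half exponents of real part greater than `-N`. -/
def triVal (d N : ℕ) (a : Fin 3 → ℕ) (e : Fin 3 → ℂ) : ℂ :=
  2 ^ Recurrence.len a * (∏ j, poch (rho d + e j) (a j)) * poch (∑ j, e j + d) (Recurrence.len a) *
    (8⁻¹ ^ N * (∏ j, poch (specParam d e j + Recurrence.len a - a j) (2 * N)) *
      nj d fun j => e j + a j + N)

theorem pow_mul_posPow (c : ℂ) {t : ℝ} (h : 0 ≤ t) (n : ℕ) :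
    (t : ℂ) ^ n * posPow c t = posPow (c + n) t := by
  induction n with
  | zero => simp
  | succ n ih => rw [pow_succ', mul_assoc, ih, mul_posPow _ h]; push_cast; rw [add_assoc]

theorem triMon_mul_tk (a : Fin 3 → ℕ) (e : Fin 3 → ℂ) (p : S d × S d × S d) :
    (triMon d a).1 p * tk (e 0) (e 1) (e 2) p =
      2 ^ Recurrence.len a * tk (e 0 + a 0) (e 1 + a 1) (e 2 + a 2) p := by
  rw [tk, tk, ← pow_mul_posPow _ (ww_nonneg _ _), ← pow_mul_posPow _ (ww_nonneg _ _),
    ← pow_mul_posPow _ (ww_nonneg _ _)]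
  have : (triMon d a).1 p = (2 * (ww p.2.1 p.2.2 : ℂ)) ^ a 0 * (2 * (ww p.1 p.2.2 : ℂ)) ^ a 1 *
    (2 * (ww p.1 p.2.1 : ℂ)) ^ a 2 := rfl
  rw [this, Recurrence.len, Fin.sum_univ_three, pow_add, pow_add, mul_pow, mul_pow, mul_pow]
  ring

theorem integral_triMon (N : ℕ) (a : Fin 3 → ℕ) {e : Fin 3 → ℂ} (he : ∀ j, 1 < (e j).re) :
    invGam d e * ∫ p, (triMon d a).1 p * tk (e 0) (e 1) (e 2) p ∂sig3 d = triVal d N a e := by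
  simp only [triMon_mul_tk, integral_const_mul]
  change invGam d e * (2 ^ Recurrence.len a * tj d (e 0 + a 0) (e 1 + a 1) (e 2 + a 2)) = _
  have h1 := nj_shift_iter (d := d) N (e := fun j => e j + a j) fun j => by
    simp only [Complex.add_re, Complex.natCast_re]
    have := Nat.cast_nonneg (α := ℝ) (a j)
    linarith [he j]
  have h2 : ∀ j, specParam d (fun j => e j + a j) j = specParam d e j + Recurrence.len a - a j :=
    fun j => by
      simp only [specParam, Recurrence.len, Finset.sum_add_distrib]; push_cast; ring
  simp only [h2] at h1
  rw [triVal, ← h1, nj]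
  have h3 : invGam d e = (∏ j, poch (rho d + e j) (a j)) *
      poch (∑ j, e j + d) (Recurrence.len a) * invGam d fun j => e j + a j := by
    simp only [invGam]
    rw [inv_Gamma_eq_poch (∑ j, e j + d) (Recurrence.len a),
      Finset.prod_congr rfl fun j _ => inv_Gamma_eq_poch (rho d + e j) (a j),
      Finset.prod_mul_distrib]
    have h4 : ∑ j, (e j + (a j : ℂ)) + d = ∑ j, e j + d + Recurrence.len a := by
      simp only [Recurrence.len, Finset.sum_add_distrib]; push_cast; ring
    simp only [h4, add_assoc]
    ring
  rw [h3]
  ring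

theorem differentiable_invGam : Differentiable ℂ fun e => invGam d e := by
  have h := Complex.differentiable_one_div_Gamma
  have h1 : ∀ j, Differentiable ℂ fun e : Fin 3 → ℂ => (Complex.Gamma (rho d + e j))⁻¹ := fun j =>
    h.comp (f := fun e : Fin 3 → ℂ => rho d + e j) (by fun_prop)
  simp only [invGam, Fin.prod_univ_three, Fin.sum_univ_three]
  refine (((h1 0).fun_mul (h1 1)).fun_mul (h1 2)).fun_mul ?_
  exact h.comp (f := fun e : Fin 3 → ℂ => e 0 + e 1 + e 2 + d) (by fun_prop)

theorem differentiableAt_triVal (N : ℕ) (a : Fin 3 → ℕ) (u v : Fin 3 → ℂ) {ξ : ℂ}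
    (h : ∀ j, 0 < (u j + ξ * v j + N).re) :
    DifferentiableAt ℂ (fun ξ => triVal d N a fun j => u j + ξ * v j) ξ := by
  have hp : ∀ (n : ℕ) {f : ℂ → ℂ}, Differentiable ℂ f → DifferentiableAt ℂ (fun ξ => poch (f ξ) n) ξ :=
    fun n f hf => ((differentiable_poch n).comp hf).differentiableAt
  have hnj : DifferentiableAt ℂ (fun ξ => nj d fun j => u j + ξ * v j + a j + N) ξ := by
    unfold nj
    refine DifferentiableAt.fun_mul ?_ ?_
    · exact (differentiable_invGam.comp (f := fun ξ j => u j + ξ * v j + a j + N)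
        (by fun_prop)).differentiableAt
    · have h0 : ∀ j, (0 : ℂ).re < (u j + a j + N + ξ * v j).re := fun j => by
        have h1 := h j
        have h2 := Nat.cast_nonneg (α := ℝ) (a j)
        simp only [Complex.add_re, Complex.natCast_re, Complex.zero_re] at h1 ⊢
        linarith
      have := differentiableAt_integral_tk (d := d) (φ := fun _ => 1) continuous_const
        integrable_tk_zero (h0 0) (h0 1) (h0 2)
      simp only [one_mul] at this
      refine this.congr_of_eventuallyEq (Filter.Eventually.of_forall fun ξ => ?_)
      simp only [tj]
      ring_nf
  unfold triVal specParam
  refine DifferentiableAt.fun_mul (DifferentiableAt.fun_mul (DifferentiableAt.fun_mul ?_ ?_) ?_)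
    (DifferentiableAt.fun_mul (DifferentiableAt.fun_mul ?_ ?_) hnj)
  · exact differentiableAt_const _
  · exact DifferentiableAt.fun_finsetProd fun j _ => hp _ (by fun_prop)
  · exact hp _ (by fun_prop)
  · exact differentiableAt_const _
  · exact DifferentiableAt.fun_finsetProd fun j _ => hp _ (by fun_prop)

theorem nondeg_of_triVal_ne_zero {N : ℕ} {a : Fin 3 → ℕ} {e : Fin 3 → ℂ} (h : triVal d N a e ≠ 0)
    (hN : ∀ j, 0 < (specParam d e j + 2 * N).re) : Recurrence.Nondeg (specParam d e) a := by
  simp only [triVal, mul_ne_zero_iff, Finset.prod_ne_zero_iff, Finset.mem_univ, true_imp_iff] at h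
  refine ⟨fun j m hm => ?_, fun j m => ?_⟩
  · have h1 := poch_ne_zero (h.1.1.2 j) hm
    have h2 : Recurrence.exc (specParam d e) j = rho d + e j := by
      simp only [Recurrence.exc, specParam, Fin.sum_univ_three, rho]; ring
    rwa [h2]
  · rcases lt_or_ge m (2 * N) with hm | hm
    · exact poch_ne_zero (h.2.1.2 j) hm
    · intro h0
      have h1 := congrArg Complex.re h0
      have h2 : (a j : ℝ) ≤ Recurrence.len a := by
        exact_mod_cast Finset.single_le_sum (fun i _ => Nat.zero_le (a i)) (Finset.mem_univ j)
      have h3 : (2 * N : ℝ) ≤ m := by exact_mod_cast hm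
      have h4 := hN j
      simp [Recurrence.coef] at h1 h4
      linarith

theorem len_le_of_triVal_ne_zero {N k : ℕ} {a : Fin 3 → ℕ} {e : Fin 3 → ℂ} (h : triVal d N a e ≠ 0)
    (he : ∑ j, e j + d = -k) : Recurrence.len a ≤ k := by
  simp only [triVal, mul_ne_zero_iff] at h
  by_contra! hk
  exact poch_ne_zero h.1.2 hk (by rw [he]; ring)

end monomials

/-! ### Estimates near the diagonal -/

section diagonal

theorem locallyLipschitz_CSSS (f : CSSS d) : LocallyLipschitz f.1 := by
  intro p
  set ι : S d × S d × S d → E d × E d × E d := fun q => (q.1, q.2.1, q.2.2) with hι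
  set π : E d × E d × E d → S d × S d × S d := fun v => (proj v.1, proj v.2.1, proj v.2.2) with hπ
  have h1 : ContMDiffAt 𝓘(ℝ, E d × E d × E d) ((𝓡 d).prod ((𝓡 d).prod (𝓡 d))) ∞ π (ι p) := by
    have a1 : ContMDiffAt 𝓘(ℝ, E d × E d × E d) (𝓡 d) ∞ (fun v => proj (d := d) v.1) (ι p) :=
      ContMDiffAt.comp (ι p) (contMDiffAt_proj (coe_ne_zero p.1)) contDiff_fst.contMDiff.contMDiffAt
    have a2 : ContMDiffAt 𝓘(ℝ, E d × E d × E d) (𝓡 d) ∞ (fun v => proj (d := d) v.2.1) (ι p) :=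
      ContMDiffAt.comp (ι p) (contMDiffAt_proj (coe_ne_zero p.2.1))
        (contDiff_fst.comp contDiff_snd).contMDiff.contMDiffAt
    have a3 : ContMDiffAt 𝓘(ℝ, E d × E d × E d) (𝓡 d) ∞ (fun v => proj (d := d) v.2.2) (ι p) :=
      ContMDiffAt.comp (ι p) (contMDiffAt_proj (coe_ne_zero p.2.2))
        (contDiff_snd.comp contDiff_snd).contMDiff.contMDiffAt
    exact a1.prodMk (a2.prodMk a3)
  have h2 : ContDiffAt ℝ 1 (f.1 ∘ π) (ι p) :=
    ((ContMDiffAt.comp (ι p) (ContMDiff.contMDiffAt f.2) h1).contDiffAt).of_le (by simp)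
  obtain ⟨K, t, ht, hK⟩ := h2.exists_lipschitzOnWith
  have hc : Continuous ι := by fun_prop
  refine ⟨K, ι ⁻¹' t, hc.continuousAt.preimage_mem_nhds ht, fun x hx y hy => ?_⟩
  have hπι : ∀ q, π (ι q) = q := fun q => by simp only [hπ, hι, proj_coe]
  have h3 := hK hx hy
  simp only [Function.comp_apply, hπι] at h3
  exact h3

theorem dist_eq_sqrt_ww (x y : S d) : dist x y = √(2 * ww x y) := by
  rw [ww, lz_lv_eq, Subtype.dist_eq, dist_eq_norm]
  rw [show 2 * (‖(x : E d) - y‖ ^ 2 / 2) = ‖(x : E d) - y‖ ^ 2 by ring, Real.sqrt_sq (norm_nonneg _)]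

theorem exists_norm_sub_diag_le (f : CSSS d) : ∃ L : ℝ, 0 ≤ L ∧ ∀ p : S d × S d × S d,
    ‖f.1 p - f.1 (p.2.2, p.2.2, p.2.2)‖ ≤ L * (√(ww p.1 p.2.2) + √(ww p.2.1 p.2.2)) := by
  obtain ⟨K, hK⟩ := ((locallyLipschitz_CSSS f).locallyLipschitzOn
    (s := univ)).exists_lipschitzOnWith_of_compact isCompact_univ
  refine ⟨K * √2, by positivity, fun p => ?_⟩
  have h1 := hK.dist_le_mul p (mem_univ _) (p.2.2, p.2.2, p.2.2) (mem_univ _)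
  rw [dist_eq_norm] at h1
  refine h1.trans ?_
  rw [mul_assoc]
  refine mul_le_mul_of_nonneg_left ?_ K.2
  rw [mul_add, ← Real.sqrt_mul zero_le_two, ← Real.sqrt_mul zero_le_two, ← dist_eq_sqrt_ww,
    ← dist_eq_sqrt_ww, Prod.dist_eq, Prod.dist_eq]
  simp only [dist_self]
  refine max_le (le_add_of_nonneg_right dist_nonneg) (max_le (le_add_of_nonneg_left dist_nonneg) ?_)
  positivity

theorem integrable_mul_of_continuous {φ k : S d × S d × S d → ℂ} (hφ : Continuous φ)
    (hk : Integrable k (sig3 d)) : Integrable (fun p => φ p * k p) (sig3 d) := by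
  obtain ⟨C, hC⟩ := exists_bound_of_continuous hφ
  exact hk.bdd_mul hφ.aestronglyMeasurable (ae_of_all _ hC)

theorem integral_last_mul_tk (hd : 1 ≤ d) {φ : S d → ℂ} (hφ : Continuous φ)
    (h0 : ∫ z, φ z ∂sigma d = 0) {a b c : ℂ} (hi : Integrable (tk (d := d) a b c) (sig3 d)) :
    ∫ p, φ p.2.2 * tk a b c p ∂sig3 d = 0 := by
  rw [integral_sig3_last (integrable_mul_of_continuous (φ := fun p => φ p.2.2)
    (hφ.comp (continuous_snd.comp continuous_snd)) hi)]
  have h1 : ∀ z, ∫ q : S d × S d, tk a b c (q.1, q.2, z) ∂(sigma d).prod (sigma d) =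
      ∫ q : S d × S d, tk a b c (q.1, q.2, pole d) ∂(sigma d).prod (sigma d) := by
    intro z
    obtain ⟨g, hg, rfl⟩ := exists_rot_pole hd z
    have h2 := (hg.measurePreserving.prod hg.measurePreserving)
    have h3 : Measurable fun q : S d × S d => tk a b c (q.1, q.2, act g (pole d)) :=
      (measurable_tk a b c).comp (f := fun q : S d × S d => (q.1, q.2, act g (pole d)))
        (by fun_prop)
    rw [← h2.map_eq, integral_map h2.measurable.aemeasurable
      (by rw [h2.map_eq]; exact h3.aestronglyMeasurable)]
    rw [h2.map_eq]
    refine integral_congr_ae (ae_of_all _ fun q => ?_)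
    simp only [tk, Prod.map_fst, Prod.map_snd, ww, hg.lz_act]
  have h4 : ∀ z, ∫ q : S d × S d, φ z * tk a b c (q.1, q.2, z) ∂(sigma d).prod (sigma d) =
      φ z * ∫ q : S d × S d, tk a b c (q.1, q.2, pole d) ∂(sigma d).prod (sigma d) := fun z => by
    rw [integral_const_mul, h1]
  simp only [h4, integral_mul_const, h0, zero_mul]

theorem sqrt_mul_norm_posPow (a : ℂ) (t : ℝ) : √t * ‖posPow a t‖ = ‖posPow (a + 1 / 2) t‖ := by
  rcases le_or_gt t 0 with h | h
  · simp [posPow_of_nonpos h]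
  · rw [norm_posPow_of_pos h, norm_posPow_of_pos h, Real.sqrt_eq_rpow, ← Real.rpow_add h]
    congr 1
    simp; ring

theorem sqrt_mul_norm_tk (a b c : ℂ) (p : S d × S d × S d) :
    (√(ww p.1 p.2.2) + √(ww p.2.1 p.2.2)) * ‖tk a b c p‖ =
      ‖tk a (b + 1 / 2) c p‖ + ‖tk (a + 1 / 2) b c p‖ := by
  simp only [tk, norm_mul, ← sqrt_mul_norm_posPow]
  ring

variable {η : Fin 3 → ℂ}

theorem integrable_tk_near (hd : 3 ≤ d) (hη : ∀ j, |(η j).re + d / 3| ≤ 1 / 12)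
    (hs : ∑ j, η j = -d) {δ : ℝ} (h0 : 0 < δ) (h1 : δ ≤ 1 / 2) :
    Integrable (tk (d := d) (η 0 + δ) (η 1 + δ) (η 2 + δ)) (sig3 d) := by
  have hre := congrArg Complex.re hs
  simp only [Fin.sum_univ_three, Complex.add_re, Complex.neg_re, Complex.natCast_re] at hre
  have hd' : (3 : ℝ) ≤ d := by exact_mod_cast hd
  have b0 := abs_le.1 (hη 0)
  have b1 := abs_le.1 (hη 1)
  have b2 := abs_le.1 (hη 2)
  refine integrable_tk_of_re (q := (d - 3 * δ) / 2) ?_ ?_ ?_ ?_ ?_ ?_ <;>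
    first | linarith | (simp only [Complex.add_re, Complex.ofReal_re]; linarith)

theorem integrable_tk_half (hd : 3 ≤ d) (hη : ∀ j, |(η j).re + d / 3| ≤ 1 / 12)
    (hs : ∑ j, η j = -d) :
    Integrable (fun p => ‖tk (d := d) (η 0) (η 1 + 1 / 2) (η 2) p‖ +
      ‖tk (d := d) (η 0 + 1 / 2) (η 1) (η 2) p‖) (sig3 d) := by
  have hre := congrArg Complex.re hs
  simp only [Fin.sum_univ_three, Complex.add_re, Complex.neg_re, Complex.natCast_re] at hre
  have hd' : (3 : ℝ) ≤ d := by exact_mod_cast hd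
  have b0 := abs_le.1 (hη 0)
  have b1 := abs_le.1 (hη 1)
  have b2 := abs_le.1 (hη 2)
  have h2 : ((1 / 2 : ℂ)).re = 1 / 2 := by norm_num
  refine Integrable.add (Integrable.norm ?_) (Integrable.norm ?_) <;>
  refine integrable_tk_of_re (q := (d - 1 / 2) / 2) ?_ ?_ ?_ ?_ ?_ ?_ <;>
    first | linarith | (simp only [Complex.add_re, h2]; linarith)

theorem norm_integral_mul_tk_le (hd : 3 ≤ d) (hη : ∀ j, |(η j).re + d / 3| ≤ 1 / 12)
    (hs : ∑ j, η j = -d) {δ : ℝ} (h0 : 0 < δ) (h1 : δ ≤ 1 / 2) {f : S d × S d × S d → ℂ}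
    (hf : Continuous f) {L : ℝ} (hL : ∀ p : S d × S d × S d,
      ‖f p - f (p.2.2, p.2.2, p.2.2)‖ ≤ L * (√(ww p.1 p.2.2) + √(ww p.2.1 p.2.2)))
    (hz : ∫ z, f (z, z, z) ∂sigma d = 0) :
    ‖∫ p, f p * tk (η 0 + δ) (η 1 + δ) (η 2 + δ) p ∂sig3 d‖ ≤
      L * (8 * ∫ p, ‖tk (d := d) (η 0) (η 1 + 1 / 2) (η 2) p‖ +
        ‖tk (d := d) (η 0 + 1 / 2) (η 1) (η 2) p‖ ∂sig3 d) := by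
  have hi := integrable_tk_near hd hη hs h0 h1
  have hdiag : Continuous fun z : S d => f (z, z, z) := by fun_prop
  have h2 := integral_last_mul_tk (by omega : 1 ≤ d) hdiag hz hi
  have h3 : ∫ p, f p * tk (η 0 + δ) (η 1 + δ) (η 2 + δ) p ∂sig3 d =
      ∫ p : S d × S d × S d, (f p * tk (η 0 + δ) (η 1 + δ) (η 2 + δ) p -
        f (p.2.2, p.2.2, p.2.2) * tk (η 0 + δ) (η 1 + δ) (η 2 + δ) p) ∂sig3 d := by
    rw [integral_sub (integrable_mul_of_continuous hf hi) (integrable_mul_of_continuous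
      (φ := fun p : S d × S d × S d => f (p.2.2, p.2.2, p.2.2)) (hdiag.comp (continuous_snd.comp continuous_snd)) hi)]
    exact (sub_eq_self.2 h2).symm
  rw [h3, ← integral_const_mul, ← integral_const_mul]
  refine norm_integral_le_of_norm_le (((integrable_tk_half hd hη hs).const_mul 8).const_mul L)
    (ae_of_all _ fun p => ?_)
  have hre : ∀ j, (η j).re ≤ (η j + δ).re ∧ (η j + δ).re ≤ (η j).re + 1 := fun j => by
    simp only [Complex.add_re, Complex.ofReal_re]; constructor <;> linarith
  have h4 := norm_tk_le_mul (hre 0).1 (hre 0).2 (hre 1).1 (hre 1).2 (hre 2).1 (hre 2).2 p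
  have h5 : (2 : ℝ) ^ (1 : ℝ) * 2 ^ (1 : ℝ) * 2 ^ (1 : ℝ) = 8 := by norm_num
  rw [h5] at h4
  rw [← sub_mul, norm_mul]
  calc _ ≤ L * (√(ww p.1 p.2.2) + √(ww p.2.1 p.2.2)) * (8 * ‖tk (η 0) (η 1) (η 2) p‖) :=
        mul_le_mul (hL p) h4 (norm_nonneg _) ((norm_nonneg _).trans (hL p))
    _ = L * (8 * ((√(ww p.1 p.2.2) + √(ww p.2.1 p.2.2)) * ‖tk (η 0) (η 1) (η 2) p‖)) := by ring
    _ = _ := by rw [sqrt_mul_norm_tk]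

end diagonal

/-! ### Vanishing at the central exponents -/

section center

open Filter Topology

variable {η : Fin 3 → ℂ}

theorem integrable_tk_right (hd : 3 ≤ d) (hη : ∀ j, |(η j).re + d / 3| ≤ 1 / 12)
    (hs : ∑ j, η j = -d) {ζ : ℂ} (hζ : 0 < ζ.re) :
    Integrable (tk (d := d) (η 0 + ζ) (η 1 + ζ) (η 2 + ζ)) (sig3 d) := by
  have h1 := integrable_tk_near hd hη hs (δ := min ζ.re (1 / 2)) (lt_min hζ (by norm_num))
    (min_le_right _ _)
  have h2 : ∀ j, (η j + (min ζ.re (1 / 2) : ℝ)).re ≤ (η j + ζ).re ∧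
      (η j + ζ).re ≤ (η j + (min ζ.re (1 / 2) : ℝ)).re + ζ.re := fun j => by
    simp only [Complex.add_re, Complex.ofReal_re]
    have := min_le_left ζ.re (1 / 2)
    have := lt_min hζ (by norm_num : (0 : ℝ) < 1 / 2)
    constructor <;> linarith
  exact (h1.norm.const_mul _).mono' (measurable_tk _ _ _).aestronglyMeasurable
    (ae_of_all _ (norm_tk_le_mul (h2 0).1 (h2 0).2 (h2 1).1 (h2 1).2 (h2 2).1 (h2 2).2))

theorem differentiableAt_integral_right (hd : 3 ≤ d) (hη : ∀ j, |(η j).re + d / 3| ≤ 1 / 12)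
    (hs : ∑ j, η j = -d) {φ : S d × S d × S d → ℂ} (hφ : Continuous φ) {ζ : ℂ} (hζ : 0 < ζ.re) :
    DifferentiableAt ℂ (fun ζ => ∫ p, φ p * tk (η 0 + ζ) (η 1 + ζ) (η 2 + ζ) p ∂sig3 d) ζ := by
  have h1 := integrable_tk_right hd hη hs (ζ := ((ζ.re / 2 : ℝ) : ℂ)) (by simpa using hζ)
  have h2 : ∀ j, (η j + ((ζ.re / 2 : ℝ) : ℂ)).re < (η j + ζ * 1).re := fun j => by
    simp only [Complex.add_re, Complex.ofReal_re, mul_one]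
    linarith
  simpa only [mul_one] using differentiableAt_integral_tk hφ h1 (h2 0) (h2 1) (h2 2)

theorem exists_polynomial_ext3 (g : CSSS d) (s₀ s₁ t₀ t₁ : ℂ) (k : ℕ) :
    ∃ n, ∃ H : ℕ → CSSS d, ∀ ζ p, ext3 (DDpow (s₀ + ζ * s₁) (t₀ + ζ * t₁) k) g p =
      ∑ j ∈ Finset.range n, ζ ^ j * (H j).1 p := by
  obtain ⟨n, C, hC, hA⟩ := polyFam_DDpow_opsZ (d := d) s₀ s₁ t₀ t₁ k
  refine ⟨n, fun j => ⟨ext3 (C j) g, hC j g⟩, fun ζ p => ?_⟩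
  refine (congrArg (fun A : Module.End ℂ (CSS d) => (A (slice3 g p.2.2)).1 (p.1, p.2.1))
    (hA ζ)).trans ?_
  simp only [LinearMap.smul_apply, LinearMap.sum_apply, Submodule.coe_smul, Pi.smul_apply,
    AddSubmonoidClass.coe_finsetSum, Finset.sum_apply, smul_eq_mul]
  rfl

theorem invGam_mul_bernProd (a b c : ℂ) (k : ℕ) :
    invGam d ![a, b, c + k] * bernProd d a b c k =
      (∏ i ∈ Finset.range k, ((c + i + 1) * (a + b + (c + i) + rho d + 1))) *
        invGam d ![a, b, c] := by
  have h1 : bernProd d a b c k =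
      (∏ i ∈ Finset.range k, ((c + i + 1) * (a + b + (c + i) + rho d + 1))) *
        poch (rho d + c) k * poch (a + b + c + d) k := by
    simp only [bernProd, poch, ← Finset.prod_mul_distrib]
    exact Finset.prod_congr rfl fun i _ => by ring
  have h2 := inv_Gamma_eq_poch (rho d + c) k
  have h3 := inv_Gamma_eq_poch (a + b + c + d) k
  simp only [invGam, Fin.prod_univ_three, Fin.sum_univ_three, Matrix.cons_val_zero,
    Matrix.cons_val_one, Matrix.cons_val_two, Matrix.head_cons, Matrix.tail_cons]
  rw [h1, h2, h3, ← add_assoc (rho d), show a + b + (c + k) + d = a + b + c + d + k by ring]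
  ring

theorem eq_zero_of_center (hd : 3 ≤ d) (k : ℕ) {g : CSSS d}
    (hg : ∀ s t, ∫ z, (BB k s t (slice3 g z)).1 z ∂sigma d = 0)
    (hη : ∀ j, |(η j).re + d / 3| ≤ 1 / 12) (hs : ∑ j, η j = -d) {Δ : ℂ → ℂ}
    (hΔ : ∀ ζ : ℂ, -1 / 2 < ζ.re → DifferentiableAt ℂ Δ ζ)
    (hΔ' : ∀ ζ : ℂ, (d + k + 5 : ℝ) < ζ.re → Δ ζ = invGam d ![η 0 + ζ, η 1 + ζ, η 2 - k + ζ] *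
      ∫ p, g.1 p * tk (η 0 + ζ) (η 1 + ζ) (η 2 - k + ζ) p ∂sig3 d) : Δ 0 = 0 := by
  obtain ⟨n, H, hH⟩ := exists_polynomial_ext3 g (d + η 1 + (η 2 - k)) 2 (d + η 0 + (η 2 - k)) 2 k
  have hd' : (3 : ℝ) ≤ d := by exact_mod_cast hd
  have hb := fun j => abs_le.1 (hη j)
  set h : ℂ → S d × S d × S d → ℂ := fun ζ p => ∑ j ∈ Finset.range n, ζ ^ j * (H j).1 p with hh
  have hhc : ∀ ζ, Continuous (h ζ) := fun ζ => continuous_finsetSum _ fun j _ =>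
    (continuous_CSSS (H j).2).const_mul _
  set I : ℂ → ℂ := fun ζ => ∫ p, h ζ p * tk (η 0 + ζ) (η 1 + ζ) (η 2 + ζ) p ∂sig3 d with hI
  set Q : ℂ → ℂ := fun ζ => ∏ i ∈ Finset.range k, ((η 2 - k + ζ + i + 1) *
    (η 0 + ζ + (η 1 + ζ) + (η 2 - k + ζ + i) + rho d + 1)) with hQ
  set R : ℂ → ℂ := fun ζ => invGam d ![η 0 + ζ, η 1 + ζ, η 2 + ζ] with hR
  have hQd : Differentiable ℂ Q := by unfold Q; fun_prop
  have hRd : Differentiable ℂ R := by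
    refine differentiable_invGam.comp (f := fun ζ => ![η 0 + ζ, η 1 + ζ, η 2 + ζ]) ?_
    refine differentiable_pi.2 fun j => ?_
    fin_cases j <;> simp <;> fun_prop
  set U : Set ℂ := {ζ | 0 < ζ.re} with hU
  have hUo : IsOpen U := isOpen_lt continuous_const Complex.continuous_re
  have hId : DifferentiableOn ℂ I U := by
    have h1 : ∀ ζ ∈ U, I ζ = ∑ j ∈ Finset.range n, ζ ^ j *
        ∫ p, (H j).1 p * tk (η 0 + ζ) (η 1 + ζ) (η 2 + ζ) p ∂sig3 d := by
      intro ζ hζ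
      simp only [hI, hh, Finset.sum_mul, ← integral_const_mul, mul_assoc]
      exact integral_finsetSum _ fun j _ => (integrable_mul_of_continuous
        (continuous_CSSS (H j).2) (integrable_tk_right hd hη hs hζ)).const_mul _
    refine DifferentiableOn.congr (fun ζ hζ => ?_) h1
    refine (DifferentiableAt.fun_sum fun j _ => ?_).differentiableWithinAt
    exact (differentiableAt_pow j).fun_mul
      (differentiableAt_integral_right hd hη hs (continuous_CSSS (H j).2) hζ)
  have hlarge : ∀ ζ : ℂ, (d + k + 5 : ℝ) < ζ.re → Δ ζ * Q ζ = R ζ * I ζ := by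
    intro ζ hζ
    have hk : (0 : ℝ) ≤ k := Nat.cast_nonneg k
    have h1 := integral_tk_DDpow (by omega : 1 ≤ d) g (a := η 0 + ζ) (b := η 1 + ζ)
      (c := η 2 - k + ζ) (s := d + η 1 + (η 2 - k) + ζ * 2) (t := d + η 0 + (η 2 - k) + ζ * 2)
      (by simp only [Complex.add_re]; linarith [hb 0]) (by simp only [Complex.add_re]; linarith [hb 1])
      (by simp only [Complex.add_re, Complex.sub_re, Complex.natCast_re]; linarith [hb 2])
      (by ring) (by ring) k
    have h2 := invGam_mul_bernProd (d := d) (η 0 + ζ) (η 1 + ζ) (η 2 - k + ζ) k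
    have h3 : η 2 - k + ζ + k = η 2 + ζ := by ring
    rw [h3] at h1 h2
    have h4 : I ζ = bernProd d (η 0 + ζ) (η 1 + ζ) (η 2 - k + ζ) k *
        ∫ p, g.1 p * tk (η 0 + ζ) (η 1 + ζ) (η 2 - k + ζ) p ∂sig3 d := by
      rw [← h1]; simp only [hI, hh, hH]
    rw [hΔ' ζ hζ, h4, ← mul_assoc, h2]
    ring
  have hEq : EqOn (fun ζ => Δ ζ * Q ζ) (fun ζ => R ζ * I ζ) U := by
    have hsub : ∀ ζ ∈ U, -1 / 2 < ζ.re := fun ζ hζ => by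
      have : 0 < ζ.re := hζ
      linarith
    have a1 : DifferentiableOn ℂ (fun ζ => Δ ζ * Q ζ) U := fun ζ hζ =>
      ((hΔ ζ (hsub ζ hζ)).fun_mul (hQd ζ)).differentiableWithinAt
    have a2 : DifferentiableOn ℂ (fun ζ => R ζ * I ζ) U := hRd.differentiableOn.fun_mul hId
    refine (a1.analyticOnNhd hUo).eqOn_of_preconnected_of_eventuallyEq (a2.analyticOnNhd hUo)
      (convex_halfSpace_re_gt 0).isPreconnected (z₀ := ((d + k + 6 : ℝ) : ℂ)) ?_ ?_
    · change (0 : ℝ) < Complex.re _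
      rw [Complex.ofReal_re]
      positivity
    · filter_upwards [(isOpen_lt continuous_const Complex.continuous_re).mem_nhds
        (show (d + k + 5 : ℝ) < ((d + k + 6 : ℝ) : ℂ).re by rw [Complex.ofReal_re]; linarith)]
        with ζ hζ using hlarge ζ hζ
  choose L hL0 hL using fun j => exists_norm_sub_diag_le (H j)
  set K := 8 * ∫ p, ‖tk (d := d) (η 0) (η 1 + 1 / 2) (η 2) p‖ +
    ‖tk (d := d) (η 0 + 1 / 2) (η 1) (η 2) p‖ ∂sig3 d with hK
  have hbound : ∀ δ : ℝ, 0 < δ → δ ≤ 1 / 2 → ‖I δ‖ ≤ (∑ j ∈ Finset.range n, L j) * K := by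
    intro δ h0 h1
    refine norm_integral_mul_tk_le hd hη hs h0 h1 (hhc δ) (fun p => ?_) ?_
    · simp only [hh, ← Finset.sum_sub_distrib, ← mul_sub, Finset.sum_mul]
      refine (norm_sum_le _ _).trans (Finset.sum_le_sum fun j _ => ?_)
      rw [norm_mul, norm_pow, Complex.norm_real, Real.norm_eq_abs, abs_of_pos h0]
      exact (mul_le_of_le_one_left (norm_nonneg _) (pow_le_one₀ h0.le (by linarith))).trans (hL j p)
    · have := hg (d + η 1 + (η 2 - k) + δ * 2) (d + η 0 + (η 2 - k) + δ * 2)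
      rw [← this]
      refine integral_congr_ae (ae_of_all _ fun z => ?_)
      exact (hH δ (z, z, z)).symm
  have hofReal : Tendsto (fun δ : ℝ => (δ : ℂ)) (𝓝[>] 0) (𝓝 0) := by
    have := (Complex.continuous_ofReal.tendsto (0 : ℝ)).mono_left (nhdsWithin_le_nhds (s := Ioi 0))
    simpa using this
  have hR0 : R 0 = 0 := by
    have h1 : η 0 + 0 + (η 1 + 0) + (η 2 + 0) + d = 0 := by
      rw [Fin.sum_univ_three] at hs
      rw [add_zero, add_zero, add_zero, hs, neg_add_cancel]
    simp only [hR, invGam, Fin.sum_univ_three, Matrix.cons_val_zero,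
      Matrix.cons_val_one, Matrix.cons_val]
    rw [h1, Complex.Gamma_zero, inv_zero, mul_zero]
  have hlim1 : Tendsto (fun δ : ℝ => R δ * I δ) (𝓝[>] 0) (𝓝 0) := by
    have h1 : Tendsto (fun δ : ℝ => R δ) (𝓝[>] 0) (𝓝 0) := by
      have := (hRd.continuous.tendsto 0).comp hofReal
      rwa [hR0] at this
    refine h1.zero_mul_isBoundedUnder_le ⟨(∑ j ∈ Finset.range n, L j) * K, ?_⟩
    rw [eventually_map]
    filter_upwards [Ioc_mem_nhdsGT (by norm_num : (0 : ℝ) < 1 / 2)] with δ hδ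
    exact hbound δ hδ.1 hδ.2
  have hlim2 : Tendsto (fun δ : ℝ => Δ δ * Q δ) (𝓝[>] 0) (𝓝 (Δ 0 * Q 0)) :=
    ((((hΔ 0 (by simp; norm_num)).continuousAt.mul hQd.continuous.continuousAt).tendsto).comp hofReal)
  have hlim3 : Tendsto (fun δ : ℝ => Δ δ * Q δ) (𝓝[>] 0) (𝓝 0) := by
    refine hlim1.congr' ?_
    filter_upwards [self_mem_nhdsWithin] with δ hδ
    exact (hEq (x := (δ : ℂ)) (show (0 : ℝ) < (δ : ℂ).re from by simpa using hδ)).symm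
  refine (mul_eq_zero.1 (tendsto_nhds_unique hlim2 hlim3)).resolve_right ?_
  refine Finset.prod_ne_zero_iff.2 fun i hi => ?_
  have hi' : (i : ℝ) + 1 ≤ k := by exact_mod_cast Finset.mem_range.1 hi
  refine mul_ne_zero (fun h0 => ?_) fun h0 => ?_
  · have := congrArg Complex.re h0
    simp at this
    linarith [hb 2]
  · have h1 := congrArg Complex.re h0
    have h2 := congrArg Complex.re hs
    simp [Fin.sum_univ_three, rho] at h1 h2
    linarith

end center

/-! ### The expansion of the normalized trilinear form -/

section expansion

open Filter Topology

/-- The spectral parameter with given half exponents. -/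
def specOf (d : ℕ) (e : Fin 3 → ℂ) (j : Fin 3) : ℂ := specParam d e j - rho d

theorem geom_specOf (e : Fin 3 → ℂ) (j : Fin 3) : geom d (specOf d e) j = 2 * e j := by
  fin_cases j <;> simp [geom, specOf, specParam, Fin.sum_univ_three, rho] <;> ring

theorem dist_cpow {c : ℂ} (hc : 0 < c.re) (x y : S d) :
    (dist x y : ℂ) ^ (2 * c) = 2 ^ c * posPow c (ww x y) := by
  rw [dist_eq_sqrt_ww]
  rcases (ww_nonneg x y).lt_or_eq with h | h
  · have h1 : 0 < √(2 * ww x y) := Real.sqrt_pos.2 (by positivity)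
    rw [two_mul c, Complex.cpow_add _ _ (by exact_mod_cast h1.ne'),
      ← Complex.mul_cpow_ofReal_nonneg h1.le h1.le, ← Complex.ofReal_mul,
      Real.mul_self_sqrt (by positivity), Complex.ofReal_mul,
      Complex.mul_cpow_ofReal_nonneg zero_le_two h.le, posPow_of_pos h, Complex.ofReal_ofNat]
  · have h0 : 2 * c ≠ 0 := fun h => by
      have := congrArg Complex.re h
      simp at this
      linarith
    rw [← h, mul_zero, Real.sqrt_zero, Complex.ofReal_zero, Complex.zero_cpow h0,
      posPow_of_nonpos le_rfl, mul_zero]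

theorem trilinearK_specOf {e : Fin 3 → ℂ} (he : ∀ j, 0 < (e j).re) (f : S d × S d × S d → ℂ) :
    trilinearK d (specOf d e) f =
      2 ^ (∑ j, e j) * ∫ p, f p * tk (e 0) (e 1) (e 2) p ∂sig3 d := by
  rw [trilinearK, ← integral_const_mul]
  refine integral_congr_ae (ae_of_all _ fun p => ?_)
  simp only [geom_specOf, dist_cpow (he _), tk, Fin.sum_univ_three,
    Complex.cpow_add _ _ (two_ne_zero (α := ℂ)), ww_comm p.2.2 p.1]
  ring

theorem inv_gammaFactors (e : Fin 3 → ℂ) : (gammaFactors d (specOf d e))⁻¹ = invGam d e := by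
  simp only [gammaFactors, geom_specOf, invGam, Fin.prod_univ_three, Fin.sum_univ_three, mul_inv]
  have h1 : ∀ j, 2 * e j / 2 = e j := fun j => by ring
  have h2 : (2 * e 0 + 2 * e 1 + 2 * e 2) / 2 + 2 * rho d = e 0 + e 1 + e 2 + d := by
    rw [rho]; ring
  rw [h2, h1, h1, h1]

theorem IsNormalizedK.apply_specOf {f : S d × S d × S d → ℂ} {F : (Fin 3 → ℂ) → ℂ}
    (hF : IsNormalizedK d f F) {e : Fin 3 → ℂ} (he : ∀ j, 0 < (e j).re) :
    F (specOf d e) = 2 ^ (∑ j, e j) * (invGam d e * ∫ p, f p * tk (e 0) (e 1) (e 2) p ∂sig3 d) := by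
  have hd := Nat.cast_nonneg (α := ℝ) d
  have h2 : ∀ z : ℂ, (2 * z).re = 2 * z.re := fun z => by simp
  have hmem : specOf d e ∈ convergenceDomain d := by
    refine ⟨fun j => ?_, ?_⟩
    · rw [geom_specOf, h2]
      linarith [he j]
    · simp only [geom_specOf, Complex.add_re, h2]
      linarith [he 0, he 1, he 2]
  rw [hF.2 _ hmem, trilinearK_specOf he, div_eq_mul_inv, inv_gammaFactors]
  ring

/-- The difference of the normalized trilinear form and a combination of its values on monomials. -/
def defect (d N M : ℕ) (F : (Fin 3 → ℂ) → ℂ) (c : (Fin 3 → Fin M) → ℂ) (e : Fin 3 → ℂ) : ℂ :=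
  2 ^ (-∑ j, e j) * F (specOf d e) - ∑ a, c a * triVal d N (fun j => a j) e

theorem differentiableAt_defect {N M : ℕ} {F : (Fin 3 → ℂ) → ℂ} (hF : AnalyticOnNhd ℂ F univ)
    (c : (Fin 3 → Fin M) → ℂ) (u v : Fin 3 → ℂ) {ξ : ℂ} (h : ∀ j, 0 < (u j + ξ * v j + N).re) :
    DifferentiableAt ℂ (fun ξ => defect d N M F c fun j => u j + ξ * v j) ξ := by
  refine DifferentiableAt.fun_sub (DifferentiableAt.fun_mul ?_ ?_) (DifferentiableAt.fun_sum
    fun a _ => (differentiableAt_triVal N _ u v h).const_mul _)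
  · exact DifferentiableAt.const_cpow (by fun_prop) (Or.inl two_ne_zero)
  · refine (hF _ (mem_univ _)).differentiableAt.comp (f := fun ξ => specOf d fun j => u j + ξ * v j)
      ξ ?_
    unfold specOf specParam
    fun_prop

theorem slice3_combination {ι : Type*} [Fintype ι] (B : CSS d →ₗ[ℂ] CS d) (f : CSSS d) (c : ι → ℂ)
    (q : ι → CSSS d) (z : S d) : (B (slice3 (f + ∑ a, c a • q a) z)).1 z =
      (B (slice3 f z)).1 z + ∑ a, c a * (B (slice3 (q a) z)).1 z := by
  let T : CSSS d →ₗ[ℂ] ℂ := evalAt z B ∘ₗ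
    { toFun := fun f => slice3 f z, map_add' := fun _ _ => rfl, map_smul' := fun _ _ => rfl }
  change T _ = T f + ∑ a, c a * T (q a)
  rw [map_add, map_sum]
  simp only [map_smul, smul_eq_mul]

theorem combination_apply {ι : Type*} [Fintype ι] (f : CSSS d) (c : ι → ℂ) (q : ι → CSSS d)
    (p : S d × S d × S d) : (f + ∑ a, c a • q a).1 p = f.1 p + ∑ a, c a * (q a).1 p := by
  simp only [Submodule.coe_add, AddSubmonoidClass.coe_finsetSum, Submodule.coe_smul, Pi.add_apply,
    Finset.sum_apply, Pi.smul_apply, smul_eq_mul]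

variable {k : ℕ} {f : CSSS d} {F : (Fin 3 → ℂ) → ℂ} {c : (Fin 3 → Fin (4 * k + 1)) → ℂ}

theorem defect_eq_zero_of_center (hd : 3 ≤ d) (hF : IsNormalizedK d f.1 F)
    (hc : ∀ s t, ∫ z, (BB k s t (slice3 f z)).1 z ∂sigma d =
      ∑ a, c a * ∫ z, (BB k s t (slice3 (triMon d fun j => a j) z)).1 z ∂sigma d)
    {N : ℕ} (hN : d + k + 1 ≤ N) {e η : Fin 3 → ℂ} (he : e = ![η 0, η 1, η 2 - k])
    (hη : ∀ j, |(η j).re + d / 3| ≤ 1 / 12) (hs : ∑ j, η j = -d) :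
    defect d N (4 * k + 1) F c e = 0 := by
  have hd' : (3 : ℝ) ≤ d := by exact_mod_cast hd
  have hk : (0 : ℝ) ≤ k := Nat.cast_nonneg k
  have hN' : (d + k + 1 : ℝ) ≤ N := by exact_mod_cast hN
  have hlow : ∀ j, -(d / 3 + 1 / 12 + k : ℝ) ≤ (e j).re := by
    have hb := fun j => abs_le.1 (hη j)
    rw [he]
    intro j
    fin_cases j
    · simp; linarith [hb 0]
    · simp; linarith [hb 1]
    · simp; linarith [hb 2]
  set q : (Fin 3 → Fin (4 * k + 1)) → CSSS d := fun a => triMon d fun j => a j with hq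
  set g : CSSS d := f + ∑ a, (-c a) • q a with hg
  have hg0 : ∀ s t, ∫ z, (BB k s t (slice3 g z)).1 z ∂sigma d = 0 := by
    intro s t
    have hi : ∀ f : CSSS d, Integrable (fun z => (BB k s t (slice3 f z)).1 z) (sigma d) := fun f =>
      integrable_of_continuous ((BB_mem_rotOps k s t).2.2 f)
    simp only [hg, slice3_combination]
    rw [integral_add (hi f) (integrable_finsetSum _ fun a _ => (hi _).const_mul _),
      integral_finsetSum _ fun a _ => (hi _).const_mul _, hc]
    simp only [integral_const_mul]
    rw [← Finset.sum_add_distrib]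
    exact Finset.sum_eq_zero fun a _ => by ring
  have key := eq_zero_of_center hd k hg0 hη hs
    (Δ := fun ζ => defect d N (4 * k + 1) F c fun j => e j + ζ * 1) (fun ζ hζ =>
      differentiableAt_defect hF.1 c e (fun _ => 1) fun j => by
        simp only [Complex.add_re, mul_one, Complex.natCast_re]
        linarith [hlow j]) fun ζ hζ => ?_
  · simpa using key
  · have hpos : ∀ j, 1 < (e j + ζ * 1).re := fun j => by
      simp only [Complex.add_re, mul_one]
      linarith [hlow j]
    have e0 : (fun j => e j + ζ * 1) = ![η 0 + ζ, η 1 + ζ, η 2 - k + ζ] := by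
      ext j; rw [he]; fin_cases j <;> simp
    have h0 : (2 : ℂ) ^ (-∑ j, (e j + ζ * 1)) * 2 ^ (∑ j, (e j + ζ * 1)) = 1 := by
      rw [← Complex.cpow_add _ _ two_ne_zero, neg_add_cancel, Complex.cpow_zero]
    have h1 : ∀ f : CSSS d, Integrable (fun p => f.1 p *
        tk (e 0 + ζ * 1) (e 1 + ζ * 1) (e 2 + ζ * 1) p) (sig3 d) := fun f =>
      integrable_mul_of_continuous (continuous_CSSS f.2)
        (integrable_tk (by linarith [hpos 0]) (by linarith [hpos 1]) (by linarith [hpos 2]))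
    have h2 : ∫ p, g.1 p * tk (e 0 + ζ * 1) (e 1 + ζ * 1) (e 2 + ζ * 1) p ∂sig3 d =
        ∫ p, f.1 p * tk (e 0 + ζ * 1) (e 1 + ζ * 1) (e 2 + ζ * 1) p ∂sig3 d + ∑ a, -c a *
          ∫ p, (q a).1 p * tk (e 0 + ζ * 1) (e 1 + ζ * 1) (e 2 + ζ * 1) p ∂sig3 d := by
      simp only [hg, combination_apply, add_mul, Finset.sum_mul, ← integral_const_mul]
      simp only [mul_assoc]
      rw [integral_add (h1 f) (integrable_finsetSum _ fun a _ => (h1 (q a)).const_mul _),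
        integral_finsetSum _ fun a _ => (h1 (q a)).const_mul _]
    have h3 := congrFun e0
    have e1 := h3 0
    have e2 := h3 1
    have e3 := h3 2
    simp only [Matrix.cons_val_zero, Matrix.cons_val_one, Matrix.cons_val] at e1 e2 e3
    rw [← e0, ← e1, ← e2, ← e3, h2]
    simp only [defect]
    rw [hF.apply_specOf fun j => by linarith [hpos j], ← mul_assoc, h0, one_mul]
    simp only [← integral_triMon N _ hpos, mul_add, Finset.mul_sum, sub_eq_add_neg,
      ← Finset.sum_neg_distrib]
    congr 1
    exact Finset.sum_congr rfl fun a _ => by ring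

theorem defect_eq_zero (hd : 3 ≤ d) (hF : IsNormalizedK d f.1 F)
    (hc : ∀ s t, ∫ z, (BB k s t (slice3 f z)).1 z ∂sigma d =
      ∑ a, c a * ∫ z, (BB k s t (slice3 (triMon d fun j => a j) z)).1 z ∂sigma d)
    {N : ℕ} (hN : d + k + 1 ≤ N) {e : Fin 3 → ℂ} (he : ∑ j, e j = -d - k)
    (heN : ∀ j, 0 < (e j + N).re) : defect d N (4 * k + 1) F c e = 0 := by
  have hd' : (3 : ℝ) ≤ d := by exact_mod_cast hd
  have hk : (0 : ℝ) ≤ k := Nat.cast_nonneg k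
  have hN' : (d + k + 1 : ℝ) ≤ N := by exact_mod_cast hN
  set u : Fin 3 → ℂ := ![-d / 3, -d / 3, -d / 3 - k] with hu
  set v : Fin 3 → ℂ := fun j => e j - u j with hv
  set W : Set ℂ := {ξ | ∀ j, 0 < (u j + ξ * v j + N).re} with hW
  have hWo : IsOpen W := by
    simp only [hW, Set.ofPred_forall]
    exact isOpen_iInter_of_finite fun j => isOpen_lt continuous_const (by fun_prop)
  have hWc : Convex ℝ W := by
    intro x hx y hy a b ha hb hab j
    have h1 : u j + (a • x + b • y) * v j + N =
        a * (u j + x * v j + N) + b * (u j + y * v j + N) := by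
      have : (a : ℂ) + b = 1 := by exact_mod_cast hab
      simp only [Complex.real_smul]
      linear_combination -(u j + N) * this
    rw [h1, Complex.add_re, Complex.re_ofReal_mul, Complex.re_ofReal_mul]
    rcases ha.lt_or_eq with h | rfl
    · have := mul_pos h (hx j)
      have := mul_nonneg hb (hy j).le
      linarith
    · have hb1 : b = 1 := by linarith
      rw [hb1, zero_mul, one_mul, zero_add]
      exact hy j
  have hd3 : (-(d : ℂ) / 3).re = -d / 3 := by
    have : (-(d : ℂ) / 3) = ((-d / 3 : ℝ) : ℂ) := by push_cast; rfl
    rw [this, Complex.ofReal_re]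
  have h0W : (0 : ℂ) ∈ W := by
    intro j
    rw [zero_mul, add_zero, Complex.add_re, Complex.natCast_re]
    fin_cases j
    · simp only [hu, Fin.zero_eta, Matrix.cons_val_zero, hd3]; linarith
    · simp only [hu, Fin.mk_one, Matrix.cons_val_one, Matrix.cons_val_zero, hd3]; linarith
    · simp only [hu, Fin.reduceFinMk, Matrix.cons_val, Complex.sub_re, Complex.natCast_re, hd3]
      linarith
  have h1W : (1 : ℂ) ∈ W := fun j => by simpa [hv] using heN j
  have hdiff : DifferentiableOn ℂ (fun ξ => defect d N (4 * k + 1) F c fun j => u j + ξ * v j) W :=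
    fun ξ hξ => (differentiableAt_defect hF.1 c u v hξ).differentiableWithinAt
  have hz := (hdiff.analyticOnNhd hWo).eqOn_of_preconnected_of_eventuallyEq
    (g := fun _ => 0) (fun _ _ => analyticAt_const) hWc.isPreconnected h0W ?_
  · simpa [hv] using hz h1W
  · have hnear : ∀ j, ∀ᶠ ξ : ℂ in 𝓝 0, |(-(d : ℂ) / 3 + ξ * v j).re + d / 3| < 1 / 12 := by
      intro j
      have hcont : Continuous fun ξ : ℂ => |(-(d : ℂ) / 3 + ξ * v j).re + d / 3| := by fun_prop
      refine hcont.continuousAt.eventually (gt_mem_nhds ?_)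
      dsimp only
      rw [zero_mul, add_zero, hd3, neg_div, neg_add_cancel, abs_zero]
      norm_num
    filter_upwards [eventually_all.2 hnear] with ξ hξ
    refine defect_eq_zero_of_center hd hF hc hN (η := fun j => -(d : ℂ) / 3 + ξ * v j) ?_
      (fun j => (hξ j).le) ?_
    · ext j
      fin_cases j <;> (simp [hu]; try ring)
    · have hv0 : v 0 + v 1 + v 2 = 0 := by
        rw [Fin.sum_univ_three] at he
        simp [hv, hu]
        linear_combination he
      rw [Fin.sum_univ_three]
      linear_combination ξ * hv0

/-- A nonvanishing normalized trilinear form yields a multi-index at which the recurrence relations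
are nondegenerate. -/
theorem exists_nondeg (hd : 3 ≤ d) (hF : IsNormalizedK d f.1 F) {l m : ℂ}
    (h : F ![l, m, -rho d - 2 * k - l - m] ≠ 0) :
    ∃ a, Recurrence.Nondeg (recParam d l m k) a ∧ Recurrence.len a ≤ k := by
  obtain ⟨c, hc⟩ := exists_combination hd f k
  set e : Fin 3 → ℂ := fun j => geom d ![l, m, -rho d - 2 * k - l - m] j / 2 with he
  have hX : specParam d e = recParam d l m k := by
    ext j
    fin_cases j <;> simp [specParam, he, geom, recParam, Fin.sum_univ_three, rho] <;> ring
  have hspec : specOf d e = ![l, m, -rho d - 2 * k - l - m] := by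
    ext j
    rw [specOf, hX]
    fin_cases j <;> simp [recParam, rho]
    ring
  have hsum : ∑ j, e j = -d - k := by
    simp [he, geom, Fin.sum_univ_three, rho]
    ring
  obtain ⟨N₁, hN₁⟩ := exists_nat_gt (∑ j, |(e j).re|)
  obtain ⟨N₂, hN₂⟩ := exists_nat_gt (∑ j, |(specParam d e j).re|)
  set N := d + k + 1 + N₁ + N₂ with hN
  have hcast : (N : ℝ) = d + k + 1 + N₁ + N₂ := by rw [hN]; push_cast; ring
  have hd0 := Nat.cast_nonneg (α := ℝ) d
  have hk0 := Nat.cast_nonneg (α := ℝ) k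
  have hn1 := Nat.cast_nonneg (α := ℝ) N₁
  have hn2 := Nat.cast_nonneg (α := ℝ) N₂
  have habs : ∀ (x : Fin 3 → ℂ) j, -∑ j, |(x j).re| ≤ (x j).re := fun x j => by
    have h1 := Finset.single_le_sum (f := fun j => |(x j).re|) (fun i _ => abs_nonneg _)
      (Finset.mem_univ j)
    linarith [neg_abs_le (x j).re]
  have hzero := defect_eq_zero hd hF hc (N := N) (by omega) hsum fun j => by
    simp only [Complex.add_re, Complex.natCast_re]
    linarith [habs e j]
  rw [defect, hspec, sub_eq_zero] at hzero
  have hne : ∑ a, c a * triVal d N (fun j => a j) e ≠ 0 := by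
    rw [← hzero]
    refine mul_ne_zero ?_ h
    rw [Ne, Complex.cpow_eq_zero_iff, not_and_or]
    exact Or.inl two_ne_zero
  obtain ⟨a, -, ha⟩ := Finset.exists_ne_zero_of_sum_ne_zero hne
  have ha' := right_ne_zero_of_mul ha
  refine ⟨_, ?_, len_le_of_triVal_ne_zero (k := k) ha' (by rw [hsum]; ring)⟩
  rw [← hX]
  refine nondeg_of_triVal_ne_zero ha' fun j => ?_
  have h2 : (specParam d e j + 2 * (N : ℂ)).re = (specParam d e j).re + 2 * N := by simp
  rw [h2]
  linarith [habs (specParam d e) j]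

end expansion


end ConformalSphere

end

theorem mainTheorem8 (d : ℕ) (hd : 3 ≤ d) (k : ℕ) (l₁ l₂ : ℂ)
    (h : (l₁, l₂) ∉ ConformalSphere.Zk d k) :
    Module.rank ℂ (ConformalSphere.BD d l₁ l₂ k) = 1 := by
  simp only [ConformalSphere.Zk, ConformalSphere.Z, Set.mem_ofPred_eq, not_forall] at h
  obtain ⟨f, hf, F, hF, hne⟩ := h
  obtain ⟨a, ha, hk⟩ := ConformalSphere.exists_nondeg (f := ⟨f, hf⟩) hd hF hne
  exact ConformalSphere.BD.rank_eq_one hd ha hk
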